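/- **Setting.** Let $U\subset\mathbb R^2$ be an open neighbourhood of the origin, $r\ge 3$, and let $\Omega$ be the normed space of pairs $Z=(X,Y)$ of $C^r$ vector fields on $U$ with bounded derivatives up to order $r$ ($C^r$ norm). $Z$ is regarded as the piecewise smooth vector field equal to $X$ where $x_1x_2>0$ and to $Y$ where $x_1x_2<0$, with switching set $\Sigma=\Sigma_1\cup\Sigma_2$, $\Sigma_i=\{x_i=0\}$. Its trajectories follow Filippov's convention on $\Sigma\setminus\{0\}$: on the crossing part of $\Sigma_i$ ($X_iY_i>0$) trajectories of $X$ and $Y$ are concatenated; on the sliding or escaping part of $\Sigma_i$ ($X_iY_i<0$) they follow the sliding field $(Y_iX_j-X_iY_j)/(Y_i-X_i)$, $j\ne i$, and the trajectories of $X,Y$ do not include points of that part. If, at the origin, one branch is crossing and the other is not, the trajectory of the origin is the sliding one. If $X_1X_2(0)<0$ and one of the numbers $X_1Y_1(0),X_2Y_2(0)$ is positive and the other negative, the orbits of $X$ in $\{x_1x_2\ge 0\}$ and of $Y$ in $\{x_1x_2\le 0\}$ (followed forward or backward in time) define near the origin transition maps $\varphi_X:\Sigma_1\to\Sigma_2$,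 $\varphi_Y:\Sigma_2\to\Sigma_1$. Write $\varphi_X(x)=a_Xx+b_Xx^2+\cdots$, $\varphi_Y(x)=a_Yx+b_Yx^2+\cdots$, $\alpha_Z=\frac{X_1Y_2}{X_2Y_1}(0)$, $\beta_Z=b_Xa_Y^2+a_Xb_Y$, and let $\eta_Z$ be the coefficient of $x^3$ in the expansion of the first return map $$\varphi_Z=(\varphi_X\circ\varphi_Y)^2,\qquad \varphi_Z(x)=\alpha_Z^2x+(\alpha_Z+\alpha_Z^2)\beta_Zx^2+\eta_Zx^3+o(x^3).$$ The *pseudo-Hopf set* $\Xi\subset\Omega$ consists of the $Z$ satisfying these sign conditions together with $\alpha_Z=-1$, $\beta_Z\neq0$, $\eta_Z\ne0$. A *versal unfolding* of $Z\in\Xi$ is a $C^1$ curve $\delta\mapsto Z_\delta\in\Omega$, $|\delta|<\delta_0$, with $Z_0=Z$, which is transverse to the hypersurface $\Xi$ at $Z$. A *local $\Sigma$-equivalence* between two piecewise smooth vector fields is an orientation preserving homeomorphism between connected neighbourhoods of the origin (containing no tangency points) which maps $\Sigma$ to $\Sigma$ and trajectories to trajectories, preserving the direction of time. Families $Z_\delta$,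 $\tilde Z_\delta$ are *locally weak equivalent* if there are a homeomorphism $\mu$ of the parameter line with $\mu(0)=0$ and a neighbourhood $W$ of the origin such that for every small $\delta$ there is a local $\Sigma$-equivalence between $Z_\delta$ and $\tilde Z_{\mu(\delta)}$ whose domain and image both contain $W$. A *pseudo-cycle* is a curve homeomorphic to $\mathbb R/\mathbb Z$ formed by finitely many different regular orbits together with their edges (departing and arrival points), cyclically ordered so that consecutive ones share an edge, such that two departing points or two arrival points coincide. **Proposition.** Let $Z\in\Xi$. Then any versal unfolding of $Z$ is locally weak equivalent to the one-parameter family $$\tilde Z_\delta=\begin{cases}\tilde X_\delta(x_1,x_2)=\big(ac,\;-(ac+\delta)\big),& x_1x_2>0,\\ \tilde Y(x_1,x_2)=\big(a,\;a+x_1+ab\,x_1^2\big),& x_1x_2<0,\end{cases}$$ where $a=\operatorname{sgn}Y_1(0)$, $b=\operatorname{sgn}\eta_Z$, $c=\operatorname{sgn}(X_1Y_1(0))$. Moreover, the origin has arbitrarily small open neighbourhoods $W$ such that for all sufficiently small $|\delta|$: if $abc\,\delta>0$, then $\tilde Z_\delta$ has exactly one pseudo-cycle in $W$; it meets $\{x_2=0,\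 x_1<0\}$ at a fixed point of the first return map, at which the derivative $d$ of this map satisfies $d>1$ (unstable) if $\eta_Z>0$ and $0<d<1$ (stable) if $\eta_Z<0$. If $abc\,\delta\le0$, then $\tilde Z_\delta$ has no pseudo-cycle in $W$. -/

import Mathlib

open Set Filter Topology
open scoped BoundedContinuousFunction

noncomputable section

namespace PseudoHopf

/-- The plane. The coordinates `x₁`, `x₂` of a point `p` are `p 0` and `p 1`; if `i : Fin 2` is one
of the two indices, then `i + 1` is the other one. -/
abbrev Plane : Type := Fin 2 → ℝ

/-! ### The switching set and its complement -/

/-- `f p > 0` for `f (x₁, x₂) = x₁ x₂`: the open first and third quadrants. -/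
def Upos : Set Plane := {p | 0 < p 0 * p 1}

/-- `f p < 0`: the open second and fourth quadrants. -/
def Uneg : Set Plane := {p | p 0 * p 1 < 0}

/-- The branch `Σᵢ = {xᵢ = 0}`. -/
def SwitchingBranch (i : Fin 2) : Set Plane := {p | p i = 0}

/-- The switching set `Σ = f⁻¹(0) = Σ₁ ∪ Σ₂`. -/
def SwitchingSet : Set Plane := {p | p 0 * p 1 = 0}

/-- The point with coordinate `x` at the index `j`, and the other coordinate zero. It lies on
`Σᵢ`, where `i` is the other index. -/
def axisPoint (j : Fin 2) (x : ℝ) : Plane := Pi.single j x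

/-! ### The Banach space of `C^r` vector fields on `U` and the space `Ω` -/

/-- Families of bounded continuous functions on `U` in which the `r`-jets of vector fields live;
the norm is the maximum of the sup norms. -/
def JetSpace (r : ℕ) (U : TopologicalSpace.Opens Plane) : Type :=
  (k : Fin (r + 1)) →
    (U →ᵇ ContinuousMultilinearMap ℝ (fun _ : Fin (k : ℕ) => Plane) Plane)

instance (r : ℕ) (U : TopologicalSpace.Opens Plane) : NormedAddCommGroup (JetSpace r U) :=
  inferInstanceAs (NormedAddCommGroup ((k : Fin (r + 1)) →
    (U →ᵇ ContinuousMultilinearMap ℝ (fun _ : Fin (k : ℕ) => Plane) Plane)))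

instance (r : ℕ) (U : TopologicalSpace.Opens Plane) : NormedSpace ℝ (JetSpace r U) :=
  inferInstanceAs (NormedSpace ℝ ((k : Fin (r + 1)) →
    (U →ᵇ ContinuousMultilinearMap ℝ (fun _ : Fin (k : ℕ) => Plane) Plane)))

/-- The space of `C^r` vector fields on `U` with bounded derivatives up to order `r`, with the
`C^r` norm. A vector field is identified with the family of its derivatives of orders `0, …, r`. -/
def VectorFields (r : ℕ) (U : TopologicalSpace.Opens Plane) : Submodule ℝ (JetSpace r U) where
  carrier := {J | ∃ V : Plane → Plane, ContDiffOn ℝ r V U ∧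
    ∀ (k : Fin (r + 1)) (x : U), J k x = iteratedFDerivWithin ℝ k V U x}
  zero_mem' := by
    refine ⟨0, contDiffOn_const, fun k x => ?_⟩
    have := iteratedFDerivWithin_fun_zero (𝕜 := ℝ) (E := Plane) (F := Plane)
      (s := (U : Set Plane)) (i := (k : ℕ))
    exact (congrFun this x).symm
  add_mem' := by
    rintro J J' ⟨V, hV, hJ⟩ ⟨V', hV', hJ'⟩
    refine ⟨V + V', hV.add hV', fun k x => ?_⟩
    have hk : ((k : ℕ) : WithTop ℕ∞) ≤ (r : WithTop ℕ∞) := by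
      exact_mod_cast Nat.lt_succ_iff.mp k.2
    rw [iteratedFDerivWithin_add_apply ((hV x x.2).of_le hk) ((hV' x x.2).of_le hk)
      U.isOpen.uniqueDiffOn x.2, ← hJ, ← hJ']
    rfl
  smul_mem' := by
    rintro a J ⟨V, hV, hJ⟩
    refine ⟨a • V, hV.const_smul a, fun k x => ?_⟩
    have hk : ((k : ℕ) : WithTop ℕ∞) ≤ (r : WithTop ℕ∞) := by
      exact_mod_cast Nat.lt_succ_iff.mp k.2
    rw [iteratedFDerivWithin_const_smul_apply ((hV x x.2).of_le hk)
      U.isOpen.uniqueDiffOn x.2, ← hJ]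
    rfl

open Classical in
/-- The value of a vector field at a point of `U` (zero, by convention, outside `U`). -/
def fieldValue {r : ℕ} {U : TopologicalSpace.Opens Plane} (V : VectorFields r U) (p : Plane) :
    Plane :=
  if hp : p ∈ U then V.1 0 ⟨p, hp⟩ 0 else 0

/-- `Ω`: the pairs `Z = (X, Y)` of `C^r` vector fields on `U`, a normed space. -/
abbrev Omega (r : ℕ) (U : TopologicalSpace.Opens Plane) : Type :=
  VectorFields r U × VectorFields r U

/-- A piecewise vector field on the open set `dom`: it is `X` where `x₁ x₂ > 0` and `Y` where
`x₁ x₂ < 0`. -/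
structure PiecewiseField where
  dom : TopologicalSpace.Opens Plane
  X : Plane → Plane
  Y : Plane → Plane

/-- The piecewise vector field given by an element of `Ω`. -/
def Omega.toField {r : ℕ} {U : TopologicalSpace.Opens Plane} (Z : Omega r U) :
    PiecewiseField where
  dom := U
  X := fieldValue Z.1
  Y := fieldValue Z.2

/-! ### Trajectories -/

/-- The regular points: those off `Σ`, the points other than the origin of the crossing regions
`Σᵢᶜ = {p ∈ Σᵢ : Xᵢ Yᵢ > 0}`, and the origin when both branches are crossing there. -/
def IsRegularPoint (Z : PiecewiseField) (p : Plane) : Prop :=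
  ∀ i, p i = 0 → 0 < Z.X p i * Z.Y p i

/-- `σ`, restricted to the interval `I`, is a piece of a regular orbit of `Z` inside `W`: it stays
among the regular points, follows `X` and `Y` where `f > 0` and `f < 0`, and goes through `Σ`
(by concatenation of such pieces) at isolated times only. -/
structure IsRegularArc (Z : PiecewiseField) (W : Set Plane) (I : Set ℝ) (σ : ℝ → Plane) :
    Prop where
  continuousOn : ContinuousOn σ I
  mem : ∀ t ∈ I, σ t ∈ W
  regular : ∀ t ∈ I, IsRegularPoint Z (σ t)
  deriv_pos : ∀ t ∈ I, σ t ∈ Upos → HasDerivWithinAt σ (Z.X (σ t)) I t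
  deriv_neg : ∀ t ∈ I, σ t ∈ Uneg → HasDerivWithinAt σ (Z.Y (σ t)) I t
  isolated : ∀ t ∈ I, σ t ∈ SwitchingSet → ∀ᶠ s in 𝓝[I \ {t}] t, σ s ∉ SwitchingSet

/-- The points of `Σᵢ` carrying a sliding orbit along `Σᵢ`: the sliding and escaping points
(`Xᵢ Yᵢ < 0`) other than the origin, and the origin when it is such a point for `Σᵢ` and the other
branch is crossing there. -/
def IsSlidingPoint (Z : PiecewiseField) (i : Fin 2) (p : Plane) : Prop :=
  p i = 0 ∧ Z.X p i * Z.Y p i < 0 ∧ (p (i + 1) = 0 → 0 < Z.X p (i + 1) * Z.Y p (i + 1))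

/-- The sliding vector field `Zᵢˢ = (Yᵢ Xⱼ - Xᵢ Yⱼ) / (Yᵢ - Xᵢ)` on `Σᵢ`, `j ≠ i`. -/
def slidingField (Z : PiecewiseField) (i : Fin 2) (p : Plane) : ℝ :=
  (Z.Y p i * Z.X p (i + 1) - Z.X p i * Z.Y p (i + 1)) / (Z.Y p i - Z.X p i)

/-- `σ`, restricted to the interval `I`, is a piece of a sliding orbit along `Σᵢ` inside `W`. -/
structure IsSlidingArc (Z : PiecewiseField) (W : Set Plane) (i : Fin 2) (I : Set ℝ)
    (σ : ℝ → Plane) : Prop where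
  mem : ∀ t ∈ I, σ t ∈ W
  sliding : ∀ t ∈ I, IsSlidingPoint Z i (σ t)
  deriv : ∀ t ∈ I,
    HasDerivWithinAt σ (axisPoint (i + 1) (slidingField Z i (σ t))) I t

/-- `σ`, restricted to `I`, rests at the origin, which is a trajectory by itself when both
branches are sliding or escaping there. -/
def IsSingularArc (Z : PiecewiseField) (W : Set Plane) (I : Set ℝ) (σ : ℝ → Plane) : Prop :=
  0 ∈ W ∧ (∀ i, Z.X 0 i * Z.Y 0 i < 0) ∧ ∀ t ∈ I, σ t = 0

/-- `σ`, restricted to the interval `I`, is a piece of a trajectory of `Z` inside `W`, where `W`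
contains no point of tangency with `Σ`. -/
def IsTrajectoryArc (Z : PiecewiseField) (W : Set Plane) (I : Set ℝ) (σ : ℝ → Plane) : Prop :=
  IsRegularArc Z W I σ ∨ (∃ i, IsSlidingArc Z W i I σ) ∨ IsSingularArc Z W I σ

/-! ### `Σ`-equivalence and weak equivalence of unfoldings -/

/-- `X` and `Y` are transverse to `Σ` at all the points of `W`: there are no tangency points. -/
def NoTangency (Z : PiecewiseField) (W : Set Plane) : Prop :=
  ∀ p ∈ W, ∀ i, p i = 0 → Z.X p i ≠ 0 ∧ Z.Y p i ≠ 0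

/-- The closed curve `c`, with parameter in `[0, 2π]`, winds exactly once, counterclockwise,
around the origin. -/
def WindsOnce (c : ℝ → Plane) : Prop :=
  ∃ θ ρ : ℝ → ℝ, Continuous θ ∧ (∀ t, 0 < ρ t) ∧
    (∀ t, c t = ![ρ t * Real.cos (θ t), ρ t * Real.sin (θ t)]) ∧
    θ (2 * Real.pi) = θ 0 + 2 * Real.pi

/-- `h` has local degree `1` at the origin. For a homeomorphism between connected open sets the
local degree is the same at all points, so this says that `h` preserves the orientation. -/
def OrientationPreserving (h : Plane → Plane) : Prop :=
  ∀ᶠ s in 𝓝[>] (0 : ℝ),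
    WindsOnce (fun t => h ![s * Real.cos t, s * Real.sin t] - h 0)

/-- `h` sends the trajectories of `Z` in `W` into trajectories of `Z'` in `W'`, respecting the
direction of time: the image of a piece of trajectory is one, up to an increasing
reparametrization. -/
def MapsTrajectories (Z Z' : PiecewiseField) (W W' : Set Plane) (h : Plane → Plane) : Prop :=
  ∀ (T : ℝ) (σ : ℝ → Plane), 0 ≤ T → IsTrajectoryArc Z W (Icc 0 T) σ →
    ∃ (T' : ℝ) (σ' : ℝ → Plane) (τ : ℝ → ℝ), 0 ≤ T' ∧ IsTrajectoryArc Z' W' (Icc 0 T') σ' ∧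
      ContinuousOn τ (Icc 0 T) ∧ StrictMonoOn τ (Icc 0 T) ∧ τ '' Icc 0 T = Icc 0 T' ∧
      ∀ t ∈ Icc 0 T, σ' (τ t) = h (σ t)

/-- The homeomorphism `h`, from the neighbourhood `h.source` of the origin onto the neighbourhood
`h.target`, is a `Σ`-equivalence between `Z` and `Z'` (two piecewise vector fields which are
transverse to `Σ` at the origin, so that small neighbourhoods contain no tangency points). -/
structure IsSigmaEquivalence (Z Z' : PiecewiseField) (h : OpenPartialHomeomorph Plane Plane) :
    Prop where
  source_subset : h.source ⊆ Z.dom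
  target_subset : h.target ⊆ Z'.dom
  zero_mem : (0 : Plane) ∈ h.source
  map_zero : h 0 = 0
  connected : IsConnected h.source
  noTangency : NoTangency Z h.source
  noTangency' : NoTangency Z' h.target
  orientation : OrientationPreserving h
  map_switching : ∀ p ∈ h.source, h p ∈ SwitchingSet ↔ p ∈ SwitchingSet
  maps : MapsTrajectories Z Z' h.source h.target h
  maps_symm : MapsTrajectories Z' Z h.target h.source h.symm

/-- Local weak equivalence of two one-parameter unfoldings: there is a homeomorphic change of
parameters `μ` fixing `0` such that, for all small `δ`, the fields `Z δ` and `Z' (μ δ)` are locally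
`Σ`-equivalent. The neighbourhoods of the origin on which these equivalences live are not allowed
to shrink to the origin: they all contain the neighbourhood `W`, which does not depend on `δ`. -/
def LocallyWeakEquivalent (Z Z' : ℝ → PiecewiseField) : Prop :=
  ∃ μ : ℝ ≃ₜ ℝ, μ 0 = 0 ∧ ∃ W ∈ 𝓝 (0 : Plane), ∀ᶠ δ in 𝓝 (0 : ℝ),
    ∃ h : OpenPartialHomeomorph Plane Plane,
      W ⊆ h.source ∧ W ⊆ h.target ∧ IsSigmaEquivalence (Z δ) (Z' (μ δ)) h

/-! ### The first return map -/

/-- The orbit of `V` through the point with coordinate `x` of `Σᵢ` goes, in forward or backward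
time and inside `W ∩ closure S`, to the point with coordinate `y` of the other branch. -/
def Transit (V : Plane → Plane) (S W : Set Plane) (i : Fin 2) (x y : ℝ) : Prop :=
  ∃ (T : ℝ) (σ : ℝ → Plane), σ 0 = axisPoint (i + 1) x ∧ σ T = axisPoint i y ∧
    ∀ t ∈ uIcc 0 T, σ t ∈ W ∩ closure S ∧ HasDerivWithinAt σ (V (σ t)) (uIcc 0 T) t

/-- `f` represents the germ at `0` of the transition map of `V` through `closure S`, from `Σᵢ` to
the other branch. -/
def IsTransitionMap (V : Plane → Plane) (S : Set Plane) (i : Fin 2) (f : ℝ → ℝ) : Prop :=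
  ∀ W ∈ 𝓝 (0 : Plane), ∀ᶠ x in 𝓝 (0 : ℝ), Transit V S W i x (f x)

/-- `f x = a x + b x² + c x³ + o(x³)` at `0`. -/
def HasTaylorThree (f : ℝ → ℝ) (a b c : ℝ) : Prop :=
  (fun x => f x - (a * x + b * x ^ 2 + c * x ^ 3)) =o[𝓝 0] fun x : ℝ => x ^ 3

/-- `α_Z = X₁ Y₂ / (X₂ Y₁)` at the origin. -/
def alpha (Z : PiecewiseField) : ℝ := (Z.X 0 0 * Z.Y 0 1) / (Z.X 0 1 * Z.Y 0 0)

/-- `β = β_Z` and `η = η_Z` are the coefficients of the first return map of `Z`. Here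
`φ_X : Σ₁ → Σ₂` and `φ_Y : Σ₂ → Σ₁` are the transition maps,
`φ_X = a_X x + b_X x² + c_X x³ + ⋯`, `φ_Y = a_Y x + b_Y x² + c_Y x³ + ⋯`,
`β_Z = b_X a_Y² + a_X b_Y`, and `η_Z` is the third coefficient of `φ_Z = (φ_X ∘ φ_Y)²`:
`φ_Z = α_Z² x + (α_Z + α_Z²) β_Z x² + η_Z x³ + ⋯`. -/
def HasReturnCoefficients (Z : PiecewiseField) (β η : ℝ) : Prop :=
  ∃ (φX φY : ℝ → ℝ) (aX bX cX aY bY cY : ℝ),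
    IsTransitionMap Z.X Upos 0 φX ∧ IsTransitionMap Z.Y Uneg 1 φY ∧
    HasTaylorThree φX aX bX cX ∧ HasTaylorThree φY aY bY cY ∧
    β = bX * aY ^ 2 + aX * bY ∧
    HasTaylorThree ((φX ∘ φY) ∘ (φX ∘ φY))
      (alpha Z ^ 2) ((alpha Z + alpha Z ^ 2) * β) η

/-- The first return map of `Z` on `Σ₂`, as a relation, the orbits being required to stay in `W`:
`x' = (φ_X ∘ φ_Y)² x`. -/
def ReturnRel (Z : PiecewiseField) (W : Set Plane) (x x' : ℝ) : Prop :=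
  ∃ y z w, Transit Z.Y Uneg W 1 x y ∧ Transit Z.X Upos W 0 y z ∧
    Transit Z.Y Uneg W 1 z w ∧ Transit Z.X Upos W 0 w x'

/-! ### The pseudo-Hopf set and its versal unfoldings -/

/-- The pseudo-Hopf conditions: one branch is crossing and the other one sliding or escaping at the
origin, `X₁ X₂ < 0` there (so that `Z` is transient), `α_Z = -1`, `β_Z ≠ 0` and `η_Z ≠ 0`. -/
def IsPseudoHopf (Z : PiecewiseField) : Prop :=
  (∃ i, 0 < Z.X 0 i * Z.Y 0 i ∧ Z.X 0 (i + 1) * Z.Y 0 (i + 1) < 0) ∧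
    Z.X 0 0 * Z.X 0 1 < 0 ∧ alpha Z = -1 ∧
    ∃ β η, HasReturnCoefficients Z β η ∧ β ≠ 0 ∧ η ≠ 0

/-- The pseudo-Hopf set, a subset of `Ω` (a submanifold of codimension one). -/
def pseudoHopfSet (r : ℕ) (U : TopologicalSpace.Opens Plane) : Set (Omega r U) :=
  {Z | IsPseudoHopf Z.toField}

/-- `γ` is a one-parameter versal unfolding of `Z` in `Ω`: a `C^1` curve in the normed space `Ω`
with `γ 0 = Z` which is transverse at `Z` to the pseudo-Hopf set, that is, whose velocity is not
tangent to this hypersurface. -/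
def IsVersalUnfolding {r : ℕ} {U : TopologicalSpace.Opens Plane} (Z : Omega r U)
    (γ : ℝ → Omega r U) : Prop :=
  γ 0 = Z ∧ (∃ δ₀ > 0, ContDiffOn ℝ 1 γ (Ioo (-δ₀) δ₀)) ∧
    deriv γ 0 ∉ tangentConeAt ℝ (pseudoHopfSet r U) Z

/-- The one-parameter family
`X_δ = (a c, -(a c + δ))`, `Y (x₁, x₂) = (a, a + x₁ + a b x₁²)`. -/
def normalForm (a b c δ : ℝ) : PiecewiseField where
  dom := ⊤
  X := fun _ => ![a * c, -(a * c + δ)]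
  Y := fun p => ![a, a + p 0 + a * b * p 0 ^ 2]

/-! ### Pseudo-cycles -/

/-- `σ`, on `[0, T]`, is a complete regular orbit of `Z` inside `W` together with its two edges:
the departing point `σ 0` and the arrival point `σ T`, at which the regular orbit stops. -/
structure IsRegularOrbitWithEdges (Z : PiecewiseField) (W : Set Plane) (T : ℝ) (σ : ℝ → Plane) :
    Prop where
  pos : 0 < T
  continuousOn : ContinuousOn σ (Icc 0 T)
  arc : IsRegularArc Z W (Ioo 0 T) σ
  departing_mem : σ 0 ∈ W
  arrival_mem : σ T ∈ W
  departing : ¬ IsRegularPoint Z (σ 0)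
  arrival : ¬ IsRegularPoint Z (σ T)

/-- `Γ` is a pseudo-cycle of `Z` inside `W`: the union of finitely many different regular orbits
with their edges, cyclically ordered so that consecutive orbits share an edge, which is homeomorphic
to `ℝ / ℤ`, and in which two departing points or two arrival points coincide. -/
def IsPseudoCycle (Z : PiecewiseField) (W Γ : Set Plane) : Prop :=
  ∃ (n : ℕ) (T : Fin (n + 1) → ℝ) (σ : Fin (n + 1) → ℝ → Plane),
    (∀ k, IsRegularOrbitWithEdges Z W (T k) (σ k)) ∧
    (Pairwise fun k l => Disjoint (σ k '' Ioo 0 (T k)) (σ l '' Ioo 0 (T l))) ∧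
    (∀ k, (({σ k 0, σ k (T k)} : Set Plane) ∩ {σ (k + 1) 0, σ (k + 1) (T (k + 1))}).Nonempty) ∧
    Γ = ⋃ k, σ k '' Icc 0 (T k) ∧
    (∃ e : UnitAddCircle → Plane, Continuous e ∧ Function.Injective e ∧ range e = Γ) ∧
    ∃ k l, k ≠ l ∧ (σ k 0 = σ l 0 ∨ σ k (T k) = σ l (T l))

/-- `Γ` meets the half-line `Σ₂⁻` at a fixed point of the first return map, and the derivative of the
first return map at this point is `d`. -/
def HasMultiplier (Z : PiecewiseField) (W Γ : Set Plane) (d : ℝ) : Prop :=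
  ∃ p < 0, axisPoint 0 p ∈ Γ ∧ ∃ f : ℝ → ℝ, f p = p ∧
    (∀ᶠ x in 𝓝 p, ReturnRel Z W x (f x)) ∧ HasDerivAt f d p

/-- A pseudo-cycle bifurcates from the origin in the family `Z` on the side `s δ > 0` of the
parameter: in arbitrarily small neighbourhoods `W` of the origin, for small `δ`, there is exactly one
pseudo-cycle if `s δ > 0` and there is none if `s δ ≤ 0`. If `b > 0` it is a hyperbolic unstable
fixed point of the first return map; if `b < 0` it is a hyperbolic stable one. -/
def PseudoCycleBifurcation (Z : ℝ → PiecewiseField) (s b : ℝ) : Prop :=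
  ∀ N ∈ 𝓝 (0 : Plane), ∃ W ⊆ N, IsOpen W ∧ 0 ∈ W ∧ ∀ᶠ δ in 𝓝 (0 : ℝ),
    (0 < s * δ → ∃ Γ, IsPseudoCycle (Z δ) W Γ ∧ (∀ Γ', IsPseudoCycle (Z δ) W Γ' → Γ' = Γ) ∧
      ∃ d, HasMultiplier (Z δ) W Γ d ∧ (0 < b → 1 < d) ∧ (b < 0 → 0 < d ∧ d < 1)) ∧
    (s * δ ≤ 0 → ∀ Γ, ¬ IsPseudoCycle (Z δ) W Γ)

end PseudoHopf

end

/-!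
The orbits of `X` and of `Y` near the origin are the level curves of first integrals `N` and `M`. As
both fields are transverse to both branches of `Σ`, these are monotone in each coordinate; they can
be normalised so that `N` is the coordinate on `Σ₂` and `N = M` on `Σ₁`. Each orbit is then labelled
by a real number, its value of `N` or `M`, and all the dynamics is in the function which `M` induces
on `Σ₂`: it is the half-return map `P`, a decreasing map fixing `0` with multiplier `α`, and the first
return map is `F = P ∘ P`. The first integrals can be chosen of class `C³` jointly in the field and the
point (`exists_first_integral`); they are obtained by solving an integral equation in `C([0, 1])` with
the implicit function theorem, the superposition operators being smooth. Hence the Taylor coefficients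
of `P` vary continuously with the field, and close to a pseudo-Hopf field, the equation `α = -1` alone
defines the pseudo-Hopf set (`eventually_isPseudoHopf`).

*Bifurcation.* When `α = -1` the map `F` has no quadratic term and its cubic coefficient is `η`. So,
for nearby fields, `F x - x` has a third derivative of constant sign and at most three zeros. They are
`0` and at most one pair `x`, `P x` on both sides of `0`; this pair exists if and only if `α + 1` and
`η` have the same sign (`exists_local_pattern`, `eventually_pattern`), and it is then repelling if
`η > 0` and attracting if `η < 0`.

*Equivalence.* Two half-return maps whose squares have the same pattern of fixed points, with the same
stability, are conjugate by an increasing homeomorphism `κ`: Abel's equation conjugates the squares on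
`[0, ∞)`, and `P` transports the conjugacy to `(-∞, 0]` (`exists_conj_of_antitone`). A radial
homeomorphism of the plane, which multiplies each point by a positive number, sends the leaf of label
`v` to the leaf of label `κ v` (`exists_radial_homeo`). It preserves `Σ` and the direction of the motion
along the leaves and along the sliding branch, so that after a change of time it sends trajectories to
trajectories (`mapsTrajectories`, `exists_sigmaEquivalence`). The conjugacy `κ` may be chosen to fix
a point `e` which does not depend on the parameter. This bounds the distortion of the radial
homeomorphism, and gives a neighbourhood `W` common to all parameters.

*Transversality.* The number `α + 1` has, up to a factor which does not vanish, the value of the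
function `X₁ Y₂ + X₂ Y₁` at the origin. If its derivative along a versal unfolding were zero, the
unfolding could be moved into the pseudo-Hopf set by a correction of order `o(δ)`, and its velocity
would be a tangent vector. Thus `α + 1` changes sign at `δ = 0` as it does for the normal form, up to
replacing `δ` by `-δ`.

*Pseudo-cycles.* A regular orbit with its edges goes through two adjacent quadrants, from one half
of the non-crossing branch to the other. In a pseudo-cycle every edge is shared by two orbits, since
a circle cannot be cut at a single point; so the finite set of labels of the edges is preserved by the
increasing map `F`, and consists of nonzero fixed points (`pseudoCycle_orbits`). Hence there is at most
one pseudo-cycle, and conversely the orbits between the two points of the pair form one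
(`exists_pseudoCycle`).
-/

noncomputable section

namespace PseudoHopf


/-! ### Smoothness of the evaluation map on the space of vector fields -/

/-- The values of the `k`-th order derivatives of vector fields. -/
abbrev Jet (k : ℕ) : Type := ContinuousMultilinearMap ℝ (fun _ : Fin k => Plane) Plane

section Evaluation

set_option maxSynthPendingDepth 3

variable {r : ℕ} {U : TopologicalSpace.Opens Plane}

/-- The derivative of order `k` of the vector field `V` at `p` (zero outside `U`). -/
def jet (k : ℕ) (hk : k ≤ r) (V : VectorFields r U) (p : Plane) : Jet k :=
  open Classical in if hp : p ∈ U then V.1 ⟨k, Nat.lt_succ_of_le hk⟩ ⟨p, hp⟩ else 0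

theorem jet_eq {k : ℕ} (hk : k ≤ r) (V : VectorFields r U) {p : Plane} (hp : p ∈ U) :
    jet k hk V p = V.1 ⟨k, Nat.lt_succ_of_le hk⟩ ⟨p, hp⟩ := by
  simp [jet, hp]

theorem norm_jet_le {k : ℕ} (hk : k ≤ r) (V : VectorFields r U) (p : Plane) :
    ‖jet k hk V p‖ ≤ ‖V‖ := by
  by_cases hp : p ∈ U
  · rw [jet_eq hk V hp]
    refine (BoundedContinuousFunction.norm_coe_le_norm _ _).trans ?_
    exact norm_le_pi_norm (f := (V.1 : (k : Fin (r + 1)) →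
      (U →ᵇ ContinuousMultilinearMap ℝ (fun _ : Fin (k : ℕ) => Plane) Plane))) _
  · simp [jet, hp]

theorem fieldValue_eq_jet (V : VectorFields r U) (p : Plane) :
    fieldValue V p = jet 0 (Nat.zero_le r) V p 0 := by
  by_cases hp : p ∈ U
  · simp only [fieldValue, hp, dif_pos, jet]
    rfl
  · simp [fieldValue, jet, hp]

theorem jet_hasFDerivAt {k : ℕ} (hk : k + 1 ≤ r) (V : VectorFields r U) {p : Plane} (hp : p ∈ U) :
    HasFDerivAt (jet k (Nat.le_of_succ_le hk) V) (jet (k + 1) hk V p).curryLeft p := by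
  obtain ⟨W, hW, hJ⟩ := V.2
  have h := (hW.ftaylorSeriesWithin U.isOpen.uniqueDiffOn).fderivWithin k
    (by exact_mod_cast Nat.lt_of_succ_le hk) p hp
  have h' := h.hasFDerivAt (U.isOpen.mem_nhds hp)
  have e1 : jet (k + 1) hk V p = ftaylorSeriesWithin ℝ W U p k.succ := by
    rw [jet_eq hk V hp]; exact hJ _ ⟨p, hp⟩
  rw [e1]
  refine h'.congr_of_eventuallyEq ?_
  filter_upwards [U.isOpen.mem_nhds hp] with q hq
  rw [jet_eq _ V hq]; exact hJ _ ⟨q, hq⟩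

theorem jet_add {k : ℕ} (hk : k ≤ r) (V W : VectorFields r U) (p : Plane) :
    jet k hk (V + W) p = jet k hk V p + jet k hk W p := by
  by_cases hp : p ∈ U
  · simp only [jet_eq hk _ hp]; rfl
  · simp [jet, hp]

theorem jet_smul {k : ℕ} (hk : k ≤ r) (a : ℝ) (V : VectorFields r U) (p : Plane) :
    jet k hk (a • V) p = a • jet k hk V p := by
  by_cases hp : p ∈ U
  · simp only [jet_eq hk _ hp]; rfl
  · simp [jet, hp]

/-- The evaluation of the derivative of order `k` at `p`, as a linear function of the field. -/
def jetCLM (k : ℕ) (hk : k ≤ r) (p : Plane) : VectorFields r U →L[ℝ] Jet k :=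
  LinearMap.mkContinuous
    { toFun := fun V => jet k hk V p
      map_add' := fun V W => jet_add hk V W p
      map_smul' := fun a V => jet_smul hk a V p } 1
    (fun V => by simpa using norm_jet_le hk V p)

@[simp] theorem jetCLM_apply {k : ℕ} (hk : k ≤ r) (p : Plane) (V : VectorFields r U) :
    jetCLM k hk p V = jet k hk V p := rfl

/-- Currying the first variable, as a continuous linear map. -/
def curryL (k : ℕ) : Jet (k + 1) →L[ℝ] (Plane →L[ℝ] Jet k) :=
  (continuousMultilinearCurryLeftEquiv ℝ (fun _ : Fin (k + 1) => Plane)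
    Plane).toContinuousLinearEquiv.toContinuousLinearMap

@[simp] theorem curryL_apply {k : ℕ} (f : Jet (k + 1)) : curryL k f = f.curryLeft := rfl

/-- The linear map sending an operator `V ↦ T V` with values in the jets of order `k + 1` to the
map `q ↦ (V ↦ (T V)(q, ⋯))`. -/
def flipCurryL (k : ℕ) : (VectorFields r U →L[ℝ] Jet (k + 1)) →L[ℝ]
    (Plane →L[ℝ] (VectorFields r U →L[ℝ] Jet k)) :=
  ((ContinuousLinearMap.flipₗᵢ ℝ (VectorFields r U) Plane
    (Jet k)).toContinuousLinearEquiv.toContinuousLinearMap).comp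
    (ContinuousLinearMap.compL ℝ (VectorFields r U) (Jet (k + 1)) (Plane →L[ℝ] Jet k) (curryL k))

theorem norm_jet_sub_le {k : ℕ} (hk : k + 1 ≤ r) {s : Set Plane} (hs : Convex ℝ s)
    (hsU : s ⊆ U) (V : VectorFields r U) {p q : Plane} (hp : p ∈ s) (hq : q ∈ s) :
    ‖jet k (Nat.le_of_succ_le hk) V q - jet k (Nat.le_of_succ_le hk) V p‖ ≤ ‖V‖ * ‖q - p‖ := by
  refine hs.norm_image_sub_le_of_norm_hasFDerivWithin_le
    (fun z hz => (jet_hasFDerivAt hk V (hsU hz)).hasFDerivWithinAt) (fun z hz => ?_) hp hq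
  rw [ContinuousMultilinearMap.curryLeft_norm]
  exact norm_jet_le hk V z

theorem exists_convex_nhds (p : Plane) (hp : p ∈ U) :
    ∃ s ∈ 𝓝 p, Convex ℝ s ∧ s ⊆ (U : Set Plane) := by
  obtain ⟨ε, hε, h⟩ := Metric.isOpen_iff.1 U.isOpen p hp
  exact ⟨_, Metric.ball_mem_nhds p hε, convex_ball p ε, h⟩

/-- In the operator norm, the evaluation of `k`-jets is Lipschitz in the point: this costs one
derivative of the fields. -/
theorem jetCLM_continuousOn {k : ℕ} (hk : k + 1 ≤ r) :
    ContinuousOn (jetCLM (r := r) (U := U) k (Nat.le_of_succ_le hk)) U := by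
  intro p hp
  obtain ⟨s, hs, hc, hsU⟩ := exists_convex_nhds p hp
  refine ContinuousAt.continuousWithinAt ?_
  have hb : ∀ᶠ q in 𝓝 p, ‖jetCLM (r := r) (U := U) k (Nat.le_of_succ_le hk) q -
      jetCLM k (Nat.le_of_succ_le hk) p‖ ≤ ‖q - p‖ := by
    filter_upwards [hs] with q hq
    refine ContinuousLinearMap.opNorm_le_bound _ (norm_nonneg _) fun V => ?_
    have := norm_jet_sub_le hk hc hsU V (mem_of_mem_nhds hs) hq
    simpa [mul_comm] using this
  rw [ContinuousAt, tendsto_iff_norm_sub_tendsto_zero]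
  refine squeeze_zero' (Eventually.of_forall fun _ => norm_nonneg _) hb ?_
  have : Tendsto (fun q : Plane => ‖q - p‖) (𝓝 p) (𝓝 ‖p - p‖) :=
    ((continuous_id.sub continuous_const).norm).tendsto p
  simpa using this

/-- The evaluation of `k`-jets is differentiable in the operator norm, by Taylor's formula with a
remainder bounded by `‖V‖ ‖q - p‖²`: this costs two derivatives of the fields. -/
theorem jetCLM_hasFDerivAt {k : ℕ} (hk : k + 2 ≤ r) {p : Plane} (hp : p ∈ U) :
    HasFDerivAt (jetCLM (r := r) (U := U) k (by omega)) (flipCurryL k (jetCLM (r := r) (U := U) (k + 1) (by omega) p)) p := by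
  obtain ⟨s, hs, hc, hsU⟩ := exists_convex_nhds p hp
  refine HasFDerivAtFilter.of_isLittleO ?_
  refine Asymptotics.IsBigO.trans_isLittleO (g := fun q : Plane × Plane => ‖q.1 - q.2‖ ^ 2) ?_ ?_
  · refine Asymptotics.IsBigO.of_bound 1 ?_
    have : ∀ᶠ q : Plane × Plane in 𝓝 p ×ˢ pure p, q.1 ∈ s ∧ q.2 = p :=
      (eventually_of_mem hs fun _ h => h).prod_mk
        (show ∀ᶠ y in pure p, y = p from eventually_pure.2 rfl)
    filter_upwards [this] with q hq
    obtain ⟨q, q'⟩ := q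
    obtain ⟨hq, hq'⟩ := hq
    simp only at hq hq'
    subst hq'
    refine ContinuousLinearMap.opNorm_le_bound _ (by positivity) fun V => ?_
    have hseg : segment ℝ q' q ⊆ s := hc.segment_subset (mem_of_mem_nhds hs) hq
    have key := (convex_segment (𝕜 := ℝ) q' q).norm_image_sub_le_of_norm_hasFDerivWithin_le'
      (f := jet (r := r) (U := U) k (by omega) V) (f' := fun z => (jet (r := r) (U := U) (k + 1) (by omega) V z).curryLeft)
      (φ := (jet (r := r) (U := U) (k + 1) (by omega) V q').curryLeft) (C := ‖V‖ * ‖q - q'‖)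
      (fun z hz => (jet_hasFDerivAt (by omega) V (hsU (hseg hz))).hasFDerivWithinAt)
      (fun z hz => by
        have e : (jet (k + 1) (by omega) V z).curryLeft - (jet (k + 1) (by omega) V q').curryLeft
          = curryL k (jet (k + 1) (by omega) V z - jet (k + 1) (by omega) V q') := by
          rw [map_sub]; rfl
        rw [e, curryL_apply, ContinuousMultilinearMap.curryLeft_norm]
        refine (norm_jet_sub_le (by omega) hc hsU V (mem_of_mem_nhds hs) (hseg hz)).trans ?_
        gcongr
        obtain ⟨a, b, ha, hb, hab, rfl⟩ := hz
        have : a • q' + b • q - q' = b • (q - q') := by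
          have : a = 1 - b := by linarith
          subst this; module
        rw [this, norm_smul, Real.norm_of_nonneg hb]
        exact mul_le_of_le_one_left (norm_nonneg _) (by linarith))
      (left_mem_segment ℝ q' q) (right_mem_segment ℝ q' q)
    calc _ = ‖jet k (by omega) V q - jet k (by omega) V q' -
          (jet (k + 1) (by omega) V q').curryLeft (q - q')‖ := rfl
      _ ≤ _ := key
      _ = _ := by rw [norm_pow, norm_norm]; ring
  · have h1 : Tendsto (fun q : Plane × Plane => q.1 - q.2) (𝓝 p ×ˢ pure p) (𝓝 0) := by
      have : Tendsto (fun q : Plane × Plane => q.1 - q.2) (𝓝 (p, p)) (𝓝 (p - p)) :=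
        (continuous_fst.sub continuous_snd).tendsto _
      rw [sub_self, nhds_prod_eq] at this
      exact this.mono_left (Filter.prod_mono le_rfl (pure_le_nhds p))
    have h2 : (fun v : Plane => ‖v‖ ^ 2) =o[𝓝 0] fun v => v := by
      have := Asymptotics.isLittleO_norm_pow_id (E' := Plane) (n := 2) (by norm_num)
      exact this
    exact h2.comp_tendsto h1

theorem jetCLM_contDiffOn (n : ℕ) : ∀ (k : ℕ) (hk : k + n + 1 ≤ r),
    ContDiffOn ℝ n (jetCLM (r := r) (U := U) k (by omega)) U := by
  induction n with
  | zero =>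
    intro k hk
    exact contDiffOn_zero.2 (jetCLM_continuousOn hk)
  | succ n ih =>
    intro k hk
    rw [show ((n + 1 : ℕ) : WithTop ℕ∞) = (n : WithTop ℕ∞) + 1 by norm_cast,
      contDiffOn_succ_iff_hasFDerivWithinAt_of_uniqueDiffOn U.isOpen.uniqueDiffOn]
    refine ⟨by simp, fun p => flipCurryL k (jetCLM (r := r) (U := U) (k + 1) (by omega) p), ?_, fun p hp =>
      (jetCLM_hasFDerivAt (by omega) hp).hasFDerivWithinAt⟩
    exact (flipCurryL k).contDiff.comp_contDiffOn (ih (k + 1) (by omega))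

theorem jet_continuousOn {k : ℕ} (hk : k ≤ r) :
    ContinuousOn (fun z : VectorFields r U × Plane => jet k hk z.1 z.2) (univ ×ˢ U) := by
  rw [continuousOn_iff_continuous_domRestrict]
  have : (univ ×ˢ (U : Set Plane)).domRestrict (fun z : VectorFields r U × Plane => jet k hk z.1 z.2)
      = fun z : (univ ×ˢ (U : Set Plane) : Set (VectorFields r U × Plane)) =>
        (z.1.1.1 ⟨k, Nat.lt_succ_of_le hk⟩ : U →ᵇ Jet k) ⟨z.1.2, z.2.2⟩ := by
    funext z
    exact jet_eq hk z.1.1 z.2.2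
  rw [this]
  have h1 : Continuous fun z : (univ ×ˢ (U : Set Plane) : Set (VectorFields r U × Plane)) =>
      (z.1.1.1 ⟨k, Nat.lt_succ_of_le hk⟩ : U →ᵇ Jet k) := by
    have : Continuous fun J : JetSpace r U => (J ⟨k, Nat.lt_succ_of_le hk⟩ : U →ᵇ Jet k) :=
      continuous_apply (A := fun k : Fin (r + 1) => (U →ᵇ Jet (k : ℕ))) _
    exact this.comp (continuous_subtype_val.comp (continuous_fst.comp continuous_subtype_val))
  exact h1.eval ((continuous_snd.comp continuous_subtype_val).subtype_mk _)

/-- Joint smoothness. The partial derivative with respect to the field is the evaluation functional,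
which is only `C^(r - k - 1)` in the operator norm, but this suffices. -/
theorem jet_contDiffOn (n : ℕ) : ∀ (k : ℕ) (hk : k + n ≤ r),
    ContDiffOn ℝ n (fun z : VectorFields r U × Plane => jet (r := r) (U := U) k (by omega) z.1 z.2)
      (univ ×ˢ U) := by
  induction n with
  | zero =>
    intro k hk
    exact contDiffOn_zero.2 (jet_continuousOn hk)
  | succ n ih =>
    intro k hk
    have ho : IsOpen ((univ : Set (VectorFields r U)) ×ˢ (U : Set Plane)) :=
      isOpen_univ.prod U.isOpen
    rw [show ((n + 1 : ℕ) : WithTop ℕ∞) = (n : WithTop ℕ∞) + 1 by norm_cast,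
      contDiffOn_succ_iff_hasFDerivWithinAt_of_uniqueDiffOn ho.uniqueDiffOn]
    have c1 : ContDiffOn ℝ n (fun z : VectorFields r U × Plane => jetCLM (r := r) (U := U) k (by omega) z.2)
        (univ ×ˢ U) :=
      (jetCLM_contDiffOn n k (by omega)).comp contDiff_snd.contDiffOn fun z hz => hz.2
    have c2 : ContDiffOn ℝ n (fun z : VectorFields r U × Plane =>
        curryL k (jet (k + 1) (by omega) z.1 z.2)) (univ ×ˢ U) :=
      (curryL k).contDiff.comp_contDiffOn (ih (k + 1) (by omega))
    refine ⟨by simp, fun z => (jetCLM (r := r) (U := U) k (by omega) z.2).coprod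
      (curryL k (jet (k + 1) (by omega) z.1 z.2)), ?_, fun z hz => ?_⟩
    · have : (fun z : VectorFields r U × Plane => (jetCLM (r := r) (U := U) k (by omega) z.2).coprod
        (curryL k (jet (k + 1) (by omega) z.1 z.2))) = fun z =>
        (jetCLM (r := r) (U := U) k (by omega) z.2).comp (ContinuousLinearMap.fst ℝ _ _) +
        (curryL k (jet (k + 1) (by omega) z.1 z.2)).comp (ContinuousLinearMap.snd ℝ _ _) := by
        funext z
        exact ContinuousLinearMap.ext fun w => rfl
      rw [this]
      exact (c1.clm_comp contDiffOn_const).add (c2.clm_comp contDiffOn_const)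
    · have := hasStrictFDerivAt_uncurry_coprod (𝕜 := ℝ) (u := z)
        (f := fun V p => jet (r := r) (U := U) k (by omega) V p) (f₁ := fun _ p => jetCLM (r := r) (U := U) k (by omega) p)
        (f₂ := fun V p => curryL k (jet (k + 1) (by omega) V p))
        (Eventually.of_forall fun v => (jetCLM k (by omega) v.2).hasFDerivAt)
        (by
          filter_upwards [ho.mem_nhds hz] with v hv
          exact jet_hasFDerivAt (by omega) v.1 hv.2)
        ((c1.continuousOn).continuousAt (ho.mem_nhds hz))
        ((c2.continuousOn).continuousAt (ho.mem_nhds hz))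
      exact this.hasFDerivAt.hasFDerivWithinAt

/-- The evaluation map `(V, p) ↦ V p` is of class `C^r` on `VectorFields r U × U`. -/
theorem fieldValue_contDiffOn :
    ContDiffOn ℝ r (fun z : VectorFields r U × Plane => fieldValue z.1 z.2) (univ ×ˢ U) := by
  have h := jet_contDiffOn (r := r) (U := U) r 0 (by omega)
  have := (ContinuousMultilinearMap.apply ℝ (fun _ : Fin 0 => Plane) Plane 0).contDiff (n := r)
    |>.comp_contDiffOn h
  refine this.congr fun z _ => ?_
  rw [fieldValue_eq_jet]; rfl

end Evaluation


/-! ### Superposition operators and the local first integral -/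

section Superposition

set_option maxSynthPendingDepth 3

variable {K X : Type} [TopologicalSpace K] [CompactSpace K] [NormedAddCommGroup X] [NormedSpace ℝ X]

/-- Pointwise application of a family of operators to a family of vectors. -/
def pointwiseApply (F : Type) [NormedAddCommGroup F] [NormedSpace ℝ F] :
    C(K, X →L[ℝ] F) →L[ℝ] (C(K, X) →L[ℝ] C(K, F)) :=
  LinearMap.mkContinuous₂
    (LinearMap.mk₂ ℝ (fun (A : C(K, X →L[ℝ] F)) (h : C(K, X)) =>
        (⟨fun θ => A θ (h θ), A.continuous.clm_apply h.continuous⟩ : C(K, F)))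
      (fun _ _ _ => by ext; simp) (fun _ _ _ => by ext; simp)
      (fun _ _ _ => by ext; simp) (fun _ _ _ => by ext; simp)) 1
    (fun A h => by
      rw [one_mul]
      refine (ContinuousMap.norm_le _ (by positivity)).2 fun θ => ?_
      refine ((A θ).le_opNorm _).trans ?_
      gcongr
      · exact A.norm_coe_le_norm θ
      · exact h.norm_coe_le_norm θ)

/-- The superposition operator `q ↦ f ∘ q` of a `C^n` map `f`, between spaces of continuous
functions on a compact space with the sup norm, is of class `C^n`. -/
theorem contDiff_superposition (n : ℕ) : ∀ {F : Type} [NormedAddCommGroup F] [NormedSpace ℝ F]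
    (f : X → F) (hf : ContDiff ℝ n f),
    ContDiff ℝ n (fun q : C(K, X) => (⟨f, hf.continuous⟩ : C(X, F)).comp q) := by
  induction n with
  | zero =>
    intro F _ _ f hf
    exact contDiff_zero.2 (ContinuousMap.continuous_postcomp _)
  | succ n ih =>
    intro F _ _ f hf
    have hf' : ContDiff ℝ ((n : WithTop ℕ∞) + 1) f := by exact_mod_cast hf
    obtain ⟨f', hf'n, hd⟩ := contDiff_succ_iff_hasFDerivAt.1 hf'
    have hs := ih f' hf'n
    -- The derivative of `q ↦ f ∘ q` is pointwise application of `f' ∘ q`.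
    suffices h : ContDiff ℝ ((n : WithTop ℕ∞) + 1)
        (fun q : C(K, X) => (⟨f, hf.continuous⟩ : C(X, F)).comp q) by exact_mod_cast h
    rw [contDiff_succ_iff_hasFDerivAt]
    refine ⟨fun q => pointwiseApply F ((⟨f', hf'n.continuous⟩ : C(X, X →L[ℝ] F)).comp q),
      ?_, fun q => ?_⟩
    · have h := ContinuousLinearMap.contDiff (𝕜 := ℝ) (E := C(K, X →L[ℝ] F))
        (F := C(K, X) →L[ℝ] C(K, F)) (n := n) (pointwiseApply F)
      exact h.comp hs
    rw [hasFDerivAt_iff_isLittleO_nhds_zero, Asymptotics.isLittleO_iff]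
    intro ε hε
    obtain ⟨δ, hδ, H⟩ := Metric.continuousAt_iff.1 hs.continuous.continuousAt ε hε
    filter_upwards [Metric.ball_mem_nhds (0 : C(K, X)) hδ] with h hh
    refine (ContinuousMap.norm_le _ (by positivity)).2 fun θ => ?_
    -- The superposition operator of `f'` is continuous at `q`, so that `f'` varies by at most `ε` on
    -- the segments from `q θ` to `q θ + h θ`, uniformly in `θ`.
    have hb : ∀ z ∈ segment ℝ (q θ) (q θ + h θ), ‖f' z - f' (q θ)‖ ≤ ε := by
      rintro z ⟨a, b, ha, hb, hab, rfl⟩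
      have e : a • q θ + b • (q θ + h θ) = (q + b • h) θ := by
        have : a = 1 - b := by linarith
        subst this
        simp only [ContinuousMap.add_apply, ContinuousMap.smul_apply]; module
      have hlt : dist (q + b • h) q < δ := by
        rw [dist_eq_norm, add_sub_cancel_left, norm_smul, Real.norm_of_nonneg hb]
        rw [mem_ball_zero_iff] at hh
        exact (mul_le_of_le_one_left (norm_nonneg _) (by linarith)).trans_lt hh
      have := (ContinuousMap.dist_apply_le_dist θ).trans (H hlt).le
      rw [e, ← dist_eq_norm]
      exact this
    have key := (convex_segment (𝕜 := ℝ) (q θ) (q θ + h θ)).norm_image_sub_le_of_norm_hasFDerivWithin_le'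
      (fun z _ => (hd z).hasFDerivWithinAt) hb (left_mem_segment ℝ _ _) (right_mem_segment ℝ _ _)
    rw [add_sub_cancel_left] at key
    refine le_trans ?_ (key.trans ?_)
    · exact le_of_eq rfl
    · gcongr
      exact h.norm_coe_le_norm θ

/-- Constant functions, as a continuous linear map. -/
def constCLM (K X : Type) [TopologicalSpace K] [CompactSpace K] [NormedAddCommGroup X]
    [NormedSpace ℝ X] : X →L[ℝ] C(K, X) :=
  LinearMap.mkContinuous
    { toFun := fun x => ContinuousMap.const K x
      map_add' := fun _ _ => rfl
      map_smul' := fun _ _ => rfl } 1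
    (fun x => by
      rw [one_mul]
      exact (ContinuousMap.norm_le _ (norm_nonneg _)).2 fun _ => le_rfl)

@[simp] theorem constCLM_apply (x : X) (θ : K) : constCLM K X x θ = x := rfl

/-- The operator `u ↦ (θ ↦ ∫_θ^1 u)` on `C([0, 1])`. -/
def tailIntegral : C(unitInterval, ℝ) →L[ℝ] C(unitInterval, ℝ) :=
  have hi : ∀ (u : C(unitInterval, ℝ)) (a b : ℝ), IntervalIntegrable
      (fun φ => u (projIcc 0 1 zero_le_one φ)) MeasureTheory.volume a b := fun u a b =>
    (u.continuous.comp continuous_projIcc).intervalIntegrable a b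
  LinearMap.mkContinuous
    { toFun := fun u => ⟨fun θ => ∫ φ in (θ : ℝ)..1, u (projIcc 0 1 zero_le_one φ), by
        have h : Continuous fun t : ℝ => ∫ φ in (1 : ℝ)..t, u (projIcc 0 1 zero_le_one φ) :=
          intervalIntegral.continuous_primitive (hi u) 1
        have : (fun θ : unitInterval => ∫ φ in (θ : ℝ)..1, u (projIcc 0 1 zero_le_one φ)) =
          fun θ : unitInterval => - ∫ φ in (1 : ℝ)..(θ : ℝ), u (projIcc 0 1 zero_le_one φ) := by
          funext θ; rw [intervalIntegral.integral_symm]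
        rw [this]
        exact (h.comp continuous_subtype_val).neg⟩
      map_add' := fun u v => by
        ext θ
        exact intervalIntegral.integral_add (hi u _ _) (hi v _ _)
      map_smul' := fun a u => by
        ext θ
        exact intervalIntegral.integral_smul a _ } 1
    (fun u => by
      rw [one_mul]
      refine (ContinuousMap.norm_le _ (norm_nonneg _)).2 fun θ => ?_
      have := intervalIntegral.norm_integral_le_of_norm_le_const (a := (θ : ℝ)) (b := 1)
        (f := fun φ => u (projIcc 0 1 zero_le_one φ)) (C := ‖u‖)
        (fun φ _ => u.norm_coe_le_norm _)
      refine this.trans ?_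
      have h0 := θ.2.1
      have h1 := θ.2.2
      rw [abs_of_nonneg (by linarith)]
      exact mul_le_of_le_one_right (norm_nonneg _) (by linarith))

theorem tailIntegral_apply (u : C(unitInterval, ℝ)) (θ : unitInterval) :
    tailIntegral u θ = ∫ φ in (θ : ℝ)..1, u (projIcc 0 1 zero_le_one φ) := rfl

end Superposition

section FirstIntegral

variable {E : Type} [NormedAddCommGroup E] [NormedSpace ℝ E]

/-- The point with coordinate `s` at the index `i` and coordinate `y` at the other index. -/
def mkPoint (i : Fin 2) (s y : ℝ) : Plane := axisPoint i s + axisPoint (i + 1) y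

@[simp] theorem mkPoint_self (i : Fin 2) (s y : ℝ) : mkPoint i s y i = s := by
  fin_cases i <;> simp [mkPoint, axisPoint]

@[simp] theorem mkPoint_succ (i : Fin 2) (s y : ℝ) : mkPoint i s y (i + 1) = y := by
  fin_cases i <;> simp [mkPoint, axisPoint]

theorem mkPoint_eta (i : Fin 2) (p : Plane) : mkPoint i (p i) (p (i + 1)) = p := by
  ext j; fin_cases i <;> fin_cases j <;> simp [mkPoint, axisPoint]

theorem norm_mkPoint (i : Fin 2) (s y : ℝ) : ‖mkPoint i s y‖ = max |s| |y| := by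
  refine le_antisymm ((pi_norm_le_iff_of_nonneg (by positivity)).2 fun j => ?_)
    (max_le ?_ ?_)
  · fin_cases i <;> fin_cases j <;> simp [mkPoint, axisPoint]
  · simpa using norm_le_pi_norm (mkPoint i s y) i
  · simpa using norm_le_pi_norm (mkPoint i s y) (i + 1)

/-- The curve `θ ↦ (e, (θ s, v θ))` as a linear function of `(e, (s, y))` and `v`. -/
def graphCLM (i : Fin 2) :
    ((E × Plane) × C(unitInterval, ℝ)) →L[ℝ] C(unitInterval, E × Plane) :=
  ((ContinuousLinearMap.inl ℝ E Plane).compLeftContinuous ℝ unitInterval).comp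
      ((constCLM unitInterval E).comp ((ContinuousLinearMap.fst ℝ E Plane).comp
        (ContinuousLinearMap.fst ℝ _ _))) +
    ((ContinuousLinearMap.inr ℝ E Plane).compLeftContinuous ℝ unitInterval).comp
      ((((ContinuousLinearMap.single ℝ (fun _ : Fin 2 => ℝ) i).compLeftContinuous ℝ
          unitInterval).comp
          (((ContinuousLinearMap.proj i).comp ((ContinuousLinearMap.snd ℝ E Plane).comp
            (ContinuousLinearMap.fst ℝ _ _))).smulRight
              (⟨Subtype.val, continuous_subtype_val⟩ : C(unitInterval, ℝ)))) +
        ((ContinuousLinearMap.single ℝ (fun _ : Fin 2 => ℝ) (i + 1)).compLeftContinuous ℝ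
          unitInterval).comp (ContinuousLinearMap.snd ℝ _ _))

theorem graphCLM_apply (i : Fin 2) (z : E × Plane) (v : C(unitInterval, ℝ)) (θ : unitInterval) :
    graphCLM i (z, v) θ = (z.1, mkPoint i (z.2 i * θ) (v θ)) := by
  refine Prod.ext ?_ ?_
  · simp [graphCLM]
  · have hA : ∀ {M N : Type} [NormedAddCommGroup M] [NormedSpace ℝ M] [NormedAddCommGroup N]
        [NormedSpace ℝ N] (g : M →L[ℝ] N) (w : C(unitInterval, M)),
        (g.compLeftContinuous ℝ unitInterval w) θ = g (w θ) := fun g w => rfl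
    simp only [graphCLM, add_apply, ContinuousLinearMap.comp_apply,
      ContinuousMap.add_apply, hA, ContinuousLinearMap.smulRight_apply, map_smul,
      ContinuousMap.smul_apply]
    simp [mkPoint, axisPoint, ← Pi.single_smul]

/-- The equation `v θ - y + s ∫_θ^1 f (e, (s φ, v φ)) dφ = 0` satisfied by the solution `v` of the
rescaled scalar equation, with slope `f`, passing through the point `(s, y)`. -/
def orbitEquation (i : Fin 2) (f : C(E × Plane, ℝ)) (w : (E × Plane) × C(unitInterval, ℝ)) :
    C(unitInterval, ℝ) :=
  w.2 - constCLM unitInterval ℝ (w.1.2 (i + 1)) + w.1.2 i • tailIntegral (f.comp (graphCLM i w))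

theorem orbitEquation_contDiff (i : Fin 2) (n : ℕ) (f : E × Plane → ℝ) (hf : ContDiff ℝ n f) :
    ContDiff ℝ n (orbitEquation i (⟨f, hf.continuous⟩ : C(E × Plane, ℝ))) := by
  have h0 : ContDiff ℝ n (graphCLM (E := E) i) := ContinuousLinearMap.contDiff _
  have h1 : ContDiff ℝ n fun w : (E × Plane) × C(unitInterval, ℝ) =>
      tailIntegral ((⟨f, hf.continuous⟩ : C(E × Plane, ℝ)).comp (graphCLM i w)) :=
    tailIntegral.contDiff.comp ((contDiff_superposition n f hf).comp h0)
  have h2 : ∀ j : Fin 2, ContDiff ℝ n fun w : (E × Plane) × C(unitInterval, ℝ) => w.1.2 j :=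
    fun j => (contDiff_apply ℝ ℝ j).comp (contDiff_snd.comp contDiff_fst)
  exact (contDiff_snd.sub ((constCLM unitInterval ℝ).contDiff.comp (h2 (i + 1)))).add
    ((h2 i).smul h1)

theorem orbitEquation_apply (i : Fin 2) (f : C(E × Plane, ℝ)) (z : E × Plane)
    (v : C(unitInterval, ℝ)) (θ : unitInterval) :
    orbitEquation i f (z, v) θ = v θ - z.2 (i + 1) + z.2 i * ∫ φ in (θ : ℝ)..1,
      f (z.1, mkPoint i (z.2 i * projIcc (0 : ℝ) 1 zero_le_one φ)
        (v (projIcc 0 1 zero_le_one φ))) := by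
  simp only [orbitEquation, ContinuousMap.add_apply, ContinuousMap.sub_apply,
    ContinuousMap.smul_apply, constCLM_apply, tailIntegral_apply, smul_eq_mul,
    ContinuousMap.comp_apply, graphCLM_apply]

/-- At the origin `s = 0`, so that the equation is `v = y`, and its derivative in `v` is the
identity. -/
theorem orbitEquation_fderiv (i : Fin 2) (n : ℕ) (hn : n ≠ 0) (f : E × Plane → ℝ)
    (hf : ContDiff ℝ n f) (e : E) :
    fderiv ℝ (orbitEquation i (⟨f, hf.continuous⟩ : C(E × Plane, ℝ))) ((e, 0), 0) ∘L
      .inr ℝ (E × Plane) C(unitInterval, ℝ) = ContinuousLinearMap.id ℝ _ := by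
  have hF : HasFDerivAt (orbitEquation i (⟨f, hf.continuous⟩ : C(E × Plane, ℝ))) _ ((e, 0), 0) :=
    ((orbitEquation_contDiff i n f hf).differentiable (by exact_mod_cast hn) _).hasFDerivAt
  have hg : HasFDerivAt (fun v : C(unitInterval, ℝ) => (((e, 0) : E × Plane), v))
      (.inr ℝ (E × Plane) C(unitInterval, ℝ)) 0 := hasFDerivAt_prodMk_right _ _
  have h1 := hF.comp (0 : C(unitInterval, ℝ)) hg
  have h2 : (orbitEquation i (⟨f, hf.continuous⟩ : C(E × Plane, ℝ))) ∘
      (fun v : C(unitInterval, ℝ) => (((e, 0) : E × Plane), v)) = id := by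
    funext v; ext θ
    simp [orbitEquation_apply]
  rw [h2] at h1
  exact h1.unique (hasFDerivAt_id _)

/-- The solution through `(s, y)`, restarted from its point at time `θ s`. -/
def restart (θ : unitInterval) (v : C(unitInterval, ℝ)) : C(unitInterval, ℝ) :=
  v.comp ⟨fun t => θ * t, by fun_prop⟩

theorem orbitEquation_restart (i : Fin 2) (f : C(E × Plane, ℝ)) (z : E × Plane)
    (v : C(unitInterval, ℝ)) (hv : orbitEquation i f (z, v) = 0) (θ : unitInterval) :
    orbitEquation i f ((z.1, mkPoint i (z.2 i * θ) (v θ)), restart θ v) = 0 := by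
  ext t
  set G : ℝ → ℝ := fun φ => f (z.1, mkPoint i (z.2 i * projIcc (0 : ℝ) 1 zero_le_one φ)
        (v (projIcc 0 1 zero_le_one φ))) with hG
  have hGc : Continuous G := by
    have hp : Continuous (projIcc (0 : ℝ) 1 zero_le_one) := continuous_projIcc
    have : Continuous fun φ : ℝ => mkPoint i (z.2 i * projIcc (0 : ℝ) 1 zero_le_one φ)
        (v (projIcc 0 1 zero_le_one φ)) := by
      unfold mkPoint axisPoint
      exact ((continuous_single (A := fun _ : Fin 2 => ℝ) i).comp
        (continuous_const.mul (continuous_subtype_val.comp hp))).add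
        ((continuous_single (A := fun _ : Fin 2 => ℝ) (i + 1)).comp (v.continuous.comp hp))
    exact f.continuous.comp (continuous_const.prodMk this)
  have eq : ∀ τ : unitInterval, v τ - z.2 (i + 1) + z.2 i * ∫ φ in (τ : ℝ)..1, G φ = 0 := by
    intro τ
    rw [← orbitEquation_apply, hv]; rfl
  have e1 := eq θ
  have e2 := eq (θ * t)
  have hsplit : (∫ φ in ((θ * t : unitInterval) : ℝ)..1, G φ) =
      (∫ φ in ((θ * t : unitInterval) : ℝ)..θ, G φ) + ∫ φ in (θ : ℝ)..1, G φ :=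
    (intervalIntegral.integral_add_adjacent_intervals (hGc.intervalIntegrable _ _)
      (hGc.intervalIntegrable _ _)).symm
  have hsub : (θ : ℝ) * (∫ φ in (t : ℝ)..1, G (θ * φ)) =
      ∫ φ in ((θ * t : unitInterval) : ℝ)..θ, G φ := by
    have := intervalIntegral.smul_integral_comp_mul_left (a := (t : ℝ)) (b := 1) (f := G) (θ : ℝ)
    rw [smul_eq_mul, mul_one] at this
    exact this
  have hcongr : (∫ φ in (t : ℝ)..1, f (z.1, mkPoint i (z.2 i * θ * projIcc (0 : ℝ) 1 zero_le_one φ)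
        (restart θ v (projIcc 0 1 zero_le_one φ)))) = ∫ φ in (t : ℝ)..1, G (θ * φ) := by
    refine intervalIntegral.integral_congr fun φ hφ => ?_
    rw [uIcc_of_le t.2.2] at hφ
    have hφ' : φ ∈ Icc (0 : ℝ) 1 := ⟨t.2.1.trans hφ.1, hφ.2⟩
    have h2 : (θ : ℝ) * φ ∈ Icc (0 : ℝ) 1 :=
      ⟨mul_nonneg θ.2.1 hφ'.1, mul_le_one₀ θ.2.2 hφ'.1 hφ'.2⟩
    simp only [hG, projIcc_of_mem _ hφ', projIcc_of_mem _ h2, restart]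
    congr 2
    rw [mul_assoc]
    rfl
  rw [orbitEquation_apply]
  simp only [mkPoint_self, mkPoint_succ]
  rw [hcongr, mul_assoc, hsub]
  have : restart θ v t = v (θ * t) := rfl
  rw [this]
  simp only [ContinuousMap.zero_apply]
  rw [hsplit] at e2
  linarith

/-- **Local first integrals.** For a slope `f` of class `C^n`, depending on a parameter in a Banach
space, the value at `pᵢ = 0` of the solution of `dpⱼ / dpᵢ = f` through `p` is a `C^n` function of the
parameter and of `p`. It solves a fixed point problem which degenerates to the identity at the
origin, so that it is produced by the implicit function theorem in `C([0, 1])`. -/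
theorem exists_local_first_integral [CompleteSpace E] (i : Fin 2) (n : ℕ) (hn : n ≠ 0)
    (f : E × Plane → ℝ) (hf : ContDiff ℝ n f) (e₀ : E) :
    ∃ H : E × Plane → ℝ, ContDiffAt ℝ n H (e₀, 0) ∧
      (∀ᶠ z : E × ℝ in 𝓝 (e₀, 0), H (z.1, axisPoint (i + 1) z.2) = z.2) ∧
      ∀ᶠ z in 𝓝 ((e₀, 0) : E × Plane), fderiv ℝ H z (0, mkPoint i 1 (f z)) = 0 := by
  set fc : C(E × Plane, ℝ) := ⟨f, hf.continuous⟩ with hfc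
  set u : (E × Plane) × C(unitInterval, ℝ) := ((e₀, 0), 0) with hu
  have cdf : ContDiffAt ℝ n (orbitEquation i fc) u := (orbitEquation_contDiff i n f hf).contDiffAt
  have hn' : (n : WithTop ℕ∞) ≠ 0 := by exact_mod_cast hn
  have if₂ : (fderiv ℝ (orbitEquation i fc) u ∘L
      .inr ℝ (E × Plane) C(unitInterval, ℝ)).IsInvertible := by
    rw [hu, hfc, orbitEquation_fderiv i n hn f hf e₀]
    exact ⟨ContinuousLinearEquiv.refl ℝ _, rfl⟩
  set Ψ := cdf.implicitFunction hn' if₂ with hΨ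
  have hu0 : orbitEquation i fc u = 0 := by
    ext θ
    simp [hu, orbitEquation_apply]
  have hΨc : ContDiffAt ℝ n Ψ u.1 := cdf.contDiffAt_implicitFunction hn' if₂
  have hΨ0 : Ψ u.1 = 0 := cdf.implicitFunction_apply_self hn' if₂
  have hΨe := cdf.eventually_apply_eq_iff_implicitFunction hn' if₂
  rw [hu0] at hΨe
  set ev : C(unitInterval, ℝ) →L[ℝ] ℝ := ContinuousMap.evalCLM ℝ (0 : unitInterval) with hev
  have hHc : ContDiffAt ℝ n (fun z => ev (Ψ z)) u.1 := ev.contDiff.contDiffAt.comp _ hΨc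
  refine ⟨fun z => ev (Ψ z), hHc, ?_, ?_⟩
  -- On the axis `s = 0` the solution is the constant function `y`.
  · have ht : Tendsto (fun z : E × ℝ => (((z.1, axisPoint (i + 1) z.2) : E × Plane),
        constCLM unitInterval ℝ z.2)) (𝓝 (e₀, 0)) (𝓝 u) := by
      have : Continuous (fun z : E × ℝ => (((z.1, axisPoint (i + 1) z.2) : E × Plane),
        constCLM unitInterval ℝ z.2)) := by
        refine (continuous_fst.prodMk ?_).prodMk ((constCLM unitInterval ℝ).continuous.comp
          continuous_snd)
        exact (continuous_single (A := fun _ : Fin 2 => ℝ) (i + 1)).comp continuous_snd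
      have h := this.tendsto (e₀, 0)
      simpa [hu, axisPoint] using h
    filter_upwards [ht.eventually hΨe] with z hz
    have h0 : (axisPoint (i + 1) z.2) i = 0 := by fin_cases i <;> simp [axisPoint]
    have h1 : (axisPoint (i + 1) z.2) (i + 1) = z.2 := by simp [axisPoint]
    have := hz.1 (by
      ext θ
      rw [orbitEquation_apply]
      simp [h0, h1])
    change ev (Ψ _) = _
    rw [hΨ, this]; rfl
  · obtain ⟨ε, hε, hball⟩ := Metric.eventually_nhds_iff.1 hΨe
    have hcont : ContinuousAt Ψ u.1 := hΨc.continuousAt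
    have hsmall : ∀ᶠ z in 𝓝 u.1, dist z u.1 < ε ∧ dist (Ψ z) 0 < ε := by
      have h1 : ∀ᶠ z in 𝓝 u.1, dist z u.1 < ε := Metric.ball_mem_nhds _ hε
      refine h1.and ?_
      have := hcont.eventually (Metric.ball_mem_nhds (Ψ u.1) hε)
      simpa [hΨ0] using this
    have hdiff : ∀ᶠ z in 𝓝 u.1, ContDiffAt ℝ 1 (fun z => ev (Ψ z)) z :=
      (hHc.of_le (by exact_mod_cast Nat.one_le_iff_ne_zero.2 hn)).eventually (by simp)
    -- The identity holds where `s ≠ 0`, since the first integral is constant along solutions.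
    have main : ∀ z, (dist z u.1 < ε ∧ dist (Ψ z) 0 < ε) → ContDiffAt ℝ 1 (fun z => ev (Ψ z)) z →
        z.2 i ≠ 0 → fderiv ℝ (fun z => ev (Ψ z)) z (0, mkPoint i 1 (f z)) = 0 := by
      intro z hz hd hs
      set v := Ψ z with hv
      have hvε : ‖v‖ < ε := by simpa using hz.2
      have hv0 : orbitEquation i fc (z, v) = 0 :=
        (hball (y := (z, v)) (by rw [Prod.dist_eq]; exact max_lt hz.1 hz.2)).2 rfl
      set vt : ℝ → ℝ := fun t => v (projIcc 0 1 zero_le_one t) with hvt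
      set G : ℝ → ℝ := fun φ => f (z.1, mkPoint i (z.2 i * projIcc (0 : ℝ) 1 zero_le_one φ)
        (v (projIcc 0 1 zero_le_one φ))) with hG
      have hGc : Continuous G := by
        have hp : Continuous (projIcc (0 : ℝ) 1 zero_le_one) := continuous_projIcc
        have : Continuous fun φ : ℝ => mkPoint i (z.2 i * projIcc (0 : ℝ) 1 zero_le_one φ)
            (v (projIcc 0 1 zero_le_one φ)) := by
          unfold mkPoint axisPoint
          exact ((continuous_single (A := fun _ : Fin 2 => ℝ) i).comp
            (continuous_const.mul (continuous_subtype_val.comp hp))).add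
            ((continuous_single (A := fun _ : Fin 2 => ℝ) (i + 1)).comp (v.continuous.comp hp))
        exact hf.continuous.comp (continuous_const.prodMk this)
      have eq : ∀ t ∈ Icc (0 : ℝ) 1, vt t = z.2 (i + 1) - z.2 i * ∫ φ in t..1, G φ := by
        intro t ht
        have h := congrArg (fun w : C(unitInterval, ℝ) => w ⟨t, ht⟩) hv0
        simp only [orbitEquation_apply, ContinuousMap.zero_apply] at h
        simp only [hvt, projIcc_of_mem _ ht]
        simp only [hG]
        have : (fc : E × Plane → ℝ) = f := rfl
        rw [this] at h
        linarith
      have hone : (1 : ℝ) ∈ Icc (0 : ℝ) 1 := ⟨zero_le_one, le_rfl⟩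
      have hv1 : vt 1 = z.2 (i + 1) := by rw [eq 1 hone]; simp
      have hder : HasDerivWithinAt vt (z.2 i * f z) (Icc 0 1) 1 := by
        have h1 : HasDerivAt (fun t => ∫ φ in t..1, G φ) (-G 1) 1 := by
          exact intervalIntegral.integral_hasDerivAt_left (hGc.intervalIntegrable _ _)
            (hGc.stronglyMeasurableAtFilter _ _) hGc.continuousAt
        have hG1 : G 1 = f z := by
          simp only [hG]
          have e1 : (projIcc (0 : ℝ) 1 zero_le_one 1 : ℝ) = 1 := by simp
          have e2 : v (projIcc (0 : ℝ) 1 zero_le_one 1) = z.2 (i + 1) := hv1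
          rw [e1, e2, mul_one, mkPoint_eta]
        have h2 : HasDerivAt (fun t => z.2 (i + 1) - z.2 i * ∫ φ in t..1, G φ)
            (z.2 i * f z) 1 := by
          have := (h1.const_mul (z.2 i)).const_sub (z.2 (i + 1))
          rwa [hG1, mul_neg, neg_neg] at this
        exact h2.hasDerivWithinAt.congr eq (eq 1 hone)
      -- The solution curve `c`, which arrives at `z` at time `1`, is tangent there to `(s, s f z)`.
      set c : ℝ → E × Plane := fun t => (z.1, mkPoint i (z.2 i * t) (vt t)) with hc
      have hc1 : c 1 = z := by
        simp only [hc, hv1, mul_one, mkPoint_eta]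
      have hcd : HasDerivWithinAt c (0, mkPoint i (z.2 i) (z.2 i * f z)) (Icc 0 1) 1 := by
        refine (hasDerivWithinAt_const _ _ _).prodMk ?_
        rw [hasDerivWithinAt_pi]
        have hlin : HasDerivWithinAt (fun t => z.2 i * t) (z.2 i) (Icc 0 1) 1 := by
          simpa using (hasDerivWithinAt_id (1 : ℝ) (Icc (0 : ℝ) 1)).const_mul (z.2 i)
        intro k
        rcases (show k = i ∨ k = i + 1 by fin_cases i <;> fin_cases k <;> simp) with rfl | rfl
        · simpa using hlin
        · simpa using hder
      have hHd := (hd.differentiableAt one_ne_zero).hasFDerivAt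
      rw [← hc1] at hHd
      have hcomp := hHd.comp_hasDerivWithinAt (1 : ℝ) hcd
      -- The point `c t` is on the same solution as `z`, and the restarted solution is small, so that it is
      -- the one given by the implicit function.
      have hconst : HasDerivWithinAt ((fun z => ev (Ψ z)) ∘ c) 0 (Icc 0 1) 1 := by
        refine (hasDerivWithinAt_const (1 : ℝ) (Icc 0 1) (ev v)).congr_of_mem ?_ hone
        intro t ht
        have hr := orbitEquation_restart i fc z v hv0 ⟨t, ht⟩
        have hct : c t = (z.1, mkPoint i (z.2 i * t) (v ⟨t, ht⟩)) := by
          simp only [hc, hvt, projIcc_of_mem _ ht]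
        have hdist : dist ((c t, restart ⟨t, ht⟩ v) : (E × Plane) × C(unitInterval, ℝ)) u < ε := by
          rw [Prod.dist_eq]
          refine max_lt ?_ ?_
          · rw [hct, Prod.dist_eq]
            have hz1 := hz.1
            rw [Prod.dist_eq, max_lt_iff] at hz1
            refine max_lt hz1.1 ?_
            simp only [hu, dist_zero_right] at hz1 ⊢
            rw [norm_mkPoint]
            refine max_lt ?_ ?_
            · rw [abs_mul, abs_of_nonneg ht.1]
              have := norm_le_pi_norm z.2 i
              rw [Real.norm_eq_abs] at this
              exact (mul_le_of_le_one_right (abs_nonneg _) ht.2).trans_lt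
                (this.trans_lt hz1.2)
            · exact (v.norm_coe_le_norm _).trans_lt hvε
          · simp only [hu, dist_zero_right]
            refine lt_of_le_of_lt ((ContinuousMap.norm_le _ (norm_nonneg v)).2 fun τ => ?_) hvε
            exact v.norm_coe_le_norm _
        rw [← hct] at hr
        have := (hball hdist).1 hr
        simp only at this
        change ev (Ψ (c t)) = ev v
        rw [hΨ, this]
        simp [hev, restart]
      have hzero := ((uniqueDiffOn_Icc zero_lt_one) 1 hone).eq_deriv _ hcomp hconst
      rw [hc1] at hzero
      have hsm : ((0, mkPoint i (z.2 i) (z.2 i * f z)) : E × Plane) =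
          z.2 i • ((0, mkPoint i 1 (f z)) : E × Plane) := by
        refine Prod.ext (by simp) ?_
        ext k
        rcases (show k = i ∨ k = i + 1 by fin_cases i <;> fin_cases k <;> simp) with rfl | rfl
        · simp
        · simp
      rw [hsm, map_smul, smul_eq_mul, mul_eq_zero] at hzero
      exact hzero.resolve_left hs
    have hall := (hsmall.and hdiff).eventually_nhds
    filter_upwards [hall] with z hz
    have hzz := hz.self_of_nhds
    by_cases hs : z.2 i ≠ 0
    · exact main z hzz.1 hzz.2 hs
    · push Not at hs
      -- Where `s = 0`, the identity follows by continuity.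
      set d : ℝ → E × Plane := fun t => (z.1, z.2 + axisPoint i t) with hd
      have hdc : Continuous d :=
        continuous_const.prodMk (continuous_const.add
          (continuous_single (A := fun _ : Fin 2 => ℝ) i))
      have hd0 : d 0 = z := by simp [hd, axisPoint]
      have hcF : ContinuousAt (fun z => fderiv ℝ (fun z => ev (Ψ z)) z (0, mkPoint i 1 (f z))) z := by
        have h1 : ContinuousAt (fderiv ℝ (fun z => ev (Ψ z))) z :=
          (hzz.2.fderiv_right (m := 0) (by simp)).continuousAt
        have h2 : Continuous fun z : E × Plane => ((0, mkPoint i 1 (f z)) : E × Plane) := by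
          refine continuous_const.prodMk ?_
          unfold mkPoint axisPoint
          exact continuous_const.add ((continuous_single (A := fun _ : Fin 2 => ℝ) (i + 1)).comp
            hf.continuous)
        exact h1.clm_apply h2.continuousAt
      have hd0t : Tendsto d (𝓝[≠] 0) (𝓝 z) := by
        have := hdc.tendsto 0
        rw [hd0] at this
        exact this.mono_left nhdsWithin_le_nhds
      have hlim := hcF.tendsto.comp hd0t
      refine tendsto_nhds_unique hlim ?_
      refine tendsto_const_nhds.congr' ?_
      filter_upwards [hd0t.eventually hz, self_mem_nhdsWithin] with t ht ht0
      refine (main (d t) ht.1 ht.2 ?_).symm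
      have : (d t).2 i = t := by simp [hd, axisPoint, hs]
      rw [this]; exact ht0

end FirstIntegral


/-! ### First integrals depending smoothly on the vector field -/

section VectorFieldsComplete

set_option maxSynthPendingDepth 3

variable {r : ℕ} {U : TopologicalSpace.Opens Plane}

instance : CompleteSpace (JetSpace r U) :=
  inferInstanceAs (CompleteSpace ((k : Fin (r + 1)) →
    (U →ᵇ ContinuousMultilinearMap ℝ (fun _ : Fin (k : ℕ) => Plane) Plane)))

/-- A uniform limit of jets of vector fields is the jet of a vector field. -/
theorem isClosed_vectorFields : IsClosed (VectorFields r U : Set (JetSpace r U)) := by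
  refine IsSeqClosed.isClosed fun J L hJ hL => ?_
  -- The components of a family of jets, extended by zero outside `U`.
  set ext : JetSpace r U → ∀ k : ℕ, k ≤ r → Plane → Jet k := fun J k hk p =>
    open Classical in if hp : p ∈ U then J ⟨k, Nat.lt_succ_of_le hk⟩ ⟨p, hp⟩ else 0 with hext
  have hJd : ∀ n k (hk : k + 1 ≤ r) p, p ∈ U → HasFDerivAt (ext (J n) k (Nat.le_of_succ_le hk))
      (ext (J n) (k + 1) hk p).curryLeft p := fun n k hk p hp => by
    have := jet_hasFDerivAt hk (⟨J n, hJ n⟩ : VectorFields r U) hp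
    exact this
  have hb : ∀ n k (hk : k ≤ r) p, ‖ext L k hk p - ext (J n) k hk p‖ ≤ ‖L - J n‖ := by
    intro n k hk p
    by_cases hp : p ∈ U
    · simp only [hext, hp, dif_pos]
      have h1 := norm_le_pi_norm (f := ((L - J n : JetSpace r U) : (k : Fin (r + 1)) →
        (U →ᵇ ContinuousMultilinearMap ℝ (fun _ : Fin (k : ℕ) => Plane) Plane)))
        ⟨k, Nat.lt_succ_of_le hk⟩
      exact (BoundedContinuousFunction.norm_coe_le_norm _ (⟨p, hp⟩ : U)).trans h1
    · simp [hext, hp]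
  have hn : Tendsto (fun n => ‖L - J n‖) atTop (𝓝 0) := by
    have := (tendsto_iff_norm_sub_tendsto_zero.1 hL)
    simpa [norm_sub_rev] using this
  have hu : ∀ k (hk : k ≤ r), TendstoUniformlyOn (fun n => ext (J n) k hk) (ext L k hk) atTop U := by
    intro k hk
    rw [Metric.tendstoUniformlyOn_iff]
    intro ε hε
    filter_upwards [hn.eventually (gt_mem_nhds hε)] with n hn p _
    rw [dist_eq_norm]
    exact (hb n k hk p).trans_lt hn
  have hLd : ∀ k (hk : k + 1 ≤ r) p, p ∈ U → HasFDerivAt (ext L k (Nat.le_of_succ_le hk))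
      (ext L (k + 1) hk p).curryLeft p := by
    intro k hk p hp
    refine hasFDerivAt_of_tendstoUniformlyOn (f := fun n => ext (J n) k (Nat.le_of_succ_le hk))
      (f' := fun n p => (ext (J n) (k + 1) hk p).curryLeft)
      (g' := fun p => (ext L (k + 1) hk p).curryLeft) (l := atTop) U.isOpen ?_
      (fun n p hp => hJd n k hk p hp) (fun p hp => (hu k (Nat.le_of_succ_le hk)).tendsto_at hp) hp
    rw [Metric.tendstoUniformlyOn_iff]
    intro ε hε
    filter_upwards [Metric.tendstoUniformlyOn_iff.1 (hu (k + 1) hk) ε hε] with n hn p hp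
    have h1 := hn p hp
    rw [dist_eq_norm] at h1 ⊢
    have e : (ext L (k + 1) hk p).curryLeft - (ext (J n) (k + 1) hk p).curryLeft =
        curryL k (ext L (k + 1) hk p - ext (J n) (k + 1) hk p) := by
      rw [map_sub]; rfl
    rwa [e, curryL_apply, ContinuousMultilinearMap.curryLeft_norm]
  have hLc : ∀ k (hk : k ≤ r), ContinuousOn (ext L k hk) U := fun k hk =>
    (hu k hk).continuousOn (Frequently.of_forall fun n =>
      (jet_continuousOn (U := U) hk).comp
        (f := fun p => ((⟨J n, hJ n⟩ : VectorFields r U), p))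
        (continuous_const.prodMk continuous_id).continuousOn fun p hp => ⟨mem_univ _, hp⟩)
  have hT : HasFTaylorSeriesUpToOn r (fun p => (ext L 0 (Nat.zero_le r) p).curry0)
      (fun p k => if hk : k ≤ r then ext L k hk p else 0) U := by
    refine ⟨fun p hp => by simp, fun m hm p hp => ?_, fun m hm => ?_⟩
    · have hm' : m + 1 ≤ r := by exact_mod_cast hm
      have hm0 : m ≤ r := by omega
      simp only [hm0, dif_pos, Nat.succ_eq_add_one, hm']
      exact (hLd m hm' p hp).hasFDerivWithinAt
    · have hm' : m ≤ r := by exact_mod_cast hm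
      simp only [hm', dif_pos]
      exact hLc m hm'
  refine ⟨fun p => (ext L 0 (Nat.zero_le r) p).curry0, hT.contDiffOn, fun k x => ?_⟩
  have hk : (k : ℕ) ≤ r := Nat.lt_succ_iff.1 k.2
  have h2 := hT.eq_iteratedFDerivWithin_of_uniqueDiffOn (m := (k : ℕ)) (by exact_mod_cast hk)
    U.isOpen.uniqueDiffOn x.2
  rw [← h2]
  simp only [hk, dif_pos, hext, x.2]

instance : CompleteSpace (VectorFields r U) :=
  (isClosed_vectorFields (r := r) (U := U)).completeSpace_coe

end VectorFieldsComplete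

section FieldFirstIntegral

variable {r : ℕ} {U : TopologicalSpace.Opens Plane}

/-- The inverse function agrees near a nonzero point with a smooth function on the line. -/
theorem exists_contDiff_inv {x₀ : ℝ} (h : x₀ ≠ 0) (n : ℕ) :
    ∃ ψ : ℝ → ℝ, ContDiff ℝ n ψ ∧ ∀ᶠ x in 𝓝 x₀, ψ x = x⁻¹ := by
  have hx : 0 < |x₀| := abs_pos.2 h
  let χ : ContDiffBump x₀ := ⟨|x₀| / 4, |x₀| / 2, by linarith, by linarith⟩
  refine ⟨fun x => χ x * x⁻¹, ?_, ?_⟩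
  · rw [contDiff_iff_contDiffAt]
    intro x
    by_cases hx0 : x = 0
    · subst hx0
      have : (fun x => χ x * x⁻¹) =ᶠ[𝓝 0] fun _ => 0 := by
        have hm : (Metric.closedBall x₀ (|x₀| / 2))ᶜ ∈ 𝓝 (0 : ℝ) := by
          refine Metric.isClosed_closedBall.isOpen_compl.mem_nhds ?_
          simp only [mem_compl_iff, Metric.mem_closedBall, not_le, dist_comm, Real.dist_eq, sub_zero]
          linarith
        filter_upwards [hm] with y hy
        have : χ y = 0 := χ.zero_of_le_dist (by
          simp only [mem_compl_iff, Metric.mem_closedBall, not_le] at hy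
          exact hy.le)
        simp [this]
      exact contDiffAt_const.congr_of_eventuallyEq this
    · exact χ.contDiffAt.mul (contDiffAt_inv ℝ hx0)
  · filter_upwards [χ.eventuallyEq_one] with x hx
    have : χ x = 1 := hx
    simp [this]

/-- The evaluation map agrees near the origin, uniformly in the field, with a `C^r` function on the
whole space. -/
theorem exists_global_fieldValue (hU : (0 : Plane) ∈ U) :
    ∃ e : VectorFields r U × Plane → Plane, ContDiff ℝ r e ∧
      ∃ N ∈ 𝓝 (0 : Plane), ∀ V, ∀ p ∈ N, e (V, p) = fieldValue V p := by
  obtain ⟨ε, hε, hball⟩ := Metric.isOpen_iff.1 U.isOpen 0 hU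
  let χ : ContDiffBump (0 : Plane) := ⟨ε / 4, ε / 2, by linarith, by linarith⟩
  refine ⟨fun z => χ z.2 • fieldValue z.1 z.2, ?_, {p | χ p = 1}, χ.eventuallyEq_one, ?_⟩
  · rw [contDiff_iff_contDiffAt]
    intro z
    by_cases hz : z.2 ∈ U
    · have h := (fieldValue_contDiffOn (r := r) (U := U)).contDiffAt
        ((isOpen_univ.prod U.isOpen).mem_nhds (⟨mem_univ _, hz⟩ : z ∈ univ ×ˢ (U : Set Plane)))
      exact (χ.contDiffAt.comp z contDiffAt_snd).smul h
    · have : (fun z : VectorFields r U × Plane => χ z.2 • fieldValue z.1 z.2) =ᶠ[𝓝 z]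
          fun _ => 0 := by
        have hm : (Metric.closedBall (0 : Plane) (ε / 2))ᶜ ∈ 𝓝 z.2 := by
          refine Metric.isClosed_closedBall.isOpen_compl.mem_nhds fun hc => hz (hball ?_)
          exact Metric.closedBall_subset_ball (by linarith) hc
        filter_upwards [continuous_snd.continuousAt.preimage_mem_nhds hm] with y hy
        have : χ y.2 = 0 := χ.zero_of_le_dist (by
          simp only [mem_preimage, mem_compl_iff, Metric.mem_closedBall, not_le] at hy
          exact hy.le)
        simp [this]
      exact contDiffAt_const.congr_of_eventuallyEq this
  · intro V p hp
    have hp' : χ p = 1 := hp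
    simp [hp']

theorem fieldValue_continuousAt (hU : (0 : Plane) ∈ U) (V₀ : VectorFields r U) :
    ContinuousAt (fun z : VectorFields r U × Plane => fieldValue z.1 z.2) (V₀, 0) :=
  (fieldValue_contDiffOn (r := r) (U := U)).continuousOn.continuousAt
    ((isOpen_univ.prod U.isOpen).mem_nhds (⟨mem_univ _, hU⟩ : (V₀, (0 : Plane)) ∈ univ ×ˢ (U : Set Plane)))

/-- First integrals of vector fields transverse to `Σᵢ` at the origin, depending smoothly on the
vector field and normalised on `Σᵢ`. -/
theorem exists_first_integral (hr : 3 ≤ r) (hU : (0 : Plane) ∈ U) (i : Fin 2)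
    (V₀ : VectorFields r U) (h₀ : fieldValue V₀ 0 i ≠ 0) :
    ∃ H : VectorFields r U × Plane → ℝ, ContDiffAt ℝ 3 H (V₀, 0) ∧
      (∀ᶠ z : VectorFields r U × ℝ in 𝓝 (V₀, 0), H (z.1, axisPoint (i + 1) z.2) = z.2) ∧
      ∀ᶠ z in 𝓝 ((V₀, 0) : VectorFields r U × Plane), fderiv ℝ H z (0, fieldValue z.1 z.2) = 0 := by
  obtain ⟨e, he, N, hN, heN⟩ := exists_global_fieldValue (r := r) hU
  obtain ⟨ψ, hψ, hψi⟩ := exists_contDiff_inv h₀ 3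
  have he3 : ContDiff ℝ 3 e := he.of_le (by exact_mod_cast hr)
  have hej : ∀ j : Fin 2, ContDiff ℝ 3 fun z => e z j := fun j => (contDiff_apply ℝ ℝ j).comp he3
  -- The slope `Vⱼ / Vᵢ` of the orbits, extended to a function of class `C³` on the whole space.
  obtain ⟨H, hH, h1, h2⟩ := exists_local_first_integral i 3 (by norm_num)
    (fun z => e z (i + 1) * ψ (e z i)) ((hej (i + 1)).mul (hψ.comp (hej i))) V₀
  refine ⟨H, hH, h1, ?_⟩
  have hcont := fieldValue_continuousAt hU V₀
  have hNe : ∀ᶠ z in 𝓝 ((V₀, 0) : VectorFields r U × Plane), z.2 ∈ N :=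
    continuous_snd.continuousAt.preimage_mem_nhds hN
  have hci : ContinuousAt (fun z : VectorFields r U × Plane => fieldValue z.1 z.2 i) (V₀, 0) :=
    (continuous_apply i).continuousAt.comp hcont
  filter_upwards [h2, hNe, hci.eventually hψi, hci.eventually_ne h₀] with z hz hzN hψz hne
  rw [heN z.1 z.2 hzN, hψz] at hz
  have : ((0, fieldValue z.1 z.2) : VectorFields r U × Plane) = fieldValue z.1 z.2 i •
      ((0, mkPoint i 1 (fieldValue z.1 z.2 (i + 1) * (fieldValue z.1 z.2 i)⁻¹)) :
        VectorFields r U × Plane) := by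
    refine Prod.ext (by simp) ?_
    ext k
    rcases (show k = i ∨ k = i + 1 by fin_cases i <;> fin_cases k <;> simp) with rfl | rfl
    · simp
    · simp only [Prod.smul_snd, Pi.smul_apply, mkPoint_succ, smul_eq_mul]
      field_simp
  rw [this, map_smul, hz, smul_zero]

end FieldFirstIntegral


/-! ### Topological conjugacy of one-dimensional maps -/

section Conjugacy

/-- On an invariant interval where `F x > x`, all orbits of `F` exceed any given point. -/
theorem exists_lt_zpow {F : ℝ ≃o ℝ} {S : Set ℝ} (hS : S.OrdConnected) (hF : ∀ x ∈ S, x < F x)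
    {x y : ℝ} (hx : x ∈ S) (hy : y ∈ S) : ∃ n : ℕ, y < (F ^ (n : ℤ)) x := by
  by_contra! h
  set a : ℕ → ℝ := fun n => (F ^ (n : ℤ)) x with ha
  have hsucc : ∀ n, a (n + 1) = F (a n) := fun n => by
    simp only [ha]
    rw [Nat.cast_succ, add_comm, zpow_one_add, RelIso.mul_apply]
  have hxa : ∀ n, x ≤ a n := by
    intro n
    induction n with
    | zero => simp [ha]
    | succ n ih =>
      rw [hsucc]
      exact ih.trans (hF _ (hS.out hx hy ⟨ih, h n⟩)).le
  have hmem : ∀ n, a n ∈ S := fun n => hS.out hx hy ⟨hxa n, h n⟩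
  have hmono : Monotone a := monotone_nat_of_le_succ fun n => by
    rw [hsucc]; exact (hF _ (hmem n)).le
  have hb : BddAbove (range a) := ⟨y, by rintro _ ⟨n, rfl⟩; exact h n⟩
  have ht := tendsto_atTop_ciSup hmono hb
  set L := ⨆ n, a n
  have hL : L ∈ S := hS.out hx hy ⟨(hxa 0).trans (le_ciSup hb 0), ciSup_le h⟩
  have h1 : Tendsto (fun n => a (n + 1)) atTop (𝓝 L) := ht.comp (tendsto_add_atTop_nat 1)
  have h2 : Tendsto (fun n => a (n + 1)) atTop (𝓝 (F L)) := by
    simp only [hsucc]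
    exact (F.continuous.tendsto L).comp ht
  exact (hF L hL).ne (tendsto_nhds_unique h1 h2)

/-- **Abel's equation** `A (F x) = A x + 1` on an invariant interval where `F x > x`. -/
theorem exists_abel {F : ℝ ≃o ℝ} {S : Set ℝ} (hS : S.OrdConnected) (hF : ∀ x ∈ S, x < F x)
    (hinv : ∀ x, F x ∈ S ↔ x ∈ S) {x₀ : ℝ} (hx₀ : x₀ ∈ S) :
    ∃ A : ℝ → ℝ, StrictMonoOn A S ∧ A '' S = univ ∧ (∀ x ∈ S, A (F x) = A x + 1) ∧ A x₀ = 0 := by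
  -- The orbit of `x₀` cuts `S` into fundamental intervals `[a n, a (n + 1))`; the number `ν x` is the
  -- index of the one which contains `x`.
  set a : ℤ → ℝ := fun n => (F ^ n) x₀ with ha
  have hcomm : ∀ (n : ℤ) x, (F ^ (n + 1)) x = F ((F ^ n) x) := fun n x => by
    rw [add_comm, zpow_one_add, RelIso.mul_apply]
  have hpow : ∀ (n : ℤ) x, (F ^ n) x ∈ S ↔ x ∈ S := by
    intro n
    induction n using Int.induction_on with
    | zero => simp
    | succ n ih => intro x; rw [hcomm, hinv, ih]
    | pred n ih =>
      intro x
      have := hcomm (-(n : ℤ) - 1) x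
      rw [sub_add_cancel] at this
      rw [← ih x, this, hinv]
  have hneg : ∀ (n : ℤ) x, (F ^ (-n)) ((F ^ n) x) = x := fun n x => by
    rw [← RelIso.mul_apply, ← zpow_add, neg_add_cancel, zpow_zero, RelIso.one_apply]
  have hneg' : ∀ (n : ℤ) x, (F ^ n) ((F ^ (-n)) x) = x := fun n x => by
    rw [← RelIso.mul_apply, ← zpow_add, add_neg_cancel, zpow_zero, RelIso.one_apply]
  have haS : ∀ n, a n ∈ S := fun n => (hpow n x₀).2 hx₀
  have hsucc : ∀ n, a (n + 1) = F (a n) := fun n => hcomm n x₀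
  have hamono : StrictMono a := strictMono_int_of_lt_succ fun n => by
    rw [hsucc]; exact hF _ (haS n)
  have hex : ∀ x ∈ S, ∃ n : ℤ, a n ≤ x ∧ x < a (n + 1) := by
    intro x hx
    obtain ⟨N, hN⟩ := exists_lt_zpow hS hF hx₀ hx
    obtain ⟨M, hM⟩ := exists_lt_zpow hS hF hx hx₀
    obtain ⟨n, hn, hmax⟩ := Int.exists_greatest_of_bdd (P := fun n => a n ≤ x)
      ⟨N, fun z hz => by
        by_contra! hlt
        exact absurd (hN.trans (hamono hlt)) (not_lt.2 hz)⟩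
      ⟨-M, by
        have : (F ^ (-(M : ℤ))) x₀ ≤ (F ^ (-(M : ℤ))) ((F ^ (M : ℤ)) x) :=
          (F ^ (-(M : ℤ))).monotone hM.le
        rwa [hneg] at this⟩
    refine ⟨n, hn, ?_⟩
    by_contra! hlt
    have := hmax _ hlt
    omega
  choose! ν hν using hex
  have huniq : ∀ x (m n : ℤ), a m ≤ x → x < a (m + 1) → a n ≤ x → x < a (n + 1) → m = n := by
    intro x m n h1 h2 h3 h4
    have e1 : m < n + 1 := hamono.lt_iff_lt.1 (h1.trans_lt h4)
    have e2 : n < m + 1 := hamono.lt_iff_lt.1 (h3.trans_lt h2)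
    omega
  have hd : 0 < F x₀ - x₀ := sub_pos.2 (hF _ hx₀)
  -- The function `A` is affine on the fundamental interval `[x₀, F x₀)`, and extended by the equation.
  set A : ℝ → ℝ := fun x => ν x + ((F ^ (-ν x)) x - x₀) / (F x₀ - x₀) with hA
  have hlow : ∀ x ∈ S, (ν x : ℝ) ≤ A x := by
    intro x hx
    have : x₀ ≤ (F ^ (-ν x)) x := by
      have := (F ^ (-ν x)).monotone (hν x hx).1
      rwa [ha, hneg] at this
    have := div_nonneg (sub_nonneg.2 this) hd.le
    simp only [hA]; linarith
  have hup : ∀ x ∈ S, A x < ν x + 1 := by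
    intro x hx
    have : (F ^ (-ν x)) x < F x₀ := by
      have e : (F ^ (-ν x)) (F ((F ^ ν x) x₀)) = F x₀ := by
        rw [← hcomm, ← RelIso.mul_apply, ← zpow_add]; simp
      have e2 : F ((F ^ ν x) x₀) = (F ^ (ν x + 1)) x₀ := (hcomm _ _).symm
      have h3 := (F ^ (-ν x)).strictMono (hν x hx).2
      rw [ha] at h3
      simp only at h3
      rwa [← e2, e] at h3
    have := (div_lt_one hd).2 (sub_lt_sub_right this x₀)
    simp only [hA]; linarith
  have hAeq : ∀ (n : ℤ) x, x₀ ≤ x → x < F x₀ → x ∈ S → A ((F ^ n) x) = n + (x - x₀) / (F x₀ - x₀) := by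
    intro n x h1 h2 hx
    have hy : (F ^ n) x ∈ S := (hpow n x).2 hx
    have : ν ((F ^ n) x) = n := by
      refine huniq _ _ _ (hν _ hy).1 (hν _ hy).2 ((F ^ n).monotone h1) ?_
      have := (F ^ n).strictMono h2
      rwa [← RelIso.mul_apply, ← zpow_add_one] at this
    simp only [hA]
    rw [this, hneg]
  refine ⟨A, ?_, ?_, ?_, ?_⟩
  · intro x hx y hy hxy
    rcases lt_trichotomy (ν x) (ν y) with h | h | h
    · have h1 : (ν x : ℝ) + 1 ≤ ν y := by exact_mod_cast h
      exact (hup x hx).trans_le (h1.trans (hlow y hy))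
    · have h1 : (F ^ (-ν y)) x < (F ^ (-ν y)) y := (F ^ (-ν y)).strictMono hxy
      simp only [hA]
      rw [h]
      have := div_lt_div_of_pos_right (sub_lt_sub_right h1 x₀) hd
      linarith
    · exfalso
      have h1 : a (ν y + 1) ≤ a (ν x) := hamono.monotone (by omega)
      exact absurd ((hν y hy).2.trans_le (h1.trans (hν x hx).1)) (not_lt.2 hxy.le)
  · refine eq_univ_of_forall fun t => ?_
    set z := x₀ + Int.fract t * (F x₀ - x₀) with hz
    have h1 : x₀ ≤ z := by
      have := mul_nonneg (Int.fract_nonneg t) hd.le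
      linarith
    have h2 : z < F x₀ := by
      have := mul_lt_of_lt_one_left hd (Int.fract_lt_one t)
      linarith
    have hzS : z ∈ S := hS.out hx₀ ((hinv x₀).2 hx₀) ⟨h1, h2.le⟩
    refine ⟨(F ^ ⌊t⌋) z, (hpow _ _).2 hzS, ?_⟩
    rw [hAeq _ _ h1 h2 hzS, hz, add_sub_cancel_left, mul_div_cancel_right₀ _ hd.ne',
      Int.floor_add_fract]
  · intro x hx
    have hy : (F ^ (-ν x)) x ∈ S := (hpow _ _).2 hx
    have h1 : x₀ ≤ (F ^ (-ν x)) x := by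
      have := (F ^ (-ν x)).monotone (hν x hx).1
      rwa [ha, hneg] at this
    have h2 : (F ^ (-ν x)) x < F x₀ := by
      have h := hup x hx
      simp only [hA] at h
      have : ((F ^ (-ν x)) x - x₀) / (F x₀ - x₀) < 1 := by linarith
      have := (div_lt_one hd).1 this
      linarith
    have e1 := hAeq (ν x) _ h1 h2 hy
    have e2 := hAeq (ν x + 1) _ h1 h2 hy
    rw [hneg'] at e1
    rw [hcomm, hneg'] at e2
    rw [e1, e2]; push_cast; ring
  · have := hAeq 0 x₀ le_rfl (hF _ hx₀) hx₀
    simpa using this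

/-- Two maps which move the points of invariant intervals to the right are conjugate there: the
solutions of Abel's equation conjugate both of them to the translation by `1`. -/
theorem exists_conj_on_of_lt {F F' : ℝ ≃o ℝ} {S S' : Set ℝ} (hS : S.OrdConnected)
    (hS' : S'.OrdConnected) (hF : ∀ x ∈ S, x < F x) (hF' : ∀ x ∈ S', x < F' x)
    (hinv : ∀ x, F x ∈ S ↔ x ∈ S) (hinv' : ∀ x, F' x ∈ S' ↔ x ∈ S') {x₀ x₀' : ℝ} (hx₀ : x₀ ∈ S)
    (hx₀' : x₀' ∈ S') :
    ∃ k : ℝ → ℝ, StrictMonoOn k S ∧ k '' S = S' ∧ (∀ x ∈ S, k (F x) = F' (k x)) ∧ k x₀ = x₀' := by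
  obtain ⟨A, hA, hAs, hAF, hA0⟩ := exists_abel hS hF hinv hx₀
  obtain ⟨B, hB, hBs, hBF, hB0⟩ := exists_abel hS' hF' hinv' hx₀'
  have hex : ∀ x, ∃ y ∈ S', B y = A x := fun x => by
    have : A x ∈ B '' S' := by rw [hBs]; trivial
    obtain ⟨y, hy, e⟩ := this
    exact ⟨y, hy, e⟩
  choose k hk hkB using hex
  refine ⟨k, ?_, ?_, ?_, ?_⟩
  · intro x hx y hy hxy
    rw [← hB.lt_iff_lt (hk x) (hk y), hkB, hkB]
    exact hA hx hy hxy
  · refine Subset.antisymm (by rintro _ ⟨x, _, rfl⟩; exact hk x) fun y hy => ?_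
    have : B y ∈ A '' S := by rw [hAs]; trivial
    obtain ⟨x, hx, e⟩ := this
    exact ⟨x, hx, hB.injOn (hk x) hy ((hkB x).trans e)⟩
  · intro x hx
    refine hB.injOn (hk _) ((hinv' _).2 (hk _)) ?_
    rw [hkB, hAF x hx, hBF _ (hk x), hkB]
  · exact hB.injOn (hk _) hx₀' (by rw [hkB, hA0, hB0])

/-- The same for two maps which move the points to the same side, told by the sign of `ε`; for the
left side, the inverse maps are used. -/
theorem exists_conj_on {F F' : ℝ ≃o ℝ} {S S' : Set ℝ} (hS : S.OrdConnected)
    (hS' : S'.OrdConnected) {ε : ℝ} (hF : ∀ x ∈ S, 0 < ε * (F x - x))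
    (hF' : ∀ x ∈ S', 0 < ε * (F' x - x))
    (hinv : ∀ x, F x ∈ S ↔ x ∈ S) (hinv' : ∀ x, F' x ∈ S' ↔ x ∈ S') {x₀ x₀' : ℝ} (hx₀ : x₀ ∈ S)
    (hx₀' : x₀' ∈ S') :
    ∃ k : ℝ → ℝ, StrictMonoOn k S ∧ k '' S = S' ∧ (∀ x ∈ S, k (F x) = F' (k x)) ∧ k x₀ = x₀' := by
  rcases lt_trichotomy ε 0 with hε | hε | hε
  · have key : ∀ {G : ℝ ≃o ℝ} {T : Set ℝ}, (∀ x ∈ T, 0 < ε * (G x - x)) →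
        (∀ x, G x ∈ T ↔ x ∈ T) → (∀ x ∈ T, x < G.symm x) ∧ ∀ x, G.symm x ∈ T ↔ x ∈ T := by
      intro G T h hi
      have hi' : ∀ x, G.symm x ∈ T ↔ x ∈ T := fun x => by
        rw [← hi (G.symm x), OrderIso.apply_symm_apply]
      refine ⟨fun x hx => ?_, hi'⟩
      have h1 := h _ ((hi' x).2 hx)
      rw [OrderIso.apply_symm_apply] at h1
      have := neg_of_mul_pos_right h1 hε.le
      linarith
    obtain ⟨k, h1, h2, h3, h4⟩ := exists_conj_on_of_lt hS hS' (key hF hinv).1 (key hF' hinv').1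
      (key hF hinv).2 (key hF' hinv').2 hx₀ hx₀'
    refine ⟨k, h1, h2, fun x hx => ?_, h4⟩
    have := h3 (F x) ((hinv x).2 hx)
    rw [OrderIso.symm_apply_apply] at this
    rw [this, OrderIso.apply_symm_apply]
  · have := hF x₀ hx₀
    simp [hε] at this
  · have key : ∀ {G : ℝ ≃o ℝ} {T : Set ℝ}, (∀ x ∈ T, 0 < ε * (G x - x)) → ∀ x ∈ T, x < G x :=
      fun h x hx => sub_pos.1 (pos_of_mul_pos_right (h x hx) hε.le)
    exact exists_conj_on_of_lt hS hS' (key hF) (key hF') hinv hinv' hx₀ hx₀'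

/-- The dynamics of `F` on `[0, ∞)`: the point `q` is fixed, it attracts or repels (according to the
sign of `ε`) on `(q, ∞)`, and `F` moves the points of `(0, q)` in the opposite direction. -/
structure HasPattern (F : ℝ → ℝ) (ε q : ℝ) : Prop where
  nonneg : 0 ≤ q
  fixed : F q = q
  outer : ∀ x, q < x → 0 < ε * (F x - x)
  inner : ∀ x, 0 < x → x < q → ε * (F x - x) < 0

/-- Two maps with the same pattern are conjugate on `[0, ∞)`. The free choice of base points allows the
conjugacy to fix a given point `e` beyond `q` and `q'`. -/
theorem exists_conj_half_line {F F' : ℝ ≃o ℝ} (h0 : F 0 = 0) (h0' : F' 0 = 0) {ε q q' : ℝ}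
    (hF : HasPattern F ε q) (hF' : HasPattern F' ε q') (hq : q = 0 ↔ q' = 0) {e : ℝ}
    (he : q < e) (he' : q' < e) :
    ∃ k : ℝ → ℝ, StrictMonoOn k (Ici 0) ∧ k '' Ici 0 = Ici 0 ∧
      (∀ x ∈ Ici (0 : ℝ), k (F x) = F' (k x)) ∧ k 0 = 0 ∧ k e = e := by
  have hio : ∀ {G : ℝ ≃o ℝ} {p : ℝ}, G p = p → ∀ x, G x ∈ Ioi p ↔ x ∈ Ioi p := by
    intro G p hp x
    rw [mem_Ioi, mem_Ioi]
    nth_rewrite 1 [← hp]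
    exact G.lt_iff_lt
  have hii : ∀ {G : ℝ ≃o ℝ} {p : ℝ}, G 0 = 0 → G p = p → ∀ x, G x ∈ Ioo 0 p ↔ x ∈ Ioo 0 p := by
    intro G p h hp x
    have e1 : 0 < G x ↔ 0 < x := by rw [← G.lt_iff_lt (x := 0) (y := x), h]
    have e2 : G x < p ↔ x < p := by rw [← G.lt_iff_lt (x := x) (y := p), hp]
    rw [mem_Ioo, mem_Ioo, e1, e2]
  obtain ⟨ko, ho1, ho2, ho3, ho4⟩ := exists_conj_on (S := Ioi q) (S' := Ioi q') ordConnected_Ioi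
    ordConnected_Ioi hF.outer hF'.outer (hio hF.fixed) (hio hF'.fixed) he he'
  have hki : ∃ k : ℝ → ℝ, StrictMonoOn k (Ioo 0 q) ∧ k '' Ioo 0 q = Ioo 0 q' ∧
      ∀ x ∈ Ioo 0 q, k (F x) = F' (k x) := by
    rcases hF.nonneg.eq_or_lt with h | h
    · have h' := hq.1 h.symm
      refine ⟨id, ?_, ?_, ?_⟩ <;> simp [← h, h', StrictMonoOn]
    · have h' : 0 < q' := lt_of_le_of_ne hF'.nonneg fun h2 => h.ne' (hq.2 h2.symm)
      obtain ⟨k, h1, h2, h3, -⟩ := exists_conj_on (S := Ioo 0 q) (S' := Ioo 0 q') (ε := -ε)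
        ordConnected_Ioo ordConnected_Ioo
        (fun x hx => by have := hF.inner x hx.1 hx.2; linarith)
        (fun x hx => by have := hF'.inner x hx.1 hx.2; linarith)
        (hii h0 hF.fixed) (hii h0' hF'.fixed) (x₀ := q / 2) (x₀' := q' / 2)
        ⟨by linarith, by linarith⟩ ⟨by linarith, by linarith⟩
      exact ⟨k, h1, h2, h3⟩
  obtain ⟨ki, hi1, hi2, hi3⟩ := hki
  have ho : ∀ x, q < x → q' < ko x := fun x hx => by
    have : ko x ∈ Ioi q' := ho2 ▸ mem_image_of_mem ko hx
    exact this
  have hi : ∀ x, 0 < x → x < q → ki x ∈ Ioo 0 q' := fun x h1 h2 => by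
    rw [← hi2]; exact mem_image_of_mem ki ⟨h1, h2⟩
  -- The conjugacies on `(q, ∞)` and `(0, q)` are glued at the fixed points.
  set k : ℝ → ℝ := fun x => if q < x then ko x else if x = q then q' else if 0 < x then ki x else 0
    with hk
  have k1 : ∀ x, q < x → k x = ko x := fun x hx => by simp [hk, hx]
  have k2 : k q = q' := by simp [hk]
  have k3 : ∀ x, 0 < x → x < q → k x = ki x := fun x h1 h2 => by
    simp [hk, h2.not_gt, h2.ne, h1]
  have k4 : k 0 = 0 := by
    rcases hF.nonneg.eq_or_lt with h | h
    · rw [h, k2, hq.1 h.symm, ← h]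
    · simp [hk, h.not_gt, h.ne]
  have hcase : ∀ x, 0 ≤ x → x = 0 ∨ (0 < x ∧ x < q) ∨ x = q ∨ q < x := by
    intro x hx
    rcases lt_trichotomy x q with h | h | h
    · rcases hx.eq_or_lt with h' | h'
      · exact Or.inl h'.symm
      · exact Or.inr (Or.inl ⟨h', h⟩)
    · exact Or.inr (Or.inr (Or.inl h))
    · exact Or.inr (Or.inr (Or.inr h))
  refine ⟨k, ?_, ?_, ?_, k4, ?_⟩
  · intro x hx y hy hxy
    have hx : (0 : ℝ) ≤ x := hx
    rcases hcase y hy with h | ⟨h1, h2⟩ | h | h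
    · linarith
    · rw [k3 y h1 h2]
      rcases hx.eq_or_lt with h | h
      · rw [← h, k4]; exact (hi y h1 h2).1
      · rw [k3 x h (hxy.trans h2)]
        exact hi1 ⟨h, hxy.trans h2⟩ ⟨h1, h2⟩ hxy
    · rw [h, k2]
      rcases hx.eq_or_lt with h' | h'
      · rw [← h', k4]
        refine lt_of_le_of_ne hF'.nonneg fun h2 => ?_
        have := hq.2 h2.symm
        linarith
      · rw [k3 x h' (by linarith)]; exact (hi x h' (by linarith)).2
    · rw [k1 y h]
      rcases hcase x hx with h' | ⟨h1, h2⟩ | h' | h'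
      · rw [h', k4]; exact hF'.nonneg.trans_lt (ho y h)
      · rw [k3 x h1 h2]; exact (hi x h1 h2).2.trans (ho y h)
      · rw [h', k2]; exact ho y h
      · rw [k1 x h']; exact ho1 h' h hxy
  · refine Subset.antisymm ?_ ?_
    · rintro _ ⟨x, hx, rfl⟩
      rcases hcase x hx with h' | ⟨h1, h2⟩ | h' | h'
      · rw [h', k4]; exact (le_refl (0 : ℝ))
      · rw [k3 x h1 h2]; exact (hi x h1 h2).1.le
      · rw [h', k2]; exact hF'.nonneg
      · rw [k1 x h']; exact hF'.nonneg.trans (ho x h').le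
    · intro y hy
      have hy : (0 : ℝ) ≤ y := hy
      rcases lt_trichotomy y q' with h | h | h
      · rcases hy.eq_or_lt with h' | h'
        · exact ⟨0, (le_refl (0 : ℝ)), by rw [k4, h']⟩
        · have : y ∈ ki '' Ioo 0 q := by rw [hi2]; exact ⟨h', h⟩
          obtain ⟨x, hx, e⟩ := this
          exact ⟨x, hx.1.le, by rw [k3 x hx.1 hx.2, e]⟩
      · exact ⟨q, hF.nonneg, by rw [k2, h]⟩
      · have : y ∈ ko '' Ioi q := by rw [ho2]; exact h
        obtain ⟨x, hx, e⟩ := this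
        exact ⟨x, hF.nonneg.trans (le_of_lt hx), by rw [k1 x hx, e]⟩
  · intro x hx
    rcases hcase x hx with h' | ⟨h1, h2⟩ | h' | h'
    · rw [h', h0, k4, h0']
    · have := (hii h0 hF.fixed x).2 ⟨h1, h2⟩
      rw [k3 x h1 h2, k3 _ this.1 this.2, hi3 x ⟨h1, h2⟩]
    · rw [h', hF.fixed, k2, hF'.fixed]
    · have := (hio hF.fixed x).2 h'
      rw [k1 x h', k1 _ this, ho3 x h']
  · rw [k1 e he, ho4]

/-- Two decreasing homeomorphisms of the line fixing `0`, whose squares have the same pattern, are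
conjugate. The conjugacy is first built on `[0, ∞)` for the squares. -/
theorem exists_conj_of_antitone {P P' : ℝ ≃ ℝ} (hP : StrictAnti P) (hP' : StrictAnti P')
    (h0 : P 0 = 0) (h0' : P' 0 = 0) {ε q q' : ℝ} (hF : HasPattern (fun x => P (P x)) ε q)
    (hF' : HasPattern (fun x => P' (P' x)) ε q') (hq : q = 0 ↔ q' = 0) {e : ℝ}
    (he : q < e) (he' : q' < e) :
    ∃ κ : ℝ ≃o ℝ, κ 0 = 0 ∧ (∀ x, κ (P x) = P' (κ x)) ∧ κ e = e := by
  have mk : ∀ {Q : ℝ ≃ ℝ}, StrictAnti Q → ∃ F : ℝ ≃o ℝ, ∀ x, F x = Q (Q x) := fun {Q} hQ =>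
    ⟨(hQ.comp hQ).orderIsoOfSurjective _ (Q.surjective.comp Q.surjective), fun x => rfl⟩
  obtain ⟨F, hFe⟩ := mk hP
  obtain ⟨F', hFe'⟩ := mk hP'
  have e1 : (F : ℝ → ℝ) = fun x => P (P x) := funext hFe
  have e2 : (F' : ℝ → ℝ) = fun x => P' (P' x) := funext hFe'
  rw [← e1] at hF
  rw [← e2] at hF'
  obtain ⟨k, k1, k2, k3, k4, k5⟩ := exists_conj_half_line (by rw [hFe, h0, h0])
    (by rw [hFe', h0', h0']) hF hF' hq he he'
  have kn : ∀ x, 0 ≤ x → 0 ≤ k x := fun x hx => by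
    have : k x ∈ Ici (0 : ℝ) := k2 ▸ mem_image_of_mem k hx
    exact this
  have kp : ∀ x, 0 < x → 0 < k x := fun x hx => by
    rw [← k4]; exact k1 (le_refl (0 : ℝ)) (le_of_lt hx) hx
  have hs : ∀ x, x < 0 → 0 < P.symm x := fun x hx => by
    rw [← hP.lt_iff_gt, P.apply_symm_apply, h0]; exact hx
  have hneg : ∀ x, 0 < x → P' x < 0 := fun x hx => by rw [← h0']; exact hP' hx
  -- On the negative half-line, the relation `κ ∘ P = P' ∘ κ` forces the value of the conjugacy.
  set κ : ℝ → ℝ := fun x => if 0 ≤ x then k x else P' (k (P.symm x)) with hκ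
  have κp : ∀ x, 0 ≤ x → κ x = k x := fun x hx => by simp [hκ, hx]
  have κm : ∀ x, x < 0 → κ x = P' (k (P.symm x)) := fun x hx => by simp [hκ, hx.not_ge]
  have hmono : StrictMono κ := by
    intro x y hxy
    rcases lt_or_ge x 0 with hx | hx
    · rw [κm x hx]
      rcases lt_or_ge y 0 with hy | hy
      · rw [κm y hy]
        refine hP' (k1 (hs y hy).le (hs x hx).le ?_)
        rw [← hP.lt_iff_gt]; simpa using hxy
      · rw [κp y hy]
        exact (hneg _ (kp _ (hs x hx))).trans_le (kn y hy)
    · rw [κp x hx, κp y (hx.trans hxy.le)]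
      exact k1 hx (hx.trans hxy.le) hxy
  have hsurj : Function.Surjective κ := by
    intro y
    rcases lt_or_ge y 0 with hy | hy
    · have h1 : 0 < P'.symm y := by rw [← hP'.lt_iff_gt, P'.apply_symm_apply, h0']; exact hy
      have : P'.symm y ∈ k '' Ici 0 := by rw [k2]; exact h1.le
      obtain ⟨x, hx, e⟩ := this
      have hx0 : 0 < x := by
        refine lt_of_le_of_ne hx fun h => ?_
        rw [← h, k4] at e
        exact h1.ne e
      refine ⟨P x, ?_⟩
      rw [κm _ (by rw [← h0]; exact hP hx0), P.symm_apply_apply, e, P'.apply_symm_apply]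
    · have : y ∈ k '' Ici 0 := by rw [k2]; exact hy
      obtain ⟨x, hx, e⟩ := this
      exact ⟨x, by rw [κp x hx, e]⟩
  refine ⟨hmono.orderIsoOfSurjective _ hsurj, ?_, fun x => ?_, ?_⟩
  · change κ 0 = 0
    rw [κp 0 le_rfl, k4]
  · change κ (P x) = P' (κ x)
    rcases lt_trichotomy x 0 with hx | hx | hx
    · have hPx : 0 < P x := by rw [← h0]; exact hP hx
      rw [κp _ hPx.le, κm x hx, ← hFe', ← k3 _ (hs x hx).le, hFe, P.apply_symm_apply]
    · rw [hx, h0, κp 0 le_rfl, k4, h0']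
    · have hPx : P x < 0 := by rw [← h0]; exact hP hx
      rw [κm _ hPx, P.symm_apply_apply, κp x hx.le]
  · change κ e = e
    rw [κp e (hF.nonneg.trans he.le), k5]

end Conjugacy


/-! ### Taylor expansions of order three -/

section Taylor

/-- A Landau symbol for the derivative is integrated by the mean value inequality. -/
theorem isLittleO_pow_succ_of_deriv {f g : ℝ → ℝ} {n : ℕ}
    (hf : ∀ᶠ x in 𝓝 (0 : ℝ), HasDerivAt f (g x) x) (h0 : f 0 = 0)
    (hg : g =o[𝓝 0] fun x : ℝ => x ^ n) : f =o[𝓝 0] fun x : ℝ => x ^ (n + 1) := by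
  rw [Asymptotics.isLittleO_iff] at hg ⊢
  intro c hc
  obtain ⟨δ, hδ, h⟩ := Metric.eventually_nhds_iff.1 (hf.and (hg hc))
  rw [Metric.eventually_nhds_iff]
  refine ⟨δ, hδ, fun x hx => ?_⟩
  rw [Real.dist_eq, sub_zero] at hx
  have hz : ∀ z ∈ uIcc 0 x, |z| ≤ |x| := fun z hz => by
    have := abs_sub_left_of_mem_uIcc hz
    simpa using this
  have key := (convex_uIcc 0 x).norm_image_sub_le_of_norm_hasDerivWithin_le (f := f) (f' := g)
    (C := c * |x| ^ n)
    (fun z hz' => ((h (y := z) (by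
      rw [Real.dist_eq, sub_zero]; exact (hz z hz').trans_lt hx)).1).hasDerivWithinAt)
    (fun z hz' => by
      have h1 := (h (y := z) (by rw [Real.dist_eq, sub_zero]; exact (hz z hz').trans_lt hx)).2
      refine h1.trans ?_
      rw [norm_pow, Real.norm_eq_abs]
      exact mul_le_mul_of_nonneg_left (pow_le_pow_left₀ (abs_nonneg _) (hz z hz') n) hc.le)
    left_mem_uIcc right_mem_uIcc
  rw [h0, sub_zero, sub_zero, Real.norm_eq_abs x] at key
  rw [norm_pow, Real.norm_eq_abs x]
  calc ‖f x‖ ≤ _ := key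
    _ = _ := by ring

/-- Taylor's formula of order three, with Peano's remainder. -/
theorem hasTaylorThree_of_hasDerivAt {f f₁ f₂ : ℝ → ℝ} {d : ℝ} (h0 : f 0 = 0)
    (h1 : ∀ᶠ x in 𝓝 (0 : ℝ), HasDerivAt f (f₁ x) x)
    (h2 : ∀ᶠ x in 𝓝 (0 : ℝ), HasDerivAt f₁ (f₂ x) x) (h3 : HasDerivAt f₂ d 0) :
    HasTaylorThree f (f₁ 0) (f₂ 0 / 2) (d / 6) := by
  have e3 : (fun x => f₂ x - f₂ 0 - d * x) =o[𝓝 0] fun x : ℝ => x ^ 1 := by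
    have := hasDerivAt_iff_isLittleO.1 h3
    simpa [mul_comm] using this
  have e2 : (fun x => f₁ x - f₁ 0 - f₂ 0 * x - d / 2 * x ^ 2) =o[𝓝 0] fun x : ℝ => x ^ 2 := by
    refine isLittleO_pow_succ_of_deriv ?_ (by simp) e3
    filter_upwards [h2] with x hx
    have := ((hx.sub_const (f₁ 0)).sub ((hasDerivAt_id x).const_mul (f₂ 0))).sub
      (((hasDerivAt_id x).pow 2).const_mul (d / 2))
    refine this.congr_deriv ?_
    simp; ring
  have e1 := isLittleO_pow_succ_of_deriv (n := 2)
    (f := fun x => f x - (f₁ 0 * x + f₂ 0 / 2 * x ^ 2 + d / 6 * x ^ 3)) ?_ (by simp [h0]) e2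
  · exact e1
  · filter_upwards [h1] with x hx
    have := hx.sub ((((hasDerivAt_id x).const_mul (f₁ 0)).add
      (((hasDerivAt_id x).pow 2).const_mul (f₂ 0 / 2))).add
      (((hasDerivAt_id x).pow 3).const_mul (d / 6)))
    refine this.congr_deriv ?_
    simp; ring

theorem eq_zero_of_pow_isLittleO {a : ℝ} {g : ℝ → ℝ} {n : ℕ}
    (h : (fun x => a * x ^ n + x ^ (n + 1) * g x) =o[𝓝 0] fun x : ℝ => x ^ n)
    (hg : ContinuousAt g 0) : a = 0 := by
  have h' := h.mono (nhdsWithin_le_nhds (s := {0}ᶜ))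
  have ht := h'.tendsto_div_nhds_zero
  have e : (fun x => (a * x ^ n + x ^ (n + 1) * g x) / x ^ n) =ᶠ[𝓝[≠] 0]
      fun x => a + x * g x := by
    filter_upwards [self_mem_nhdsWithin] with x hx
    have : x ≠ 0 := hx
    field_simp
    ring
  rw [tendsto_congr' e] at ht
  have h2 : Tendsto (fun x => a + x * g x) (𝓝[≠] 0) (𝓝 (a + 0 * g 0)) :=
    ((continuousAt_const.add (continuousAt_id.mul hg)).tendsto).mono_left nhdsWithin_le_nhds
  have := tendsto_nhds_unique ht h2
  linarith

theorem HasTaylorThree.unique {f : ℝ → ℝ} {a b c a' b' c' : ℝ} (h : HasTaylorThree f a b c)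
    (h' : HasTaylorThree f a' b' c') : a = a' ∧ b = b' ∧ c = c' := by
  have hd : (fun x : ℝ => (a - a') * x + (b - b') * x ^ 2 + (c - c') * x ^ 3) =o[𝓝 0]
      fun x : ℝ => x ^ 3 := by
    have := h'.sub h
    refine this.congr_left fun x => ?_
    ring
  have hp : ∀ {m : ℕ}, m ≤ 3 → (fun x : ℝ => x ^ 3) =O[𝓝 0] fun x : ℝ => x ^ m := fun {m} hm => by
    refine Asymptotics.IsBigO.of_bound 1 ?_
    filter_upwards [Metric.ball_mem_nhds (0 : ℝ) one_pos] with x hx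
    rw [mem_ball_zero_iff] at hx
    rw [norm_pow, norm_pow, one_mul]
    exact pow_le_pow_of_le_one (norm_nonneg _) hx.le hm
  have ha : a - a' = 0 := eq_zero_of_pow_isLittleO (n := 1)
    (g := fun x => (b - b') + (c - c') * x)
    ((hd.trans_isBigO (hp (by norm_num))).congr_left fun x => by ring) (by fun_prop)
  have hb : b - b' = 0 := eq_zero_of_pow_isLittleO (n := 2)
    (g := fun x => (c - c'))
    ((hd.trans_isBigO (hp (by norm_num))).congr_left fun x => by rw [ha]; ring) (by fun_prop)
  have hc : c - c' = 0 := eq_zero_of_pow_isLittleO (n := 3)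
    (g := fun x => 0) (hd.congr_left fun x => by rw [ha, hb]; ring) (by fun_prop)
  exact ⟨by linarith, by linarith, by linarith⟩

theorem HasTaylorThree.congr {f g : ℝ → ℝ} {a b c : ℝ} (h : HasTaylorThree f a b c)
    (hfg : f =ᶠ[𝓝 0] g) : HasTaylorThree g a b c :=
  Asymptotics.IsLittleO.congr' h (hfg.mono fun x hx => by simp only [hx]) EventuallyEq.rfl

end Taylor

/-! ### The bifurcation of period two orbits -/

section Bifurcation

/-- A property of the points near `(l₀, 0)` holds on a ball which is the same for all `l` near `l₀`. -/
theorem eventually_box {E F : Type*} [TopologicalSpace E] [SeminormedAddCommGroup F] {l₀ : E}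
    {p : E × F → Prop} (h : ∀ᶠ z in 𝓝 (l₀, (0 : F)), p z) :
    ∃ r > 0, ∀ᶠ l in 𝓝 l₀, ∀ x : F, ‖x‖ < r → p (l, x) := by
  rw [nhds_prod_eq, Filter.eventually_prod_iff] at h
  obtain ⟨pa, ha, pb, hb, hab⟩ := h
  obtain ⟨r, hr, hball⟩ := Metric.eventually_nhds_iff.1 hb
  refine ⟨r, hr, ha.mono fun l hl x hx => hab hl (hball ?_)⟩
  rwa [dist_zero_right]

/-- The partial derivative of a function of class `C^(n + 1)` with respect to its real argument. -/
theorem exists_partial_deriv {E : Type*} [NormedAddCommGroup E] [NormedSpace ℝ E] {n : ℕ}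
    {P : E × ℝ → ℝ} {z₀ : E × ℝ} (h : ContDiffAt ℝ (n + 1) P z₀) :
    ∃ P' : E × ℝ → ℝ, ContDiffAt ℝ n P' z₀ ∧
      ∀ᶠ z in 𝓝 z₀, HasDerivAt (fun x => P (z.1, x)) (P' z) z.2 := by
  refine ⟨fun z => fderiv ℝ P z (0, 1), ?_, ?_⟩
  · exact (h.fderiv_right (m := n) le_rfl).clm_apply contDiffAt_const
  · have h1 : ContDiffAt ℝ 1 P z₀ := h.of_le (by exact_mod_cast Nat.le_add_left 1 n)
    filter_upwards [h1.eventually (by simp)] with z hz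
    have hd : HasFDerivAt P (fderiv ℝ P z) (z.1, z.2) :=
      (hz.differentiableAt one_ne_zero).hasFDerivAt
    have hc : HasDerivAt (fun x : ℝ => (z.1, x)) ((0 : E), (1 : ℝ)) z.2 :=
      (hasDerivAt_const _ _).prodMk (hasDerivAt_id _)
    exact hd.comp_hasDerivAt z.2 hc

section Zeros

variable {D D₁ D₂ D₃ : ℝ → ℝ} {r : ℝ} (h1 : ∀ x ∈ Ioo (-r) r, HasDerivAt D (D₁ x) x)
  (h2 : ∀ x ∈ Ioo (-r) r, HasDerivAt D₁ (D₂ x) x) (h3 : ∀ x ∈ Ioo (-r) r, HasDerivAt D₂ (D₃ x) x)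
  (hpos : ∀ x ∈ Ioo (-r) r, 0 < D₃ x)

include h1 h2 h3 hpos

/-- Three zeros of a function with positive third derivative are simple, and the derivatives there
are positive, negative, positive. -/
theorem deriv_sign_of_three_zeros {a b c : ℝ} (ha : -r < a) (hab : a < b) (hbc : b < c) (hc : c < r)
    (za : D a = 0) (zb : D b = 0) (zc : D c = 0) : 0 < D₁ a ∧ D₁ b < 0 ∧ 0 < D₁ c := by
  have hin : ∀ x ∈ Icc a c, x ∈ Ioo (-r) r := fun x hx => ⟨ha.trans_le hx.1, hx.2.trans_lt hc⟩
  have rolle : ∀ {f f' : ℝ → ℝ} {u v : ℝ}, a ≤ u → u < v → v ≤ c →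
      (∀ x ∈ Ioo (-r) r, HasDerivAt f (f' x) x) → f u = f v → ∃ ξ ∈ Ioo u v, f' ξ = 0 := by
    intro f f' u v hu huv hv hf he
    exact exists_hasDerivAt_eq_zero huv
      (fun x hx => (hf x (hin x ⟨hu.trans hx.1, hx.2.trans hv⟩)).continuousAt.continuousWithinAt)
      he fun x hx => hf x (hin x ⟨hu.trans hx.1.le, hx.2.le.trans hv⟩)
  -- By Rolle's theorem `D₁` vanishes at `ξ₁` and `ξ₂`, which separate the zeros of `D`, and `D₂` at `ζ`
  -- between them. Since `D₂` increases, `D₁` decreases before `ζ` and increases after it.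
  obtain ⟨ξ₁, hξ₁, e1⟩ := rolle le_rfl hab hbc.le h1 (za.trans zb.symm)
  obtain ⟨ξ₂, hξ₂, e2⟩ := rolle hab.le hbc le_rfl h1 (zb.trans zc.symm)
  obtain ⟨ζ, hζ, e3⟩ := rolle hξ₁.1.le (hξ₁.2.trans hξ₂.1) hξ₂.2.le h2 (e1.trans e2.symm)
  have hmono : StrictMonoOn D₂ (Icc a c) := by
    refine strictMonoOn_of_deriv_pos (convex_Icc a c)
      (fun x hx => (h3 x (hin x hx)).continuousAt.continuousWithinAt) fun x hx => ?_
    rw [interior_Icc] at hx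
    rw [(h3 x (hin x ⟨hx.1.le, hx.2.le⟩)).deriv]
    exact hpos x (hin x ⟨hx.1.le, hx.2.le⟩)
  have hζm : ζ ∈ Icc a c := ⟨(hξ₁.1.trans hζ.1).le, (hζ.2.trans hξ₂.2).le⟩
  have hleft : StrictAntiOn D₁ (Icc a ζ) := by
    refine strictAntiOn_of_deriv_neg (convex_Icc a ζ)
      (fun x hx => (h2 x (hin x ⟨hx.1, hx.2.trans hζm.2⟩)).continuousAt.continuousWithinAt)
      fun x hx => ?_
    rw [interior_Icc] at hx
    have hx' : x ∈ Icc a c := ⟨hx.1.le, hx.2.le.trans hζm.2⟩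
    rw [(h2 x (hin x hx')).deriv, ← e3]
    exact hmono hx' hζm hx.2
  have hright : StrictMonoOn D₁ (Icc ζ c) := by
    refine strictMonoOn_of_deriv_pos (convex_Icc ζ c)
      (fun x hx => (h2 x (hin x ⟨hζm.1.trans hx.1, hx.2⟩)).continuousAt.continuousWithinAt)
      fun x hx => ?_
    rw [interior_Icc] at hx
    have hx' : x ∈ Icc a c := ⟨hζm.1.trans hx.1.le, hx.2.le⟩
    rw [(h2 x (hin x hx')).deriv, ← e3]
    exact hmono hζm hx' hx.1
  refine ⟨?_, ?_, ?_⟩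
  · rw [← e1]
    exact hleft ⟨le_rfl, hζm.1⟩ ⟨hξ₁.1.le, hζ.1.le⟩ hξ₁.1
  · rcases le_total b ζ with h | h
    · rw [← e1]
      exact hleft ⟨hξ₁.1.le, hζ.1.le⟩ ⟨hab.le, h⟩ hξ₁.2
    · rw [← e2]
      exact hright ⟨h, hbc.le⟩ ⟨hζ.2.le, hξ₂.2.le⟩ hξ₂.1
  · rw [← e2]
    exact hright ⟨hζ.2.le, hξ₂.2.le⟩ ⟨hζm.2, le_rfl⟩ hξ₂.2

/-- The third zero would be the last of three, and the middle one of three. -/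
theorem not_four_zeros {a b c d : ℝ} (ha : -r < a) (hab : a < b) (hbc : b < c) (hcd : c < d)
    (hd : d < r) (za : D a = 0) (zb : D b = 0) (zc : D c = 0) (zd : D d = 0) : False := by
  have e1 := (deriv_sign_of_three_zeros h1 h2 h3 hpos ha hab hbc (hcd.trans hd) za zb zc).2.2
  have e2 := (deriv_sign_of_three_zeros h1 h2 h3 hpos (ha.trans hab) hbc hcd hd zb zc zd).2.1
  linarith

end Zeros

theorem exists_zero_between {D : ℝ → ℝ} {u v : ℝ} (huv : u ≤ v) (hc : ContinuousOn D (Icc u v))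
    (h : D u * D v < 0) : ∃ z ∈ Ioo u v, D z = 0 := by
  have hu : D u ≠ 0 := fun h' => by simp [h'] at h
  have hv : D v ≠ 0 := fun h' => by simp [h'] at h
  have : ∃ z ∈ Icc u v, D z = 0 := by
    rcases lt_or_gt_of_ne hu with h' | h'
    · exact intermediate_value_Icc huv hc ⟨h'.le, by nlinarith⟩
    · exact intermediate_value_Icc' huv hc ⟨by nlinarith, h'.le⟩
  obtain ⟨z, hz, e⟩ := this
  refine ⟨z, ⟨lt_of_le_of_ne hz.1 ?_, lt_of_le_of_ne hz.2 ?_⟩, e⟩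
  · rintro rfl; exact hu e
  · rintro rfl; exact hv e

/-- The fixed points of the square of a decreasing map `P` for which `P ∘ P` has third derivative
of constant sign. Nonzero fixed points of `P ∘ P` come in pairs `x`, `P x`, on both sides of the fixed
point `0`, so that there is at most one pair. -/
theorem exists_local_pattern {P D₁ D₂ D₃ : ℝ → ℝ} {r R R' ε α : ℝ}
    (h1 : ∀ x ∈ Ioo (-r) r, HasDerivAt (fun x => P (P x) - x) (D₁ x) x)
    (h2 : ∀ x ∈ Ioo (-r) r, HasDerivAt D₁ (D₂ x) x) (h3 : ∀ x ∈ Ioo (-r) r, HasDerivAt D₂ (D₃ x) x)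
    (hpos : ∀ x ∈ Ioo (-r) r, 0 < ε * D₃ x) (hR' : 0 < R') (hRR : R' ≤ R) (hRr : R < r)
    (h0 : P 0 = 0) (hP : ∀ x, 0 < x → x ≤ R → P x ∈ Ioo (-r) 0) (hα : D₁ 0 = α ^ 2 - 1)
    (hα0 : α < 0) (hDR : 0 < ε * (P (P R) - R)) (hDR' : 0 < ε * (P (P R') - R')) :
    ∃ q, 0 ≤ q ∧ q < R' ∧ P (P q) = q ∧ (∀ x, q < x → x ≤ R → 0 < ε * (P (P x) - x)) ∧
      (∀ x, 0 < x → x < q → ε * (P (P x) - x) < 0) ∧ (q = 0 ↔ ε * (α + 1) ≤ 0) ∧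
      (0 < q → 0 < ε * D₁ (P q)) := by
  set D : ℝ → ℝ := fun x => ε * (P (P x) - x) with hD
  have d1 : ∀ x ∈ Ioo (-r) r, HasDerivAt D (ε * D₁ x) x := fun x hx => (h1 x hx).const_mul ε
  have d2 : ∀ x ∈ Ioo (-r) r, HasDerivAt (fun x => ε * D₁ x) (ε * D₂ x) x :=
    fun x hx => (h2 x hx).const_mul ε
  have d3 : ∀ x ∈ Ioo (-r) r, HasDerivAt (fun x => ε * D₂ x) (ε * D₃ x) x :=
    fun x hx => (h3 x hx).const_mul ε
  have hε : ε ≠ 0 := fun h => by simp [h] at hDR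
  have z0 : D 0 = 0 := by simp [hD, h0]
  have hfix : ∀ x, D x = 0 → P (P x) = x := fun x hx => by
    have := (mul_eq_zero.1 hx).resolve_left hε
    linarith
  have hzP : ∀ x, D x = 0 → D (P x) = 0 := fun x hx => by
    simp only [hD, hfix x hx, sub_self, mul_zero]
  have hcont : ∀ {u v : ℝ}, 0 ≤ u → v ≤ R → ContinuousOn D (Icc u v) := fun hu hv x hx =>
    (d1 x ⟨by linarith [hx.1], by linarith [hx.2]⟩).continuousAt.continuousWithinAt
  -- A positive fixed point `x` gives three zeros `P x < 0 < x` of `D`.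
  have three : ∀ x, 0 < x → x ≤ R → D x = 0 →
      0 < ε * D₁ (P x) ∧ ε * D₁ 0 < 0 ∧ 0 < ε * D₁ x := fun x hx hxR hz =>
    deriv_sign_of_three_zeros d1 d2 d3 hpos (hP x hx hxR).1 (hP x hx hxR).2 hx
      (hxR.trans_lt hRr) (hzP x hz) z0 hz
  have hαs : ε * D₁ 0 < 0 ↔ 0 < ε * (α + 1) := by
    rw [hα, show ε * (α ^ 2 - 1) = (ε * (α + 1)) * (α - 1) by ring]
    constructor
    · intro h; nlinarith
    · intro h; exact mul_neg_of_pos_of_neg h (by linarith)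
  -- If `ε (α + 1) ≤ 0`, the sign of `D₁ 0` excludes a positive zero. Otherwise `D` is negative just to
  -- the right of `0` and positive at `R'`, so that there is one.
  rcases le_or_gt (ε * (α + 1)) 0 with hs | hs
  · have hnz : ∀ x, 0 < x → x ≤ R → D x ≠ 0 := fun x hx hxR hz => by
      have := hαs.1 (three x hx hxR hz).2.1
      linarith
    refine ⟨0, le_rfl, hR', by rw [h0, h0], fun x hx hxR => ?_, fun x h h' => by linarith,
      by simp [hs], fun h => (lt_irrefl _ h).elim⟩
    by_contra! hneg
    have hlt : D x < 0 := lt_of_le_of_ne hneg (hnz x hx hxR)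
    obtain ⟨z, hz, e⟩ := exists_zero_between hxR (hcont hx.le le_rfl)
      (mul_neg_of_neg_of_pos hlt hDR)
    exact hnz z (hx.trans hz.1) hz.2.le e
  · have hneg0 : ε * D₁ 0 < 0 := hαs.2 hs
    have hx1 : ∃ x₁ ∈ Ioo 0 R', D x₁ < 0 := by
      have hd := d1 0 ⟨by linarith, by linarith⟩
      have hev := (hasDerivAt_iff_tendsto_slope.1 hd).eventually (gt_mem_nhds hneg0)
      have hev' : ∀ᶠ x in 𝓝[>] (0 : ℝ), slope D 0 x < 0 :=
        hev.filter_mono (nhdsWithin_mono _ fun x hx => ne_of_gt hx)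
      obtain ⟨x, hx, hx2⟩ := (hev'.and (Ioo_mem_nhdsGT hR')).exists
      refine ⟨x, hx2, ?_⟩
      rw [slope_def_field, z0, sub_zero, sub_zero] at hx
      exact neg_of_div_neg_left hx hx2.1.le
    obtain ⟨x₁, hx₁, hx₁D⟩ := hx1
    obtain ⟨q, hq, zq⟩ := exists_zero_between hx₁.2.le (hcont hx₁.1.le hRR)
      (mul_neg_of_neg_of_pos hx₁D hDR')
    have hq0 : 0 < q := hx₁.1.trans hq.1
    have hqR : q ≤ R := hq.2.le.trans hRR
    have huniq : ∀ x, 0 < x → x ≤ R → D x = 0 → x = q := by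
      intro x hx hxR hz
      rcases lt_trichotomy x q with h | h | h
      · exact (not_four_zeros d1 d2 d3 hpos (hP q hq0 hqR).1 (hP q hq0 hqR).2 hx h
          (hqR.trans_lt hRr) (hzP q zq) z0 hz zq).elim
      · exact h
      · exact (not_four_zeros d1 d2 d3 hpos (hP q hq0 hqR).1 (hP q hq0 hqR).2 hq0 h
          (hxR.trans_lt hRr) (hzP q zq) z0 zq hz).elim
    refine ⟨q, hq0.le, hq.2, hfix q zq, fun x hx hxR => ?_, fun x hx hxq => ?_,
      ⟨fun h => by linarith, fun h => by linarith⟩, fun _ => (three q hq0 hqR zq).1⟩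
    · by_contra! hneg
      have hx0 := hq0.trans hx
      have hlt : D x < 0 := lt_of_le_of_ne hneg fun e => hx.ne' (huniq x hx0 hxR e)
      obtain ⟨z, hz, e⟩ := exists_zero_between hxR (hcont hx0.le le_rfl)
        (mul_neg_of_neg_of_pos hlt hDR)
      exact (hx.trans hz.1).ne' (huniq z (hx0.trans hz.1) hz.2.le e)
    · by_contra! hge
      have hgt : 0 < D x := lt_of_le_of_ne hge fun e => hxq.ne
        (huniq x hx (hxq.le.trans hqR) e.symm)
      rcases lt_trichotomy x x₁ with h | h | h
      · obtain ⟨z, hz, e⟩ := exists_zero_between h.le (hcont hx.le (hx₁.2.le.trans hRR))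
          (mul_neg_of_pos_of_neg hgt hx₁D)
        exact (hz.2.trans hq.1).ne (huniq z (hx.trans hz.1) (hz.2.le.trans (hx₁.2.le.trans hRR)) e)
      · rw [h] at hgt; linarith
      · obtain ⟨z, hz, e⟩ := exists_zero_between h.le (hcont hx₁.1.le (hxq.le.trans hqR))
          (mul_neg_of_neg_of_pos hx₁D hgt)
        exact (hz.2.trans hxq).ne (huniq z (hx₁.1.trans hz.1) (hz.2.le.trans (hxq.le.trans hqR)) e)

end Bifurcation


/-! ### Extension of a local decreasing map to the line -/

section Extension

/-- The nearest point of `[-ρ, ρ]`. -/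
def clamp (ρ x : ℝ) : ℝ := max (-ρ) (min x ρ)

theorem clamp_eq {ρ x : ℝ} (hx : |x| ≤ ρ) : clamp ρ x = x := by
  rw [abs_le] at hx
  rw [clamp, min_eq_left hx.2, max_eq_right hx.1]

theorem clamp_of_le {ρ x : ℝ} (hρ : 0 ≤ ρ) (hx : ρ ≤ x) : clamp ρ x = ρ := by
  rw [clamp, min_eq_right hx, max_eq_right (by linarith)]

theorem clamp_of_le_neg {ρ x : ℝ} (hx : x ≤ -ρ) : clamp ρ x = -ρ := by
  rw [clamp, max_eq_left ((min_le_left _ _).trans hx)]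

theorem abs_clamp_le {ρ : ℝ} (hρ : 0 ≤ ρ) (x : ℝ) : |clamp ρ x| ≤ ρ :=
  abs_le.2 ⟨le_max_left _ _, max_le (by linarith) (min_le_right _ _)⟩

theorem monotone_clamp (ρ : ℝ) : Monotone (clamp ρ) := fun _ _ h =>
  max_le_max_left _ (min_le_min_right _ h)

theorem clamp_sub_le {ρ u v : ℝ} (h : u ≤ v) : clamp ρ v - clamp ρ u ≤ v - u := by
  unfold clamp
  rcases max_cases (-ρ) (min v ρ) with h1 | h1 <;> rcases max_cases (-ρ) (min u ρ) with h2 | h2 <;>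
  rcases min_cases v ρ with h3 | h3 <;> rcases min_cases u ρ with h4 | h4 <;> linarith

theorem clamp_zero {ρ : ℝ} (hρ : 0 ≤ ρ) : clamp ρ 0 = 0 := clamp_eq (by simpa using hρ)

/-- The extension of `P` from `[-ρ, ρ]` to the line, with slope `-s` outside the interval. -/
def extendSlope (ρ s : ℝ) (P : ℝ → ℝ) (x : ℝ) : ℝ := P (clamp ρ x) - s * (x - clamp ρ x)

/-- The function `P` is decreasing on `[-ρ, ρ]`, with slopes between `-M` and `-m`. -/
def SlopeOn (P : ℝ → ℝ) (ρ m M : ℝ) : Prop :=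
  ∀ u v, -ρ ≤ u → u ≤ v → v ≤ ρ → m * (v - u) ≤ P u - P v ∧ P u - P v ≤ M * (v - u)

theorem SlopeOn.mono {P : ℝ → ℝ} {ρ ρ' m M : ℝ} (h : SlopeOn P ρ m M) (hρ : ρ' ≤ ρ) :
    SlopeOn P ρ' m M := fun u v hu huv hv => h u v (by linarith) huv (by linarith)

theorem extendSlope_eq {ρ s : ℝ} {P : ℝ → ℝ} {x : ℝ} (hx : |x| ≤ ρ) :
    extendSlope ρ s P x = P x := by
  rw [extendSlope, clamp_eq hx, sub_self, mul_zero, sub_zero]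

theorem extendSlope_slope {ρ s m M : ℝ} {P : ℝ → ℝ} (hρ : 0 ≤ ρ) (hP : SlopeOn P ρ m M)
    (hm : m ≤ s) (hM : s ≤ M) {u v : ℝ} (huv : u ≤ v) :
    m * (v - u) ≤ extendSlope ρ s P u - extendSlope ρ s P v ∧
      extendSlope ρ s P u - extendSlope ρ s P v ≤ M * (v - u) := by
  have h := hP (clamp ρ u) (clamp ρ v) (abs_le.1 (abs_clamp_le hρ u)).1 (monotone_clamp ρ huv)
    (abs_le.1 (abs_clamp_le hρ v)).2
  have h2 := clamp_sub_le (ρ := ρ) huv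
  have e : extendSlope ρ s P u - extendSlope ρ s P v = (P (clamp ρ u) - P (clamp ρ v)) +
      s * ((v - u) - (clamp ρ v - clamp ρ u)) := by unfold extendSlope; ring
  rw [e]
  constructor
  · nlinarith [mul_le_mul_of_nonneg_right hm (sub_nonneg.2 h2)]
  · nlinarith [mul_le_mul_of_nonneg_right hM (sub_nonneg.2 h2)]

/-- A function whose slopes are bounded between two negative constants is a decreasing bijection
of the line. -/
theorem exists_equiv_of_slope {f : ℝ → ℝ} {m M : ℝ} (hm : 0 < m)
    (hf : ∀ u v, u ≤ v → m * (v - u) ≤ f u - f v ∧ f u - f v ≤ M * (v - u)) :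
    ∃ Q : ℝ ≃ ℝ, (∀ x, Q x = f x) ∧ StrictAnti Q ∧ Continuous f := by
  have hanti : StrictAnti f := fun u v h => by
    have := (hf u v h.le).1
    nlinarith [mul_pos hm (sub_pos.2 h)]
  have hcont : Continuous f := by
    have : LipschitzWith (Real.toNNReal M) f := by
      refine LipschitzWith.of_dist_le' fun x y => ?_
      rw [Real.dist_eq, Real.dist_eq]
      rcases le_total x y with h | h
      · rw [abs_of_nonneg (by nlinarith [hf x y h, sub_nonneg.2 h]), abs_sub_comm,
          abs_of_nonneg (sub_nonneg.2 h)]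
        exact (hf x y h).2
      · rw [abs_sub_comm, abs_of_nonneg (by nlinarith [hf y x h, sub_nonneg.2 h]),
          abs_of_nonneg (sub_nonneg.2 h)]
        exact (hf y x h).2
    exact this.continuous
  have htop : Tendsto f atTop atBot := by
    have h1 : Tendsto (fun x : ℝ => f 0 - m * x) atTop atBot := by
      have := (tendsto_id.const_mul_atTop hm (f := fun x : ℝ => x))
      exact (tendsto_atBot_add_const_left _ (f 0) (tendsto_neg_atTop_atBot.comp this)).congr
        fun x => by simp [sub_eq_add_neg]
    refine tendsto_atBot_mono' _ ?_ h1
    filter_upwards [eventually_ge_atTop 0] with x hx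
    have := (hf 0 x hx).1
    simp only [sub_zero] at this
    linarith
  have hbot : Tendsto f atBot atTop := by
    have h1 : Tendsto (fun x : ℝ => f 0 - m * x) atBot atTop := by
      have := (tendsto_id.const_mul_atBot hm (f := fun x : ℝ => x))
      exact (tendsto_atTop_add_const_left _ (f 0) (tendsto_neg_atBot_atTop.comp this)).congr
        fun x => by simp [sub_eq_add_neg]
    refine tendsto_atTop_mono' _ ?_ h1
    filter_upwards [eventually_le_atBot 0] with x hx
    have := (hf x 0 hx).1
    simp only [zero_sub] at this
    linarith
  refine ⟨Equiv.ofBijective f ⟨hanti.injective, hcont.surjective' hbot htop⟩, fun x => rfl,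
    hanti, hcont⟩

/-- The extension of a map with slopes close to `-1` has no other recurrence than the map itself:
the slopes `-2` and `-1/2` outside the interval are chosen so that the square of the extension moves
points away from, respectively towards, the origin. -/
theorem extendSlope_hasPattern {P : ℝ → ℝ} {ρ ε q : ℝ} (hρ : 0 < ρ) (h0 : P 0 = 0)
    (hP : SlopeOn P (2 * ρ) (3 / 4) (5 / 4)) (hq0 : 0 ≤ q) (hq : q < ρ / 2) (hfix : P (P q) = q)
    (hout : ∀ x, q < x → x ≤ ρ → 0 < ε * (P (P x) - x))
    (hin : ∀ x, 0 < x → x < q → ε * (P (P x) - x) < 0) :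
    HasPattern (fun x => extendSlope ρ (if 0 < ε then 2 else 1 / 2) P
      (extendSlope ρ (if 0 < ε then 2 else 1 / 2) P x)) ε q := by
  set s : ℝ := if 0 < ε then 2 else 1 / 2 with hs
  set E := extendSlope ρ s P with hE
  have hbd : ∀ x, 0 ≤ x → x ≤ 2 * ρ → 3 / 4 * x ≤ - P x ∧ - P x ≤ 5 / 4 * x := fun x hx hx' => by
    have := hP 0 x (by linarith) hx hx'
    rw [h0] at this
    constructor <;> linarith [this.1, this.2]
  have hsmall : ∀ x, 0 ≤ x → x ≤ q → E (E x) = P (P x) := fun x hx hx' => by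
    have h := hbd x hx (by linarith)
    have e : E x = P x := extendSlope_eq (abs_le.2 ⟨by linarith, by linarith⟩)
    rw [e]
    exact extendSlope_eq (abs_le.2 ⟨by linarith, by linarith⟩)
  -- If `P x` leaves `[-ρ, ρ]`, then `E` is steeper than `P` there when `ε > 0`, and flatter otherwise, so
  -- that `E (P x)` is even further in the direction of the sign of `ε`.
  have hmid : ∀ x, q < x → x ≤ ρ → 0 < ε * (E (E x) - x) := fun x hx hx' => by
    have h := hbd x (by linarith) (by linarith)
    have e : E x = P x := extendSlope_eq (abs_le.2 ⟨by linarith, by linarith⟩)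
    rw [e]
    have ho := hout x hx hx'
    rcases le_or_gt (-ρ) (P x) with hy | hy
    · rw [hE, extendSlope_eq (abs_le.2 ⟨by linarith, by linarith⟩)]
      exact ho
    · have e2 : E (P x) = P (-ρ) - s * (P x + ρ) := by
        rw [hE, extendSlope, clamp_of_le_neg hy.le]; ring
      have h2 := hP (P x) (-ρ) (by linarith) hy.le (by linarith)
      rw [e2]
      rcases lt_or_ge 0 ε with hε | hε
      · have hs' : s = 2 := if_pos hε
        rw [hs']
        nlinarith [h2.2]
      · have hs' : s = 1 / 2 := if_neg hε.not_gt
        rw [hs']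
        nlinarith [h2.1]
  refine ⟨hq0, (hsmall q hq0 le_rfl).trans hfix, fun x hx => ?_, fun x hx hx' => ?_⟩
  · rcases le_or_gt x ρ with h | h
    · exact hmid x hx h
    -- Beyond `ρ`, the slopes of `E ∘ E` are at least `3 / 4 * 2 > 1` if `ε > 0` and at most
    -- `5 / 4 * (1 / 2) < 1` if `ε < 0`, which propagates the sign from `ρ`.
    · have hR := hmid ρ (by linarith) le_rfl
      have e1 : E ρ = P ρ := extendSlope_eq (abs_of_pos hρ).le
      have e2 : E x = P ρ - s * (x - ρ) := by
        rw [hE, extendSlope, clamp_of_le hρ.le h.le]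
      rcases lt_or_ge 0 ε with hε | hε
      · have hs' : s = 2 := if_pos hε
        have h3 := (extendSlope_slope (s := s) (m := 3 / 4) (M := 2) hρ.le
          (fun u v a b c => ⟨((hP.mono (by linarith)) u v a b c).1,
            ((hP.mono (by linarith)) u v a b c).2.trans (by nlinarith)⟩)
          (by rw [hs']; norm_num) hs'.le (u := E x) (v := E ρ) (by rw [e1, e2, hs']; linarith)).1
        rw [← hE, show E ρ - E x = s * (x - ρ) by rw [e1, e2]; ring, hs'] at h3
        have h4 : 0 < E (E ρ) - ρ := by
          by_contra! h'; nlinarith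
        exact mul_pos hε (by linarith)
      · have hs' : s = 1 / 2 := if_neg hε.not_gt
        have h3 := (extendSlope_slope (s := s) (m := 1 / 2) (M := 5 / 4) hρ.le
          (fun u v a b c => ⟨le_trans (by nlinarith) ((hP.mono (by linarith)) u v a b c).1,
            ((hP.mono (by linarith)) u v a b c).2⟩)
          hs'.ge (by rw [hs']; norm_num) (u := E x) (v := E ρ) (by rw [e1, e2, hs']; linarith)).2
        rw [← hE, show E ρ - E x = s * (x - ρ) by rw [e1, e2]; ring, hs'] at h3
        have hε' : ε < 0 := lt_of_le_of_ne hε fun h' => by simp [h'] at hR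
        have h4 : E (E ρ) - ρ < 0 := by
          by_contra! h'; nlinarith
        exact mul_pos_of_neg_of_neg hε' (by linarith)
  · rw [hsmall x hx.le hx'.le]
    exact hin x hx hx'

end Extension

/-! ### Bifurcation of period two orbits in a family -/

section FamilyPattern

variable {E : Type*} [NormedAddCommGroup E] [NormedSpace ℝ E]

/-- In a family of decreasing maps `P l` with multiplier `-1` at the fixed point `0` for `l = l₀`, and
nonzero cubic coefficient of the square, the sign of `α + 1`, where `α` is the multiplier, tells
whether there is an orbit of period two. -/
theorem eventually_pattern {P : E × ℝ → ℝ} {l₀ : E} (hP : ContDiffAt ℝ 3 P (l₀, 0))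
    (h0 : ∀ᶠ l in 𝓝 l₀, P (l, 0) = 0) {α : E → ℝ}
    (hα : ∀ᶠ l in 𝓝 l₀, HasDerivAt (fun x => P (l, x)) (α l) 0) (hα₀ : α l₀ = -1) {η ε : ℝ}
    (hη : HasTaylorThree (fun x => P (l₀, P (l₀, x))) 1 0 η) (hε : 0 < ε * η) :
    ∃ ρ₀ > 0, ∀ ρ, 0 < ρ → ρ ≤ ρ₀ → ∀ R, 0 < R → R ≤ ρ → ∀ᶠ l in 𝓝 l₀,
      SlopeOn (fun x => P (l, x)) (2 * ρ) (3 / 4) (5 / 4) ∧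
      ∃ q, 0 ≤ q ∧ q < R ∧ P (l, P (l, q)) = q ∧
        (∀ x, q < x → x ≤ ρ → 0 < ε * (P (l, P (l, x)) - x)) ∧
        (∀ x, 0 < x → x < q → ε * (P (l, P (l, x)) - x) < 0) ∧ (q = 0 ↔ ε * (α l + 1) ≤ 0) ∧
        (0 < q → ∃ d, HasDerivAt (fun x => P (l, P (l, x))) d (P (l, q)) ∧ 0 < d ∧
          0 < ε * (d - 1)) := by
  obtain ⟨P₁, hP₁, d1⟩ := exists_partial_deriv (n := 2) (by exact_mod_cast hP)
  obtain ⟨P₂, hP₂, d2⟩ := exists_partial_deriv (n := 1) (by exact_mod_cast hP₁)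
  obtain ⟨P₃, hP₃, d3⟩ := exists_partial_deriv (n := 0) (by exact_mod_cast hP₂)
  have hP00 : P (l₀, 0) = 0 := h0.self_of_nhds
  have hG : ContinuousAt (fun z : E × ℝ => (z.1, P z)) (l₀, 0) :=
    continuousAt_fst.prodMk hP.continuousAt
  have hGt : Tendsto (fun z : E × ℝ => (z.1, P z)) (𝓝 (l₀, 0)) (𝓝 (l₀, 0)) := by
    have := hG.tendsto
    rwa [hP00] at this
  have hcomp : ∀ {Q : E × ℝ → ℝ}, ContinuousAt Q (l₀, 0) →
      ContinuousAt (fun z : E × ℝ => Q (z.1, P z)) (l₀, 0) := fun {Q} hQ => by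
    refine ContinuousAt.comp (g := Q) (f := fun z : E × ℝ => (z.1, P z)) ?_ hG
    simpa only [hP00] using hQ
  have hα1 : P₁ (l₀, 0) = -1 := by
    rw [← hα₀]
    exact (d1.self_of_nhds).unique hα.self_of_nhds
  set D₁ : E × ℝ → ℝ := fun z => P₁ (z.1, P z) * P₁ z - 1 with hD₁
  set D₂ : E × ℝ → ℝ := fun z => P₂ (z.1, P z) * P₁ z * P₁ z + P₁ (z.1, P z) * P₂ z with hD₂
  set D₃ : E × ℝ → ℝ := fun z => P₃ (z.1, P z) * P₁ z * P₁ z * P₁ z +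
    P₂ (z.1, P z) * P₂ z * P₁ z * 3 + P₁ (z.1, P z) * P₃ z with hD₃
  have c1 := hP₁.continuousAt
  have c2 := hP₂.continuousAt
  have c3 := hP₃.continuousAt
  have hD₃c : ContinuousAt D₃ (l₀, 0) :=
    ((((hcomp c3).mul c1).mul c1).mul c1 |>.add ((((hcomp c2).mul c2).mul c1).mul
      continuousAt_const)).add ((hcomp c1).mul c3)
  -- The derivatives of `x ↦ P (l, P (l, x)) - x`.
  have hder : ∀ᶠ z in 𝓝 (l₀, (0 : ℝ)),
      HasDerivAt (fun x => P (z.1, P (z.1, x))) (D₁ z + 1) z.2 ∧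
      HasDerivAt (fun x => D₁ (z.1, x)) (D₂ z) z.2 ∧
      HasDerivAt (fun x => D₂ (z.1, x)) (D₃ z) z.2 := by
    filter_upwards [d1, d2, d3, hGt.eventually d1, hGt.eventually d2, hGt.eventually d3]
      with z e1 e2 e3 g1 g2 g3
    have f1 : HasDerivAt (fun x => P (z.1, P (z.1, x))) (P₁ (z.1, P z) * P₁ z) z.2 :=
      HasDerivAt.comp (h₂ := fun x => P (z.1, x)) (h := fun x => P (z.1, x)) z.2 g1 e1
    have f2 : HasDerivAt (fun x => P₁ (z.1, P (z.1, x))) (P₂ (z.1, P z) * P₁ z) z.2 :=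
      HasDerivAt.comp (h₂ := fun x => P₁ (z.1, x)) (h := fun x => P (z.1, x)) z.2 g2 e1
    have f3 : HasDerivAt (fun x => P₂ (z.1, P (z.1, x))) (P₃ (z.1, P z) * P₁ z) z.2 :=
      HasDerivAt.comp (h₂ := fun x => P₂ (z.1, x)) (h := fun x => P (z.1, x)) z.2 g3 e1
    refine ⟨f1.congr_deriv (by simp [hD₁]), ((f2.mul e2).sub_const 1).congr_deriv ?_,
      (((f3.mul e2).mul e2).add (f2.mul e3)).congr_deriv ?_⟩
    · simp [hD₂]
    · simp [hD₃]; ring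
  -- By uniqueness of the Taylor coefficients, `D₃ (l₀, 0) = 6 η`.
  have hD₃0 : 0 < ε * D₃ (l₀, 0) := by
    have hsl : ∀ {p : E × ℝ → Prop}, (∀ᶠ z in 𝓝 (l₀, (0 : ℝ)), p z) → ∀ᶠ x in 𝓝 (0 : ℝ), p (l₀, x) :=
      fun {p} h => (ContinuousAt.tendsto (f := fun x : ℝ => (l₀, x)) (by fun_prop)).eventually h
    have ht := hasTaylorThree_of_hasDerivAt (f := fun x => P (l₀, P (l₀, x)))
      (f₁ := fun x => D₁ (l₀, x) + 1) (f₂ := fun x => D₂ (l₀, x)) (d := D₃ (l₀, 0))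
      (by simp only [hP00]) ((hsl hder).mono fun x hx => hx.1)
      ((hsl hder).mono fun x hx => hx.2.1.add_const 1) hder.self_of_nhds.2.2
    have := (ht.unique hη).2.2
    have : D₃ (l₀, 0) = 6 * η := by linarith
    rw [this]; linarith
  -- All the local properties hold on a common box, and in particular the slopes of `P` are close to
  -- `-1` and the third derivative of the square has the sign of `ε`.
  obtain ⟨r, hr, hbox⟩ := eventually_box (((((hder.and (hP.continuousAt.eventually_mem
      (Metric.ball_mem_nhds _ one_pos))).and
    ((hP.eventually (by simp)).mono fun z hz => hz.continuousAt)).and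
    (hGt.eventually ((hP.eventually (by simp)).mono fun z hz => hz.continuousAt))).and
    (c1.eventually (Ioo_mem_nhds (show (-5 / 4 : ℝ) < P₁ (l₀, 0) by rw [hα1]; norm_num)
      (show P₁ (l₀, 0) < (-3 / 4 : ℝ) by rw [hα1]; norm_num)))).and
    ((d1.and (hGt.eventually (c1.eventually (gt_mem_nhds (show P₁ (l₀, 0) < 0 by
      rw [hα1]; norm_num))))).and
      ((continuousAt_const.mul hD₃c).eventually (lt_mem_nhds hD₃0))))
  have hbase := hbox.self_of_nhds
  -- For `l = l₀`, the cubic term tells the sign of `P (P x) - x`; at the two points `R` and `ρ`, this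
  -- sign persists for `l` near `l₀`.
  have hsgn : ∀ᶠ x in 𝓝[>] (0 : ℝ), 0 < ε * (P (l₀, P (l₀, x)) - x) := by
    have h3 : 0 < |η| := abs_pos.2 fun h => by simp [h] at hε
    filter_upwards [(hη.def (half_pos h3)).filter_mono nhdsWithin_le_nhds, self_mem_nhdsWithin]
      with x hx hx0
    have hx0 : 0 < x := hx0
    rw [norm_pow, Real.norm_eq_abs, Real.norm_eq_abs, abs_of_pos hx0, abs_le] at hx
    have hx3 : 0 < x ^ 3 := by positivity
    rcases lt_or_ge 0 η with h | h
    · have hε' : 0 < ε := by by_contra! h'; nlinarith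
      rw [abs_of_pos h] at hx
      exact mul_pos hε' (by nlinarith [mul_pos h hx3])
    · have hη' : η < 0 := lt_of_le_of_ne h fun h' => by simp [h'] at hε
      have hε' : ε < 0 := by by_contra! h'; nlinarith
      rw [abs_of_neg hη'] at hx
      exact mul_pos_of_neg_of_neg hε' (by nlinarith [mul_pos (neg_pos.2 hη') hx3])
  obtain ⟨r', hr', hsgn⟩ := mem_nhdsGT_iff_exists_Ioo_subset.1 hsgn
  refine ⟨min r r' / 4, by have : 0 < r' := hr'; positivity, fun ρ hρ hρ₀ R hR hRρ => ?_⟩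
  have hr' : 0 < r' := hr'
  have hρr : 2 * ρ < r := by have := min_le_left r r'; linarith
  have hρr' : ρ < r' := by have := min_le_right r r'; linarith
  have hcont : ∀ x, 0 < x → x ≤ ρ → ∀ᶠ l in 𝓝 l₀, 0 < ε * (P (l, P (l, x)) - x) := by
    intro x hx hxρ
    have hb := hbase x (by rw [Real.norm_eq_abs, abs_of_pos hx]; linarith)
    have k1 : ContinuousAt (fun l : E => P (l, x)) l₀ :=
      ContinuousAt.comp (g := P) (f := fun l : E => (l, x)) hb.1.1.1.2 (by fun_prop)
    have k2 : ContinuousAt (fun l : E => P (l, P (l, x))) l₀ :=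
      ContinuousAt.comp (g := P) (f := fun l : E => (l, P (l, x))) hb.1.1.2
        (continuousAt_id.prodMk k1)
    exact (continuousAt_const.mul (k2.sub continuousAt_const)).eventually
      (lt_mem_nhds (hsgn ⟨hx, hxρ.trans_lt hρr'⟩))
  filter_upwards [hbox, h0, hα, hcont ρ hρ le_rfl, hcont R hR hRρ] with l hl hl0 hlα hlρ hlR
  have hmem : ∀ {x}, x ∈ Ioo (-r) r → ‖x‖ < r := fun hx => by
    rw [Real.norm_eq_abs, abs_lt]; exact hx
  have hslope : SlopeOn (fun x => P (l, x)) (2 * ρ) (3 / 4) (5 / 4) := by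
    intro u v hu huv hv
    have hin : ∀ x ∈ Icc u v, ‖x‖ < r := fun x hx => by
      rw [Real.norm_eq_abs, abs_lt]; constructor <;> linarith [hx.1, hx.2]
    rcases huv.eq_or_lt with rfl | huv
    · simp
    obtain ⟨ξ, hξ, e⟩ := exists_hasDerivAt_eq_slope (fun x => P (l, x)) (fun x => P₁ (l, x)) huv
      (fun x hx => (hl x (hin x hx)).2.1.1.continuousAt.continuousWithinAt)
      (fun x hx => (hl x (hin x ⟨hx.1.le, hx.2.le⟩)).2.1.1)
    have hb := (hl ξ (hin ξ ⟨hξ.1.le, hξ.2.le⟩)).1.2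
    have hvu : 0 < v - u := sub_pos.2 huv
    rw [eq_div_iff hvu.ne'] at e
    constructor <;> nlinarith [hb.1, hb.2]
  refine ⟨hslope, ?_⟩
  have e1 : α l = P₁ (l, 0) := hlα.unique (hl 0 (by simpa using hr)).2.1.1
  have hneg := (hl 0 (by simpa using hr)).1.2.2
  obtain ⟨q, hq0, hqR, hfix, hout, hin, hiff, hmul⟩ := exists_local_pattern
    (P := fun x => P (l, x)) (D₁ := fun x => D₁ (l, x)) (D₂ := fun x => D₂ (l, x))
    (D₃ := fun x => D₃ (l, x)) (r := r) (R := ρ) (R' := R) (ε := ε) (α := α l)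
    (fun x hx => ((hl x (hmem hx)).1.1.1.1.1.1.sub (hasDerivAt_id x)).congr_deriv (by simp))
    (fun x hx => (hl x (hmem hx)).1.1.1.1.1.2.1) (fun x hx => (hl x (hmem hx)).1.1.1.1.1.2.2)
    (fun x hx => (hl x (hmem hx)).2.2) hR hRρ (by linarith) hl0
    (fun x hx hx' => by
      have := hslope 0 x (by linarith) hx.le (by linarith)
      simp only [hl0] at this
      constructor <;> linarith [this.1, this.2])
    (by simp only [hD₁, hl0, e1]; ring) (by rw [e1]; linarith) hlρ hlR
  refine ⟨q, hq0, hqR, hfix, hout, hin, hiff, fun hq => ⟨D₁ (l, P (l, q)) + 1, ?_, ?_, ?_⟩⟩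
  all_goals
    have hb := hslope 0 q (by linarith) hq.le (by linarith)
    simp only [hl0] at hb
    have hPq : ‖P (l, q)‖ < r := hmem ⟨by linarith [hb.2], by linarith [hb.1]⟩
  · exact (hl _ hPq).1.1.1.1.1.1
  -- The derivative of the square is a product of two negative numbers.
  · have g1 := (hl _ hPq).1.2.2
    have g2 := (hl _ hPq).2.1.2
    simp only [hD₁] at g1 g2 ⊢
    nlinarith
  · have := hmul hq
    linarith

end FamilyPattern


/-! ### Increasing functions on the plane -/

section Slope

/-- `N` increases along the increasing directions of the plane, with slopes between `m` and
`m⁻¹`. -/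
def HasSlope (N : Plane → ℝ) (m : ℝ) : Prop :=
  ∀ p q, p ≤ q → m * ‖q - p‖ ≤ N q - N p ∧ N q - N p ≤ m⁻¹ * ‖q - p‖

variable {N : Plane → ℝ} {m : ℝ}

theorem HasSlope.monotone (hN : HasSlope N m) (hm : 0 < m) : Monotone N := fun p q h => by
  have := (hN p q h).1
  have h2 := mul_nonneg hm.le (norm_nonneg (q - p))
  linarith

theorem HasSlope.strictMono (hN : HasSlope N m) (hm : 0 < m) : StrictMono N := fun p q h => by
  have := (hN p q h.le).1
  have h2 := mul_pos hm (norm_pos_iff.2 (sub_ne_zero.2 h.ne'))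
  linarith

theorem HasSlope.continuous (hN : HasSlope N m) (hm : 0 < m) : Continuous N := by
  have key : ∀ p q : Plane, N q - N p ≤ m⁻¹ * ‖p - q‖ := fun p q => by
    have h1 := (hN p (p ⊔ q) le_sup_left).2
    have h2 := hN.monotone hm (le_sup_right : q ≤ p ⊔ q)
    have h3 : ‖p ⊔ q - p‖ ≤ ‖p - q‖ := by
      refine (pi_norm_le_iff_of_nonneg (norm_nonneg _)).2 fun i => ?_
      refine le_trans ?_ (norm_le_pi_norm (p - q) i)
      simp only [Pi.sub_apply, Pi.sup_apply, Real.norm_eq_abs]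
      rcases le_total (p i) (q i) with h | h
      · rw [sup_of_le_right h, abs_sub_comm]
      · rw [sup_of_le_left h, sub_self, abs_zero]; exact abs_nonneg _
    have := mul_le_mul_of_nonneg_left h3 (inv_pos.2 hm).le
    linarith
  refine LipschitzWith.continuous (K := Real.toNNReal m⁻¹) (LipschitzWith.of_dist_le' fun p q => ?_)
  rw [Real.dist_eq, dist_eq_norm, abs_le]
  have := key q p
  rw [norm_sub_rev] at this
  constructor <;> linarith [key p q]

theorem HasSlope.neg (hN : HasSlope N m) : HasSlope (fun p => -N (-p)) m := fun p q h => by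
  have := hN (-q) (-p) (neg_le_neg h)
  rw [show -p - -q = q - p by abel] at this
  constructor <;> linarith [this.1, this.2]

theorem HasSlope.bounds (hN : HasSlope N m) (h0 : N 0 = 0) {p : Plane} (hp : 0 ≤ p) :
    m * ‖p‖ ≤ N p ∧ N p ≤ m⁻¹ * ‖p‖ := by
  have := hN 0 p hp
  rwa [h0, sub_zero, sub_zero] at this

/-- An increasing function takes any prescribed positive value at exactly one point of every ray of
the first quadrant, and this point depends continuously on the ray and the value. -/
theorem HasSlope.exists_radius (hN : HasSlope N m) (hm : 0 < m) (h0 : N 0 = 0) {τ : Plane → ℝ}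
    (hτ : ContinuousOn τ {p | 0 ≤ p ∧ p ≠ 0}) (hpos : ∀ p, 0 ≤ p → p ≠ 0 → 0 < τ p) :
    ∃ l : Plane → ℝ, ContinuousOn l {p | 0 ≤ p ∧ p ≠ 0} ∧
      ∀ p, 0 ≤ p → p ≠ 0 → 0 < l p ∧ N (l p • p) = τ p := by
  have hcont := hN.continuous hm
  have hmono : ∀ p : Plane, 0 ≤ p → p ≠ 0 → StrictMono fun t : ℝ => N (t • p) :=
    fun p hp hp0 s t hst => hN.strictMono hm (by
      refine lt_of_le_of_ne (smul_le_smul_of_nonneg_right hst.le hp) fun h => ?_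
      exact hst.ne (smul_left_injective ℝ hp0 h))
  have hex : ∀ p : Plane, ∃ t : ℝ, 0 ≤ p → p ≠ 0 → 0 < t ∧ N (t • p) = τ p := by
    intro p
    by_cases hp : 0 ≤ p ∧ p ≠ 0
    swap
    · exact ⟨0, fun h h' => (hp ⟨h, h'⟩).elim⟩
    have hnp : 0 < ‖p‖ := norm_pos_iff.2 hp.2
    have hb : 0 ≤ τ p / (m * ‖p‖) := (div_pos (hpos p hp.1 hp.2) (mul_pos hm hnp)).le
    have hle : τ p ≤ N ((τ p / (m * ‖p‖)) • p) := by
      refine le_trans (le_of_eq ?_) (hN.bounds h0 (smul_nonneg hb hp.1)).1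
      rw [norm_smul, Real.norm_of_nonneg hb]
      field_simp
    obtain ⟨t, ht, e⟩ := intermediate_value_Icc hb
      (f := fun t : ℝ => N (t • p)) (by fun_prop : Continuous fun t : ℝ => N (t • p)).continuousOn
      ⟨by simpa [h0] using (hpos p hp.1 hp.2).le, hle⟩
    refine ⟨t, fun _ _ => ⟨lt_of_le_of_ne ht.1 ?_, e⟩⟩
    rintro rfl
    simp only [zero_smul, h0] at e
    exact (hpos p hp.1 hp.2).ne e
  choose l hl using hex
  refine ⟨l, fun p hp => tendsto_order.2 ⟨fun b hb => ?_, fun b hb => ?_⟩, fun p => hl p⟩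
  all_goals
    have hcb : ContinuousWithinAt (fun q : Plane => N (b • q)) {p | 0 ≤ p ∧ p ≠ 0} p :=
      (by fun_prop : Continuous fun q : Plane => N (b • q)).continuousWithinAt
  · have h1 : N (b • p) < τ p := by
      rw [← (hl p hp.1 hp.2).2]; exact hmono p hp.1 hp.2 hb
    filter_upwards [hcb.tendsto.eventually_lt (hτ p hp).tendsto h1, self_mem_nhdsWithin] with q hq hq'
    rw [← (hl q hq'.1 hq'.2).2] at hq
    exact (hmono q hq'.1 hq'.2).lt_iff_lt.1 hq
  · have h1 : τ p < N (b • p) := by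
      rw [← (hl p hp.1 hp.2).2]; exact hmono p hp.1 hp.2 hb
    filter_upwards [(hτ p hp).tendsto.eventually_lt hcb.tendsto h1, self_mem_nhdsWithin] with q hq hq'
    rw [← (hl q hq'.1 hq'.2).2] at hq
    exact (hmono q hq'.1 hq'.2).lt_iff_lt.1 hq

end Slope

/-! ### Pairs of foliations and radial homeomorphisms between them -/

section Radial

/-- Multiplication of the coordinates by `s` and `t`. -/
def rescale (s t : ℝ) (p : Plane) : Plane := ![s * p 0, t * p 1]

@[simp] theorem rescale_zero' (s t : ℝ) (p : Plane) : rescale s t p 0 = s * p 0 := rfl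
@[simp] theorem rescale_one' (s t : ℝ) (p : Plane) : rescale s t p 1 = t * p 1 := rfl

theorem continuous_rescale (s t : ℝ) : Continuous (rescale s t) := by
  unfold rescale
  refine continuous_pi fun i => ?_
  fin_cases i
  · simp; fun_prop
  · simp; fun_prop

theorem rescale_smul (s t r : ℝ) (p : Plane) : rescale s t (r • p) = r • rescale s t p := by
  ext i; fin_cases i <;> simp <;> ring

theorem rescale_rescale {s t : ℝ} (hs : s * s = 1) (ht : t * t = 1) (p : Plane) :
    rescale s t (rescale s t p) = p := by
  ext i; fin_cases i <;> simp [← mul_assoc, hs, ht]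

theorem rescale_zero (s t : ℝ) : rescale s t 0 = 0 := by
  ext i; fin_cases i <;> simp

theorem axisPoint_zero (j : Fin 2) : axisPoint j 0 = 0 := Pi.single_zero j

theorem smul_axisPoint (j : Fin 2) (r x : ℝ) : r • axisPoint j x = axisPoint j (r * x) := by
  rw [axisPoint, ← Pi.single_smul, smul_eq_mul]; rfl

theorem eq_axisPoint_zero {p : Plane} (h : p 1 = 0) : p = axisPoint 0 (p 0) := by
  ext i; fin_cases i <;> simp [axisPoint, h]

theorem eq_axisPoint_one {p : Plane} (h : p 0 = 0) : p = axisPoint 1 (p 1) := by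
  ext i; fin_cases i <;> simp [axisPoint, h]

/-- The leaves of the orbits of a piecewise vector field: `N` is a first integral of the field on
`p 0 * p 1 ≥ 0` and `M` is one of the field on `p 0 * p 1 ≤ 0`. They agree on `Σ₁`, and `N` is the
coordinate on `Σ₂`, so that `M` restricted to `Σ₂` is the half-return map. The function `N`
increases with both coordinates, `M` decreases with the first one and increases with the second
one. -/
structure IsFoliation (N M : Plane → ℝ) (m : ℝ) : Prop where
  pos : 0 < m
  slope : HasSlope N m
  slope' : HasSlope (fun p => M (rescale (-1) 1 p)) m
  axis : ∀ x, N (axisPoint 0 x) = x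
  eq_axis : ∀ y, N (axisPoint 1 y) = M (axisPoint 1 y)

namespace IsFoliation

variable {N M N' M' : Plane → ℝ} {m m' : ℝ}

theorem map_zero (h : IsFoliation N M m) : N 0 = 0 := by
  have := h.axis 0
  rwa [axisPoint_zero] at this

theorem map_zero' (h : IsFoliation N M m) : M 0 = 0 := by
  have := h.eq_axis 0
  rw [axisPoint_zero] at this
  rw [← this, h.map_zero]

theorem continuous (h : IsFoliation N M m) : Continuous N := h.slope.continuous h.pos

theorem continuous' (h : IsFoliation N M m) : Continuous M := by
  have := (h.slope'.continuous h.pos).comp (continuous_rescale (-1) 1)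
  refine this.congr fun p => ?_
  simp only [Function.comp]
  rw [rescale_rescale (by norm_num) (by norm_num)]

/-- The half-return map has slopes between `-m⁻¹` and `-m`. -/
theorem half_return_slope (h : IsFoliation N M m) {u v : ℝ} (huv : u ≤ v) :
    m * (v - u) ≤ M (axisPoint 0 u) - M (axisPoint 0 v) ∧
      M (axisPoint 0 u) - M (axisPoint 0 v) ≤ m⁻¹ * (v - u) := by
  have e : ∀ x : ℝ, rescale (-1) 1 (axisPoint 0 (-x)) = axisPoint 0 x := fun x => by
    ext i; fin_cases i <;> simp [axisPoint]
  have := h.slope' (axisPoint 0 (-v)) (axisPoint 0 (-u)) (by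
    intro i; fin_cases i <;> simp [axisPoint, huv])
  simp only [e] at this
  have hn : ‖(axisPoint 0 (-u) : Plane) - axisPoint 0 (-v)‖ = v - u := by
    rw [axisPoint, axisPoint, ← Pi.single_sub, Pi.norm_single, Real.norm_of_nonneg (by linarith)]
    ring
  rwa [hn] at this

theorem half_return_strictAnti (h : IsFoliation N M m) : StrictAnti fun x => M (axisPoint 0 x) :=
  fun u v huv => by
    have := (h.half_return_slope huv.le).1
    nlinarith [mul_pos h.pos (sub_pos.2 huv)]

/-- The first integral which applies to the quadrant with signs `s` and `t`, transported to the
first quadrant and with a sign that makes it increasing. -/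
def onQuadrant (N M : Plane → ℝ) (s t : ℝ) (p : Plane) : ℝ :=
  t * (if 0 < s * t then N else M) (rescale s t p)

theorem onQuadrant_slope (h : IsFoliation N M m) {s t : ℝ} (hs : s = 1 ∨ s = -1)
    (ht : t = 1 ∨ t = -1) : HasSlope (onQuadrant N M s t) m := by
  have e1 : ∀ p, rescale 1 1 p = p := fun p => by ext i; fin_cases i <;> simp
  have e2 : ∀ p, rescale (-1) (-1) p = -p := fun p => by ext i; fin_cases i <;> simp
  have e3 : ∀ p, rescale 1 (-1) p = rescale (-1) 1 (-p) := fun p => by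
    ext i; fin_cases i <;> simp
  have e0 : ¬ (1 : ℝ) < 0 := by norm_num
  unfold onQuadrant
  rcases hs with rfl | rfl <;> rcases ht with rfl | rfl
  · simpa [e1] using h.slope
  · simpa [e3, e0] using h.slope'.neg
  · simpa [e0] using h.slope'
  · simpa [e2] using h.slope.neg

theorem onQuadrant_zero (h : IsFoliation N M m) (s t : ℝ) : onQuadrant N M s t 0 = 0 := by
  unfold onQuadrant
  rw [rescale_zero]
  split_ifs <;> simp [h.map_zero, h.map_zero']

theorem exists_signs (p : Plane) : ∃ s t : ℝ, (s = 1 ∨ s = -1) ∧ (t = 1 ∨ t = -1) ∧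
    0 ≤ rescale s t p := by
  have key : ∀ x : ℝ, ∃ s : ℝ, (s = 1 ∨ s = -1) ∧ 0 ≤ s * x := fun x => by
    rcases le_total 0 x with h | h
    · exact ⟨1, Or.inl rfl, by linarith⟩
    · exact ⟨-1, Or.inr rfl, by linarith⟩
  obtain ⟨s, hs, h⟩ := key (p 0)
  obtain ⟨t, ht, h'⟩ := key (p 1)
  refine ⟨s, t, hs, ht, fun i => ?_⟩
  fin_cases i
  · exact h
  · exact h'

theorem sq_of_sign {s : ℝ} (hs : s = 1 ∨ s = -1) : s * s = 1 := by
  rcases hs with rfl | rfl <;> norm_num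

/-- `r` is the factor by which the radial map multiplies `p`: the map sends leaves to leaves, the
leaf of level `v` to the leaf of level `κ v`. -/
def IsFactor (N M N' M' : Plane → ℝ) (κ : ℝ → ℝ) (p : Plane) (r : ℝ) : Prop :=
  0 < r ∧ (0 ≤ p 0 * p 1 → N' (r • p) = κ (N p)) ∧ (p 0 * p 1 ≤ 0 → M' (r • p) = κ (M p))

variable {κ : ℝ ≃o ℝ}

/-- On one closed quadrant only one of the two conditions of `IsFactor` has to be checked, since the
conjugacy relation for `κ` says that they agree on the axes. -/
theorem isFactor_of_onQuadrant (h : IsFoliation N M m) (h' : IsFoliation N' M' m')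
    (hκ : ∀ x, κ (M (axisPoint 0 x)) = M' (axisPoint 0 (κ x))) {s t r : ℝ} (hs : s = 1 ∨ s = -1)
    (ht : t = 1 ∨ t = -1) {p : Plane} (hp : 0 ≤ rescale s t p) (hr : 0 < r)
    (e : onQuadrant N' M' s t (r • rescale s t p) =
      t * κ ((if 0 < s * t then N else M) p)) : IsFactor N M N' M' κ p r := by
  have ht0 : t ≠ 0 := by rcases ht with rfl | rfl <;> norm_num
  have e' : (if 0 < s * t then N' else M') (r • p) = κ ((if 0 < s * t then N else M) p) := by
    unfold onQuadrant at e
    rw [rescale_smul, rescale_rescale (sq_of_sign hs) (sq_of_sign ht)] at e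
    exact mul_left_cancel₀ ht0 e
  have hpq : 0 ≤ s * t * (p 0 * p 1) := by
    have h1 := hp 0
    have h2 := hp 1
    simp only [Pi.zero_apply, rescale_zero', rescale_one'] at h1 h2
    calc 0 ≤ (s * p 0) * (t * p 1) := mul_nonneg h1 h2
      _ = _ := by ring
  -- On the axes both conditions are the same.
  have haxis : p 0 * p 1 = 0 → (N' (r • p) = κ (N p) ↔ M' (r • p) = κ (M p)) := by
    intro hz
    rcases mul_eq_zero.1 hz with h0 | h0
    · rw [eq_axisPoint_one h0, smul_axisPoint, h.eq_axis, h'.eq_axis]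
    · rw [eq_axisPoint_zero h0, smul_axisPoint, h.axis, h'.axis, hκ]
      exact ⟨fun h1 => by rw [h1], fun h1 => h'.half_return_strictAnti.injective h1⟩
  refine ⟨hr, fun hp1 => ?_, fun hp1 => ?_⟩
  · by_cases hst : 0 < s * t
    · simpa only [if_pos hst] using e'
    · simp only [if_neg hst] at e'
      refine (haxis ?_).2 e'
      have hst' : s * t = -1 := by
        rcases hs with rfl | rfl <;> rcases ht with rfl | rfl <;> first | (norm_num; done) | norm_num at hst
      rw [hst'] at hpq
      linarith
  · by_cases hst : 0 < s * t
    · simp only [if_pos hst] at e'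
      refine (haxis ?_).1 e'
      have hst' : s * t = 1 := by
        rcases hs with rfl | rfl <;> rcases ht with rfl | rfl <;> first | (norm_num; done) | norm_num at hst
      rw [hst'] at hpq
      linarith
    · simpa only [if_neg hst] using e'

theorem IsFactor.onQuadrant_eq {s t r : ℝ} (hs : s = 1 ∨ s = -1) (ht : t = 1 ∨ t = -1) {p : Plane}
    {κ : ℝ → ℝ} (hp : 0 ≤ rescale s t p) (hr : IsFactor N M N' M' κ p r) :
    onQuadrant N' M' s t (r • rescale s t p) = t * κ ((if 0 < s * t then N else M) p) := by
  have hpq : 0 ≤ s * t * (p 0 * p 1) := by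
    have h1 := hp 0
    have h2 := hp 1
    simp only [Pi.zero_apply, rescale_zero', rescale_one'] at h1 h2
    calc 0 ≤ (s * p 0) * (t * p 1) := mul_nonneg h1 h2
      _ = _ := by ring
  unfold onQuadrant
  rw [rescale_smul, rescale_rescale (sq_of_sign hs) (sq_of_sign ht)]
  by_cases hst : 0 < s * t
  · simp only [if_pos hst]
    rw [hr.2.1 ((mul_nonneg_iff_of_pos_left hst).1 hpq)]
  · simp only [if_neg hst]
    have hst' : s * t = -1 := by
      rcases hs with rfl | rfl <;> rcases ht with rfl | rfl <;> first | (norm_num; done) | norm_num at hst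
    rw [hr.2.2 (by rw [hst'] at hpq; linarith)]

theorem onQuadrant_rescale {s t : ℝ} (hs : s = 1 ∨ s = -1) (ht : t = 1 ∨ t = -1) (p : Plane) :
    onQuadrant N M s t (rescale s t p) = t * (if 0 < s * t then N else M) p := by
  unfold onQuadrant
  rw [rescale_rescale (sq_of_sign hs) (sq_of_sign ht)]

theorem rescale_ne_zero {s t : ℝ} (hs : s = 1 ∨ s = -1) (ht : t = 1 ∨ t = -1) {p : Plane}
    (hp : p ≠ 0) : rescale s t p ≠ 0 := fun h => hp (by
  rw [← rescale_rescale (sq_of_sign hs) (sq_of_sign ht) p, h, rescale_zero])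

theorem norm_rescale {s t : ℝ} (hs : s = 1 ∨ s = -1) (ht : t = 1 ∨ t = -1) (p : Plane) :
    ‖rescale s t p‖ = ‖p‖ := by
  have key : ∀ q : Plane, ‖rescale s t q‖ ≤ ‖q‖ := fun q => by
    refine (pi_norm_le_iff_of_nonneg (norm_nonneg _)).2 fun i => ?_
    refine le_trans (le_of_eq ?_) (norm_le_pi_norm q i)
    fin_cases i
    · rcases hs with rfl | rfl <;> simp
    · rcases ht with rfl | rfl <;> simp
  refine le_antisymm (key p) ?_
  have := key (rescale s t p)
  rwa [rescale_rescale (sq_of_sign hs) (sq_of_sign ht)] at this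

theorem sign_map {κ : ℝ ≃o ℝ} (h0 : κ 0 = 0) {t x : ℝ} (ht : t = 1 ∨ t = -1) (hx : 0 < t * x) :
    0 < t * κ x := by
  rcases ht with rfl | rfl
  · have := κ.strictMono (show 0 < x by linarith)
    rw [h0] at this; linarith
  · have := κ.strictMono (show x < 0 by linarith)
    rw [h0] at this; linarith

theorem IsFactor.unique {κ : ℝ → ℝ} (h' : IsFoliation N' M' m') {p : Plane} (hp : p ≠ 0) {r r' : ℝ}
    (hr : IsFactor N M N' M' κ p r) (hr' : IsFactor N M N' M' κ p r') : r = r' := by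
  obtain ⟨s, t, hs, ht, hq⟩ := exists_signs p
  have e := (hr.onQuadrant_eq hs ht hq).trans (hr'.onQuadrant_eq hs ht hq).symm
  have hq0 := rescale_ne_zero hs ht hp
  have hmono : StrictMono fun u : ℝ => onQuadrant N' M' s t (u • rescale s t p) := fun u v huv =>
    (h'.onQuadrant_slope hs ht).strictMono h'.pos (by
      refine lt_of_le_of_ne (smul_le_smul_of_nonneg_right huv.le hq) fun h => ?_
      exact huv.ne (smul_left_injective ℝ hq0 h))
  exact hmono.injective e

/-- The radial map which sends the leaves of level `v` to the leaves of level `κ v`. -/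
theorem exists_radial_map (h : IsFoliation N M m) (h' : IsFoliation N' M' m') (h0 : κ 0 = 0)
    (hκ : ∀ x, κ (M (axisPoint 0 x)) = M' (axisPoint 0 (κ x))) :
    ∃ r : Plane → ℝ, (∀ p, IsFactor N M N' M' κ p (r p)) ∧ Continuous fun p => r p • p := by
  have hquad : ∀ s t : ℝ, (s = 1 ∨ s = -1) → (t = 1 ∨ t = -1) → ∃ l : Plane → ℝ,
      ContinuousOn l {p | 0 ≤ p ∧ p ≠ 0} ∧ ∀ p, 0 ≤ p → p ≠ 0 → 0 < l p ∧
        onQuadrant N' M' s t (l p • p) = t * κ ((if 0 < s * t then N else M) (rescale s t p)) := by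
    intro s t hs ht
    refine (h'.onQuadrant_slope hs ht).exists_radius h'.pos (h'.onQuadrant_zero s t) ?_ ?_
    · have hc : Continuous (if 0 < s * t then N else M) := by
        split_ifs
        exacts [h.continuous, h.continuous']
      exact (continuous_const.mul (κ.continuous.comp (hc.comp (continuous_rescale s t)))).continuousOn
    · intro p hp hp0
      refine sign_map h0 ht ?_
      have := (h.onQuadrant_slope hs ht).strictMono h.pos (lt_of_le_of_ne hp hp0.symm)
      rwa [h.onQuadrant_zero] at this
  have hex : ∀ p : Plane, ∃ r, IsFactor N M N' M' κ p r := by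
    intro p
    by_cases hp : p = 0
    · subst hp
      exact ⟨1, one_pos, fun _ => by rw [smul_zero, h.map_zero, h'.map_zero, h0],
        fun _ => by rw [smul_zero, h.map_zero', h'.map_zero', h0]⟩
    · obtain ⟨s, t, hs, ht, hq⟩ := exists_signs p
      obtain ⟨l, -, hl⟩ := hquad s t hs ht
      have := hl _ hq (rescale_ne_zero hs ht hp)
      rw [rescale_rescale (sq_of_sign hs) (sq_of_sign ht)] at this
      exact ⟨_, isFactor_of_onQuadrant h h' hκ hs ht hq this.1 this.2⟩
  choose r hr using hex
  refine ⟨r, hr, ?_⟩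
  -- Continuity is checked on the four closed quadrants.
  refine LocallyFinite.continuous (f := fun u : Bool × Bool =>
    {p : Plane | 0 ≤ rescale (if u.1 then 1 else -1) (if u.2 then 1 else -1) p})
    (locallyFinite_of_finite _) ?_ ?_ ?_
  · refine eq_univ_of_forall fun p => ?_
    obtain ⟨s, t, hs, ht, hq⟩ := exists_signs p
    refine mem_iUnion.2 ⟨⟨decide (s = 1), decide (t = 1)⟩, ?_⟩
    have e1 : (if decide (s = 1) = true then (1 : ℝ) else -1) = s := by
      rcases hs with rfl | rfl <;> norm_num
    have e2 : (if decide (t = 1) = true then (1 : ℝ) else -1) = t := by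
      rcases ht with rfl | rfl <;> norm_num
    change 0 ≤ rescale _ _ p
    rw [e1, e2]
    exact hq
  · exact fun u => isClosed_le continuous_const (continuous_rescale _ _)
  rintro ⟨u, v⟩
  have hs : (if u then (1 : ℝ) else -1) = 1 ∨ (if u then (1 : ℝ) else -1) = -1 := by
    cases u <;> simp
  have ht : (if v then (1 : ℝ) else -1) = 1 ∨ (if v then (1 : ℝ) else -1) = -1 := by
    cases v <;> simp
  generalize (if u then (1 : ℝ) else -1) = s at hs
  generalize (if v then (1 : ℝ) else -1) = t at ht
  intro p hp
  change 0 ≤ rescale s t p at hp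
  by_cases hp0 : p = 0
  · -- At the origin, the norm of the image is bounded by the level.
    subst hp0
    have hc : Continuous (if 0 < s * t then N else M) := by
      split_ifs
      exacts [h.continuous, h.continuous']
    have hz : (if 0 < s * t then N else M) 0 = 0 := by
      split_ifs
      exacts [h.map_zero, h.map_zero']
    have hlim : Tendsto (fun q : Plane => m'⁻¹ * (t * κ ((if 0 < s * t then N else M) q)))
        (𝓝[{p | 0 ≤ rescale s t p}] 0) (𝓝 0) := by
      have : Continuous fun q : Plane => m'⁻¹ * (t * κ ((if 0 < s * t then N else M) q)) :=
        continuous_const.mul (continuous_const.mul (κ.continuous.comp hc))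
      have h2 := this.tendsto 0
      rw [hz, h0, mul_zero, mul_zero] at h2
      exact h2.mono_left nhdsWithin_le_nhds
    rw [ContinuousWithinAt, smul_zero]
    refine squeeze_zero_norm' ?_ hlim
    filter_upwards [self_mem_nhdsWithin] with q hq
    have hq : 0 ≤ rescale s t q := hq
    have h1 := ((h'.onQuadrant_slope hs ht).bounds (h'.onQuadrant_zero s t)
      (smul_nonneg (hr q).1.le hq)).1
    rw [(hr q).onQuadrant_eq hs ht hq, ← rescale_smul, norm_rescale hs ht] at h1
    rw [inv_mul_eq_div, le_div_iff₀' h'.pos]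
    exact h1
  · obtain ⟨l, hl, hl'⟩ := hquad s t hs ht
    have hrl : ∀ q, 0 ≤ rescale s t q → q ≠ 0 → r q = l (rescale s t q) := fun q hq hq0 => by
      have := hl' _ hq (rescale_ne_zero hs ht hq0)
      rw [rescale_rescale (sq_of_sign hs) (sq_of_sign ht)] at this
      exact (hr q).unique h' hq0 (isFactor_of_onQuadrant h h' hκ hs ht hq this.1 this.2)
    have hcl : ContinuousWithinAt (fun q => l (rescale s t q)) {p | 0 ≤ rescale s t p ∧ p ≠ 0} p :=
      ContinuousWithinAt.comp (t := {p | 0 ≤ p ∧ p ≠ 0})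
        (hl _ ⟨hp, rescale_ne_zero hs ht hp0⟩) (continuous_rescale s t).continuousWithinAt
        fun q hq => ⟨hq.1, rescale_ne_zero hs ht hq.2⟩
    have hset : {p | 0 ≤ rescale s t p ∧ p ≠ 0} ∈ 𝓝[{p | 0 ≤ rescale s t p}] p := by
      filter_upwards [self_mem_nhdsWithin, mem_nhdsWithin_of_mem_nhds (isOpen_ne.mem_nhds hp0)]
        with q hq hq' using ⟨hq, hq'⟩
    have hcl' := hcl.mono_of_mem_nhdsWithin hset
    refine (ContinuousWithinAt.congr_of_eventuallyEq hcl' ?_ (hrl p hp hp0)).smul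
      continuousWithinAt_id
    filter_upwards [hset] with q hq using hrl q hq.1 hq.2

/-- The radial map is a homeomorphism: the radial map for `κ⁻¹` is its inverse. -/
theorem exists_radial_homeo (h : IsFoliation N M m) (h' : IsFoliation N' M' m') (h0 : κ 0 = 0)
    (hκ : ∀ x, κ (M (axisPoint 0 x)) = M' (axisPoint 0 (κ x))) :
    ∃ (H : Plane ≃ₜ Plane) (r r' : Plane → ℝ), (∀ p, IsFactor N M N' M' κ p (r p)) ∧
      (∀ p, H p = r p • p) ∧ (∀ p, IsFactor N' M' N M κ.symm p (r' p)) ∧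
      ∀ p, H.symm p = r' p • p := by
  obtain ⟨r, hr, hc⟩ := exists_radial_map h h' h0 hκ
  have hκ' : ∀ x, κ.symm (M' (axisPoint 0 x)) = M (axisPoint 0 (κ.symm x)) := fun x => by
    rw [OrderIso.symm_apply_eq, hκ, OrderIso.apply_symm_apply]
  obtain ⟨r', hr', hc'⟩ := exists_radial_map h' h (κ := κ.symm)
    (by rw [OrderIso.symm_apply_eq, h0]) hκ'
  have hinv : ∀ {N M N' M' : Plane → ℝ} {m : ℝ} {κ : ℝ ≃o ℝ} {r r' : Plane → ℝ}, IsFoliation N M m →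
      (∀ p, IsFactor N M N' M' κ p (r p)) → (∀ p, IsFactor N' M' N M κ.symm p (r' p)) →
      ∀ p, r' (r p • p) • r p • p = p := by
    intro N M N' M' m κ r r' h hr hr' p
    by_cases hp : p = 0
    · rw [hp, smul_zero, smul_zero]
    have hsgn : (r p • p) 0 * (r p • p) 1 = (r p * r p) * (p 0 * p 1) := by
      simp only [Pi.smul_apply, smul_eq_mul]; ring
    have hpos := mul_pos (hr p).1 (hr p).1
    have hf : IsFactor N M N M id p (r' (r p • p) * r p) := by
      refine ⟨mul_pos (hr' _).1 (hr p).1, fun hq => ?_, fun hq => ?_⟩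
      · rw [mul_smul, (hr' _).2.1 (by rw [hsgn]; exact mul_nonneg hpos.le hq), (hr p).2.1 hq,
          OrderIso.symm_apply_apply, id]
      · rw [mul_smul, (hr' _).2.2 (by rw [hsgn]; exact mul_nonpos_of_nonneg_of_nonpos hpos.le hq),
          (hr p).2.2 hq, OrderIso.symm_apply_apply, id]
    have h1 : IsFactor N M N M id p 1 := ⟨one_pos, fun _ => by rw [one_smul, id],
      fun _ => by rw [one_smul, id]⟩
    rw [smul_smul, hf.unique h hp h1, one_smul]
  refine ⟨⟨⟨fun p => r p • p, fun p => r' p • p, hinv h hr hr', ?_⟩, hc, hc'⟩, r, r', hr,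
    fun p => rfl, hr', fun p => rfl⟩
  exact hinv (κ := κ.symm) h' hr' (by simpa using hr)

end IsFoliation

end Radial


/-! ### Following a leaf with prescribed speed -/

section Clock

/-- The primitive of a positive function, as a bijection of the line. -/
theorem exists_primitive_orderIso {w : ℝ → ℝ} (hw : Measurable w) {m M : ℝ} (hm : 0 < m)
    (hb : ∀ u, m ≤ w u ∧ w u ≤ M) (b : ℝ) :
    ∃ Φ : ℝ ≃o ℝ, Φ b = 0 ∧ ∀ u, ContinuousAt w u → HasDerivAt Φ (w u) u := by
  have hint : ∀ u v : ℝ, IntervalIntegrable w MeasureTheory.volume u v := fun u v => by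
    refine (intervalIntegrable_const (c := M)).mono_fun' hw.aestronglyMeasurable ?_
    refine Eventually.of_forall fun x => ?_
    simp only
    rw [Real.norm_of_nonneg (hm.le.trans (hb x).1)]
    exact (hb x).2
  set f : ℝ → ℝ := fun u => -∫ x in b..u, w x with hf
  have hsub : ∀ u v, f u - f v = ∫ x in u..v, w x := fun u v => by
    rw [hf]
    simp only
    rw [neg_sub_neg, intervalIntegral.integral_interval_sub_left (hint _ _) (hint _ _)]
  obtain ⟨Q, hQ, hanti, -⟩ := exists_equiv_of_slope (f := f) (M := M) hm (fun u v huv => by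
    rw [hsub]
    constructor
    · have := intervalIntegral.integral_mono_on huv intervalIntegrable_const (hint u v)
        (fun x _ => (hb x).1)
      simpa [mul_comm] using this
    · have := intervalIntegral.integral_mono_on huv (hint u v) intervalIntegrable_const
        (fun x _ => (hb x).2)
      simpa [mul_comm] using this)
  have hmono : StrictMono fun u => -Q u := fun u v huv => neg_lt_neg (hanti huv)
  refine ⟨hmono.orderIsoOfSurjective _ fun y => ?_, ?_, fun u hu => ?_⟩
  · obtain ⟨x, hx⟩ := Q.surjective (-y)
    exact ⟨x, by simp [hx]⟩
  · change -Q b = 0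
    rw [hQ, hf]
    simp
  · have e : ⇑(hmono.orderIsoOfSurjective (fun u => -Q u) fun y => by
        obtain ⟨x, hx⟩ := Q.surjective (-y)
        exact ⟨x, by simp [hx]⟩) = fun u => ∫ x in b..u, w x := by
      funext u
      change -Q u = _
      rw [hQ, hf]
      simp
    rw [e]
    exact intervalIntegral.integral_hasDerivAt_right (hint b u)
      hw.stronglyMeasurable.stronglyMeasurableAtFilter hu

/-- An increasing continuous function on `[0, L]` extends to an order isomorphism of the line: it is
continued with slope one on both sides. -/
theorem exists_orderIso_extension {f : ℝ → ℝ} {L : ℝ} (hL : 0 ≤ L)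
    (hf : ContinuousOn f (Icc 0 L)) (hmono : StrictMonoOn f (Icc 0 L)) :
    ∃ e : ℝ ≃o ℝ, ∀ t ∈ Icc 0 L, e t = f t := by
  set c : ℝ → ℝ := fun t => max 0 (min t L) with hc
  have hcm : ∀ t, c t ∈ Icc 0 L := fun t => ⟨le_max_left _ _, max_le hL (min_le_right _ _)⟩
  have hce : ∀ t ∈ Icc 0 L, c t = t := fun t ht => by
    simp only [hc]
    rw [min_eq_left ht.2, max_eq_right ht.1]
  have hcc : Continuous c := by fun_prop
  have hcmono : Monotone c := fun u v h => max_le_max_left _ (min_le_min_right _ h)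
  have hsub : ∀ u v, u ≤ v → c v - c u ≤ v - u := fun u v h => by
    simp only [hc]
    rcases max_cases 0 (min v L) with h1 | h1 <;> rcases max_cases 0 (min u L) with h2 | h2 <;>
    rcases min_cases v L with h3 | h3 <;> rcases min_cases u L with h4 | h4 <;> linarith
  set g : ℝ → ℝ := fun t => f (c t) + (t - c t) with hg
  have hgc : Continuous g := (hf.comp_continuous hcc hcm).add (continuous_id.sub hcc)
  have hgm : StrictMono g := fun u v huv => by
    simp only [hg]
    rcases (hcmono huv.le).eq_or_lt with h | h
    · rw [h]; linarith
    · have := hmono (hcm u) (hcm v) h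
      linarith [hsub u v huv.le]
  have htop : Tendsto g atTop atTop := by
    refine tendsto_atTop_mono (f := fun t => (f 0 - L) + t) (fun t => ?_)
      (tendsto_atTop_add_const_left _ _ tendsto_id)
    have := hmono.monotoneOn ⟨le_rfl, hL⟩ (hcm t) (hcm t).1
    simp only [hg]; linarith [(hcm t).2]
  have hbot : Tendsto g atBot atBot := by
    refine tendsto_atBot_mono (fun t => ?_) (tendsto_atBot_add_const_left _ (f L) tendsto_id)
    have := hmono.monotoneOn (hcm t) ⟨hL, le_rfl⟩ (hcm t).2
    simp only [hg, id]; linarith [(hcm t).1]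
  refine ⟨hgm.orderIsoOfSurjective g (hgc.surjective htop hbot), fun t ht => ?_⟩
  change g t = f t
  simp only [hg]
  rw [hce t ht]; ring

theorem exists_bounds_of_pos {s : ℝ → ℝ} {L : ℝ} (hL : 0 ≤ L) (hs : ContinuousOn s (Icc 0 L))
    (hpos : ∀ t ∈ Icc 0 L, 0 < s t) : ∃ m M, 0 < m ∧ ∀ t ∈ Icc 0 L, m ≤ s t ∧ s t ≤ M := by
  have hne : (Icc 0 L).Nonempty := nonempty_Icc.2 hL
  obtain ⟨u, hu, hum⟩ := isCompact_Icc.exists_isMinOn hne hs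
  obtain ⟨v, hv, hvm⟩ := isCompact_Icc.exists_isMaxOn hne hs
  exact ⟨s u, s v, hpos u hu, fun t ht => ⟨hum ht, hvm ht⟩⟩

/-- A change of time: an increasing function `f` on `[0, L]` is reparametrized so that its speed is
`s₁` before `t₀` and `s₂` after `t₀`. -/
theorem exists_clock {f s₁ s₂ : ℝ → ℝ} {L : ℝ} (t₀ : ℝ) (hL : 0 ≤ L)
    (hf : ContinuousOn f (Icc 0 L)) (hmono : StrictMonoOn f (Icc 0 L))
    (hs₁ : ContinuousOn s₁ (Icc 0 L)) (hs₂ : ContinuousOn s₂ (Icc 0 L))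
    (hp₁ : ∀ t ∈ Icc 0 L, 0 < s₁ t) (hp₂ : ∀ t ∈ Icc 0 L, 0 < s₂ t) :
    ∃ τ : ℝ ≃o ℝ, τ 0 = 0 ∧ 0 ≤ τ L ∧ ∀ u ∈ Icc 0 (τ L),
      (τ.symm u < t₀ → HasDerivWithinAt (fun u => f (τ.symm u)) (s₁ (τ.symm u)) (Icc 0 (τ L)) u) ∧
      (t₀ < τ.symm u → HasDerivWithinAt (fun u => f (τ.symm u)) (s₂ (τ.symm u)) (Icc 0 (τ L)) u)
    := by
  obtain ⟨e, he⟩ := exists_orderIso_extension hL hf hmono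
  obtain ⟨m₁, M₁, hm₁, hb₁⟩ := exists_bounds_of_pos hL hs₁ hp₁
  obtain ⟨m₂, M₂, hm₂, hb₂⟩ := exists_bounds_of_pos hL hs₂ hp₂
  set c : ℝ → ℝ := fun t => max 0 (min t L) with hc
  have hcm : ∀ t, c t ∈ Icc 0 L := fun t => ⟨le_max_left _ _, max_le hL (min_le_right _ _)⟩
  have hce : ∀ t ∈ Icc 0 L, c t = t := fun t ht => by
    simp only [hc]
    rw [min_eq_left ht.2, max_eq_right ht.1]
  have hcc : Continuous c := by fun_prop
  have c₁ : Continuous fun t => s₁ (c t) := hs₁.comp_continuous hcc hcm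
  have c₂ : Continuous fun t => s₂ (c t) := hs₂.comp_continuous hcc hcm
  -- With the value `f t` as the variable, the required time is the primitive of the inverse of the
  -- speed; the speed is first extended to the line by clamping `t` to `[0, L]`.
  set s : ℝ → ℝ := fun t => if t < t₀ then s₁ (c t) else s₂ (c t) with hs
  have hsm : Measurable s := Measurable.ite measurableSet_Iio c₁.measurable c₂.measurable
  have hsb : ∀ t, min m₁ m₂ ≤ s t ∧ s t ≤ max M₁ M₂ := fun t => by
    simp only [hs]
    split_ifs
    · exact ⟨(min_le_left _ _).trans (hb₁ _ (hcm t)).1, (hb₁ _ (hcm t)).2.trans (le_max_left _ _)⟩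
    · exact ⟨(min_le_right _ _).trans (hb₂ _ (hcm t)).1, (hb₂ _ (hcm t)).2.trans (le_max_right _ _)⟩
  have hm : 0 < min m₁ m₂ := lt_min hm₁ hm₂
  have hspos : ∀ t, 0 < s t := fun t => hm.trans_le (hsb t).1
  set w : ℝ → ℝ := fun u => (s (e.symm u))⁻¹ with hw
  obtain ⟨Φ, hΦ0, hΦ⟩ := exists_primitive_orderIso (w := w) (m := (max M₁ M₂)⁻¹)
    (M := (min m₁ m₂)⁻¹) (hsm.comp e.symm.continuous.measurable).inv
    (inv_pos.2 (hm.trans_le ((hsb 0).1.trans (hsb 0).2)))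
    (fun u => ⟨inv_anti₀ (hspos _) (hsb _).2, inv_anti₀ hm (hsb _).1⟩) (e 0)
  have key : ∀ {s' : ℝ → ℝ} {u : ℝ}, ContinuousAt (fun t => s' (c t)) ((e.trans Φ).symm u) →
      s =ᶠ[𝓝 ((e.trans Φ).symm u)] (fun t => s' (c t)) → (e.trans Φ).symm u ∈ Icc 0 L →
      u ∈ Icc 0 ((e.trans Φ) L) → HasDerivWithinAt (fun u => f ((e.trans Φ).symm u))
        (s' ((e.trans Φ).symm u)) (Icc 0 ((e.trans Φ) L)) u := by
    intro s' u hs' hse ht hu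
    have hcs : ContinuousAt s (e.symm (Φ.symm u)) := hs'.congr hse.symm
    have hcw : ContinuousAt w (Φ.symm u) :=
      (ContinuousAt.comp (g := s) hcs e.symm.continuous.continuousAt).inv₀ (hspos _).ne'
    have hd : HasDerivAt Φ.symm (w (Φ.symm u))⁻¹ u :=
      HasDerivAt.of_local_left_inverse Φ.symm.continuous.continuousAt (hΦ _ hcw)
        (inv_pos.2 (hspos _)).ne' (Eventually.of_forall fun y => Φ.apply_symm_apply y)
    have hval : (w (Φ.symm u))⁻¹ = s' ((e.trans Φ).symm u) := by
      rw [hw]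
      simp only [inv_inv]
      have : s ((e.trans Φ).symm u) = s' (c ((e.trans Φ).symm u)) := hse.self_of_nhds
      rw [hce _ ht] at this
      exact this
    rw [hval] at hd
    refine hd.hasDerivWithinAt.congr (fun v hv => ?_) ?_
    · have hv' : (e.trans Φ).symm v ∈ Icc 0 L := by
        refine ⟨?_, ?_⟩
        · rw [← OrderIso.symm_apply_apply (e.trans Φ) 0]
          exact (e.trans Φ).symm.monotone (by
            change Φ (e 0) ≤ v
            rw [hΦ0]; exact hv.1)
        · rw [← OrderIso.symm_apply_apply (e.trans Φ) L]
          exact (e.trans Φ).symm.monotone hv.2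
      rw [← he _ hv']
      change e (e.symm (Φ.symm v)) = _
      rw [OrderIso.apply_symm_apply]
    · rw [← he _ ht]
      change e (e.symm (Φ.symm u)) = _
      rw [OrderIso.apply_symm_apply]
  have h0 : (e.trans Φ) 0 = 0 := hΦ0
  have hmem : ∀ u ∈ Icc 0 ((e.trans Φ) L), (e.trans Φ).symm u ∈ Icc 0 L := fun u hu => by
    constructor
    · rw [← OrderIso.symm_apply_apply (e.trans Φ) 0, h0]
      exact (e.trans Φ).symm.monotone hu.1
    · rw [← OrderIso.symm_apply_apply (e.trans Φ) L]
      exact (e.trans Φ).symm.monotone hu.2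
  refine ⟨e.trans Φ, h0, by rw [← h0]; exact (e.trans Φ).monotone hL, fun u hu => ⟨fun h => ?_,
    fun h => ?_⟩⟩
  · refine key c₁.continuousAt ?_ (hmem u hu) hu
    filter_upwards [Iio_mem_nhds h] with t ht
    exact if_pos ht
  · refine key c₂.continuousAt ?_ (hmem u hu) hu
    filter_upwards [Ioi_mem_nhds h] with t ht
    exact if_neg (not_lt.2 (le_of_lt ht))

end Clock

section Leaves

/-- `N` is, at first order, constant along `V` at the point `p`, and its partial derivatives do not
vanish. -/
structure HasLeaf (V : Plane → Plane) (N : Plane → ℝ) (p : Plane) : Prop where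
  continuousAt : ContinuousAt V p
  exists_fderiv : ∃ A : Plane →L[ℝ] ℝ, HasFDerivAt N A p ∧ A (V p) = 0 ∧
    ∀ i, A (axisPoint i 1) ≠ 0

theorem axisPoint_add (p : Plane) (i : Fin 2) :
    p = p i • axisPoint i 1 + p (i + 1) • axisPoint (i + 1) 1 := by
  ext k
  fin_cases i <;> fin_cases k <;> simp [axisPoint]

/-- A curve which stays on a leaf, and moves at the right speed in one of the coordinates, is an
orbit. -/
theorem HasLeaf.hasDerivWithinAt {V : Plane → Plane} {N : Plane → ℝ} {σ : ℝ → Plane} {s : Set ℝ}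
    {u : ℝ} (h : HasLeaf V N (σ u)) {i : Fin 2} (hσ : ContinuousWithinAt σ s u)
    (hi : HasDerivWithinAt (fun u => σ u i) (V (σ u) i) s u)
    (hN : ∀ᶠ v in 𝓝[s] u, N (σ v) = N (σ u)) : HasDerivWithinAt σ (V (σ u)) s u := by
  obtain ⟨A, hA, hAV, hA0⟩ := h.exists_fderiv
  set j := i + 1 with hj
  set x : ℝ → Plane := fun v => σ v - σ u with hx
  have hexp : ∀ p : Plane, A p = p i * A (axisPoint i 1) + p j * A (axisPoint j 1) := fun p => by
    conv_lhs => rw [axisPoint_add p i]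
    rw [map_add, map_smul, map_smul, smul_eq_mul, smul_eq_mul]
  -- `N` is constant along the curve, hence its differential kills the displacement at first order.
  have hlo : (fun v => A (x v)) =o[𝓝[s] u] x := by
    have h1 := (hasFDerivAt_iff_isLittleO.1 hA).comp_tendsto hσ.tendsto
    have h2 : (fun v => -A (x v)) =o[𝓝[s] u] x := by
      refine h1.congr' ?_ EventuallyEq.rfl
      filter_upwards [hN] with v hv
      simp only [Function.comp, hv, sub_self, zero_sub, hx]
    simpa using h2.neg_left
  have hid : (fun v => x v i - (v - u) * V (σ u) i) =o[𝓝[s] u] fun v => v - u := by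
    exact hasDerivWithinAt_iff_isLittleO.1 hi
  have hiO : (fun v => x v i) =O[𝓝[s] u] fun v => v - u := by
    have h1 : (fun v : ℝ => (v - u) * V (σ u) i) =O[𝓝[s] u] fun v => v - u := by
      simpa [mul_comm] using (Asymptotics.isBigO_refl (fun v : ℝ => v - u) (𝓝[s] u)).const_mul_left
        (V (σ u) i)
    simpa using hid.isBigO.add h1
  -- The displacement is controlled by its `i`-th coordinate.
  have hxO : x =O[𝓝[s] u] fun v => v - u := by
    have h1 : (fun v => (A (x v) / A (axisPoint j 1)) • axisPoint j 1) =o[𝓝[s] u] x := by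
      have h2 : (fun v => A (x v) / A (axisPoint j 1)) =o[𝓝[s] u] x := by
        simpa [div_eq_inv_mul] using hlo.const_mul_left (A (axisPoint j 1))⁻¹
      refine Asymptotics.IsBigO.trans_isLittleO ?_ h2
      exact Asymptotics.isBigO_of_le' (c := ‖(axisPoint j 1 : Plane)‖) _ fun v => by
        rw [norm_smul, mul_comm]
    have h3 := h1.right_isBigO_sub
    refine h3.trans (Asymptotics.IsBigO.trans ?_ hiO)
    have h4 : ∀ v, x v - (A (x v) / A (axisPoint j 1)) • axisPoint j 1 =
        x v i • (axisPoint i 1 - (A (axisPoint i 1) / A (axisPoint j 1)) • axisPoint j 1) :=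
      fun v => by
        conv_lhs => rw [axisPoint_add (x v) i, hexp]
        rw [← hj]
        have := hA0 j
        simp only [smul_sub, smul_smul]
        ext k
        have hii : (axisPoint i 1 : Plane) i = 1 := by simp [axisPoint]
        have hjj : (axisPoint j 1 : Plane) j = 1 := by simp [axisPoint]
        have hij : (axisPoint i 1 : Plane) j = 0 := by fin_cases i <;> simp [axisPoint, hj]
        have hji : (axisPoint j 1 : Plane) i = 0 := by fin_cases i <;> simp [axisPoint, hj]
        simp only [Pi.sub_apply, Pi.add_apply, Pi.smul_apply, smul_eq_mul, hii, hjj, hij, hji]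
        field_simp
        ring
    rw [funext h4]
    exact Asymptotics.isBigO_of_le'
      (c := ‖(axisPoint i 1 - (A (axisPoint i 1) / A (axisPoint j 1)) • axisPoint j 1 : Plane)‖) _
      fun v => by rw [norm_smul, mul_comm]
  have hlo' : (fun v => A (x v)) =o[𝓝[s] u] fun v => v - u := hlo.trans_isBigO hxO
  -- `A` kills both `V` and, at first order, the displacement; as `A` does not vanish on the `j`-th
  -- axis, the derivative of the `i`-th coordinate determines that of the `j`-th one.
  have hjd : HasDerivWithinAt (fun v => σ v j) (V (σ u) j) s u := by
    rw [hasDerivWithinAt_iff_isLittleO]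
    have hcomb := (hlo'.sub (hid.const_mul_left (A (axisPoint i 1)))).const_mul_left
      (A (axisPoint j 1))⁻¹
    refine hcomb.congr_left fun v => ?_
    have e1 := hexp (x v)
    have e2 := hexp (V (σ u))
    rw [hAV] at e2
    have := hA0 j
    rw [e1]
    have e3 : x v j = σ v j - σ u j := rfl
    rw [smul_eq_mul, ← e3]
    field_simp
    linear_combination (-(v - u)) * e2
  refine hasDerivWithinAt_pi.2 fun k => ?_
  have : k = i ∨ k = j := by
    rw [hj]; fin_cases i <;> fin_cases k <;> simp
  rcases this with rfl | rfl
  · exact hi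
  · exact hjd

/-- A curve along which the `i`-th coordinate is monotone, and which follows a leaf of `N₁` before
the time `t₀` and a leaf of `N₂` after it, becomes an orbit of `V₁`, then of `V₂`, after a change of
time. -/
theorem exists_orbit_of_leaf {V₁ V₂ : Plane → Plane} {N₁ N₂ : Plane → ℝ} {i : Fin 2} {a L : ℝ}
    {c : ℝ → Plane} (t₀ : ℝ) (ha : a ≠ 0) (hL : 0 ≤ L) (hc : ContinuousOn c (Icc 0 L))
    (hmono : StrictMonoOn (fun t => a * c t i) (Icc 0 L))
    (h₁ : ∀ t ∈ Icc 0 L, HasLeaf V₁ N₁ (c t)) (h₂ : ∀ t ∈ Icc 0 L, HasLeaf V₂ N₂ (c t))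
    (hp₁ : ∀ t ∈ Icc 0 L, 0 < a * V₁ (c t) i) (hp₂ : ∀ t ∈ Icc 0 L, 0 < a * V₂ (c t) i)
    (hN₁ : ∀ t ∈ Icc 0 L, ∀ t' ∈ Icc 0 L, t ≤ t₀ → t' ≤ t₀ → N₁ (c t) = N₁ (c t'))
    (hN₂ : ∀ t ∈ Icc 0 L, ∀ t' ∈ Icc 0 L, t₀ ≤ t → t₀ ≤ t' → N₂ (c t) = N₂ (c t')) :
    ∃ τ : ℝ ≃o ℝ, τ 0 = 0 ∧ 0 ≤ τ L ∧ (∀ u ∈ Icc 0 (τ L), τ.symm u ∈ Icc 0 L) ∧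
      ContinuousOn (fun u => c (τ.symm u)) (Icc 0 (τ L)) ∧ ∀ u ∈ Icc 0 (τ L),
      (τ.symm u < t₀ → HasDerivWithinAt (fun u => c (τ.symm u)) (V₁ (c (τ.symm u)))
        (Icc 0 (τ L)) u) ∧
      (t₀ < τ.symm u → HasDerivWithinAt (fun u => c (τ.symm u)) (V₂ (c (τ.symm u)))
        (Icc 0 (τ L)) u) := by
  have hci : ContinuousOn (fun t => a * c t i) (Icc 0 L) :=
    continuousOn_const.mul ((continuous_apply i).comp_continuousOn hc)
  have hs : ∀ {V : Plane → Plane}, (∀ t ∈ Icc 0 L, ContinuousAt V (c t)) →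
      ContinuousOn (fun t => a * V (c t) i) (Icc 0 L) := fun {V} hV t ht =>
    continuousWithinAt_const.mul (((continuous_apply i).continuousAt).comp_continuousWithinAt
      (ContinuousAt.comp_continuousWithinAt (hV t ht) (hc t ht)))
  obtain ⟨τ, h0, hτL, hder⟩ := exists_clock t₀ hL hci hmono
    (hs fun t ht => (h₁ t ht).continuousAt) (hs fun t ht => (h₂ t ht).continuousAt) hp₁ hp₂
  have hmem : ∀ u ∈ Icc 0 (τ L), τ.symm u ∈ Icc 0 L := fun u hu => by
    constructor
    · rw [← OrderIso.symm_apply_apply τ 0, h0]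
      exact τ.symm.monotone hu.1
    · rw [← OrderIso.symm_apply_apply τ L]
      exact τ.symm.monotone hu.2
  have hcont : ContinuousOn (fun u => c (τ.symm u)) (Icc 0 (τ L)) :=
    hc.comp τ.symm.continuous.continuousOn hmem
  refine ⟨τ, h0, hτL, hmem, hcont, fun u hu => ⟨fun h => ?_, fun h => ?_⟩⟩
  · refine (h₁ _ (hmem u hu)).hasDerivWithinAt (σ := fun u => c (τ.symm u)) (i := i) (hcont u hu) ?_ ?_
    · have := ((hder u hu).1 h).const_mul a⁻¹
      simpa [← mul_assoc, inv_mul_cancel₀ ha] using this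
    · filter_upwards [self_mem_nhdsWithin, mem_nhdsWithin_of_mem_nhds
        (τ.symm.continuous.continuousAt.preimage_mem_nhds (Iio_mem_nhds h))] with v hv hv'
      exact hN₁ _ (hmem v hv) _ (hmem u hu) (le_of_lt hv') h.le
  · refine (h₂ _ (hmem u hu)).hasDerivWithinAt (σ := fun u => c (τ.symm u)) (i := i) (hcont u hu) ?_ ?_
    · have := ((hder u hu).2 h).const_mul a⁻¹
      simpa [← mul_assoc, inv_mul_cancel₀ ha] using this
    · filter_upwards [self_mem_nhdsWithin, mem_nhdsWithin_of_mem_nhds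
        (τ.symm.continuous.continuousAt.preimage_mem_nhds (Ioi_mem_nhds h))] with v hv hv'
      exact hN₂ _ (hmem v hv) _ (hmem u hu) (le_of_lt hv') h.le

end Leaves


/-! ### Charts adapted to a transient piecewise vector field -/

section Chart

/-- The disc of radius `ρ` contains no tangency, the branch `Σᵢ` is crossing there, with the
fields pointing in the direction of sign `a`, and the other branch is sliding or escaping; the
functions `N` and `M` are first integrals of `X` and `Y` in this disc. -/
structure IsChart (Z : PiecewiseField) (a : ℝ) (i : Fin 2) (m ρ : ℝ) (N M : Plane → ℝ) :
    Prop extends IsFoliation N M m where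
  sign : a = 1 ∨ a = -1
  rad_pos : 0 < ρ
  mem_dom : ∀ p, ‖p‖ < ρ → p ∈ Z.dom
  leaf_X : ∀ p, ‖p‖ < ρ → HasLeaf Z.X N p
  leaf_Y : ∀ p, ‖p‖ < ρ → HasLeaf Z.Y M p
  crossing_X : ∀ p, ‖p‖ < ρ → 0 < a * Z.X p i
  crossing_Y : ∀ p, ‖p‖ < ρ → 0 < a * Z.Y p i
  sliding_X : ∀ p, ‖p‖ < ρ → a * Z.X p (i + 1) < 0
  sliding_Y : ∀ p, ‖p‖ < ρ → 0 < a * Z.Y p (i + 1)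

theorem coord_mul (i : Fin 2) (p : Plane) : p 0 * p 1 = p i * p (i + 1) := by
  fin_cases i
  · rfl
  · simp [mul_comm]

theorem fin_two_add (i : Fin 2) : i + 1 + 1 = i := by fin_cases i <;> rfl

theorem fin_two_cases (i k : Fin 2) : k = i ∨ k = i + 1 := by
  fin_cases i <;> fin_cases k <;> simp

theorem axisPoint_self (i : Fin 2) (x : ℝ) : axisPoint i x i = x := by simp [axisPoint]

theorem axisPoint_succ (i : Fin 2) (x : ℝ) : axisPoint i x (i + 1) = 0 := by
  simp [axisPoint]

theorem eq_axisPoint {i : Fin 2} {p : Plane} (h : p (i + 1) = 0) : p = axisPoint i (p i) := by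
  ext k
  rcases fin_two_cases i k with rfl | rfl
  · rw [axisPoint_self]
  · rw [axisPoint_succ, h]

theorem mem_Upos_iff (i : Fin 2) {p : Plane} : p ∈ Upos ↔ 0 < p i * p (i + 1) := by
  rw [Upos, mem_ofPred_eq, coord_mul i]

theorem mem_Uneg_iff (i : Fin 2) {p : Plane} : p ∈ Uneg ↔ p i * p (i + 1) < 0 := by
  rw [Uneg, mem_ofPred_eq, coord_mul i]

theorem mem_SwitchingSet_iff (i : Fin 2) {p : Plane} :
    p ∈ SwitchingSet ↔ p i = 0 ∨ p (i + 1) = 0 := by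
  rw [SwitchingSet, mem_ofPred_eq, coord_mul i, mul_eq_zero]

namespace IsChart

variable {Z : PiecewiseField} {a : ℝ} {i : Fin 2} {m ρ : ℝ} {N M : Plane → ℝ}

theorem sq_sign (C : IsChart Z a i m ρ N M) : a * a = 1 := IsFoliation.sq_of_sign C.sign

theorem mul_pos_iff (C : IsChart Z a i m ρ N M) {x y : ℝ} (hx : 0 < a * x) :
    0 < x * y ↔ 0 < a * y := by
  rcases C.sign with rfl | rfl
  · rw [one_mul] at hx ⊢; exact mul_pos_iff_of_pos_left hx
  · constructor
    · intro h; nlinarith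
    · intro h; nlinarith

theorem crossing (C : IsChart Z a i m ρ N M) {p : Plane} (hp : ‖p‖ < ρ) :
    0 < Z.X p i * Z.Y p i := (C.mul_pos_iff (C.crossing_X p hp)).2 (C.crossing_Y p hp)

theorem sliding (C : IsChart Z a i m ρ N M) {p : Plane} (hp : ‖p‖ < ρ) :
    Z.X p (i + 1) * Z.Y p (i + 1) < 0 := by
  have h1 := C.sliding_X p hp
  have := (C.mul_pos_iff (x := Z.Y p (i + 1)) (y := -Z.X p (i + 1)) (C.sliding_Y p hp)).2
    (by linarith)
  linarith

/-- In a chart the tangent directions are settled: a point is regular if and only if it is off the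
branch `Σᵢ₊₁`. -/
theorem isRegularPoint_iff (C : IsChart Z a i m ρ N M) {p : Plane} (hp : ‖p‖ < ρ) :
    IsRegularPoint Z p ↔ p (i + 1) ≠ 0 := by
  constructor
  · intro h h0
    exact lt_asymm (h _ h0) (C.sliding hp)
  · intro h k hk
    rcases fin_two_cases i k with rfl | rfl
    · exact C.crossing hp
    · exact (h hk).elim

/-- The origin counts as a sliding point of `Σᵢ₊₁`, because the other branch is crossing there. -/
theorem isSlidingPoint_iff (C : IsChart Z a i m ρ N M) {p : Plane} (hp : ‖p‖ < ρ) (k : Fin 2) :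
    IsSlidingPoint Z k p ↔ k = i + 1 ∧ p (i + 1) = 0 := by
  constructor
  · rintro ⟨h0, h1, -⟩
    rcases fin_two_cases i k with rfl | rfl
    · exact (lt_asymm (C.crossing hp) h1).elim
    · exact ⟨rfl, h0⟩
  · rintro ⟨rfl, h0⟩
    exact ⟨h0, C.sliding hp, fun _ => by rw [fin_two_add]; exact C.crossing hp⟩

theorem slidingField_pos (C : IsChart Z a i m ρ N M) {p : Plane} (hp : ‖p‖ < ρ) :
    0 < a * slidingField Z (i + 1) p := by
  have h1 := C.crossing_X p hp
  have h2 := C.crossing_Y p hp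
  have h3 := C.sliding_X p hp
  have h4 := C.sliding_Y p hp
  have haa := C.sq_sign
  rw [slidingField, fin_two_add]
  set x := Z.X p i
  set y := Z.Y p i
  set u := Z.X p (i + 1)
  set v := Z.Y p (i + 1)
  have hd : 0 < a * (v - u) := by linarith
  have hn : 0 < v * x - u * y := by
    have e : v * x - u * y = (a * v) * (a * x) - (a * u) * (a * y) := by
      linear_combination (-(v * x - u * y)) * haa
    rw [e]
    nlinarith [mul_pos h4 h1, mul_pos (neg_pos.2 h3) h2]
  have e : a * ((v * x - u * y) / (v - u)) = (v * x - u * y) / (a * (v - u)) := by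
    have hne : v - u ≠ 0 := fun h => by rw [h] at hd; simp at hd
    have ha0 : a ≠ 0 := fun h => by rw [h] at hd; simp at hd
    field_simp
    linear_combination haa
  rw [e]
  exact div_pos hn hd

theorem continuousAt_slidingField (C : IsChart Z a i m ρ N M) {p : Plane} (hp : ‖p‖ < ρ) :
    ContinuousAt (slidingField Z (i + 1)) p := by
  have hX := fun k => ((continuous_apply k).continuousAt.comp (C.leaf_X p hp).continuousAt :
    ContinuousAt (fun q => Z.X q k) p)
  have hY := fun k => ((continuous_apply k).continuousAt.comp (C.leaf_Y p hp).continuousAt :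
    ContinuousAt (fun q => Z.Y q k) p)
  have hd : Z.Y p (i + 1) - Z.X p (i + 1) ≠ 0 := fun h => by
    have h3 := C.sliding_X p hp
    have h4 := C.sliding_Y p hp
    rw [show Z.Y p (i + 1) = Z.X p (i + 1) by linarith] at h4
    linarith
  exact ((((hY _).mul (hX _)).sub ((hX _).mul (hY _))).div ((hY _).sub (hX _)) hd)

end IsChart

end Chart

/-! ### Regular arcs -/

section Arcs

/-- A function with positive derivative off its zeros, which are isolated, is increasing. -/
theorem strictMonoOn_of_isolated_zeros {f : ℝ → ℝ} {I : Set ℝ} (hI : I.OrdConnected)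
    (hc : ContinuousOn f I) (hd : ∀ t ∈ I, f t ≠ 0 → ∃ d > 0, HasDerivWithinAt f d I t)
    (hiso : ∀ t ∈ I, f t = 0 → ∀ᶠ s in 𝓝[I \ {t}] t, f s ≠ 0) : StrictMonoOn f I := by
  have step : ∀ u ∈ I, ∀ v ∈ I, u < v → (∀ t ∈ Ioo u v, f t ≠ 0) → f u < f v := by
    intro u hu v hv huv hne
    have hsub := hI.out hu hv
    refine strictMonoOn_of_deriv_pos (convex_Icc u v) (hc.mono hsub) (fun t ht => ?_)
      ⟨le_rfl, huv.le⟩ ⟨huv.le, le_rfl⟩ huv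
    rw [interior_Icc] at ht
    obtain ⟨d, hd0, hd⟩ := hd t (hsub ⟨ht.1.le, ht.2.le⟩) (hne t ht)
    have : HasDerivAt f d t := hd.hasDerivAt
      (mem_of_superset (Ioo_mem_nhds ht.1 ht.2) fun x hx => hsub ⟨hx.1.le, hx.2.le⟩)
    rw [this.deriv]
    exact hd0
  -- A positive value stays positive: `f` increases up to its first zero after `u`, where it would
  -- therefore be positive.
  have hB : ∀ u ∈ I, ∀ v ∈ I, u ≤ v → 0 < f u → 0 < f v := by
    intro u hu v hv huv hfu
    by_contra! hfv
    have hsub := hI.out hu hv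
    have hcuv := hc.mono hsub
    have hne : (Icc u v ∩ f ⁻¹' {0}).Nonempty := by
      obtain ⟨z, hz, e⟩ := intermediate_value_Icc' huv hcuv ⟨hfv, hfu.le⟩
      exact ⟨z, hz, e⟩
    have hcomp : IsCompact (Icc u v ∩ f ⁻¹' {0}) :=
      isCompact_Icc.of_isClosed_subset (hcuv.preimage_isClosed_of_isClosed isClosed_Icc
        isClosed_singleton) inter_subset_left
    obtain ⟨z, ⟨hz, hz0⟩, hmin⟩ := hcomp.exists_isLeast hne
    have hz0 : f z = 0 := hz0
    have huz : u < z := lt_of_le_of_ne hz.1 fun h => by rw [← h] at hz0; linarith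
    have := step u hu z (hsub hz) huz fun t ht h0 =>
      ht.2.not_ge (hmin ⟨⟨ht.1.le, ht.2.le.trans hz.2⟩, h0⟩)
    linarith
  have hC : ∀ u ∈ I, ∀ v ∈ I, u ≤ v → f v < 0 → f u < 0 := by
    intro u hu v hv huv hfv
    by_contra! hfu
    have hsub := hI.out hu hv
    have hcuv := hc.mono hsub
    have hne : (Icc u v ∩ f ⁻¹' {0}).Nonempty := by
      obtain ⟨z, hz, e⟩ := intermediate_value_Icc' huv hcuv ⟨hfv.le, hfu⟩
      exact ⟨z, hz, e⟩
    have hcomp : IsCompact (Icc u v ∩ f ⁻¹' {0}) :=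
      isCompact_Icc.of_isClosed_subset (hcuv.preimage_isClosed_of_isClosed isClosed_Icc
        isClosed_singleton) inter_subset_left
    obtain ⟨z, ⟨hz, hz0⟩, hmax⟩ := hcomp.exists_isGreatest hne
    have hz0 : f z = 0 := hz0
    have hzv : z < v := lt_of_le_of_ne hz.2 fun h => by rw [h] at hz0; linarith
    have := step z (hsub hz) v hv hzv fun t ht h0 =>
      ht.1.not_ge (hmax ⟨⟨hz.1.trans ht.1.le, ht.2.le⟩, h0⟩)
    linarith
  intro u hu v hv huv
  have hsub := hI.out hu hv
  rcases lt_trichotomy (f u) 0 with h | h | h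
  · rcases lt_or_ge (f v) 0 with h' | h'
    · exact step u hu v hv huv fun t ht =>
        (hC t (hsub ⟨ht.1.le, ht.2.le⟩) v hv ht.2.le h').ne
    · linarith
  · rcases lt_trichotomy (f v) 0 with h' | h' | h'
    · have := hC u hu v hv huv.le h'; linarith
    -- Between two zeros `f` would vanish identically, and zeros are isolated.
    · have hz : ∀ t ∈ Ioo u v, f t = 0 := fun t ht => by
        have htI := hsub ⟨ht.1.le, ht.2.le⟩
        rcases lt_trichotomy (f t) 0 with h1 | h1 | h1
        · have := hC u hu t htI ht.1.le h1; linarith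
        · exact h1
        · have := hB t htI v hv ht.2.le h1; linarith
      have hle : 𝓝[Ioo u v] u ≤ 𝓝[I \ {u}] u := nhdsWithin_mono _ fun t ht =>
        ⟨hsub ⟨ht.1.le, ht.2.le⟩, ht.1.ne'⟩
      have hne : (𝓝[Ioo u v] u).NeBot := left_nhdsWithin_Ioo_neBot huv
      obtain ⟨t, h1, h2⟩ := (((hiso u hu h).filter_mono hle).and self_mem_nhdsWithin).exists
      exact (h1 (hz t h2)).elim
    · linarith
  · exact step u hu v hv huv fun t ht => (hB u hu t (hsub ⟨ht.1.le, ht.2.le⟩) ht.1.le h).ne'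

theorem exists_const_sign {f : ℝ → ℝ} {I : Set ℝ} (hI : I.OrdConnected) (hc : ContinuousOn f I)
    (h0 : ∀ t ∈ I, f t ≠ 0) : ∃ s : ℝ, (s = 1 ∨ s = -1) ∧ ∀ t ∈ I, 0 < s * f t := by
  by_cases h : ∃ t ∈ I, f t < 0
  · obtain ⟨t, ht, hft⟩ := h
    refine ⟨-1, Or.inr rfl, fun u hu => ?_⟩
    by_contra! hfu
    have hu0 : 0 < f u := lt_of_le_of_ne (by linarith) (h0 u hu).symm
    obtain ⟨z, hz, e⟩ := (hI.isPreconnected.image f hc).ordConnected.out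
      (mem_image_of_mem f ht) (mem_image_of_mem f hu) ⟨hft.le, hu0.le⟩
    exact h0 z hz e
  · push Not at h
    exact ⟨1, Or.inl rfl, fun t ht => by
      rw [one_mul]; exact lt_of_le_of_ne (h t ht) (h0 t ht).symm⟩

/-- A first integral is constant along a curve which satisfies the equation between two times. -/
theorem leaf_eq_of_deriv {V : Plane → Plane} {N : Plane → ℝ} {σ : ℝ → Plane} {u v : ℝ} (huv : u ≤ v)
    (hc : ContinuousOn σ (Icc u v)) (hN : ∀ t ∈ Icc u v, HasLeaf V N (σ t))
    (hd : ∀ t ∈ Ioo u v, HasDerivAt σ (V (σ t)) t) : N (σ u) = N (σ v) := by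
  rcases huv.eq_or_lt with rfl | huv
  · rfl
  have hcN : ContinuousOn (fun t => N (σ t)) (Icc u v) := fun t ht => by
    obtain ⟨A, hA, -⟩ := (hN t ht).exists_fderiv
    exact hA.continuousAt.comp_continuousWithinAt (hc t ht)
  obtain ⟨t, ht, e⟩ := exists_hasDerivAt_eq_slope (fun t => N (σ t)) (fun _ => 0) huv hcN
    fun t ht => by
      obtain ⟨A, hA, hAV, -⟩ := (hN t ⟨ht.1.le, ht.2.le⟩).exists_fderiv
      have := hA.comp_hasDerivAt t (hd t ht)
      rwa [hAV] at this
  have : v - u ≠ 0 := (sub_pos.2 huv).ne'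
  rw [eq_div_iff this, zero_mul] at e
  linarith

/-- The curve `σ`, in the half-plane where `p (i + 1)` has the sign `s`, stays on leaves: the first
integral `N` is constant in the quadrant of this half-plane where `p 0 * p 1 ≥ 0`, and `M` is
constant in the other one. -/
def StaysOnLeaves (N M : Plane → ℝ) (i : Fin 2) (s : ℝ) (I : Set ℝ) (σ : ℝ → Plane) : Prop :=
  ∀ t ∈ I, ∀ t' ∈ I, (0 ≤ s * σ t i → 0 ≤ s * σ t' i → N (σ t) = N (σ t')) ∧
    (s * σ t i ≤ 0 → s * σ t' i ≤ 0 → M (σ t) = M (σ t'))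

namespace IsChart

variable {Z : PiecewiseField} {a : ℝ} {i : Fin 2} {m ρ : ℝ} {N M : Plane → ℝ}

theorem sign_ne_zero (C : IsChart Z a i m ρ N M) : a ≠ 0 := fun h => by
  have := C.sq_sign
  simp [h] at this

theorem mul_sign (C : IsChart Z a i m ρ N M) {s : ℝ} (hs : s = 1 ∨ s = -1) :
    a * s = 1 ∨ a * s = -1 := by
  rcases C.sign with rfl | rfl <;> rcases hs with rfl | rfl <;> norm_num

theorem staysOnLeaves_of_deriv (C : IsChart Z a i m ρ N M) {I : Set ℝ} (hI : I.OrdConnected)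
    {σ : ℝ → Plane} (hc : ContinuousOn σ I) (hball : ∀ t ∈ I, ‖σ t‖ < ρ) {s : ℝ}
    (hs : s = 1 ∨ s = -1) (hmono : StrictMonoOn (fun t => a * σ t i) I)
    (hsj : ∀ t, I ∈ 𝓝 t → 0 < s * σ t (i + 1))
    (hX : ∀ t, I ∈ 𝓝 t → σ t ∈ Upos → HasDerivAt σ (Z.X (σ t)) t)
    (hY : ∀ t, I ∈ 𝓝 t → σ t ∈ Uneg → HasDerivAt σ (Z.Y (σ t)) t) :
    StaysOnLeaves N M i s I σ := by
  have hs2 := IsFoliation.sq_of_sign hs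
  have ha2 := C.sq_sign
  have hsi : ∀ t, s * σ t i = (a * s) * (a * σ t i) := fun t => by
    linear_combination (-(s * σ t i)) * ha2
  -- Between two times in the same quadrant, `σ` stays strictly inside this quadrant.
  have main : ∀ t ∈ I, ∀ t' ∈ I, t ≤ t' →
      (0 ≤ s * σ t i → 0 ≤ s * σ t' i → N (σ t) = N (σ t')) ∧
      (s * σ t i ≤ 0 → s * σ t' i ≤ 0 → M (σ t) = M (σ t')) := by
    intro t ht t' ht' htt
    have hsub := hI.out ht ht'
    have hint : ∀ u ∈ Ioo t t', I ∈ 𝓝 u := fun u hu =>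
      mem_of_superset (Ioo_mem_nhds hu.1 hu.2) fun x hx => hsub ⟨hx.1.le, hx.2.le⟩
    have hbetween : ∀ u ∈ Ioo t t', a * σ t i < a * σ u i ∧ a * σ u i < a * σ t' i :=
      fun u hu => ⟨hmono ht (hsub ⟨hu.1.le, hu.2.le⟩) hu.1, hmono (hsub ⟨hu.1.le, hu.2.le⟩) ht' hu.2⟩
    have hfac : ∀ u, σ u i * σ u (i + 1) = (s * σ u i) * (s * σ u (i + 1)) := fun u => by
      linear_combination (-(σ u i * σ u (i + 1))) * hs2
    have has := C.mul_sign hs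
    have hcont := hc.mono hsub
    refine ⟨fun h1 h2 => ?_, fun h1 h2 => ?_⟩
    · refine leaf_eq_of_deriv htt hcont (fun u hu => C.leaf_X _ (hball u (hsub hu))) fun u hu => ?_
      refine hX u (hint u hu) ((mem_Upos_iff i).2 ?_)
      rw [hfac]
      refine mul_pos ?_ (hsj u (hint u hu))
      rw [hsi] at h1 h2 ⊢
      have := hbetween u hu
      rcases has with h | h <;> rw [h] at h1 h2 ⊢ <;> linarith
    · refine leaf_eq_of_deriv htt hcont (fun u hu => C.leaf_Y _ (hball u (hsub hu))) fun u hu => ?_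
      refine hY u (hint u hu) ((mem_Uneg_iff i).2 ?_)
      rw [hfac]
      refine mul_neg_of_neg_of_pos ?_ (hsj u (hint u hu))
      rw [hsi] at h1 h2 ⊢
      have := hbetween u hu
      rcases has with h | h <;> rw [h] at h1 h2 ⊢ <;> linarith
  intro t ht t' ht'
  rcases le_total t t' with h | h
  · exact main t ht t' ht' h
  · have := main t' ht' t ht h
    exact ⟨fun h1 h2 => (this.1 h2 h1).symm, fun h1 h2 => (this.2 h2 h1).symm⟩

theorem regularArc_coord (C : IsChart Z a i m ρ N M) {W : Set Plane} (hW : ∀ p ∈ W, ‖p‖ < ρ)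
    {I : Set ℝ} (hI : I.OrdConnected) {σ : ℝ → Plane} (hσ : IsRegularArc Z W I σ) :
    (∃ s : ℝ, (s = 1 ∨ s = -1) ∧ ∀ t ∈ I, 0 < s * σ t (i + 1)) ∧
      StrictMonoOn (fun t => a * σ t i) I := by
  have hball : ∀ t ∈ I, ‖σ t‖ < ρ := fun t ht => hW _ (hσ.mem t ht)
  have hj : ∀ t ∈ I, σ t (i + 1) ≠ 0 := fun t ht =>
    (C.isRegularPoint_iff (hball t ht)).1 (hσ.regular t ht)
  have hck : ∀ k, ContinuousOn (fun t => σ t k) I := fun k =>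
    (continuous_apply k).comp_continuousOn hσ.continuousOn
  have ha0 := C.sign_ne_zero
  refine ⟨exists_const_sign hI (hck (i + 1)) hj, strictMonoOn_of_isolated_zeros hI
    (continuousOn_const.mul (hck i)) (fun t ht h => ?_) fun t ht h => ?_⟩
  · have hi : σ t i ≠ 0 := fun h' => h (by simp only [h', mul_zero])
    rcases (mul_ne_zero hi (hj t ht)).lt_or_gt with hlt | hgt
    · exact ⟨_, C.crossing_Y _ (hball t ht), (hasDerivWithinAt_pi.1 (hσ.deriv_neg t ht
        ((mem_Uneg_iff i).2 hlt)) i).const_mul a⟩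
    · exact ⟨_, C.crossing_X _ (hball t ht), (hasDerivWithinAt_pi.1 (hσ.deriv_pos t ht
        ((mem_Upos_iff i).2 hgt)) i).const_mul a⟩
  · have hi : σ t i = 0 := (mul_eq_zero.1 h).resolve_left ha0
    filter_upwards [hσ.isolated t ht ((mem_SwitchingSet_iff i).2 (Or.inl hi))] with u hu
    exact mul_ne_zero ha0 fun h' => hu ((mem_SwitchingSet_iff i).2 (Or.inl h'))

/-- A regular arc does not meet the sliding branch, moves monotonically along the other coordinate,
and stays on leaves. -/
theorem regularArc (C : IsChart Z a i m ρ N M) {W : Set Plane} (hW : ∀ p ∈ W, ‖p‖ < ρ) {I : Set ℝ}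
    (hI : I.OrdConnected) {σ : ℝ → Plane} (hσ : IsRegularArc Z W I σ) :
    StrictMonoOn (fun t => a * σ t i) I ∧ ∃ s : ℝ, (s = 1 ∨ s = -1) ∧
      (∀ t ∈ I, 0 < s * σ t (i + 1)) ∧ StaysOnLeaves N M i s I σ := by
  obtain ⟨⟨s, hs, hsj⟩, hmono⟩ := C.regularArc_coord hW hI hσ
  exact ⟨hmono, s, hs, hsj, C.staysOnLeaves_of_deriv hI hσ.continuousOn
    (fun t ht => hW _ (hσ.mem t ht)) hs hmono (fun t ht => hsj t (mem_of_mem_nhds ht))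
    (fun t ht hp => (hσ.deriv_pos t (mem_of_mem_nhds ht) hp).hasDerivAt ht)
    fun t ht hp => (hσ.deriv_neg t (mem_of_mem_nhds ht) hp).hasDerivAt ht⟩

/-- The time at which an increasing function vanishes. If it does not vanish on `[0, L]`, then `t₀`
is taken outside this interval, on the appropriate side. -/
theorem exists_switch_time {f : ℝ → ℝ} {L : ℝ} (hL : 0 ≤ L) (hc : ContinuousOn f (Icc 0 L))
    (hmono : StrictMonoOn f (Icc 0 L)) : ∃ t₀, ∀ t ∈ Icc 0 L,
      (t ≤ t₀ → f t ≤ 0) ∧ (t₀ ≤ t → 0 ≤ f t) ∧ (0 < f t → t₀ < t) ∧ (f t < 0 → t < t₀) := by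
  have h0 : (0 : ℝ) ∈ Icc 0 L := ⟨le_rfl, hL⟩
  have hL' : L ∈ Icc 0 L := ⟨hL, le_rfl⟩
  rcases lt_or_ge (f L) 0 with h | h
  · refine ⟨L + 1, fun t ht => ?_⟩
    have := hmono.monotoneOn ht hL' ht.2
    exact ⟨fun _ => by linarith, fun h' => by linarith [ht.2], fun h' => by linarith,
      fun _ => by linarith [ht.2]⟩
  rcases lt_or_ge 0 (f 0) with h' | h'
  · refine ⟨-1, fun t ht => ?_⟩
    have := hmono.monotoneOn h0 ht ht.1
    exact ⟨fun h' => by linarith [ht.1], fun _ => by linarith, fun _ => by linarith [ht.1],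
      fun _ => by linarith⟩
  obtain ⟨z, hz, e⟩ := intermediate_value_Icc hL hc ⟨h', h⟩
  refine ⟨z, fun t ht => ⟨fun h1 => ?_, fun h1 => ?_, fun h1 => ?_, fun h1 => ?_⟩⟩
  · rw [← e]; exact hmono.monotoneOn ht hz h1
  · rw [← e]; exact hmono.monotoneOn hz ht h1
  · rw [← e] at h1; exact (hmono.lt_iff_lt hz ht).1 h1
  · rw [← e] at h1; exact (hmono.lt_iff_lt ht hz).1 h1

/-- Conversely, a curve on leaves which is monotone with respect to the crossing coordinate is a
regular arc after a change of time. -/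
theorem exists_arc (C : IsChart Z a i m ρ N M) {L : ℝ} {c : ℝ → Plane} (hL : 0 ≤ L)
    (hc : ContinuousOn c (Icc 0 L)) (hball : ∀ t ∈ Icc 0 L, ‖c t‖ < ρ)
    (hmono : StrictMonoOn (fun t => a * c t i) (Icc 0 L)) {s : ℝ} (hs : s = 1 ∨ s = -1)
    (hsj : ∀ t ∈ Icc 0 L, 0 ≤ s * c t (i + 1)) (hleaf : StaysOnLeaves N M i s (Icc 0 L) c) :
    ∃ τ : ℝ ≃o ℝ, τ 0 = 0 ∧ 0 ≤ τ L ∧ (∀ u ∈ Icc 0 (τ L), τ.symm u ∈ Icc 0 L) ∧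
      ContinuousOn (fun u => c (τ.symm u)) (Icc 0 (τ L)) ∧
      ∀ J ⊆ Icc 0 (τ L), ∀ W : Set Plane, (∀ u ∈ J, c (τ.symm u) ∈ W) →
        (∀ u ∈ J, c (τ.symm u) (i + 1) ≠ 0) → IsRegularArc Z W J fun u => c (τ.symm u) := by
  have ha0 := C.sign_ne_zero
  obtain ⟨t₀, ht₀⟩ := exists_switch_time (f := fun t => a * c t i) hL
    (continuousOn_const.mul ((continuous_apply i).comp_continuousOn hc)) hmono
  have hfac : ∀ t, c t 0 * c t 1 = (a * s) * ((a * c t i) * (s * c t (i + 1))) := fun u => by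
    rw [coord_mul i]
    have h1 := C.sq_sign
    have h2 := IsFoliation.sq_of_sign hs
    linear_combination (-(c u i * c u (i + 1) * (s * s))) * h1 - (c u i * c u (i + 1)) * h2
  have has := C.mul_sign hs
  have hsi : ∀ t, s * c t i = (a * s) * (a * c t i) := fun t => by
    linear_combination (-(s * c t i)) * C.sq_sign
  have hstrict : ∀ t ∈ Icc 0 L, (0 < (a * c t i) * (s * c t (i + 1)) → t₀ < t) ∧
      ((a * c t i) * (s * c t (i + 1)) < 0 → t < t₀) := fun t ht => by
    refine ⟨fun h => (ht₀ t ht).2.2.1 ?_, fun h => (ht₀ t ht).2.2.2 ?_⟩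
    · by_contra! h'
      have := mul_nonpos_of_nonpos_of_nonneg h' (hsj t ht)
      linarith
    · by_contra! h'
      have := mul_nonneg h' (hsj t ht)
      linarith
  have main : ∃ τ : ℝ ≃o ℝ, τ 0 = 0 ∧ 0 ≤ τ L ∧ (∀ u ∈ Icc 0 (τ L), τ.symm u ∈ Icc 0 L) ∧
      ContinuousOn (fun u => c (τ.symm u)) (Icc 0 (τ L)) ∧ ∀ u ∈ Icc 0 (τ L),
      (c (τ.symm u) ∈ Upos → HasDerivWithinAt (fun u => c (τ.symm u)) (Z.X (c (τ.symm u)))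
        (Icc 0 (τ L)) u) ∧
      (c (τ.symm u) ∈ Uneg → HasDerivWithinAt (fun u => c (τ.symm u)) (Z.Y (c (τ.symm u)))
        (Icc 0 (τ L)) u) := by
    -- The curve moves in the direction `a`: in the half-plane of sign `s` it goes from the region of
    -- `Y` to that of `X` if `a * s = 1`, and the other way round if `a * s = -1`.
    rcases has with h | h
    · obtain ⟨τ, h1, h2, h3, h4, h5⟩ := exists_orbit_of_leaf (V₁ := Z.Y) (V₂ := Z.X) (N₁ := M)
        (N₂ := N) t₀ ha0 hL hc hmono (fun t ht => C.leaf_Y _ (hball t ht))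
        (fun t ht => C.leaf_X _ (hball t ht)) (fun t ht => C.crossing_Y _ (hball t ht))
        (fun t ht => C.crossing_X _ (hball t ht))
        (fun t ht t' ht' e e' => (hleaf t ht t' ht').2 (by rw [hsi, h, one_mul]; exact (ht₀ t ht).1 e)
          (by rw [hsi, h, one_mul]; exact (ht₀ t' ht').1 e'))
        (fun t ht t' ht' e e' => (hleaf t ht t' ht').1 (by rw [hsi, h, one_mul]; exact (ht₀ t ht).2.1 e)
          (by rw [hsi, h, one_mul]; exact (ht₀ t' ht').2.1 e'))
      refine ⟨τ, h1, h2, h3, h4, fun u hu => ⟨fun hp => (h5 u hu).2 ?_, fun hp => (h5 u hu).1 ?_⟩⟩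
      · have hp : 0 < c (τ.symm u) 0 * c (τ.symm u) 1 := hp
        rw [hfac, h, one_mul] at hp
        exact (hstrict _ (h3 u hu)).1 hp
      · have hp : c (τ.symm u) 0 * c (τ.symm u) 1 < 0 := hp
        rw [hfac, h, one_mul] at hp
        exact (hstrict _ (h3 u hu)).2 hp
    · obtain ⟨τ, h1, h2, h3, h4, h5⟩ := exists_orbit_of_leaf (V₁ := Z.X) (V₂ := Z.Y) (N₁ := N)
        (N₂ := M) t₀ ha0 hL hc hmono (fun t ht => C.leaf_X _ (hball t ht))
        (fun t ht => C.leaf_Y _ (hball t ht)) (fun t ht => C.crossing_X _ (hball t ht))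
        (fun t ht => C.crossing_Y _ (hball t ht))
        (fun t ht t' ht' e e' => (hleaf t ht t' ht').1
          (by rw [hsi, h]; linarith [(ht₀ t ht).1 e]) (by rw [hsi, h]; linarith [(ht₀ t' ht').1 e']))
        (fun t ht t' ht' e e' => (hleaf t ht t' ht').2
          (by rw [hsi, h]; linarith [(ht₀ t ht).2.1 e]) (by rw [hsi, h]; linarith [(ht₀ t' ht').2.1 e']))
      refine ⟨τ, h1, h2, h3, h4, fun u hu => ⟨fun hp => (h5 u hu).1 ?_, fun hp => (h5 u hu).2 ?_⟩⟩
      · have hp : 0 < c (τ.symm u) 0 * c (τ.symm u) 1 := hp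
        rw [hfac, h] at hp
        exact (hstrict _ (h3 u hu)).2 (by linarith)
      · have hp : c (τ.symm u) 0 * c (τ.symm u) 1 < 0 := hp
        rw [hfac, h] at hp
        exact (hstrict _ (h3 u hu)).1 (by linarith)
  obtain ⟨τ, h1, h2, h3, h4, h5⟩ := main
  refine ⟨τ, h1, h2, h3, h4, fun J hJ W hW hne => ⟨h4.mono hJ, hW, fun u hu => ?_, fun u hu hp => ?_,
    fun u hu hp => ?_, fun u hu hp => ?_⟩⟩
  · exact (C.isRegularPoint_iff (hball _ (h3 u (hJ hu)))).2 (hne u hu)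
  · exact ((h5 u (hJ hu)).1 hp).mono hJ
  · exact ((h5 u (hJ hu)).2 hp).mono hJ
  · have hi := ((mem_SwitchingSet_iff i).1 hp).resolve_right (hne u hu)
    filter_upwards [self_mem_nhdsWithin] with v hv hvp
    have hvi := ((mem_SwitchingSet_iff i).1 hvp).resolve_right (hne v hv.1)
    exact hv.2 (τ.symm.injective (hmono.injOn (h3 v (hJ hv.1)) (h3 u (hJ hu))
      (by simp only [hi, hvi])))

end IsChart

end Arcs


/-! ### The radial homeomorphism is a `Σ`-equivalence -/

section Equivalence

/-- On two rays of the first quadrant, the order of the coordinates on a leaf of `G` is the same as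
the order on a leaf of `G'`: it is the order of the slopes of the rays. -/
theorem HasSlope.coord_lt_of_leaf {G G' : Plane → ℝ} {m m' : ℝ} (hG : HasSlope G m) (hm : 0 < m)
    (hG' : HasSlope G' m') (hm' : 0 < m') {q q' : Plane} (hq : 0 ≤ q) (hq' : 0 ≤ q')
    (e : G q = G q') {l l' : ℝ} (hl : 0 < l) (e' : G' (l • q) = G' (l' • q')) {i : Fin 2}
    (hi : q i < q' i) : l * q i < l' * q' i := by
  have le_of : ∀ {p p' : Plane}, p i ≤ p' i → p (i + 1) ≤ p' (i + 1) → p ≤ p' := fun h h' k => by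
    rcases fin_two_cases i k with rfl | rfl
    exacts [h, h']
  have hj : q' (i + 1) < q (i + 1) := by
    by_contra! h
    have := hG.strictMono hm (lt_of_le_of_ne (le_of hi.le h) fun h' => by
      rw [h'] at hi; exact lt_irrefl _ hi)
    linarith
  by_contra! h
  have hj' : l * q (i + 1) ≤ l' * q' (i + 1) := by
    by_contra! h'
    have hlt : l' • q' < l • q := lt_of_le_of_ne
      (le_of (by simpa using h) (by simpa using h'.le)) fun h2 => by
        have := congrFun h2 (i + 1)
        simp only [Pi.smul_apply, smul_eq_mul] at this
        linarith
    have := hG'.strictMono hm' hlt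
    linarith
  have h1 := hq i
  have h2 := hq' (i + 1)
  simp only [Pi.zero_apply] at h1 h2
  rcases le_or_gt l l' with hll | hll
  · nlinarith [mul_le_mul_of_nonneg_right hll (h1.trans hi.le)]
  · nlinarith [mul_le_mul_of_nonneg_right hll.le h2]

theorem exists_common_signs {p p' : Plane} (h : ∀ k, 0 ≤ p k * p' k) :
    ∃ s t : ℝ, (s = 1 ∨ s = -1) ∧ (t = 1 ∨ t = -1) ∧ 0 ≤ rescale s t p ∧ 0 ≤ rescale s t p' := by
  have key : ∀ x y : ℝ, 0 ≤ x * y → ∃ s : ℝ, (s = 1 ∨ s = -1) ∧ 0 ≤ s * x ∧ 0 ≤ s * y :=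
    fun x y hxy => by
      rcases mul_nonneg_iff.1 hxy with ⟨h1, h2⟩ | ⟨h1, h2⟩
      · exact ⟨1, Or.inl rfl, by linarith, by linarith⟩
      · exact ⟨-1, Or.inr rfl, by linarith, by linarith⟩
  obtain ⟨s, hs, h1, h2⟩ := key _ _ (h 0)
  obtain ⟨t, ht, h3, h4⟩ := key _ _ (h 1)
  refine ⟨s, t, hs, ht, fun k => ?_, fun k => ?_⟩ <;> fin_cases k
  exacts [h1, h3, h2, h4]

/-- The two first integrals have the same values at `p` and `p'`, in the regions where they
apply. -/
def SameLeaf (N M : Plane → ℝ) (p p' : Plane) : Prop :=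
  (0 ≤ p 0 * p 1 → 0 ≤ p' 0 * p' 1 → N p = N p') ∧ (p 0 * p 1 ≤ 0 → p' 0 * p' 1 ≤ 0 → M p = M p')

namespace IsFoliation

variable {N M N' M' : Plane → ℝ} {m m' : ℝ}

theorem le_one (h : IsFoliation N M m) : m ≤ 1 := by
  have h1 := (h.slope 0 (axisPoint 0 1) (by intro k; fin_cases k <;> simp [axisPoint])).1
  rw [h.axis, h.map_zero, sub_zero, sub_zero] at h1
  have : ‖(axisPoint 0 1 : Plane)‖ = 1 := by rw [axisPoint, Pi.norm_single, norm_one]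
  rwa [this, mul_one] at h1

theorem product_nonneg_of_rescale {s t : ℝ} {p : Plane} (hp : 0 ≤ rescale s t p) :
    0 ≤ s * t * (p 0 * p 1) := by
  have h1 := hp 0
  have h2 := hp 1
  simp only [Pi.zero_apply, rescale_zero', rescale_one'] at h1 h2
  calc 0 ≤ (s * p 0) * (t * p 1) := mul_nonneg h1 h2
    _ = _ := by ring

theorem sameLeaf_onQuadrant {s t : ℝ} (hs : s = 1 ∨ s = -1) (ht : t = 1 ∨ t = -1) {p p' : Plane}
    (hp : 0 ≤ rescale s t p) (hp' : 0 ≤ rescale s t p') (h : SameLeaf N M p p') :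
    (if 0 < s * t then N else M) p = (if 0 < s * t then N else M) p' := by
  have e := product_nonneg_of_rescale hp
  have e' := product_nonneg_of_rescale hp'
  by_cases hst : 0 < s * t
  · simp only [if_pos hst]
    exact h.1 ((mul_nonneg_iff_of_pos_left hst).1 e) ((mul_nonneg_iff_of_pos_left hst).1 e')
  · simp only [if_neg hst]
    have hst' : s * t = -1 := by
      rcases hs with rfl | rfl <;> rcases ht with rfl | rfl <;>
        first | (norm_num; done) | norm_num at hst
    rw [hst'] at e e'
    exact h.2 (by linarith) (by linarith)

theorem rescale_apply_eq (i : Fin 2) (s t : ℝ) (p : Plane) :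
    rescale s t p i = (if i = 0 then s else t) * p i := by
  fin_cases i <;> simp

/-- A radial map between foliations preserves the order of the coordinates on each leaf. -/
theorem IsFactor.coord_lt {κ : ℝ → ℝ} (h : IsFoliation N M m) (h' : IsFoliation N' M' m')
    {p p' : Plane} {r r' : ℝ} (hr : IsFactor N M N' M' κ p r) (hr' : IsFactor N M N' M' κ p' r')
    (hpp : ∀ k, 0 ≤ p k * p' k) (hleaf : SameLeaf N M p p') {i : Fin 2} (hi : p i < p' i) :
    r * p i < r' * p' i := by
  obtain ⟨s, t, hs, ht, hq, hq'⟩ := exists_common_signs hpp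
  have hl := sameLeaf_onQuadrant hs ht hq hq' hleaf
  have e : onQuadrant N M s t (rescale s t p) = onQuadrant N M s t (rescale s t p') := by
    rw [onQuadrant_rescale hs ht, onQuadrant_rescale hs ht, hl]
  have e' : onQuadrant N' M' s t (r • rescale s t p) =
      onQuadrant N' M' s t (r' • rescale s t p') := by
    rw [hr.onQuadrant_eq hs ht hq, hr'.onQuadrant_eq hs ht hq', hl]
  have hsi : (if i = 0 then s else t) = 1 ∨ (if i = 0 then s else t) = -1 := by
    split_ifs
    exacts [hs, ht]
  have g := h.onQuadrant_slope hs ht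
  have g' := h'.onQuadrant_slope hs ht
  rcases hsi with h1 | h1
  · have := g.coord_lt_of_leaf h.pos g' h'.pos hq hq' e hr.1 e' (i := i)
      (by rw [rescale_apply_eq, rescale_apply_eq, h1]; linarith)
    rw [rescale_apply_eq, rescale_apply_eq, h1] at this
    linarith
  · have := g.coord_lt_of_leaf h.pos g' h'.pos hq' hq e.symm hr'.1 e'.symm (i := i)
      (by rw [rescale_apply_eq, rescale_apply_eq, h1]; linarith)
    rw [rescale_apply_eq, rescale_apply_eq, h1] at this
    linarith

variable {κ : ℝ ≃o ℝ}

/-- A radial map between foliations is increasing along the axes. -/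
theorem IsFactor.coord_lt_axis (h : IsFoliation N M m) (h' : IsFoliation N' M' m')
    {i : Fin 2} {x x' r r' : ℝ} (hr : IsFactor N M N' M' κ (axisPoint i x) r)
    (hr' : IsFactor N M N' M' κ (axisPoint i x') r') (hx : x < x') : r * x < r' * x' := by
  have hz : ∀ y, 0 ≤ (axisPoint i y : Plane) 0 * (axisPoint i y : Plane) 1 := fun y => by
    rw [coord_mul i, axisPoint_succ, mul_zero]
  have hle : ∀ {y y' : ℝ}, y ≤ y' → (axisPoint i y : Plane) ≤ axisPoint i y' := fun hy k => by
    rcases fin_two_cases i k with rfl | rfl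
    · rwa [axisPoint_self, axisPoint_self]
    · rw [axisPoint_succ, axisPoint_succ]
  have h1 : N (axisPoint i x) < N (axisPoint i x') :=
    h.slope.strictMono h.pos (lt_of_le_of_ne (hle hx.le) fun e => by
      have := congrFun e i
      rw [axisPoint_self, axisPoint_self] at this
      exact hx.ne this)
  have h2 := κ.strictMono h1
  rw [← hr.2.1 (hz _), ← hr'.2.1 (hz _), smul_axisPoint, smul_axisPoint] at h2
  by_contra! h3
  have := h'.slope.monotone h'.pos (hle h3)
  linarith

/-- The norm of the image by a radial map increases along the rays. -/
theorem IsFactor.mul_le (h : IsFoliation N M m) (h' : IsFoliation N' M' m') {p : Plane} (hp : p ≠ 0)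
    {θ r r' : ℝ} (hθ : 0 ≤ θ) (hθ1 : θ ≤ 1) (hr : IsFactor N M N' M' κ p r)
    (hr' : IsFactor N M N' M' κ (θ • p) r') : r' * θ ≤ r := by
  obtain ⟨s, t, hs, ht, hq⟩ := exists_signs p
  have hqθ : 0 ≤ rescale s t (θ • p) := by rw [rescale_smul]; exact smul_nonneg hθ hq
  have hle : rescale s t (θ • p) ≤ rescale s t p := by
    rw [rescale_smul]
    intro k
    have := hq k
    simp only [Pi.zero_apply, Pi.smul_apply, smul_eq_mul] at this ⊢
    nlinarith
  have h1 := (h.onQuadrant_slope hs ht).monotone h.pos hle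
  rw [onQuadrant_rescale hs ht, onQuadrant_rescale hs ht] at h1
  have h2 : t * κ ((if 0 < s * t then N else M) (θ • p)) ≤
      t * κ ((if 0 < s * t then N else M) p) := by
    rcases ht with rfl | rfl
    · have := κ.monotone (show (if 0 < s * 1 then N else M) (θ • p) ≤ (if 0 < s * 1 then N else M) p
        by linarith)
      linarith
    · have := κ.monotone (show (if 0 < s * -1 then N else M) p ≤
        (if 0 < s * -1 then N else M) (θ • p) by linarith)
      linarith
  rw [← hr.onQuadrant_eq hs ht hq, ← hr'.onQuadrant_eq hs ht hqθ, rescale_smul, smul_smul] at h2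
  by_contra! h3
  have := (h'.onQuadrant_slope hs ht).strictMono h'.pos
    (show r • rescale s t p < (r' * θ) • rescale s t p from
      lt_of_le_of_ne (smul_le_smul_of_nonneg_right h3.le hq) fun e =>
        h3.ne (smul_left_injective ℝ (rescale_ne_zero hs ht hp) e))
  linarith

/-- If `κ` fixes `e`, then the radial map sends a disc whose radius depends on `e` and on the
slopes only into another such disc. -/
theorem IsFactor.norm_lt (h : IsFoliation N M m) (h' : IsFoliation N' M' m)
    (hκ : ∀ x, κ (M (axisPoint 0 x)) = M' (axisPoint 0 (κ x))) {e : ℝ} (he : 0 < e) (hκe : κ e = e)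
    {p : Plane} {r : ℝ} (hr : IsFactor N M N' M' κ p r) (hp : ‖p‖ < m ^ 2 * e) :
    m ^ 2 * ‖r • p‖ < e := by
  obtain ⟨s, t, hs, ht, hq⟩ := exists_signs p
  have hm := h.pos
  have hm1 := h.le_one
  have b := ((h.onQuadrant_slope hs ht).bounds (h.onQuadrant_zero s t) hq).2
  have b' := ((h'.onQuadrant_slope hs ht).bounds (h'.onQuadrant_zero s t)
    (smul_nonneg hr.1.le hq)).1
  rw [onQuadrant_rescale hs ht, norm_rescale hs ht] at b
  rw [hr.onQuadrant_eq hs ht hq, ← rescale_smul, norm_rescale hs ht] at b'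
  set v := (if 0 < s * t then N else M) p with hv
  have b2 : t * v < m * e := by
    have : m⁻¹ * ‖p‖ < m * e := by
      rw [inv_mul_lt_iff₀ hm]
      calc ‖p‖ < _ := hp
        _ = _ := by ring
    linarith
  have b3 : t * κ v < m⁻¹ * e := by
    have hinv : e ≤ m⁻¹ * e := le_mul_of_one_le_left he.le ((one_le_inv₀ hm).2 hm1)
    rcases ht with rfl | rfl
    · have := κ.strictMono (show v < e by nlinarith)
      rw [hκe] at this
      linarith
    · have h1 := (h.half_return_slope he.le).1
      have h2 := (h'.half_return_slope he.le).2
      rw [axisPoint_zero, h.map_zero', sub_zero] at h1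
      rw [axisPoint_zero, h'.map_zero', sub_zero] at h2
      have := κ.strictMono (show M (axisPoint 0 e) < v by linarith)
      rw [hκ, hκe] at this
      linarith
  calc m ^ 2 * ‖r • p‖ = m * (m * ‖r • p‖) := by ring
    _ < m * (m⁻¹ * e) := mul_lt_mul_of_pos_left (b'.trans_lt b3) hm
    _ = e := by field_simp

end IsFoliation

theorem StrictMonoOn.of_sign {a : ℝ} (ha : a = 1 ∨ a = -1) {f g : ℝ → ℝ} {I : Set ℝ}
    (hf : StrictMonoOn (fun t => a * f t) I)
    (hfg : ∀ t ∈ I, ∀ t' ∈ I, f t < f t' → g t < g t') : StrictMonoOn (fun t => a * g t) I := by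
  intro t ht t' ht' htt
  have := hf ht ht' htt
  rcases ha with rfl | rfl
  · simp only [one_mul] at this ⊢
    exact hfg t ht t' ht' this
  · have := hfg t' ht' t ht (by linarith)
    simp only
    linarith

namespace IsChart

variable {Z Z' : PiecewiseField} {a : ℝ} {i : Fin 2} {m m' ρ ρ' : ℝ} {N M N' M' : Plane → ℝ}
  {κ : ℝ ≃o ℝ}

open IsFoliation

/-- A radial map sends trajectories to trajectories. -/
theorem mapsTrajectories (C : IsChart Z a i m ρ N M) (C' : IsChart Z' a i m' ρ' N' M')
    {S S' : Set Plane} (hS : ∀ p ∈ S, ‖p‖ < ρ) (hS' : ∀ p ∈ S', ‖p‖ < ρ') {H : Plane → Plane}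
    (hH : Continuous H) (hHS : ∀ p ∈ S, H p ∈ S') {r : Plane → ℝ}
    (hr : ∀ p, IsFactor N M N' M' κ p (r p)) (hHr : ∀ p, H p = r p • p) :
    MapsTrajectories Z Z' S S' H := by
  have hcoord : ∀ p k, H p k = r p * p k := fun p k => by rw [hHr]; rfl
  have ha0 := C.sign_ne_zero
  rintro T σ hT (hσ | ⟨k, hσ⟩ | hσ)
  · -- Regular arcs.
    obtain ⟨hmono, s, hs, hsj, hleaf⟩ := C.regularArc hS ordConnected_Icc hσ
    have hsprod : ∀ t, σ t 0 * σ t 1 = (s * σ t i) * (s * σ t (i + 1)) := fun t => by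
      rw [coord_mul i]
      linear_combination (-(σ t i * σ t (i + 1))) * IsFoliation.sq_of_sign hs
    have hpos_iff : ∀ t ∈ Icc 0 T, 0 ≤ σ t 0 * σ t 1 ↔ 0 ≤ s * σ t i := fun t ht => by
      rw [hsprod]; exact mul_nonneg_iff_of_pos_right (hsj t ht)
    have hneg_iff : ∀ t ∈ Icc 0 T, σ t 0 * σ t 1 ≤ 0 ↔ s * σ t i ≤ 0 := fun t ht => by
      rw [hsprod]
      exact ⟨fun h => nonpos_of_mul_nonpos_left h (hsj t ht),
        fun h => mul_nonpos_of_nonpos_of_nonneg h (hsj t ht).le⟩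
    have hcont : ContinuousOn (fun t => H (σ t)) (Icc 0 T) := hH.comp_continuousOn hσ.continuousOn
    have hball : ∀ t ∈ Icc 0 T, ‖H (σ t)‖ < ρ' := fun t ht => hS' _ (hHS _ (hσ.mem t ht))
    have hmono' : StrictMonoOn (fun t => a * H (σ t) i) (Icc 0 T) := by
      refine StrictMonoOn.of_sign C.sign hmono fun t ht t' ht' hlt => ?_
      rw [hcoord, hcoord]
      -- In a closed quadrant the order of the `i`-th coordinates is kept because the two points are on
      -- a leaf; in different quadrants the signs decide.
      rcases le_or_gt 0 (σ t i * σ t' i) with hp | hp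
      · refine IsFactor.coord_lt C.toIsFoliation C'.toIsFoliation (hr _) (hr _) (fun k => ?_)
          ⟨fun h1 h2 => (hleaf t ht t' ht').1 ((hpos_iff t ht).1 h1) ((hpos_iff t' ht').1 h2),
            fun h1 h2 => (hleaf t ht t' ht').2 ((hneg_iff t ht).1 h1) ((hneg_iff t' ht').1 h2)⟩ hlt
        rcases fin_two_cases i k with rfl | rfl
        · exact hp
        · have h1 := mul_pos (hsj t ht) (hsj t' ht')
          have h2 := IsFoliation.sq_of_sign hs
          have : σ t (i + 1) * σ t' (i + 1) = s * σ t (i + 1) * (s * σ t' (i + 1)) := by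
            linear_combination (-(σ t (i + 1) * σ t' (i + 1))) * h2
          rw [this]; exact h1.le
      · have h1 : σ t i < 0 := by
          by_contra! h; nlinarith
        have h2 : 0 < σ t' i := by
          by_contra! h; nlinarith
        have h3 := mul_neg_of_pos_of_neg (hr (σ t)).1 h1
        have h4 := mul_pos (hr (σ t')).1 h2
        linarith
    have hsj' : ∀ t ∈ Icc 0 T, 0 < s * H (σ t) (i + 1) := fun t ht => by
      rw [hcoord, mul_left_comm]
      exact mul_pos (hr _).1 (hsj t ht)
    have hleaf' : StaysOnLeaves N' M' i s (Icc 0 T) fun t => H (σ t) := by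
      intro t ht t' ht'
      have e : ∀ u, s * H (σ u) i = r (σ u) * (s * σ u i) := fun u => by rw [hcoord]; ring
      simp only [e]
      refine ⟨fun h1 h2 => ?_, fun h1 h2 => ?_⟩
      · have h1 := (mul_nonneg_iff_of_pos_left (hr _).1).1 h1
        have h2 := (mul_nonneg_iff_of_pos_left (hr _).1).1 h2
        rw [hHr, hHr, (hr _).2.1 ((hpos_iff t ht).2 h1), (hr _).2.1 ((hpos_iff t' ht').2 h2),
          (hleaf t ht t' ht').1 h1 h2]
      · have h1 := nonpos_of_mul_nonpos_right h1 (hr _).1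
        have h2 := nonpos_of_mul_nonpos_right h2 (hr _).1
        rw [hHr, hHr, (hr _).2.2 ((hneg_iff t ht).2 h1), (hr _).2.2 ((hneg_iff t' ht').2 h2),
          (hleaf t ht t' ht').2 h1 h2]
    obtain ⟨τ, h0, hτ, hmem, hc, harc⟩ := C'.exists_arc hT hcont hball hmono' hs
      (fun t ht => (hsj' t ht).le) hleaf'
    refine ⟨τ T, fun u => H (σ (τ.symm u)), τ, hτ, Or.inl (harc _ subset_rfl _
      (fun u hu => hHS _ (hσ.mem _ (hmem u hu))) fun u hu h => ?_), τ.continuous.continuousOn,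
      τ.strictMono.strictMonoOn _, ?_, fun t ht => by simp only [OrderIso.symm_apply_apply]⟩
    · have := hsj' _ (hmem u hu)
      rw [h, mul_zero] at this
      exact lt_irrefl _ this
    · rw [OrderIso.image_Icc, h0]
  · -- Sliding arcs.
    have hk : ∀ t ∈ Icc 0 T, k = i + 1 ∧ σ t (i + 1) = 0 := fun t ht =>
      (C.isSlidingPoint_iff (hS _ (hσ.mem t ht)) k).1 (hσ.sliding t ht)
    obtain rfl := (hk 0 ⟨le_rfl, hT⟩).1
    have hax : ∀ t ∈ Icc 0 T, σ t = axisPoint i (σ t i) := fun t ht => eq_axisPoint (hk t ht).2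
    have hcσ : ContinuousOn σ (Icc 0 T) := fun t ht => (hσ.deriv t ht).continuousWithinAt
    have hdi : ∀ t ∈ Icc 0 T, HasDerivWithinAt (fun t => a * σ t i)
        (a * slidingField Z (i + 1) (σ t)) (Icc 0 T) t := fun t ht => by
      have := (hasDerivWithinAt_pi.1 (hσ.deriv t ht) i).const_mul a
      rwa [fin_two_add, axisPoint_self] at this
    have hmono : StrictMonoOn (fun t => a * σ t i) (Icc 0 T) := by
      refine strictMonoOn_of_deriv_pos (convex_Icc 0 T)
        (fun t ht => (hdi t ht).continuousWithinAt) fun t ht => ?_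
      rw [interior_Icc] at ht
      rw [((hdi t ⟨ht.1.le, ht.2.le⟩).hasDerivAt (Icc_mem_nhds ht.1 ht.2)).deriv]
      exact C.slidingField_pos (hS _ (hσ.mem t ⟨ht.1.le, ht.2.le⟩))
    have hcont : ContinuousOn (fun t => H (σ t)) (Icc 0 T) := hH.comp_continuousOn hcσ
    have hball : ∀ t ∈ Icc 0 T, ‖H (σ t)‖ < ρ' := fun t ht => hS' _ (hHS _ (hσ.mem t ht))
    have hj' : ∀ t ∈ Icc 0 T, H (σ t) (i + 1) = 0 := fun t ht => by
      rw [hcoord, (hk t ht).2, mul_zero]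
    have hmono' : StrictMonoOn (fun t => a * H (σ t) i) (Icc 0 T) := by
      refine StrictMonoOn.of_sign C.sign hmono fun t ht t' ht' hlt => ?_
      rw [hcoord, hcoord]
      have key : ∀ {p p' : Plane}, p = axisPoint i (p i) → p' = axisPoint i (p' i) →
          p i < p' i → r p * p i < r p' * p' i := fun {p p'} hp hp' hlt => by
        have h1 := hr p
        have h2 := hr p'
        rw [hp] at h1
        rw [hp'] at h2
        have := h1.coord_lt_axis C.toIsFoliation C'.toIsFoliation h2 hlt
        rwa [← hp, ← hp'] at this
      exact key (hax t ht) (hax t' ht') hlt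
    have hsp : ContinuousOn (fun t => a * slidingField Z' (i + 1) (H (σ t))) (Icc 0 T) :=
      fun t ht => continuousWithinAt_const.mul
        (ContinuousAt.comp_continuousWithinAt (g := slidingField Z' (i + 1))
          (C'.continuousAt_slidingField (hball t ht)) (hcont t ht))
    have hspos : ∀ t ∈ Icc 0 T, 0 < a * slidingField Z' (i + 1) (H (σ t)) := fun t ht =>
      C'.slidingField_pos (hball t ht)
    -- There is a single speed here, so the switch is put after the end of the interval.
    obtain ⟨τ, h0, hτ, hder⟩ := exists_clock (f := fun t => a * H (σ t) i) (T + 1) hT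
      (continuousOn_const.mul ((continuous_apply i).comp_continuousOn hcont)) hmono' hsp hsp hspos
      hspos
    have hmem : ∀ u ∈ Icc 0 (τ T), τ.symm u ∈ Icc 0 T := fun u hu => by
      constructor
      · rw [← OrderIso.symm_apply_apply τ 0, h0]
        exact τ.symm.monotone hu.1
      · rw [← OrderIso.symm_apply_apply τ T]
        exact τ.symm.monotone hu.2
    refine ⟨τ T, fun u => H (σ (τ.symm u)), τ, hτ, Or.inr (Or.inl ⟨i + 1,
      fun u hu => hHS _ (hσ.mem _ (hmem u hu)), fun u hu => ?_, fun u hu => ?_⟩),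
      τ.continuous.continuousOn, τ.strictMono.strictMonoOn _, ?_,
      fun t ht => by simp only [OrderIso.symm_apply_apply]⟩
    · exact (C'.isSlidingPoint_iff (hball _ (hmem u hu)) _).2 ⟨rfl, hj' _ (hmem u hu)⟩
    · refine hasDerivWithinAt_pi.2 fun k => ?_
      rw [fin_two_add]
      rcases fin_two_cases i k with rfl | rfl
      · rw [axisPoint_self]
        have := ((hder u hu).1 (by linarith [(hmem u hu).2])).const_mul a⁻¹
        simpa [← mul_assoc, inv_mul_cancel₀ ha0] using this
      · rw [axisPoint_succ]
        exact (hasDerivWithinAt_const u _ (0 : ℝ)).congr (fun v hv => hj' _ (hmem v hv))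
          (hj' _ (hmem u hu))
    · rw [OrderIso.image_Icc, h0]
  · -- The origin is not a singular point.
    exact (lt_asymm (hσ.2.1 i) (C.crossing (p := 0) (by rw [norm_zero]; exact C.rad_pos))).elim

theorem noTangency (C : IsChart Z a i m ρ N M) {W : Set Plane} (hW : ∀ p ∈ W, ‖p‖ < ρ) :
    NoTangency Z W := by
  intro p hp k _
  have h : Z.X p k * Z.Y p k ≠ 0 := by
    rcases fin_two_cases i k with rfl | rfl
    exacts [(C.crossing (hW p hp)).ne', (C.sliding (hW p hp)).ne]
  exact ⟨left_ne_zero_of_mul h, right_ne_zero_of_mul h⟩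

theorem orientationPreserving_of_radial {H : Plane → Plane} {r : Plane → ℝ} (hr : ∀ p, 0 < r p)
    (hH : ∀ p, H p = r p • p) : OrientationPreserving H := by
  filter_upwards [self_mem_nhdsWithin] with s hs
  have hs : 0 < s := hs
  refine ⟨id, fun t => r ![s * Real.cos t, s * Real.sin t] * s, continuous_id,
    fun t => mul_pos (hr _) hs, fun t => ?_, by simp⟩
  have h0 : H 0 = 0 := by rw [hH, smul_zero]
  simp only [h0, sub_zero, hH ![s * Real.cos t, s * Real.sin t]]
  ext k
  fin_cases k
  · simp [mul_assoc]
  · simp [mul_assoc]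

/-- Two fields with charts of the same type, whose half-return maps are conjugate by `κ`, are
locally `Σ`-equivalent. The size of the domain depends only on the size of the charts, on the slopes
of the first integrals, and on a fixed point `e` of `κ`. -/
theorem exists_sigmaEquivalence (C : IsChart Z a i m ρ N M) (C' : IsChart Z' a i m ρ N' M')
    (h0 : κ 0 = 0) (hκ : ∀ x, κ (M (axisPoint 0 x)) = M' (axisPoint 0 (κ x))) {e : ℝ} (he : 0 < e)
    (hκe : κ e = e) (heρ : e < m ^ 2 * ρ) : ∃ h : OpenPartialHomeomorph Plane Plane,
      Metric.ball 0 (m ^ 2 * e) ⊆ h.source ∧ Metric.ball 0 (m ^ 2 * e) ⊆ h.target ∧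
        IsSigmaEquivalence Z Z' h := by
  obtain ⟨H, r, r', hr, hHr, hr', hHr'⟩ := exists_radial_homeo C.toIsFoliation C'.toIsFoliation h0 hκ
  have hm := C.pos
  have hm1 := C.le_one
  have hm2 : 0 < m ^ 2 := by positivity
  have hsmall : m ^ 2 * e < ρ := by
    have h1 : m ^ 2 ≤ 1 := pow_le_one₀ hm.le hm1
    have := C.rad_pos
    nlinarith
  have hκ' : ∀ x, κ.symm (M' (axisPoint 0 x)) = M (axisPoint 0 (κ.symm x)) := fun x => by
    rw [OrderIso.symm_apply_eq, hκ, OrderIso.apply_symm_apply]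
  -- The domain consists of the points of the disc whose image is in the disc. It is star-shaped,
  -- because the radial map is increasing along the rays.
  set S : Set Plane := {p | ‖p‖ < ρ ∧ ‖H p‖ < ρ} with hS
  have hSo : IsOpen S := (isOpen_lt continuous_norm continuous_const).inter
    (isOpen_lt (continuous_norm.comp H.continuous) continuous_const)
  set h := H.toOpenPartialHomeomorphOfImageEq S hSo (H.symm ⁻¹' S) (H.toEquiv.image_eq_preimage_symm S)
    with hh
  have hsrc : h.source = S := rfl
  have htgt : h.target = H.symm ⁻¹' S := rfl
  have hz : H 0 = 0 := by rw [hHr, smul_zero]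
  have htn : ∀ p ∈ H.symm ⁻¹' S, ‖p‖ < ρ := fun p hp => by
    have := hp.2
    rwa [Homeomorph.apply_symm_apply] at this
  have hb : ∀ {p : Plane}, p ∈ Metric.ball (0 : Plane) (m ^ 2 * e) → ‖p‖ < m ^ 2 * e := fun hp => by
    rwa [mem_ball_zero_iff] at hp
  have hzS : (0 : Plane) ∈ S := by
    rw [hS, mem_ofPred_eq, hz, norm_zero]
    exact ⟨C.rad_pos, C.rad_pos⟩
  refine ⟨h, fun p hp => ?_, fun p hp => ?_, ⟨?_, ?_, hzS, hz, ?_, ?_, ?_, ?_, ?_, ?_, ?_⟩⟩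
  · refine ⟨(hb hp).trans hsmall, ?_⟩
    have := (hr p).norm_lt C.toIsFoliation C'.toIsFoliation hκ he hκe (hb hp)
    rw [← hHr] at this
    exact lt_of_mul_lt_mul_left (this.trans heρ) hm2.le
  · change ‖H.symm p‖ < ρ ∧ ‖H (H.symm p)‖ < ρ
    rw [Homeomorph.apply_symm_apply]
    refine ⟨?_, (hb hp).trans hsmall⟩
    have := (hr' p).norm_lt C'.toIsFoliation C.toIsFoliation hκ' he
      (by rw [OrderIso.symm_apply_eq, hκe]) (hb hp)
    rw [← hHr'] at this
    exact lt_of_mul_lt_mul_left (this.trans heρ) hm2.le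
  · exact fun p hp => C.mem_dom p hp.1
  · exact fun p hp => C'.mem_dom p (htn p hp)
  · have hstar : StarConvex ℝ 0 S := by
      rw [starConvex_zero_iff]
      intro p hp θ hθ hθ1
      by_cases hp0 : p = 0
      · rw [hp0, smul_zero]; exact hzS
      refine ⟨?_, ?_⟩
      · rw [norm_smul, Real.norm_of_nonneg hθ]
        exact (mul_le_of_le_one_left (norm_nonneg _) hθ1).trans_lt hp.1
      · refine lt_of_le_of_lt ?_ hp.2
        rw [hHr, hHr, smul_smul, norm_smul, norm_smul,
          Real.norm_of_nonneg (mul_nonneg (hr _).1.le hθ), Real.norm_of_nonneg (hr _).1.le]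
        exact mul_le_mul_of_nonneg_right ((hr p).mul_le C.toIsFoliation C'.toIsFoliation hp0 hθ hθ1
          (hr _)) (norm_nonneg _)
    exact (hstar.isPathConnected hzS).isConnected
  · exact C.noTangency fun p hp => hp.1
  · exact C'.noTangency htn
  · exact orientationPreserving_of_radial (fun p => (hr p).1) hHr
  · intro p _
    change H p ∈ SwitchingSet ↔ _
    rw [mem_SwitchingSet_iff 0, mem_SwitchingSet_iff 0, hHr]
    simp [(hr p).1.ne']
  · exact C.mapsTrajectories (κ := κ) C' (fun p hp => hp.1) htn H.continuous
      (fun p hp => by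
        change H.symm (H p) ∈ S
        rwa [Homeomorph.symm_apply_apply]) hr hHr
  · exact C'.mapsTrajectories (κ := κ.symm) C htn (fun p hp => hp.1) H.symm.continuous
      (fun p hp => hp) hr' hHr'

end IsChart

end Equivalence


/-! ### Transition maps -/

section Transition

theorem continuous_axisPoint (k : Fin 2) : Continuous (axisPoint k) := by
  refine continuous_pi fun l => ?_
  rcases fin_two_cases k l with rfl | rfl
  · simpa only [axisPoint_self] using continuous_id'
  · simpa only [axisPoint_succ] using continuous_const

theorem hasSlope_sum : HasSlope (fun p => p 0 + p 1) (1 / 2) := by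
  intro p q hpq
  have h0 := hpq 0
  have h1 := hpq 1
  have e0 : q 0 - p 0 ≤ ‖q - p‖ := (le_abs_self _).trans (norm_le_pi_norm (q - p) 0)
  have e1 : q 1 - p 1 ≤ ‖q - p‖ := (le_abs_self _).trans (norm_le_pi_norm (q - p) 1)
  have e2 : ‖q - p‖ ≤ (q 0 - p 0) + (q 1 - p 1) := by
    refine (pi_norm_le_iff_of_nonneg (by linarith)).2 fun k => ?_
    rw [Pi.sub_apply, Real.norm_eq_abs, abs_of_nonneg (sub_nonneg.2 (hpq k))]
    fin_cases k <;> simp <;> linarith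
  constructor
  · have := norm_nonneg (q - p)
    linarith
  · norm_num
    linarith

/-- The part in the quadrant with signs `s`, `t` of a leaf, as a curve from `Σ₂` to `Σ₁` along
which both coordinates are monotone. -/
theorem IsFoliation.exists_leaf_curve {N M : Plane → ℝ} {m : ℝ} (h : IsFoliation N M m) {s t : ℝ}
    (hs : s = 1 ∨ s = -1) (ht : t = 1 ∨ t = -1) {v : ℝ} (hv : 0 < v) :
    ∃ c : ℝ → Plane, ContinuousOn c (Icc 0 1) ∧ (∀ θ ∈ Icc (0 : ℝ) 1, 0 ≤ rescale s t (c θ) ∧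
      t * (if 0 < s * t then N else M) (c θ) = v ∧ m * ‖c θ‖ ≤ v) ∧ c 0 1 = 0 ∧ c 1 0 = 0 ∧
      StrictAntiOn (fun θ => s * c θ 0) (Icc 0 1) ∧ StrictMonoOn (fun θ => t * c θ 1) (Icc 0 1) := by
  have g := h.onQuadrant_slope hs ht
  obtain ⟨l, hl, hl'⟩ := g.exists_radius h.pos (h.onQuadrant_zero s t) (τ := fun _ => v)
    continuousOn_const fun _ _ _ => hv
  -- The rays of the quadrant are parametrized by the segment `p 0 + p 1 = 1`, each of them meets the
  -- leaf once, and monotonicity on the segment passes to the leaf.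
  set d : ℝ → Plane := fun θ => ![1 - θ, θ] with hd
  have hdc : Continuous d := continuous_pi fun k => by fin_cases k <;> simp [hd] <;> fun_prop
  have hd0 : ∀ θ ∈ Icc (0 : ℝ) 1, 0 ≤ d θ := fun θ hθ k => by
    fin_cases k
    · simpa [hd] using hθ.2
    · simpa [hd] using hθ.1
  have hdn : ∀ θ, d θ ≠ 0 := fun θ h0 => by
    have h1 := congrFun h0 0
    have h2 := congrFun h0 1
    simp [hd] at h1 h2
    linarith
  have hleaf : ∀ θ ∈ Icc (0 : ℝ) 1, onQuadrant N M s t (l (d θ) • d θ) = v :=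
    fun θ hθ => (hl' _ (hd0 θ hθ) (hdn θ)).2
  have hpos : ∀ θ ∈ Icc (0 : ℝ) 1, 0 < l (d θ) := fun θ hθ => (hl' _ (hd0 θ hθ) (hdn θ)).1
  have hlt : ∀ θ ∈ Icc (0 : ℝ) 1, ∀ θ' ∈ Icc (0 : ℝ) 1, ∀ k, d θ k < d θ' k →
      l (d θ) * d θ k < l (d θ') * d θ' k := fun θ hθ θ' hθ' k hk =>
    hasSlope_sum.coord_lt_of_leaf (by norm_num) g h.pos (hd0 θ hθ) (hd0 θ' hθ') (by simp [hd])
      (hpos θ hθ) ((hleaf θ hθ).trans (hleaf θ' hθ').symm) hk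
  have hrr : ∀ p, rescale s t (rescale s t p) = p := rescale_rescale (sq_of_sign hs) (sq_of_sign ht)
  refine ⟨fun θ => rescale s t (l (d θ) • d θ), ?_, fun θ hθ => ⟨?_, ?_, ?_⟩, ?_, ?_, ?_, ?_⟩
  · have hld : ContinuousOn (fun θ => l (d θ)) (Icc 0 1) :=
      hl.comp hdc.continuousOn fun θ hθ => ⟨hd0 θ hθ, hdn θ⟩
    exact (continuous_rescale s t).comp_continuousOn
      (show ContinuousOn (fun θ => l (d θ) • d θ) (Icc 0 1) from hld.smul hdc.continuousOn)
  · rw [hrr]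
    exact smul_nonneg (hpos θ hθ).le (hd0 θ hθ)
  · exact hleaf θ hθ
  · rw [norm_rescale hs ht]
    have := (g.bounds (h.onQuadrant_zero s t) (smul_nonneg (hpos θ hθ).le (hd0 θ hθ))).1
    rwa [hleaf θ hθ] at this
  · simp [hd]
  · simp [hd]
  · intro θ hθ θ' hθ' hlt'
    have := hlt θ' hθ' θ hθ 0 (by simpa [hd] using hlt')
    simpa [← mul_assoc, sq_of_sign hs] using this
  · intro θ hθ θ' hθ' hlt'
    have := hlt θ hθ θ' hθ' 1 (by simpa [hd] using hlt')
    simpa [← mul_assoc, sq_of_sign ht] using this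

theorem mem_closure_Upos {p : Plane} (h : 0 ≤ p 0 * p 1) : p ∈ closure Upos := by
  obtain ⟨s, hs, h0, h1⟩ : ∃ s : ℝ, s * s = 1 ∧ 0 ≤ s * p 0 ∧ 0 ≤ s * p 1 := by
    rcases mul_nonneg_iff.1 h with ⟨h0, h1⟩ | ⟨h0, h1⟩
    · exact ⟨1, by norm_num, by linarith, by linarith⟩
    · exact ⟨-1, by norm_num, by linarith, by linarith⟩
  have hlim : Tendsto (fun ε : ℝ => p + ε • (![s, s] : Plane)) (𝓝[>] 0) (𝓝 p) := by
    have : Continuous fun ε : ℝ => p + ε • (![s, s] : Plane) := by fun_prop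
    have h2 := this.tendsto 0
    rw [zero_smul, add_zero] at h2
    exact h2.mono_left nhdsWithin_le_nhds
  refine mem_closure_of_tendsto hlim ?_
  filter_upwards [self_mem_nhdsWithin] with ε hε
  have hε : 0 < ε := hε
  have : (p + ε • (![s, s] : Plane)) 0 * (p + ε • (![s, s] : Plane)) 1 =
      (s * p 0 + ε) * (s * p 1 + ε) := by
    simp
    linear_combination (ε ^ 2 - p 0 * p 1) * hs
  rw [Upos, mem_ofPred_eq, this]
  exact mul_pos (by linarith) (by linarith)

theorem mem_closure_Uneg {p : Plane} (h : p 0 * p 1 ≤ 0) : p ∈ closure Uneg := by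
  have h1 : rescale (-1) 1 p ∈ closure Upos := mem_closure_Upos (by simpa using h)
  have h2 := image_closure_subset_closure_image (continuous_rescale (-1) 1)
    (mem_image_of_mem (rescale (-1) 1) h1)
  rw [rescale_rescale (by norm_num) (by norm_num)] at h2
  refine closure_mono ?_ h2
  rintro _ ⟨q, hq, rfl⟩
  have hq : 0 < q 0 * q 1 := hq
  change rescale (-1) 1 q 0 * rescale (-1) 1 q 1 < 0
  simpa using hq

theorem Transit.mono {V : Plane → Plane} {S W W' : Set Plane} {i : Fin 2} {x y : ℝ} (hW : W ⊆ W')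
    (h : Transit V S W i x y) : Transit V S W' i x y := by
  obtain ⟨T, σ, h0, h1, h2⟩ := h
  exact ⟨T, σ, h0, h1, fun t ht => ⟨⟨hW (h2 t ht).1.1, (h2 t ht).1.2⟩, (h2 t ht).2⟩⟩

theorem transit_of_backward {V : Plane → Plane} {S W : Set Plane} {i : Fin 2} {x y T : ℝ}
    {σ : ℝ → Plane} (hT : 0 ≤ T) (h0 : σ T = axisPoint (i + 1) x) (h1 : σ 0 = axisPoint i y)
    (h : ∀ t ∈ Icc 0 T, σ t ∈ W ∩ closure S ∧ HasDerivWithinAt σ (V (σ t)) (Icc 0 T) t) :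
    Transit V S W i x y := by
  have hu : uIcc 0 (-T) = Icc (-T) 0 := by rw [uIcc_comm, uIcc_of_le (by linarith)]
  refine ⟨-T, fun t => σ (t + T), by simpa using h0, by simpa using h1, fun t ht => ?_⟩
  rw [hu] at ht ⊢
  obtain ⟨h2, h3⟩ := h (t + T) ⟨by linarith [ht.1], by linarith [ht.2]⟩
  refine ⟨h2, ?_⟩
  have hm : MapsTo (fun u => id u + T) (Icc (-T) 0) (Icc 0 T) := fun u hu =>
    ⟨by simp only [id]; linarith [hu.1], by simp only [id]; linarith [hu.2]⟩
  have := h3.scomp t (((hasDerivAt_id t).add_const T).hasDerivWithinAt (s := Icc (-T) 0)) hm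
  simpa [Function.comp_def] using this

theorem StrictMonoOn.comp_one_sub {f : ℝ → ℝ} (hf : StrictAntiOn f (Icc 0 1)) :
    StrictMonoOn (fun θ => f (1 - θ)) (Icc 0 1) := fun u hu v hv huv =>
  hf ⟨by linarith [hv.2], by linarith [hv.1]⟩ ⟨by linarith [hu.2], by linarith [hu.1]⟩
    (by linarith)

namespace IsChart

variable {Z : PiecewiseField} {a : ℝ} {i : Fin 2} {m ρ : ℝ} {N M : Plane → ℝ}

/-- The orbits through a quadrant, between points of the two branches on the same leaf. -/
theorem exists_transit (C : IsChart Z a i m ρ N M) {s t : ℝ} (hs : s = 1 ∨ s = -1)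
    (ht : t = 1 ∨ t = -1) {x y R : ℝ} (hR : R ≤ ρ) (hy : 0 < t * y) {V : Plane → Plane}
    {F : Plane → ℝ} {S : Set Plane} (hV : 0 < s * t ∧ V = Z.X ∧ F = N ∧ S = Upos ∨
      s * t < 0 ∧ V = Z.Y ∧ F = M ∧ S = Uneg)
    (hF : F (axisPoint 0 x) = F (axisPoint 1 y)) (hsm : t * F (axisPoint 1 y) < m * R) :
    Transit V S (Metric.ball 0 R) 1 x y ∧ Transit V S (Metric.ball 0 R) 0 y x := by
  have hFe : F = if 0 < s * t then N else M := by
    rcases hV with ⟨h, -, e, -⟩ | ⟨h, -, e, -⟩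
    · rw [if_pos h, e]
    · rw [if_neg h.not_gt, e]
  have hFN : ∀ w, F (axisPoint 1 w) = N (axisPoint 1 w) := fun w => by
    rcases hV with ⟨-, -, e, -⟩ | ⟨-, -, e, -⟩
    · rw [e]
    · rw [e, C.eq_axis]
  have hs0 : s ≠ 0 := by rcases hs with rfl | rfl <;> norm_num
  have ht0 : t ≠ 0 := by rcases ht with rfl | rfl <;> norm_num
  have hax : StrictMono fun w => N (axisPoint 1 w) := fun u w huw =>
    C.slope.strictMono C.pos (lt_of_le_of_ne (fun k => by
      fin_cases k <;> simp [axisPoint, huw.le]) fun e => by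
        have := congrFun e 1
        simp [axisPoint] at this
        exact huw.ne this)
  have hv : 0 < t * F (axisPoint 1 y) := by
    rw [hFN]
    have h0 : N (axisPoint 1 0) = 0 := by rw [axisPoint_zero, C.map_zero]
    rcases ht with rfl | rfl
    · have := hax (show 0 < y by linarith)
      simp only [h0] at this
      linarith
    · have := hax (show y < 0 by linarith)
      simp only [h0] at this
      linarith
  obtain ⟨c, hc, hcq, hc0, hc1, hanti, hmono⟩ := C.exists_leaf_curve hs ht hv
  rw [← hFe] at hcq
  have z : (0 : ℝ) ∈ Icc (0 : ℝ) 1 := ⟨le_rfl, zero_le_one⟩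
  have o : (1 : ℝ) ∈ Icc (0 : ℝ) 1 := ⟨zero_le_one, le_rfl⟩
  -- The ends of the leaf are the two given points: they are on the axes and on the same leaf.
  have hinj : Function.Injective fun w => F (axisPoint 0 w) := by
    rcases hV with ⟨-, -, e, -⟩ | ⟨-, -, e, -⟩
    · intro u w huw
      simpa [e, C.axis] using huw
    · rw [e]
      exact C.half_return_strictAnti.injective
  have hstart : c 0 = axisPoint 0 x := by
    have e := eq_axisPoint_zero hc0
    rw [e]
    congr 1
    refine hinj ?_
    change F _ = F _
    rw [← e, hF]
    exact mul_left_cancel₀ ht0 (hcq 0 z).2.1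
  have hend : c 1 = axisPoint 1 y := by
    have e := eq_axisPoint_one hc1
    rw [e]
    congr 1
    refine hax.injective ?_
    rw [← hFN, ← hFN, ← e]
    exact mul_left_cancel₀ ht0 (hcq 1 o).2.1
  have hball : ∀ θ ∈ Icc (0 : ℝ) 1, ‖c θ‖ < R := fun θ hθ =>
    lt_of_mul_lt_mul_left ((hcq θ hθ).2.2.trans_lt hsm) C.pos.le
  have hclos : ∀ θ ∈ Icc (0 : ℝ) 1, c θ ∈ closure S := fun θ hθ => by
    have h1 := IsFoliation.product_nonneg_of_rescale (hcq θ hθ).1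
    rcases hV with ⟨h, -, -, e⟩ | ⟨h, -, -, e⟩
    · rw [e]
      exact mem_closure_Upos ((mul_nonneg_iff_of_pos_left h).1 h1)
    · rw [e]
      refine mem_closure_Uneg ?_
      by_contra! h2
      have := mul_neg_of_neg_of_pos h h2
      linarith
  have hleaf : ∀ p, ‖p‖ < R → HasLeaf V F p := fun p hp => by
    rcases hV with ⟨-, e, e', -⟩ | ⟨-, e, e', -⟩
    · rw [e, e']; exact C.leaf_X p (hp.trans_le hR)
    · rw [e, e']; exact C.leaf_Y p (hp.trans_le hR)
  have hcross : ∀ p, ‖p‖ < R → 0 < a * V p i := fun p hp => by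
    rcases hV with ⟨-, e, -, -⟩ | ⟨-, e, -, -⟩
    · rw [e]; exact C.crossing_X p (hp.trans_le hR)
    · rw [e]; exact C.crossing_Y p (hp.trans_le hR)
  -- The orbit which runs through a monotone parametrization of the leaf.
  have orbit : ∀ b : ℝ → Plane, ContinuousOn b (Icc 0 1) → (∀ θ ∈ Icc (0 : ℝ) 1,
      ∃ θ' ∈ Icc (0 : ℝ) 1, b θ = c θ') → StrictMonoOn (fun θ => a * b θ i) (Icc 0 1) →
      ∃ (T : ℝ) (σ : ℝ → Plane), 0 ≤ T ∧ σ 0 = b 0 ∧ σ T = b 1 ∧ ∀ u ∈ Icc 0 T,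
        σ u ∈ Metric.ball 0 R ∩ closure S ∧ HasDerivWithinAt σ (V (σ u)) (Icc 0 T) u := by
    intro b hb hbc hbm
    have hbb : ∀ θ ∈ Icc (0 : ℝ) 1, ‖b θ‖ < R := fun θ hθ => by
      obtain ⟨θ', hθ', e⟩ := hbc θ hθ
      rw [e]; exact hball θ' hθ'
    have hbF : ∀ θ ∈ Icc (0 : ℝ) 1, t * F (b θ) = t * F (axisPoint 1 y) := fun θ hθ => by
      obtain ⟨θ', hθ', e⟩ := hbc θ hθ
      rw [e]; exact (hcq θ' hθ').2.1
    have hconst : ∀ θ ∈ Icc (0 : ℝ) 1, ∀ θ' ∈ Icc (0 : ℝ) 1, F (b θ) = F (b θ') :=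
      fun θ hθ θ' hθ' => mul_left_cancel₀ ht0 ((hbF θ hθ).trans (hbF θ' hθ').symm)
    -- There is a single field; the switching time `2` is beyond the end of the leaf.
    obtain ⟨τ, h0, hτ, hmem, -, hder⟩ := exists_orbit_of_leaf (V₁ := V) (V₂ := V) (N₁ := F)
      (N₂ := F) 2 C.sign_ne_zero zero_le_one hb hbm (fun θ hθ => hleaf _ (hbb θ hθ))
      (fun θ hθ => hleaf _ (hbb θ hθ)) (fun θ hθ => hcross _ (hbb θ hθ))
      (fun θ hθ => hcross _ (hbb θ hθ)) (fun θ hθ θ' hθ' _ _ => hconst θ hθ θ' hθ')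
      (fun θ hθ θ' hθ' _ _ => hconst θ hθ θ' hθ')
    refine ⟨τ 1, fun u => b (τ.symm u), hτ, ?_, by simp, fun u hu => ⟨⟨?_, ?_⟩, ?_⟩⟩
    · simp only
      rw [← h0, OrderIso.symm_apply_apply, h0]
    · rw [mem_ball_zero_iff]; exact hbb _ (hmem u hu)
    · obtain ⟨θ', hθ', e⟩ := hbc _ (hmem u hu)
      change b (τ.symm u) ∈ _
      rw [e]; exact hclos θ' hθ'
    · exact (hder u hu).1 (by linarith [(hmem u hu).2])
  -- The leaf is run through in the direction of the field, so that one of the two transits goes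
  -- forward in time and the other one backward.
  have hdir : StrictMonoOn (fun θ => a * c θ i) (Icc 0 1) ∨
      StrictAntiOn (fun θ => a * c θ i) (Icc 0 1) := by
    have key : ∀ k, StrictMonoOn (fun θ => c θ k) (Icc 0 1) ∨
        StrictAntiOn (fun θ => c θ k) (Icc 0 1) := fun k => by
      fin_cases k
      · rcases hs with rfl | rfl
        · right; simpa using hanti
        · left; intro u hu w hw huw
          have := hanti hu hw huw
          simp only [Fin.zero_eta] at this ⊢
          linarith
      · rcases ht with rfl | rfl
        · left; simpa using hmono
        · right; intro u hu w hw huw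
          have := hmono hu hw huw
          simp only [Fin.mk_one] at this ⊢
          linarith
    rcases C.sign with e | e <;> rcases key i with h | h
    · left; simpa [e] using h
    · right; simpa [e] using h
    · right; intro u hu w hw huw
      have := h hu hw huw
      simp only [e] at this ⊢
      linarith
    · left; intro u hu w hw huw
      have := h hu hw huw
      simp only [e] at this ⊢
      linarith
  rcases hdir with h | h
  · obtain ⟨T, σ, hT, h0, h1, h2⟩ := orbit c hc (fun θ hθ => ⟨θ, hθ, rfl⟩) h
    rw [hstart] at h0
    rw [hend] at h1
    refine ⟨⟨T, σ, h0, h1, ?_⟩, transit_of_backward hT h1 h0 h2⟩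
    rwa [uIcc_of_le hT]
  · obtain ⟨T, σ, hT, h0, h1, h2⟩ := orbit (fun θ => c (1 - θ))
      (hc.comp (by fun_prop) fun θ hθ => ⟨by linarith [hθ.2], by linarith [hθ.1]⟩)
      (fun θ hθ => ⟨1 - θ, ⟨by linarith [hθ.2], by linarith [hθ.1]⟩, rfl⟩)
      (StrictMonoOn.comp_one_sub h)
    simp only [sub_zero, sub_self] at h0 h1
    rw [hend] at h0
    rw [hstart] at h1
    refine ⟨transit_of_backward hT h1 h0 h2, ⟨T, σ, h0, h1, ?_⟩⟩
    rwa [uIcc_of_le hT]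

/-- The points of `Σ` joined by an orbit of a field have the same value of its first integral. -/
theorem transit_leaf {V : Plane → Plane} {F : Plane → ℝ} {S W : Set Plane} {k : Fin 2} {x y : ℝ}
    (hF : ∀ p ∈ W, HasLeaf V F p) (h : Transit V S W k x y) :
    F (axisPoint (k + 1) x) = F (axisPoint k y) := by
  obtain ⟨T, σ, h0, h1, h2⟩ := h
  rw [← h0, ← h1]
  have key : ∀ {u v : ℝ}, u ≤ v → Icc u v = uIcc 0 T → F (σ u) = F (σ v) := fun {u v} huv e =>
    leaf_eq_of_deriv huv (fun t ht => by
        rw [e] at ht ⊢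
        exact (h2 t ht).2.continuousWithinAt)
      (fun t ht => hF _ (h2 t (e ▸ ht)).1.1) fun t ht => by
        have ht' : t ∈ Icc u v := ⟨ht.1.le, ht.2.le⟩
        refine (h2 t (e ▸ ht')).2.hasDerivAt ?_
        rw [← e]
        exact Icc_mem_nhds ht.1 ht.2
  rcases le_total 0 T with hT | hT
  · exact key hT (uIcc_of_le hT).symm
  · exact (key hT (uIcc_of_ge hT).symm).symm

theorem axis_one_strictMono (C : IsChart Z a i m ρ N M) : StrictMono fun w => N (axisPoint 1 w) :=
  fun u w huw => C.slope.strictMono C.pos (lt_of_le_of_ne (fun k => by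
      fin_cases k <;> simp [axisPoint, huw.le]) fun e => by
        have := congrFun e 1
        simp [axisPoint] at this
        exact huw.ne this)

theorem transit_self {V : Plane → Plane} {S W : Set Plane} {k : Fin 2} (hW : (0 : Plane) ∈ W)
    (hS : (0 : Plane) ∈ closure S) : Transit V S W k 0 0 := by
  refine ⟨0, fun _ => 0, by rw [axisPoint_zero], by rw [axisPoint_zero], fun t ht => ?_⟩
  rw [uIcc_self] at ht ⊢
  exact ⟨⟨hW, hS⟩, by rw [mem_singleton_iff.1 ht]; exact HasFDerivWithinAt.singleton⟩

/-- Since `N` is the coordinate on `Σ₂`, the transition map of `X` is the restriction of `N` to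
`Σ₁`. -/
theorem transit_X (C : IsChart Z a i m ρ N M) {R y : ℝ} (hR0 : 0 < R) (hR : R ≤ ρ)
    (hy : |N (axisPoint 1 y)| < m * R) :
    Transit Z.X Upos (Metric.ball 0 R) 0 y (N (axisPoint 1 y)) := by
  have h0 : N (axisPoint 1 0) = 0 := by rw [axisPoint_zero, C.map_zero]
  rw [abs_lt] at hy
  rcases lt_trichotomy y 0 with h | rfl | h
  · exact (C.exists_transit (Or.inr rfl) (Or.inr rfl) hR (by linarith)
      (Or.inl ⟨by norm_num, rfl, rfl, rfl⟩) (by rw [C.axis]) (by linarith [hy.1])).2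
  · rw [h0]
    exact transit_self (Metric.mem_ball_self hR0) (mem_closure_Upos (by simp))
  · exact (C.exists_transit (Or.inl rfl) (Or.inl rfl) hR (by linarith)
      (Or.inl ⟨by norm_num, rfl, rfl, rfl⟩) (by rw [C.axis]) (by linarith [hy.2])).2

theorem transit_Y (C : IsChart Z a i m ρ N M) {R x y : ℝ} (hR0 : 0 < R) (hR : R ≤ ρ)
    (hF : M (axisPoint 0 x) = M (axisPoint 1 y)) (hy : |M (axisPoint 1 y)| < m * R) :
    Transit Z.Y Uneg (Metric.ball 0 R) 1 x y := by
  have h0 : M (axisPoint 1 0) = 0 := by rw [axisPoint_zero, C.map_zero']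
  rw [abs_lt] at hy
  rcases lt_trichotomy y 0 with h | rfl | h
  · exact (C.exists_transit (Or.inl rfl) (Or.inr rfl) hR (by linarith)
      (Or.inr ⟨by norm_num, rfl, rfl, rfl⟩) hF (by linarith [hy.1])).1
  · have : x = 0 := C.half_return_strictAnti.injective (by
      rw [hF, h0, axisPoint_zero, C.map_zero'])
    rw [this]
    exact transit_self (Metric.mem_ball_self hR0) (mem_closure_Uneg (by simp))
  · exact (C.exists_transit (Or.inr rfl) (Or.inl rfl) hR (by linarith)
      (Or.inr ⟨by norm_num, rfl, rfl, rfl⟩) hF (by linarith [hy.2])).1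

theorem isTransitionMap_X (C : IsChart Z a i m ρ N M) :
    IsTransitionMap Z.X Upos 0 fun y => N (axisPoint 1 y) := by
  intro W hW
  obtain ⟨R, hR, hRW⟩ := Metric.mem_nhds_iff.1 hW
  have hR' : 0 < min R ρ := lt_min hR C.rad_pos
  have hc : ContinuousAt (fun y => |N (axisPoint 1 y)|) 0 := by
    have : Continuous fun y : ℝ => (axisPoint 1 y : Plane) := continuous_axisPoint 1
    exact (continuous_abs.comp (C.continuous.comp this)).continuousAt
  filter_upwards [hc.eventually_lt (continuousAt_const (y := m * min R ρ)) (by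
    simp only [axisPoint_zero, C.map_zero, abs_zero]
    exact mul_pos C.pos hR')] with y hy
  exact (C.transit_X hR' (min_le_right _ _) hy).mono
    ((Metric.ball_subset_ball (min_le_left _ _)).trans hRW)

theorem isTransitionMap_Y (C : IsChart Z a i m ρ N M) {g : ℝ → ℝ}
    (hg : ∀ᶠ x in 𝓝 0, M (axisPoint 0 x) = M (axisPoint 1 (g x))) :
    IsTransitionMap Z.Y Uneg 1 g := by
  intro W hW
  obtain ⟨R, hR, hRW⟩ := Metric.mem_nhds_iff.1 hW
  have hR' : 0 < min R ρ := lt_min hR C.rad_pos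
  have hc : ContinuousAt (fun y => |M (axisPoint 0 y)|) 0 := by
    have : Continuous fun y : ℝ => (axisPoint 0 y : Plane) := continuous_axisPoint 0
    exact (continuous_abs.comp (C.continuous'.comp this)).continuousAt
  filter_upwards [hg, hc.eventually_lt (continuousAt_const (y := m * min R ρ)) (by
    simp only [axisPoint_zero, C.map_zero', abs_zero]
    exact mul_pos C.pos hR')] with x hx hx'
  exact (C.transit_Y hR' (min_le_right _ _) hx (by rw [← hx]; exact hx')).mono
    ((Metric.ball_subset_ball (min_le_left _ _)).trans hRW)

theorem eventually_eq_of_isTransitionMap_X (C : IsChart Z a i m ρ N M) {f : ℝ → ℝ}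
    (hf : IsTransitionMap Z.X Upos 0 f) : ∀ᶠ y in 𝓝 0, f y = N (axisPoint 1 y) := by
  filter_upwards [hf _ (Metric.ball_mem_nhds 0 C.rad_pos)] with y hy
  have := transit_leaf (fun p hp => C.leaf_X p (by rwa [mem_ball_zero_iff] at hp)) hy
  rw [C.axis] at this
  exact this.symm

theorem eventually_eq_of_isTransitionMap_Y (C : IsChart Z a i m ρ N M) {g : ℝ → ℝ}
    (hg : IsTransitionMap Z.Y Uneg 1 g) :
    ∀ᶠ x in 𝓝 0, M (axisPoint 0 x) = M (axisPoint 1 (g x)) := by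
  filter_upwards [hg _ (Metric.ball_mem_nhds 0 C.rad_pos)] with x hx
  exact transit_leaf (k := 1) (fun p hp => C.leaf_Y p (by rwa [mem_ball_zero_iff] at hp)) hx

theorem _root_.PseudoHopf.HasTaylorThree.tendsto {f : ℝ → ℝ} {α β γ : ℝ}
    (h : HasTaylorThree f α β γ) : Tendsto f (𝓝 0) (𝓝 0) := by
  have h1 : Tendsto (fun x : ℝ => x ^ 3) (𝓝 0) (𝓝 0) := by
    simpa using (continuous_pow 3 (M := ℝ)).tendsto 0
  have h2 := Asymptotics.IsBigO.trans_tendsto h.isBigO h1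
  have h3 : Tendsto (fun x : ℝ => α * x + β * x ^ 2 + γ * x ^ 3) (𝓝 0) (𝓝 0) := by
    have : Continuous fun x : ℝ => α * x + β * x ^ 2 + γ * x ^ 3 := by fun_prop
    simpa using this.tendsto 0
  simpa using h2.add h3

/-- The coefficients of the return map are those of the square of the half-return map. -/
theorem taylor_of_hasReturnCoefficients (C : IsChart Z a i m ρ N M) {β η : ℝ}
    (h : HasReturnCoefficients Z β η) :
    HasTaylorThree (fun x => M (axisPoint 0 (M (axisPoint 0 x))))
      (alpha Z ^ 2) ((alpha Z + alpha Z ^ 2) * β) η := by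
  obtain ⟨f, g, aX, bX, cX, aY, bY, cY, hf, hg, tf, tg, -, hF⟩ := h
  refine hF.congr ?_
  have e1 := C.eventually_eq_of_isTransitionMap_X hf
  have e2 := C.eventually_eq_of_isTransitionMap_Y hg
  -- `N = M` on `Σ₁`, so that the value of `M` on `Σ₂` is the half-return map.
  have e3 : ∀ᶠ x in 𝓝 0, f (g x) = M (axisPoint 0 x) := by
    filter_upwards [e2, tg.tendsto.eventually e1] with x hx hx'
    rw [hx', C.eq_axis, hx]
  have hc : Tendsto (fun x : ℝ => M (axisPoint 0 x)) (𝓝 0) (𝓝 0) := by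
    have : Continuous fun y : ℝ => (axisPoint 0 y : Plane) := continuous_axisPoint 0
    have := (C.continuous'.comp this).tendsto 0
    simpa [Function.comp_def, axisPoint_zero, C.map_zero'] using this
  filter_upwards [e3, hc.eventually e3] with x hx hx'
  simp only [Function.comp]
  rw [hx, hx']

end IsChart

end Transition


/-! ### Complete regular orbits -/

section HalfOrbits

namespace IsFoliation

variable {N M : Plane → ℝ} {m : ℝ}

theorem eq_of_coord_eq (h : IsFoliation N M m) {p q : Plane} {k : Fin 2} (hk : p k = q k) :
    (N p = N q → p = q) ∧ (M p = M q → p = q) := by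
  have gen : ∀ {G : Plane → ℝ}, StrictMono G → ∀ {p q : Plane}, p k = q k → G p = G q → p = q := by
    intro G hG p q hk e
    have le_of : ∀ {p q : Plane}, p k = q k → p (k + 1) ≤ q (k + 1) → p ≤ q := fun h h' l => by
      rcases fin_two_cases k l with rfl | rfl
      exacts [h.le, h']
    rcases le_total (p (k + 1)) (q (k + 1)) with hle | hle
    · exact (le_of hk hle).eq_of_not_lt fun hlt => (hG hlt).ne e
    · exact ((le_of hk.symm hle).eq_of_not_lt fun hlt => (hG hlt).ne e.symm).symm
  refine ⟨gen (h.slope.strictMono h.pos) hk, fun e => ?_⟩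
  have hrr : ∀ p, rescale (-1) 1 (rescale (-1) 1 p) = p := rescale_rescale (by norm_num) (by norm_num)
  have := gen (h.slope'.strictMono h.pos) (p := rescale (-1) 1 p) (q := rescale (-1) 1 q)
    (by fin_cases k <;> simpa using hk) (by simpa only [hrr] using e)
  rw [← hrr p, this, hrr]

end IsFoliation

/-- An orbit in the half-plane where `p (i + 1)` has the sign `s`, with its two edges on `Σ` and
with time running in `[0, T]`: it stays on leaves and the coordinate `p i` moves in the direction of
sign `a`. -/
structure IsHalfOrbit (N M : Plane → ℝ) (a : ℝ) (i : Fin 2) (s T : ℝ) (σ : ℝ → Plane) : Prop where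
  sign : s = 1 ∨ s = -1
  pos : 0 < T
  continuousOn : ContinuousOn σ (Icc 0 T)
  side : ∀ t ∈ Ioo 0 T, 0 < s * σ t (i + 1)
  departing : σ 0 (i + 1) = 0
  arrival : σ T (i + 1) = 0
  mono : StrictMonoOn (fun t => a * σ t i) (Icc 0 T)
  leaf : StaysOnLeaves N M i s (Icc 0 T) σ

/-- The sign of the half-planes in which the orbits run from a label `x` to the label given by the
half-return map at `x`. -/
def forwardSide (a : ℝ) (i : Fin 2) : ℝ := if i = 0 then a else -a

namespace IsHalfOrbit

variable {N M : Plane → ℝ} {a m s T : ℝ} {i : Fin 2} {σ : ℝ → Plane}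

theorem zero_mem (o : IsHalfOrbit N M a i s T σ) : (0 : ℝ) ∈ Icc 0 T := ⟨le_rfl, o.pos.le⟩

theorem end_mem (o : IsHalfOrbit N M a i s T σ) : T ∈ Icc 0 T := ⟨o.pos.le, le_rfl⟩

theorem injOn (o : IsHalfOrbit N M a i s T σ) : InjOn σ (Icc 0 T) := fun t ht t' ht' e =>
  o.mono.injOn ht ht' (by simp only [e])

theorem side_nonneg (o : IsHalfOrbit N M a i s T σ) {t : ℝ} (ht : t ∈ Icc 0 T) :
    0 ≤ s * σ t (i + 1) := by
  rcases ht.1.eq_or_lt with rfl | h0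
  · rw [o.departing, mul_zero]
  rcases ht.2.eq_or_lt with rfl | h1
  · rw [o.arrival, mul_zero]
  · exact (o.side t ⟨h0, h1⟩).le

/-- The orbit crosses the other branch: otherwise it would stay in one quadrant, on one leaf, which
meets each branch once. -/
theorem endpoints (o : IsHalfOrbit N M a i s T σ) (h : IsFoliation N M m) (ha : a = 1 ∨ a = -1) :
    a * σ 0 i < 0 ∧ 0 < a * σ T i := by
  have ha2 := IsFoliation.sq_of_sign ha
  have has : a * s = 1 ∨ a * s = -1 := by
    rcases ha with rfl | rfl <;> rcases o.sign with rfl | rfl <;> norm_num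
  have hsi : ∀ t, s * σ t i = (a * s) * (a * σ t i) := fun t => by
    linear_combination (-(s * σ t i)) * ha2
  have hne : σ 0 ≠ σ T := fun e => o.pos.ne (o.injOn o.zero_mem o.end_mem e)
  have hinj := h.eq_of_coord_eq (p := σ 0) (q := σ T) (k := i + 1) (by rw [o.departing, o.arrival])
  have hl := o.leaf 0 o.zero_mem T o.end_mem
  have hlt := o.mono o.zero_mem o.end_mem o.pos
  simp only at hlt
  rw [hsi, hsi] at hl
  constructor
  · by_contra! h0
    rcases has with e | e <;> rw [e] at hl
    · exact hne (hinj.1 (hl.1 (by linarith) (by linarith)))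
    · exact hne (hinj.2 (hl.2 (by linarith) (by linarith)))
  · by_contra! h0
    rcases has with e | e <;> rw [e] at hl
    · exact hne (hinj.2 (hl.2 (by linarith) (by linarith)))
    · exact hne (hinj.1 (hl.1 (by linarith) (by linarith)))

theorem exists_crossing (o : IsHalfOrbit N M a i s T σ) (h : IsFoliation N M m)
    (ha : a = 1 ∨ a = -1) : ∃ t ∈ Ioo 0 T, σ t i = 0 := by
  obtain ⟨h0, h1⟩ := o.endpoints h ha
  obtain ⟨t, ht, e⟩ := intermediate_value_Icc o.pos.le (f := fun t => a * σ t i)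
    (continuousOn_const.mul ((continuous_apply i).comp_continuousOn o.continuousOn)) ⟨h0.le, h1.le⟩
  have ha0 : a ≠ 0 := by rcases ha with rfl | rfl <;> norm_num
  simp only at e
  refine ⟨t, ⟨lt_of_le_of_ne ht.1 ?_, lt_of_le_of_ne ht.2 ?_⟩, (mul_eq_zero.1 e).resolve_left ha0⟩
  · rintro rfl; linarith
  · rintro rfl; linarith

/-- At the crossing point, `N` and `M` take the values they have at the edges. -/
theorem crossing_leaf (o : IsHalfOrbit N M a i s T σ) (h : IsFoliation N M m)
    (ha : a = 1 ∨ a = -1) {t : ℝ} (ht : t ∈ Ioo 0 T) (hti : σ t i = 0) :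
    (s = a → M (σ 0) = M (σ t) ∧ N (σ t) = N (σ T)) ∧
      (s = -a → N (σ 0) = N (σ t) ∧ M (σ t) = M (σ T)) := by
  obtain ⟨h0, h1⟩ := o.endpoints h ha
  have ht' : t ∈ Icc 0 T := ⟨ht.1.le, ht.2.le⟩
  have l0 := o.leaf 0 o.zero_mem t ht'
  have l1 := o.leaf t ht' T o.end_mem
  rw [hti, mul_zero] at l0 l1
  constructor
  · rintro rfl
    exact ⟨l0.2 h0.le le_rfl, l1.1 le_rfl h1.le⟩
  · rintro rfl
    exact ⟨l0.1 (by linarith) le_rfl, l1.2 le_rfl (by linarith)⟩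

theorem axis_value (h : IsFoliation N M m) {p : Plane} :
    (p 1 = 0 → M p = M (axisPoint 0 (N p))) ∧ (p 0 = 0 → M p = N p) := by
  refine ⟨fun h1 => ?_, fun h0 => ?_⟩
  · rw [eq_axisPoint_zero h1, h.axis]
  · rw [eq_axisPoint_one h0, h.eq_axis]

/-- The labels of the two edges correspond to each other under the half-return map. -/
theorem label (o : IsHalfOrbit N M a i s T σ) (h : IsFoliation N M m) (ha : a = 1 ∨ a = -1) :
    (s = forwardSide a i → N (σ T) = M (axisPoint 0 (N (σ 0)))) ∧
      (s = -forwardSide a i → N (σ 0) = M (axisPoint 0 (N (σ T)))) := by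
  obtain ⟨t, ht, hti⟩ := o.exists_crossing h ha
  obtain ⟨c1, c2⟩ := o.crossing_leaf h ha ht hti
  have d0 := o.departing
  have d1 := o.arrival
  rcases fin_two_cases 0 i with rfl | rfl
  · rw [forwardSide, if_pos rfl]
    constructor
    · intro e
      obtain ⟨e1, e2⟩ := c1 e
      rw [← (axis_value h).1 d0, e1, ← e2, (axis_value h).2 hti]
    · intro e
      obtain ⟨e1, e2⟩ := c2 e
      rw [← (axis_value h).1 d1, e1, ← e2, (axis_value h).2 hti]
  · rw [forwardSide, if_neg (by decide), neg_neg]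
    constructor
    · intro e
      obtain ⟨e1, e2⟩ := c2 e
      rw [e1, ← (axis_value h).1 hti, e2, (axis_value h).2 d1]
    · intro e
      obtain ⟨e1, e2⟩ := c1 e
      rw [← e2, ← (axis_value h).1 hti, ← e1, (axis_value h).2 d0]

theorem sign_cases (o : IsHalfOrbit N M a i s T σ) (ha : a = 1 ∨ a = -1) :
    s = forwardSide a i ∨ s = -forwardSide a i := by
  rw [forwardSide]
  rcases ha with rfl | rfl <;> rcases o.sign with rfl | rfl <;> split <;> simp

variable {T' : ℝ} {σ' : ℝ → Plane}

theorem label_iff (o : IsHalfOrbit N M a i s T σ) (o' : IsHalfOrbit N M a i s T' σ')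
    (h : IsFoliation N M m) (ha : a = 1 ∨ a = -1) : N (σ 0) = N (σ' 0) ↔ N (σ T) = N (σ' T') := by
  have hinj := h.half_return_strictAnti.injective
  rcases o.sign_cases ha with e | e
  · rw [(o.label h ha).1 e, (o'.label h ha).1 e]
    exact hinj.eq_iff.symm
  · rw [(o.label h ha).2 e, (o'.label h ha).2 e]
    exact hinj.eq_iff

/-- Two orbits in the same half-plane with the same labels have the same image. -/
theorem image_subset (o : IsHalfOrbit N M a i s T σ) (o' : IsHalfOrbit N M a i s T' σ')
    (h : IsFoliation N M m) (ha : a = 1 ∨ a = -1) (e0 : N (σ 0) = N (σ' 0)) :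
    ∀ t ∈ Icc 0 T, ∃ t' ∈ Icc 0 T', σ' t' = σ t ∧ (t ∈ Ioo 0 T → t' ∈ Ioo 0 T') := by
  intro t ht
  have p0 : σ 0 = σ' 0 := (h.eq_of_coord_eq (k := i + 1) (by rw [o.departing, o'.departing])).1 e0
  have p1 : σ T = σ' T' := (h.eq_of_coord_eq (k := i + 1) (by rw [o.arrival, o'.arrival])).1
    ((o.label_iff o' h ha).1 e0)
  obtain ⟨h0, h1⟩ := o.endpoints h ha
  have hmem : a * σ t i ∈ Icc (a * σ' 0 i) (a * σ' T' i) := by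
    rw [← p0, ← p1]
    exact ⟨o.mono.monotoneOn o.zero_mem ht ht.1, o.mono.monotoneOn ht o.end_mem ht.2⟩
  -- The two orbits have the same edges; the point of the second one with the same `i`-th coordinate
  -- is on the same leaf, hence it is the same point.
  obtain ⟨t', ht', e⟩ := intermediate_value_Icc o'.pos.le (f := fun t => a * σ' t i)
    (continuousOn_const.mul ((continuous_apply i).comp_continuousOn o'.continuousOn)) hmem
  have ha0 : a ≠ 0 := by rcases ha with rfl | rfl <;> norm_num
  have ei : σ' t' i = σ t i := mul_left_cancel₀ ha0 e
  have key : ∀ u, u = 0 ∧ σ u = σ' 0 ∨ u = T ∧ σ u = σ' T' →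
      (0 ≤ s * σ u i → 0 ≤ s * σ t i → N (σ' t') = N (σ t)) ∧
      (s * σ u i ≤ 0 → s * σ t i ≤ 0 → M (σ' t') = M (σ t)) := by
    rintro u (⟨rfl, hu⟩ | ⟨rfl, hu⟩)
    · have l := o.leaf t ht 0 o.zero_mem
      have l' := o'.leaf t' ht' 0 o'.zero_mem
      rw [← hu, ei] at l'
      exact ⟨fun x y => (l'.1 y x).trans (l.1 y x).symm, fun x y => (l'.2 y x).trans (l.2 y x).symm⟩
    · have l := o.leaf t ht u o.end_mem
      have l' := o'.leaf t' ht' T' o'.end_mem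
      rw [← hu, ei] at l'
      exact ⟨fun x y => (l'.1 y x).trans (l.1 y x).symm, fun x y => (l'.2 y x).trans (l.2 y x).symm⟩
  have k0 := key 0 (Or.inl ⟨rfl, p0⟩)
  have k1 := key T (Or.inr ⟨rfl, p1⟩)
  have hs0 : (s * σ 0 i ≤ 0 ∧ 0 ≤ s * σ T i) ∨ (0 ≤ s * σ 0 i ∧ s * σ T i ≤ 0) := by
    rcases ha with rfl | rfl <;> rcases o.sign with rfl | rfl
    · left; constructor <;> linarith
    · right; constructor <;> linarith
    · right; constructor <;> linarith
    · left; constructor <;> linarith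
  have hpt : σ' t' = σ t := by
    have g := h.eq_of_coord_eq ei
    rcases le_total 0 (s * σ t i) with hh | hh <;> rcases hs0 with ⟨x, y⟩ | ⟨x, y⟩
    · exact g.1 (k1.1 y hh)
    · exact g.1 (k0.1 x hh)
    · exact g.2 (k0.2 x hh)
    · exact g.2 (k1.2 y hh)
  refine ⟨t', ht', hpt, fun hto => ⟨lt_of_le_of_ne ht'.1 ?_, lt_of_le_of_ne ht'.2 ?_⟩⟩
  · rintro rfl
    exact hto.1.ne (o.injOn o.zero_mem ht (p0.trans hpt))
  · rintro rfl
    exact hto.2.ne' (o.injOn o.end_mem ht (p1.trans hpt))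

theorem image_eq (o : IsHalfOrbit N M a i s T σ) (o' : IsHalfOrbit N M a i s T' σ')
    (h : IsFoliation N M m) (ha : a = 1 ∨ a = -1) (e0 : N (σ 0) = N (σ' 0)) :
    σ '' Icc 0 T = σ' '' Icc 0 T' := by
  apply Subset.antisymm
  · rintro _ ⟨t, ht, rfl⟩
    obtain ⟨t', ht', e, -⟩ := o.image_subset o' h ha e0 t ht
    exact ⟨t', ht', e⟩
  · rintro _ ⟨t, ht, rfl⟩
    obtain ⟨t', ht', e, -⟩ := o'.image_subset o h ha e0.symm t ht
    exact ⟨t', ht', e⟩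

theorem not_disjoint (o : IsHalfOrbit N M a i s T σ) (o' : IsHalfOrbit N M a i s T' σ')
    (h : IsFoliation N M m) (ha : a = 1 ∨ a = -1) (e0 : N (σ 0) = N (σ' 0)) :
    ¬ Disjoint (σ '' Ioo 0 T) (σ' '' Ioo 0 T') := by
  have hm : T / 2 ∈ Ioo 0 T := ⟨by linarith [o.pos], by linarith [o.pos]⟩
  obtain ⟨t', -, e, ht'⟩ := o.image_subset o' h ha e0 (T / 2) ⟨hm.1.le, hm.2.le⟩
  exact not_disjoint_iff.2 ⟨_, mem_image_of_mem σ hm, t', ht' hm, e⟩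

end IsHalfOrbit

theorem StrictMonoOn.Icc_of_Ioo {f : ℝ → ℝ} {T : ℝ} (hT : 0 < T) (hc : ContinuousOn f (Icc 0 T))
    (hf : StrictMonoOn f (Ioo 0 T)) : StrictMonoOn f (Icc 0 T) := by
  have h0 : (0 : ℝ) ∈ Icc 0 T := ⟨le_rfl, hT.le⟩
  have h1 : T ∈ Icc 0 T := ⟨hT.le, le_rfl⟩
  have low : ∀ u ∈ Ioo 0 T, f 0 ≤ f u := fun u hu => by
    have hne : (𝓝[Ioo 0 u] (0 : ℝ)).NeBot := left_nhdsWithin_Ioo_neBot hu.1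
    refine le_of_tendsto ((hc 0 h0).mono (show Ioo 0 u ⊆ Icc 0 T from fun x hx =>
      ⟨hx.1.le, hx.2.le.trans hu.2.le⟩)) ?_
    filter_upwards [self_mem_nhdsWithin] with v hv
    exact (hf ⟨hv.1, hv.2.trans hu.2⟩ hu hv.2).le
  have high : ∀ u ∈ Ioo 0 T, f u ≤ f T := fun u hu => by
    have hne : (𝓝[Ioo u T] T).NeBot := right_nhdsWithin_Ioo_neBot hu.2
    refine ge_of_tendsto ((hc T h1).mono (show Ioo u T ⊆ Icc 0 T from fun x hx =>
      ⟨(hu.1.trans hx.1).le, hx.2.le⟩)) ?_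
    filter_upwards [self_mem_nhdsWithin] with v hv
    exact (hf hu ⟨hu.1.trans hv.1, hv.2⟩ hv.1).le
  intro u hu v hv huv
  obtain ⟨x, hx1, hx2⟩ := exists_between huv
  obtain ⟨y, hy1, hy2⟩ := exists_between hx2
  have hx : x ∈ Ioo 0 T := ⟨hu.1.trans_lt hx1, hx2.trans_le hv.2⟩
  have hy : y ∈ Ioo 0 T := ⟨hx.1.trans hy1, hy2.trans_le hv.2⟩
  have e1 : f u ≤ f x := by
    rcases hu.1.eq_or_lt with rfl | h
    · exact low x hx
    · exact (hf ⟨h, hx1.trans hx.2⟩ hx hx1).le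
  have e2 : f y ≤ f v := by
    rcases hv.2.eq_or_lt with rfl | h
    · exact high y hy
    · exact (hf hy ⟨hy.1.trans hy2, h⟩ hy2).le
  have := hf hx hy hy1
  linarith

theorem IsChart.isHalfOrbit {Z : PiecewiseField} {a : ℝ} {i : Fin 2} {m ρ : ℝ} {N M : Plane → ℝ}
    (C : IsChart Z a i m ρ N M) {W : Set Plane} (hW : ∀ p ∈ W, ‖p‖ < ρ) {T : ℝ} {σ : ℝ → Plane}
    (hσ : IsRegularOrbitWithEdges Z W T σ) : ∃ s, IsHalfOrbit N M a i s T σ := by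
  have hball : ∀ t ∈ Icc 0 T, ‖σ t‖ < ρ := fun t ht => by
    rcases ht.1.eq_or_lt with rfl | h0
    · exact hW _ hσ.departing_mem
    rcases ht.2.eq_or_lt with rfl | h1
    · exact hW _ hσ.arrival_mem
    · exact hW _ (hσ.arc.mem t ⟨h0, h1⟩)
  obtain ⟨⟨s, hs, hsj⟩, hmono⟩ := C.regularArc_coord hW ordConnected_Ioo hσ.arc
  have hmono' := StrictMonoOn.Icc_of_Ioo hσ.pos
    (continuousOn_const.mul ((continuous_apply i).comp_continuousOn hσ.continuousOn)) hmono
  have hint : ∀ t, Icc 0 T ∈ 𝓝 t → t ∈ Ioo 0 T := fun t ht => by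
    have := mem_interior_iff_mem_nhds.2 ht
    rwa [interior_Icc] at this
  have hio : ∀ t ∈ Ioo 0 T, Ioo 0 T ∈ 𝓝 t := fun t ht => Ioo_mem_nhds ht.1 ht.2
  refine ⟨s, hs, hσ.pos, hσ.continuousOn, hsj, ?_, ?_, hmono', ?_⟩
  · by_contra h
    exact hσ.departing ((C.isRegularPoint_iff (hball 0 ⟨le_rfl, hσ.pos.le⟩)).2 h)
  · by_contra h
    exact hσ.arrival ((C.isRegularPoint_iff (hball T ⟨hσ.pos.le, le_rfl⟩)).2 h)
  · exact C.staysOnLeaves_of_deriv ordConnected_Icc hσ.continuousOn hball hs hmono'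
      (fun t ht => hsj t (hint t ht))
      (fun t ht hp => (hσ.arc.deriv_pos t (hint t ht) hp).hasDerivAt (hio t (hint t ht)))
      (fun t ht hp => (hσ.arc.deriv_neg t (hint t ht) hp).hasDerivAt (hio t (hint t ht)))

end HalfOrbits


/-! ### Pseudo-cycles -/

section PseudoCycles

/-- A circle cannot be cut into two pieces at a single point. -/
theorem circle_not_union {E : UnitAddCircle → Plane} (hc : Continuous E)
    (hi : Function.Injective E) {K L : Set Plane} (hK : IsClosed K) (hL : IsClosed L)
    (hKL : range E = K ∪ L) {p : Plane} (hp : p ∈ range E) (hsep : ∀ x ∈ K, x ∈ L → x = p) :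
    K ⊆ {p} ∨ L ⊆ {p} := by
  obtain ⟨z, rfl⟩ := hp
  obtain ⟨t, rfl⟩ := QuotientAddGroup.mk_surjective z
  set q : ℝ → UnitAddCircle := fun x => (x : UnitAddCircle)
  have hq : q '' Ico t (t + 1) = univ := AddCircle.coe_image_Ico_eq 1 t
  have himg : (E ∘ q) '' Ioo t (t + 1) = range E \ {E (q t)} := by
    ext x
    constructor
    · rintro ⟨u, hu, rfl⟩
      refine ⟨mem_range_self _, fun e => ?_⟩
      have e2 : q u = q t := hi e
      have : u = t := (AddCircle.coe_eq_coe_iff_of_mem_Ico (p := (1 : ℝ)) (a := t) ⟨hu.1.le, hu.2⟩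
        ⟨le_rfl, by linarith⟩).1 e2
      exact hu.1.ne' this
    · rintro ⟨⟨z, rfl⟩, hz⟩
      obtain ⟨u, hu, rfl⟩ : z ∈ q '' Ico t (t + 1) := by rw [hq]; trivial
      exact ⟨u, ⟨lt_of_le_of_ne hu.1 fun e => hz (by rw [e]; rfl), hu.2⟩, rfl⟩
  have hpre : IsPreconnected (range E \ {E (q t)}) := by
    rw [← himg]
    exact isPreconnected_Ioo.image _ (hc.comp (AddCircle.continuous_mk' 1)).continuousOn
  have := (isPreconnected_iff_subset_of_disjoint_closed.1 hpre) K L hK hL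
    (by rw [← hKL]; exact sdiff_subset) (by
      rw [eq_empty_iff_forall_notMem]
      rintro x ⟨⟨-, hx⟩, hxK, hxL⟩
      exact hx (hsep x hxK hxL))
  rcases this with h | h
  · right
    intro x hx
    by_contra hne
    exact hne (hsep x (h ⟨hKL ▸ Or.inr hx, hne⟩) hx)
  · left
    intro x hx
    by_contra hne
    exact hne (hsep x hx (h ⟨hKL ▸ Or.inl hx, hne⟩))

/-- An increasing map which preserves a finite set fixes its points. -/
theorem StrictMono.eq_of_mapsTo_finite {F : ℝ → ℝ} (hF : StrictMono F) {S : Set ℝ} (hS : S.Finite)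
    (h : ∀ x ∈ S, F x ∈ S) {x : ℝ} (hx : x ∈ S) : F x = x := by
  have hit : ∀ n, F^[n] x ∈ S := fun n => by
    induction n with
    | zero => exact hx
    | succ n ih => rw [Function.iterate_succ_apply']; exact h _ ih
  rcases lt_trichotomy (F x) x with hlt | heq | hgt
  · have := hF.strictAnti_iterate_of_map_lt hlt
    exact ((hS.subset (range_subset_iff.2 hit)).not_infinite
      (infinite_range_of_injective this.injective)).elim
  · exact heq
  · have := hF.strictMono_iterate_of_lt_map hgt
    exact ((hS.subset (range_subset_iff.2 hit)).not_infinite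
      (infinite_range_of_injective this.injective)).elim

/-- The labels of the edges of the pseudo-cycle, on the half-line of sign `t`: they are the fixed
points of the return map. -/
def cycleLabel (P : ℝ → ℝ) (q t : ℝ) : ℝ := if t = 1 then q else P q

variable {Z : PiecewiseField} {a : ℝ} {i : Fin 2} {m ρ : ℝ} {N M : Plane → ℝ}

theorem cycleLabel_spec (h : IsFoliation N M m) {ε q : ℝ}
    (hF : HasPattern (fun x => M (axisPoint 0 (M (axisPoint 0 x)))) ε q) (hq : 0 < q) {t : ℝ}
    (ht : t = 1 ∨ t = -1) : 0 < t * cycleLabel (fun x => M (axisPoint 0 x)) q t ∧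
      M (axisPoint 0 (cycleLabel (fun x => M (axisPoint 0 x)) q t)) =
        cycleLabel (fun x => M (axisPoint 0 x)) q (-t) := by
  have h0 : M (axisPoint 0 0) = 0 := by rw [axisPoint_zero, h.map_zero']
  have hneg : M (axisPoint 0 q) < 0 := by
    have := h.half_return_strictAnti hq
    simpa only [h0] using this
  rcases ht with rfl | rfl
  · norm_num [cycleLabel, hq]
  · norm_num [cycleLabel, hneg]
    exact hF.fixed

/-- By the pattern, `q` is the only positive fixed point of the return map; the half-return map sends
the negative fixed points to positive ones. -/
theorem fixed_eq_cycleLabel (h : IsFoliation N M m) {ε q : ℝ}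
    (hF : HasPattern (fun x => M (axisPoint 0 (M (axisPoint 0 x)))) ε q) {x t : ℝ}
    (ht : t = 1 ∨ t = -1) (hx : 0 < t * x) (hfix : M (axisPoint 0 (M (axisPoint 0 x))) = x) :
    0 < q ∧ x = cycleLabel (fun x => M (axisPoint 0 x)) q t := by
  have h0 : M (axisPoint 0 0) = 0 := by rw [axisPoint_zero, h.map_zero']
  have pos : ∀ x, 0 < x → M (axisPoint 0 (M (axisPoint 0 x))) = x → x = q := by
    intro x hx hfix
    rcases lt_trichotomy x q with hlt | heq | hgt
    · have := hF.inner x hx hlt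
      simp only [hfix, sub_self, mul_zero, lt_irrefl] at this
    · exact heq
    · have := hF.outer x hgt
      simp only [hfix, sub_self, mul_zero, lt_irrefl] at this
  rcases ht with rfl | rfl
  · have := pos x (by linarith) hfix
    subst this
    exact ⟨by linarith, by simp [cycleLabel]⟩
  · have hx' : x < 0 := by linarith
    have h1 : 0 < M (axisPoint 0 x) := by
      have := h.half_return_strictAnti hx'
      simpa only [h0] using this
    have := pos _ h1 (by rw [hfix])
    refine ⟨this ▸ h1, ?_⟩
    rw [cycleLabel, if_neg (by norm_num), ← this, hfix]

/-- The orbits of a pseudo-cycle are the orbits between the fixed points of the return map, and there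
is at least one of them in each half-plane. -/
theorem IsChart.pseudoCycle_orbits (C : IsChart Z a i m ρ N M) {W Γ : Set Plane}
    (hW : ∀ p ∈ W, ‖p‖ < ρ) {ε q : ℝ}
    (hF : HasPattern (fun x => M (axisPoint 0 (M (axisPoint 0 x)))) ε q)
    (hΓ : IsPseudoCycle Z W Γ) : 0 < q ∧
      (∀ p ∈ Γ, ∃ s T σ, IsHalfOrbit N M a i s T σ ∧
        N (σ 0) = cycleLabel (fun x => M (axisPoint 0 x)) q (-a) ∧ p ∈ σ '' Icc 0 T) ∧
      ∀ s, s = 1 ∨ s = -1 → ∃ T σ, IsHalfOrbit N M a i s T σ ∧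
        N (σ 0) = cycleLabel (fun x => M (axisPoint 0 x)) q (-a) ∧ σ '' Icc 0 T ⊆ Γ := by
  obtain ⟨n, T, σ, hσ, hdisj, -, hun, ⟨E, hEc, hEi, hEr⟩, k₁, k₂, hk12, -⟩ := hΓ
  have h := C.toIsFoliation
  have ha := C.sign
  choose s o using fun k => C.isHalfOrbit hW (hσ k)
  set P := fun x => M (axisPoint 0 x) with hP
  have hanti : StrictAnti P := h.half_return_strictAnti
  -- Every edge is shared: otherwise the other edge of the same orbit would cut the circle.
  have hcut : ∀ (k : Fin (n + 1)) (u v : ℝ), u ∈ Icc 0 (T k) → v ∈ Icc 0 (T k) →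
      (∀ t ∈ Icc 0 (T k), t = u ∨ t = v ∨ t ∈ Ioo 0 (T k)) → u ≠ v →
      ∃ l ≠ k, ∃ w, (w = 0 ∨ w = T l) ∧ σ l w = σ k u := by
    intro k u v hu hv huv hne
    by_contra! hcon
    have hcomp : ∀ l, IsCompact (σ l '' Icc 0 (T l)) := fun l =>
      isCompact_Icc.image_of_continuousOn (o l).continuousOn
    have hKL : range E = σ k '' Icc 0 (T k) ∪ ⋃ l ∈ {l | l ≠ k}, σ l '' Icc 0 (T l) := by
      rw [hEr, hun]
      ext x
      simp only [mem_iUnion, mem_union, exists_prop]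
      constructor
      · rintro ⟨l, hl⟩
        by_cases e : l = k
        · left; rwa [← e]
        · exact Or.inr ⟨l, e, hl⟩
      · rintro (hx | ⟨l, -, hl⟩)
        exacts [⟨k, hx⟩, ⟨l, hl⟩]
    have := circle_not_union hEc hEi (hcomp k).isClosed
      ((Set.toFinite {l | l ≠ k}).isClosed_biUnion fun l _ => (hcomp l).isClosed) hKL
      (p := σ k v) (by rw [hKL]; exact Or.inl ⟨v, hv, rfl⟩) (by
        rintro _ ⟨t, ht, rfl⟩ hx
        simp only [mem_iUnion, exists_prop] at hx
        obtain ⟨l, hl, t', ht', e⟩ := hx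
        have hends : t' ∉ Ioo 0 (T l) → t' = 0 ∨ t' = T l := fun hn => by
          by_contra! h'
          exact hn ⟨lt_of_le_of_ne ht'.1 h'.1.symm, lt_of_le_of_ne ht'.2 h'.2⟩
        have hz : t' = 0 ∨ t' = T l → σ l t' (i + 1) = 0 := by
          rintro (rfl | rfl)
          exacts [(o l).departing, (o l).arrival]
        have hnz : ∀ {l t'}, t' ∈ Ioo 0 (T l) → σ l t' (i + 1) ≠ 0 := fun {l t'} ht' h0 => by
          have := (o l).side t' ht'
          rw [h0, mul_zero] at this
          exact lt_irrefl _ this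
        rcases huv t ht with rfl | rfl | hto
        · have : t' ∉ Ioo 0 (T l) := fun hto => hnz hto (by
            rw [e]
            by_contra hne0
            rcases ht.1.eq_or_lt with rfl | h0
            · exact hne0 (o k).departing
            rcases ht.2.eq_or_lt with rfl | h1
            · exact hne0 (o k).arrival
            exact disjoint_left.1 (hdisj hl) ⟨t', hto, rfl⟩ ⟨t, ⟨h0, h1⟩, e.symm⟩)
          exact (hcon l hl t' (hends this) e).elim
        · rfl
        · by_cases hto' : t' ∈ Ioo 0 (T l)
          · exact (disjoint_left.1 (hdisj hl) ⟨t', hto', rfl⟩ ⟨t, hto, e.symm⟩).elim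
          · exact (hnz hto (e ▸ hz (hends hto'))).elim)
    rcases this with hsub | hsub
    · exact hne ((o k).injOn hu hv (hsub (mem_image_of_mem _ hu)))
    · obtain ⟨l, hl⟩ : ∃ l, l ≠ k := by
        by_cases e : k₁ = k
        · exact ⟨k₂, fun e' => hk12 (e.trans e'.symm)⟩
        · exact ⟨k₁, e⟩
      have hmem : ∀ w ∈ Icc 0 (T l), σ l w = σ k v := fun w hw =>
        hsub (mem_iUnion₂.2 ⟨l, hl, w, hw, rfl⟩)
      exact (o l).pos.ne ((o l).injOn (o l).zero_mem (o l).end_mem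
        ((hmem 0 (o l).zero_mem).trans (hmem _ (o l).end_mem).symm))
  have hcases : ∀ k, ∀ t ∈ Icc 0 (T k), t = 0 ∨ t = T k ∨ t ∈ Ioo 0 (T k) := fun k t ht => by
    rcases ht.1.eq_or_lt with rfl | h0
    · exact Or.inl rfl
    rcases ht.2.eq_or_lt with rfl | h1
    · exact Or.inr (Or.inl rfl)
    · exact Or.inr (Or.inr ⟨h0, h1⟩)
  -- Orbits which leave from the same point are in opposite half-planes, since otherwise they would
  -- coincide.
  have hopp : ∀ k l, l ≠ k → N (σ l 0) = N (σ k 0) → s l = -s k := by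
    intro k l hlk e
    by_contra hs
    have hs' : s l = s k := by
      rcases (o l).sign with h1 | h1 <;> rcases (o k).sign with h2 | h2 <;> rw [h1, h2] at hs ⊢ <;>
        norm_num at hs
    have ol := o l
    rw [hs'] at ol
    exact ol.not_disjoint (o k) h ha e (hdisj hlk)
  have hdep : ∀ k, ∃ l, s l = -s k ∧ N (σ l 0) = N (σ k 0) := by
    intro k
    obtain ⟨l, hl, w, hw, e⟩ := hcut k 0 (T k) (o k).zero_mem (o k).end_mem (hcases k) (o k).pos.ne
    have e1 := (o k).endpoints h ha
    have e2 := (o l).endpoints h ha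
    rcases hw with rfl | rfl
    · exact ⟨l, hopp k l hl (by rw [e]), by rw [e]⟩
    · rw [e] at e2; linarith
  have harr : ∀ k, ∃ l, s l = -s k ∧ N (σ l (T l)) = N (σ k (T k)) := by
    intro k
    obtain ⟨l, hl, w, hw, e⟩ := hcut k (T k) 0 (o k).end_mem (o k).zero_mem
      (fun t ht => by have := hcases k t ht; tauto) (o k).pos.ne'
    have e1 := (o k).endpoints h ha
    have e2 := (o l).endpoints h ha
    rcases hw with rfl | rfl
    · rw [e] at e2; linarith
    · refine ⟨l, ?_, by rw [e]⟩
      by_contra hs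
      have hs' : s l = s k := by
        rcases (o l).sign with h1 | h1 <;> rcases (o k).sign with h2 | h2 <;> rw [h1, h2] at hs ⊢ <;>
          norm_num at hs
      have ol := o l
      rw [hs'] at ol
      exact ol.not_disjoint (o k) h ha ((ol.label_iff (o k) h ha).2 (by rw [e])) (hdisj hl)
  -- Following the orbits from edge to edge, the return map preserves the finite set of labels.
  set S : Set ℝ := {x | ∃ k, s k = forwardSide a i ∧ N (σ k 0) = x} with hS
  have hSfin : S.Finite := (Set.finite_range fun k => N (σ k 0)).subset (by
    rintro x ⟨k, -, rfl⟩; exact ⟨k, rfl⟩)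
  have hSmap : ∀ x ∈ S, P (P x) ∈ S := by
    rintro _ ⟨k, hk, rfl⟩
    obtain ⟨l, hl, el⟩ := harr k
    obtain ⟨j, hj, ej⟩ := hdep l
    refine ⟨j, by rw [hj, hl, neg_neg, hk], ?_⟩
    rw [ej, ((o l).label h ha).2 (by rw [hl, hk]), el, ((o k).label h ha).1 hk]
  have hfix : ∀ k, P (P (N (σ k 0))) = N (σ k 0) := fun k => by
    have : N (σ k 0) ∈ S := by
      rcases (o k).sign_cases ha with hk | hk
      · exact ⟨k, hk, rfl⟩
      · obtain ⟨l, hl, el⟩ := hdep k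
        exact ⟨l, by rw [hl, hk, neg_neg], el⟩
    exact StrictMono.eq_of_mapsTo_finite (hanti.comp hanti) hSfin hSmap this
  -- Every orbit departs from the half-line `a * p i < 0`; hence its departing label has the sign of
  -- `-a`, which leaves a single fixed point of the return map.
  have hsgn : ∀ k, 0 < -a * N (σ k 0) := fun k => by
    have e := ((o k).endpoints h ha).1
    have d := (o k).departing
    have hm : ∀ c : ℝ, 0 < -a * c → 0 < -a * N (axisPoint i c) := fun c hc => by
      have hmono : StrictMono fun c => N (axisPoint i c) := by
        rcases fin_two_cases 0 i with rfl | rfl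
        · intro u v huv
          simpa only [h.axis] using huv
        · exact C.axis_one_strictMono
      have h0 : N (axisPoint i 0) = 0 := by rw [axisPoint_zero, h.map_zero]
      rcases ha with rfl | rfl
      · have := hmono (show c < 0 by linarith)
        simp only [h0] at this
        linarith
      · have := hmono (show 0 < c by linarith)
        simp only [h0] at this
        linarith
    rw [eq_axisPoint d]
    exact hm _ (by linarith)
  have hna : -a = 1 ∨ -a = -1 := by rcases ha with rfl | rfl <;> norm_num
  have hlab := fun k => fixed_eq_cycleLabel h hF hna (hsgn k) (hfix k)
  refine ⟨(hlab k₁).1, fun p hp => ?_, fun s' hs' => ?_⟩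
  · rw [hun] at hp
    obtain ⟨k, hk⟩ := mem_iUnion.1 hp
    exact ⟨s k, T k, σ k, o k, (hlab k).2, hk⟩
  · obtain ⟨k, hk⟩ : ∃ k, s k = s' := by
      by_cases e : s k₁ = s'
      · exact ⟨k₁, e⟩
      · obtain ⟨l, hl, -⟩ := hdep k₁
        refine ⟨l, ?_⟩
        rw [hl]
        rcases (o k₁).sign with h1 | h1 <;> rcases hs' with rfl | rfl <;> rw [h1] at e ⊢ <;>
          first | exact (e rfl).elim | norm_num
    exact ⟨T k, σ k, hk ▸ o k, (hlab k).2, hun ▸ subset_iUnion (fun k => σ k '' Icc 0 (T k)) k⟩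

theorem IsChart.pseudoCycle_unique (C : IsChart Z a i m ρ N M) {W Γ Γ' : Set Plane}
    (hW : ∀ p ∈ W, ‖p‖ < ρ) {ε q : ℝ}
    (hF : HasPattern (fun x => M (axisPoint 0 (M (axisPoint 0 x)))) ε q)
    (hΓ : IsPseudoCycle Z W Γ) (hΓ' : IsPseudoCycle Z W Γ') : Γ = Γ' := by
  have key : ∀ {Γ Γ' : Set Plane}, IsPseudoCycle Z W Γ → IsPseudoCycle Z W Γ' → Γ ⊆ Γ' := by
    intro Γ Γ' hΓ hΓ' p hp
    obtain ⟨s, T, σ, o, e, hpσ⟩ := (C.pseudoCycle_orbits hW hF hΓ).2.1 p hp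
    obtain ⟨T', σ', o', e', hsub⟩ := (C.pseudoCycle_orbits hW hF hΓ').2.2 s o.sign
    rw [o.image_eq o' C.toIsFoliation C.sign (e.trans e'.symm)] at hpσ
    exact hsub hpσ
  exact (key hΓ hΓ').antisymm (key hΓ' hΓ)

end PseudoCycles


/-! ### Construction of the pseudo-cycle -/

section Construction

/-- Two arcs with the same endpoints, and without other common points, form a circle. -/
theorem exists_circle {f g : ℝ → Plane} {S T : ℝ} (hS : 0 < S) (hT : 0 < T)
    (hf : ContinuousOn f (Icc 0 S)) (hg : ContinuousOn g (Icc 0 T)) (hfi : InjOn f (Icc 0 S))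
    (hgi : InjOn g (Icc 0 T)) (h0 : f 0 = g 0) (h1 : f S = g T)
    (hne : ∀ u ∈ Icc 0 S, ∀ v ∈ Ioo 0 T, f u ≠ g v) :
    ∃ E : UnitAddCircle → Plane, Continuous E ∧ Function.Injective E ∧
      range E = f '' Icc 0 S ∪ g '' Icc 0 T := by
  -- The arc `f` is run through forward, then `g` backward.
  set c : ℝ → Plane := fun t => if t ≤ 1 / 2 then f (S * (2 * t)) else g (T * (2 - 2 * t)) with hc
  have m1 : ∀ {t : ℝ}, 0 ≤ t → t ≤ 1 / 2 → S * (2 * t) ∈ Icc 0 S := fun h h' =>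
    ⟨by positivity, by nlinarith⟩
  have m2 : ∀ {t : ℝ}, 1 / 2 < t → t < 1 → T * (2 - 2 * t) ∈ Ioo 0 T := fun h h' =>
    ⟨mul_pos hT (by linarith), by nlinarith⟩
  have c0 : c 0 = f 0 := by simp [hc]
  have c1 : c (0 + 1) = g 0 := by norm_num [hc]
  have hcc : ContinuousOn c (Icc 0 (0 + 1)) := by
    rw [zero_add]
    have e1 : ContinuousOn c (Icc 0 (1 / 2)) :=
      (hf.comp (f := fun t : ℝ => S * (2 * t)) (by fun_prop) fun t ht => m1 ht.1 ht.2).congr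
        fun t ht => by simp only [hc, if_pos ht.2, Function.comp]
    have e2 : ContinuousOn c (Icc (1 / 2) 1) := by
      refine (hg.comp (f := fun t : ℝ => T * (2 - 2 * t)) (by fun_prop) fun t ht =>
        ⟨mul_nonneg hT.le (by linarith [ht.2]), by nlinarith [ht.1]⟩).congr fun t ht => ?_
      simp only [hc, Function.comp]
      split
      · have : t = 1 / 2 := le_antisymm (by assumption) ht.1
        rw [this]
        norm_num
        exact h1
      · rfl
    have := e1.union_of_isClosed e2 isClosed_Icc isClosed_Icc
    rwa [Icc_union_Icc_eq_Icc (by norm_num) (by norm_num)] at this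
  have hci : InjOn c (Ico 0 (0 + 1)) := by
    have key : ∀ u ∈ Ico (0 : ℝ) 1, ∀ v ∈ Ico (0 : ℝ) 1, u ≤ v → c u = c v → u = v := by
      intro u hu v hv huv e
      simp only [hc] at e
      by_cases hv2 : v ≤ 1 / 2
      · rw [if_pos hv2, if_pos (huv.trans hv2)] at e
        have := mul_left_cancel₀ hS.ne' (hfi (m1 hu.1 (huv.trans hv2)) (m1 hv.1 hv2) e)
        linarith
      rw [if_neg hv2] at e
      have mv := m2 (not_le.1 hv2) hv.2
      by_cases hu2 : u ≤ 1 / 2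
      · rw [if_pos hu2] at e
        exact (hne _ (m1 hu.1 hu2) _ mv e).elim
      · rw [if_neg hu2] at e
        have mu := m2 (not_le.1 hu2) hu.2
        have := mul_left_cancel₀ hT.ne' (hgi ⟨mu.1.le, mu.2.le⟩ ⟨mv.1.le, mv.2.le⟩ e)
        linarith
    intro u hu v hv e
    rw [zero_add] at hu hv
    rcases le_total u v with h | h
    · exact key u hu v hv h e
    · exact (key v hv u hu h e.symm).symm
  have hq : ∀ z : UnitAddCircle, ∃ t ∈ Ico (0 : ℝ) (0 + 1), (t : UnitAddCircle) = z := fun z => by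
    have := AddCircle.coe_image_Ico_eq (1 : ℝ) 0
    have hz : z ∈ ((↑) : ℝ → UnitAddCircle) '' Ico 0 (0 + 1) := by rw [this]; trivial
    exact hz
  refine ⟨AddCircle.liftIco 1 0 c, AddCircle.liftIco_continuous (by rw [c0, c1, h0]) hcc, ?_, ?_⟩
  · intro z w e
    obtain ⟨t, ht, rfl⟩ := hq z
    obtain ⟨u, hu, rfl⟩ := hq w
    rw [AddCircle.liftIco_coe_apply ht, AddCircle.liftIco_coe_apply hu] at e
    rw [hci ht hu e]
  · ext x
    constructor
    · rintro ⟨z, rfl⟩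
      obtain ⟨t, ht, rfl⟩ := hq z
      rw [AddCircle.liftIco_coe_apply ht]
      rw [zero_add] at ht
      simp only [hc]
      split
      · exact Or.inl ⟨_, m1 ht.1 (by assumption), rfl⟩
      · have := m2 (not_le.1 (by assumption)) ht.2
        exact Or.inr ⟨_, ⟨this.1.le, this.2.le⟩, rfl⟩
    · have hfr : ∀ u ∈ Icc 0 S, f u ∈ range (AddCircle.liftIco 1 0 c) := fun u hu => by
        have hle : u / S / 2 ≤ 1 / 2 := by
          have := (div_le_one hS).2 hu.2
          linarith
        have h00 : 0 ≤ u / S / 2 := by have := div_nonneg hu.1 hS.le; linarith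
        refine ⟨((u / S / 2 : ℝ) : UnitAddCircle), ?_⟩
        rw [AddCircle.liftIco_coe_apply ⟨h00, by linarith⟩]
        simp only [hc, if_pos hle]
        congr 1
        field_simp
      rintro (⟨u, hu, rfl⟩ | ⟨v, hv, rfl⟩)
      · exact hfr u hu
      · rcases hv.1.eq_or_lt with rfl | hv0
        · rw [← h0]; exact hfr 0 ⟨le_rfl, hS.le⟩
        rcases hv.2.eq_or_lt with rfl | hv1
        · rw [← h1]; exact hfr S ⟨hS.le, le_rfl⟩
        have hlt : v / T < 1 := (div_lt_one hT).2 hv1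
        have hpos : 0 < v / T := div_pos hv0 hT
        refine ⟨((1 - v / T / 2 : ℝ) : UnitAddCircle), ?_⟩
        rw [AddCircle.liftIco_coe_apply ⟨by linarith, by linarith⟩]
        simp only [hc, if_neg (show ¬ (1 - v / T / 2 ≤ 1 / 2) by linarith)]
        congr 1
        field_simp
        ring

variable {Z : PiecewiseField} {a : ℝ} {i : Fin 2} {m ρ : ℝ} {N M : Plane → ℝ}

theorem zero_add_one_ne : ¬ ((0 : Fin 2) + 1 = 0) := by decide

/-- The part of a leaf in a quadrant, as a curve starting on a given branch. -/
theorem IsFoliation.exists_leaf_curve_from (h : IsFoliation N M m) (i : Fin 2) {u v : ℝ}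
    (hu : u = 1 ∨ u = -1) (hv : v = 1 ∨ v = -1) {l : ℝ → ℝ}
    (hl : ∀ t, t = 1 ∨ t = -1 → 0 < t * l t) :
    ∃ c : ℝ → Plane, ContinuousOn c (Icc 0 1) ∧ (∀ θ ∈ Icc (0 : ℝ) 1, 0 ≤ u * c θ i ∧
      0 ≤ v * c θ (i + 1) ∧ (if 0 < u * v then N else M) (c θ) = l (if i = 0 then v else u) ∧
      m * ‖c θ‖ ≤ |l (if i = 0 then v else u)|) ∧ c 0 (i + 1) = 0 ∧ c 1 i = 0 ∧
      StrictAntiOn (fun θ => u * c θ i) (Icc 0 1) ∧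
      ∀ θ ∈ Ioc (0 : ℝ) 1, 0 < v * c θ (i + 1) := by
  have z : (0 : ℝ) ∈ Icc (0 : ℝ) 1 := ⟨le_rfl, zero_le_one⟩
  have o : (1 : ℝ) ∈ Icc (0 : ℝ) 1 := ⟨zero_le_one, le_rfl⟩
  have value : ∀ {t x : ℝ}, (t = 1 ∨ t = -1) → t * x = t * l t → x = l t := fun {t x} ht e =>
    mul_left_cancel₀ (by rcases ht with rfl | rfl <;> norm_num) e
  have habs : ∀ {t : ℝ}, (t = 1 ∨ t = -1) → t * l t = |l t| := fun {t} ht => by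
    have := hl t ht
    rcases ht with rfl | rfl
    · rw [abs_of_pos (by linarith)]; ring
    · rw [abs_of_neg (by linarith)]; ring
  rcases fin_two_cases 0 i with rfl | rfl
  · obtain ⟨c, hc, hq, hc0, hc1, hanti, hmono⟩ := h.exists_leaf_curve hu hv (hl v hv)
    refine ⟨c, hc, fun θ hθ => ⟨(hq θ hθ).1 0, (hq θ hθ).1 1, ?_, ?_⟩, hc0, hc1, hanti,
      fun θ hθ => ?_⟩
    · rw [if_pos rfl]
      exact value hv (hq θ hθ).2.1
    · rw [if_pos rfl, ← habs hv]
      exact (hq θ hθ).2.2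
    · have := hmono z ⟨hθ.1.le, hθ.2⟩ hθ.1
      simp only [hc0, mul_zero] at this
      exact this
  · obtain ⟨c, hc, hq, hc0, hc1, hanti, hmono⟩ := h.exists_leaf_curve hv hu (hl u hu)
    have hr : ∀ {θ : ℝ}, θ ∈ Icc (0 : ℝ) 1 → 1 - θ ∈ Icc (0 : ℝ) 1 := fun {θ} hθ =>
      ⟨by linarith [hθ.2], by linarith [hθ.1]⟩
    refine ⟨fun θ => c (1 - θ), hc.comp (by fun_prop) fun θ hθ => hr hθ, fun θ hθ =>
      ⟨(hq _ (hr hθ)).1 1, (hq _ (hr hθ)).1 0, ?_, ?_⟩, ?_, ?_, fun x hx y hy hxy => ?_,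
      fun θ hθ => ?_⟩
    · rw [if_neg zero_add_one_ne, mul_comm u v]
      exact value hu (hq _ (hr hθ)).2.1
    · rw [if_neg zero_add_one_ne, ← habs hu]
      exact (hq _ (hr hθ)).2.2
    · simpa using hc1
    · simpa using hc0
    · exact hmono (hr hy) (hr hx) (by linarith)
    · have := hanti (hr ⟨hθ.1.le, hθ.2⟩) o (by linarith [hθ.1])
      simp only [hc1, mul_zero] at this
      exact this

/-- The curve through two consecutive quadrants between the points with labels exchanged by the
half-return map. -/
theorem IsFoliation.exists_half_curve (h : IsFoliation N M m) (ha : a = 1 ∨ a = -1) (i : Fin 2)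
    {s : ℝ} (hs : s = 1 ∨ s = -1) {l : ℝ → ℝ} (hl : ∀ t, t = 1 ∨ t = -1 → 0 < t * l t)
    (hP : ∀ t, t = 1 ∨ t = -1 → M (axisPoint 0 (l t)) = l (-t)) :
    ∃ c : ℝ → Plane, IsHalfOrbit N M a i s 2 c ∧ N (c 0) = l (-a) ∧ N (c 2) = l a ∧
      ∀ t ∈ Icc (0 : ℝ) 2, ∃ t', (t' = 1 ∨ t' = -1) ∧ m * ‖c t‖ ≤ |l t'| := by
  have hna : -a = 1 ∨ -a = -1 := by rcases ha with rfl | rfl <;> norm_num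
  have has : s = a ∨ s = -a := by
    rcases ha with rfl | rfl <;> rcases hs with rfl | rfl <;> norm_num
  have ha2 := sq_of_sign ha
  obtain ⟨c₁, hc₁, hq₁, h10, h11, hm₁, hp₁⟩ := h.exists_leaf_curve_from i hna hs hl
  obtain ⟨c₂, hc₂, hq₂, h20, h21, hm₂, hp₂⟩ := h.exists_leaf_curve_from i ha hs hl
  have z : (0 : ℝ) ∈ Icc (0 : ℝ) 1 := ⟨le_rfl, zero_le_one⟩
  have o : (1 : ℝ) ∈ Icc (0 : ℝ) 1 := ⟨zero_le_one, le_rfl⟩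
  -- The two pieces start at the edges and end at the crossing point; the labels match there because
  -- they are exchanged by the half-return map.
  have hcross : c₁ 1 = c₂ 1 := by
    have hj := h.eq_of_coord_eq (h11.trans h21.symm)
    have e1 := (hq₁ 1 o).2.2.1
    have e2 := (hq₂ 1 o).2.2.1
    have ax1 := IsHalfOrbit.axis_value h (p := c₁ 1)
    have ax2 := IsHalfOrbit.axis_value h (p := c₂ 1)
    refine hj.1 ?_
    rcases fin_two_cases 0 i with rfl | rfl
    · rw [if_pos rfl] at e1 e2
      have f1 : N (c₁ 1) = l s := by
        rw [← e1]; split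
        · rfl
        · exact (ax1.2 h11).symm
      have f2 : N (c₂ 1) = l s := by
        rw [← e2]; split
        · rfl
        · exact (ax2.2 h21).symm
      rw [f1, f2]
    · rw [if_neg zero_add_one_ne] at e1 e2
      have hinj := h.half_return_strictAnti.injective
      refine hinj ?_
      change M _ = M _
      rcases has with rfl | rfl
      · rw [if_neg (by linarith), ax1.1 h11] at e1
        rw [if_pos (by linarith)] at e2
        rw [e1, e2, hP _ hs]
      · rw [if_pos (by linarith)] at e1
        rw [if_neg (by linarith), ax2.1 h21] at e2
        rw [e1, e2, hP _ hna, neg_neg]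
  set c : ℝ → Plane := fun t => if t ≤ 1 then c₁ t else c₂ (2 - t) with hc
  have v1 : ∀ {t : ℝ}, t ≤ 1 → c t = c₁ t := fun ht => by simp only [hc, if_pos ht]
  have v2 : ∀ {t : ℝ}, 1 ≤ t → c t = c₂ (2 - t) := fun {t} ht => by
    rcases ht.eq_or_lt with rfl | ht
    · simp only [hc, if_pos le_rfl]
      norm_num
      exact hcross
    · simp only [hc, if_neg ht.not_ge]
  have i2 : ∀ {t : ℝ}, t ∈ Icc (1 : ℝ) 2 → 2 - t ∈ Icc (0 : ℝ) 1 := fun ht =>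
    ⟨by linarith [ht.2], by linarith [ht.1]⟩
  have hun : Icc (0 : ℝ) 1 ∪ Icc 1 2 = Icc 0 2 :=
    Icc_union_Icc_eq_Icc (by norm_num) (by norm_num)
  have mem : ∀ {t : ℝ}, t ∈ Icc (0 : ℝ) 2 → t ∈ Icc (0 : ℝ) 1 ∨ t ∈ Icc (1 : ℝ) 2 := fun ht => by
    rwa [← hun] at ht
  have hmono : StrictMonoOn (fun t => a * c t i) (Icc 0 2) := by
    rw [← hun]
    refine StrictMonoOn.union (c := 1) ?_ ?_ (isGreatest_Icc zero_le_one)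
      (isLeast_Icc (by norm_num))
    · intro x hx y hy hxy
      have := hm₁ hx hy hxy
      simp only [v1 hx.2, v1 hy.2] at this ⊢
      linarith
    · intro x hx y hy hxy
      have := hm₂ (i2 hy) (i2 hx) (by linarith)
      simpa only [v2 hx.1, v2 hy.1] using this
  -- On the quadrant of `N` the level is `l s`, on the other one it is `l` of the sign of `p 1`.
  have leafN : ∀ t ∈ Icc (0 : ℝ) 2, 0 ≤ s * c t i → N (c t) = l s := by
    intro t ht hst
    have zero : ∀ {w}, 0 ≤ (-s) * w → 0 ≤ s * w → w = 0 := fun {w} h1 h2 => by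
      rcases hs with rfl | rfl <;> linarith
    have e1 : s = -a → ∀ θ ∈ Icc (0 : ℝ) 1, N (c₁ θ) = l s := fun e θ hθ => by
      have := (hq₁ θ hθ).2.2.1
      subst e
      rw [if_pos (by linarith)] at this
      simpa using this
    have e2 : s = a → ∀ θ ∈ Icc (0 : ℝ) 1, N (c₂ θ) = l s := fun e θ hθ => by
      have := (hq₂ θ hθ).2.2.1
      subst e
      rw [if_pos (by linarith)] at this
      simpa using this
    rcases mem ht with h1 | h2
    · rcases has with e | e
      · -- Only the crossing point of this quadrant remains.
        have hz := zero (w := c t i) (by rw [v1 h1.2, e]; exact (hq₁ t h1).1) hst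
        have ht1 : t = 1 := hmono.injOn ht ⟨zero_le_one, one_le_two⟩
          (by simp only [hz, v1 le_rfl, h11])
        rw [ht1, v1 le_rfl, hcross]
        exact e2 e 1 o
      · rw [v1 h1.2]; exact e1 e t h1
    · rcases has with e | e
      · rw [v2 h2.1]; exact e2 e _ (i2 h2)
      · have hz := zero (w := c t i) (by
          rw [v2 h2.1, e, neg_neg]; exact (hq₂ _ (i2 h2)).1) hst
        have ht1 : t = 1 := hmono.injOn ht ⟨zero_le_one, one_le_two⟩
          (by simp only [hz, v1 le_rfl, h11])
        rw [ht1, v1 le_rfl]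
        exact e1 e 1 o
  have leafM : ∀ t ∈ Icc (0 : ℝ) 2, s * c t i ≤ 0 → M (c t) = l (if i = 0 then s else -s) := by
    intro t ht hst
    have zero : ∀ {w}, 0 ≤ s * w → s * w ≤ 0 → w = 0 := fun {w} h1 h2 => by
      rcases hs with rfl | rfl <;> linarith
    have e1 : s = a → ∀ θ ∈ Icc (0 : ℝ) 1, M (c₁ θ) = l (if i = 0 then s else -s) := fun e θ hθ => by
      have := (hq₁ θ hθ).2.2.1
      subst e
      rwa [if_neg (by linarith)] at this
    have e2 : s = -a → ∀ θ ∈ Icc (0 : ℝ) 1, M (c₂ θ) = l (if i = 0 then s else -s) :=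
      fun e θ hθ => by
        have := (hq₂ θ hθ).2.2.1
        subst e
        rw [if_neg (by linarith)] at this
        rwa [neg_neg]
    rcases mem ht with h1 | h2
    · rcases has with e | e
      · rw [v1 h1.2]; exact e1 e t h1
      · have hz := zero (w := c t i) (by rw [v1 h1.2, e]; exact (hq₁ t h1).1) hst
        have ht1 : t = 1 := hmono.injOn ht ⟨zero_le_one, one_le_two⟩
          (by simp only [hz, v1 le_rfl, h11])
        rw [ht1, v1 le_rfl, hcross]
        exact e2 e 1 o
    · rcases has with e | e
      · have hz := zero (w := c t i) (by
          rw [v2 h2.1, e]; exact (hq₂ _ (i2 h2)).1) hst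
        have ht1 : t = 1 := hmono.injOn ht ⟨zero_le_one, one_le_two⟩
          (by simp only [hz, v1 le_rfl, h11])
        rw [ht1, v1 le_rfl]
        exact e1 e 1 o
      · rw [v2 h2.1]; exact e2 e _ (i2 h2)
  have c0 : c 0 (i + 1) = 0 := by rw [v1 zero_le_one, h10]
  have c2 : c 2 (i + 1) = 0 := by
    rw [v2 one_le_two, sub_self, h20]
  have half : IsHalfOrbit N M a i s 2 c := by
    refine ⟨hs, two_pos, ?_, fun t ht => ?_, c0, c2, hmono, fun t ht t' ht' => ⟨fun e e' => ?_,
      fun e e' => ?_⟩⟩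
    · rw [← hun]
      refine ContinuousOn.union_of_isClosed ?_ ?_ isClosed_Icc isClosed_Icc
      · exact hc₁.congr fun t ht => v1 ht.2
      · exact (hc₂.comp (f := fun t : ℝ => 2 - t) (by fun_prop) fun t ht => i2 ht).congr
          fun t ht => v2 ht.1
    · rcases le_total t 1 with h1 | h1
      · rw [v1 h1]; exact hp₁ t ⟨ht.1, h1⟩
      · rw [v2 h1]; exact hp₂ _ ⟨by linarith [ht.2], by linarith⟩
    · rw [leafN t ht e, leafN t' ht' e']
    · rw [leafM t ht e, leafM t' ht' e']
  obtain ⟨n0, n1⟩ := half.endpoints h ha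
  -- The label of the edge of sign `-s`.
  have other : ∀ t ∈ Icc (0 : ℝ) 2, c t (i + 1) = 0 → s * c t i ≤ 0 → N (c t) = l (-s) := by
    intro t ht h0 hst
    have e := leafM t ht hst
    rcases fin_two_cases 0 i with rfl | rfl
    · rw [if_pos rfl, (IsHalfOrbit.axis_value h).1 h0] at e
      refine h.half_return_strictAnti.injective ?_
      have hns : -s = 1 ∨ -s = -1 := by rcases hs with rfl | rfl <;> norm_num
      change M _ = M _
      rw [e, hP _ hns, neg_neg]
    · rwa [if_neg zero_add_one_ne, (IsHalfOrbit.axis_value h).2 h0] at e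
  have hlab : N (c 0) = l (-a) ∧ N (c 2) = l a := by
    rcases has with e | e
    · rw [leafN 2 half.end_mem (by rw [e]; exact n1.le), e,
        other 0 half.zero_mem c0 (by rw [e]; exact n0.le), e]
      exact ⟨rfl, rfl⟩
    · rw [leafN 0 half.zero_mem (by rw [e]; linarith), e,
        other 2 half.end_mem c2 (by rw [e]; linarith), e, neg_neg]
      exact ⟨rfl, rfl⟩
  refine ⟨c, half, hlab.1, hlab.2, fun t ht => ?_⟩
  rcases mem ht with h1 | h2
  · refine ⟨_, ?_, (v1 h1.2).symm ▸ (hq₁ t h1).2.2.2⟩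
    split
    exacts [hs, hna]
  · refine ⟨_, ?_, (v2 h2.1).symm ▸ (hq₂ _ (i2 h2)).2.2.2⟩
    split
    exacts [hs, ha]

end Construction


section Existence

variable {Z : PiecewiseField} {a : ℝ} {i : Fin 2} {m ρ : ℝ} {N M : Plane → ℝ}

namespace IsChart

/-- A half-orbit becomes an orbit of the piecewise field after a change of time. -/
theorem exists_orbit (C : IsChart Z a i m ρ N M) {s T R : ℝ} {c : ℝ → Plane}
    (o : IsHalfOrbit N M a i s T c) (hR : R ≤ ρ) (hc : ∀ t ∈ Icc 0 T, ‖c t‖ < R) :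
    ∃ T' σ, IsRegularOrbitWithEdges Z (Metric.ball 0 R) T' σ ∧ IsHalfOrbit N M a i s T' σ ∧
      σ 0 = c 0 ∧ σ T' = c T ∧ ∀ t ∈ Icc 0 T, c t ∈ σ '' Icc 0 T' := by
  have hcρ : ∀ t ∈ Icc 0 T, ‖c t‖ < ρ := fun t ht => (hc t ht).trans_le hR
  obtain ⟨τ, h0, -, hmem, hcont, harc⟩ := C.exists_arc o.pos.le o.continuousOn hcρ o.mono o.sign
    (fun t ht => o.side_nonneg ht) o.leaf
  have hpos : 0 < τ T := by rw [← h0]; exact τ.strictMono o.pos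
  have hs0 : τ.symm 0 = 0 := by rw [← h0, OrderIso.symm_apply_apply, h0]
  have hsT : τ.symm (τ T) = T := τ.symm_apply_apply T
  have hopen : ∀ u ∈ Ioo 0 (τ T), τ.symm u ∈ Ioo 0 T := fun u hu => by
    have h1 := τ.symm.strictMono hu.1
    have h2 := τ.symm.strictMono hu.2
    rw [hs0] at h1
    rw [hsT] at h2
    exact ⟨h1, h2⟩
  refine ⟨τ T, fun u => c (τ.symm u), ⟨hpos, hcont, harc _ Ioo_subset_Icc_self _ ?_ ?_, ?_, ?_, ?_, ?_⟩,
    ⟨o.sign, hpos, hcont, fun u hu => o.side _ (hopen u hu), ?_, ?_, ?_, ?_⟩, ?_, ?_, ?_⟩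
  · intro u hu
    rw [mem_ball_zero_iff]
    exact hc _ (hmem u (Ioo_subset_Icc_self hu))
  · intro u hu h
    have := o.side _ (hopen u hu)
    rw [h, mul_zero] at this
    exact lt_irrefl _ this
  · simp only [hs0, mem_ball_zero_iff]; exact hc 0 o.zero_mem
  · simp only [hsT, mem_ball_zero_iff]; exact hc T o.end_mem
  · simp only [hs0, C.isRegularPoint_iff (hcρ 0 o.zero_mem), o.departing, ne_eq, not_true_eq_false,
      not_false_eq_true]
  · simp only [hsT, C.isRegularPoint_iff (hcρ T o.end_mem), o.arrival, ne_eq, not_true_eq_false,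
      not_false_eq_true]
  · simp only [hs0, o.departing]
  · simp only [hsT, o.arrival]
  · exact fun u hu v hv huv => o.mono (hmem u hu) (hmem v hv) (τ.symm.strictMono huv)
  · exact fun u hu v hv => o.leaf _ (hmem u hu) _ (hmem v hv)
  · simp only [hs0]
  · simp only [hsT]
  · refine fun t ht => ⟨τ t, ⟨?_, τ.monotone ht.2⟩, by simp⟩
    rw [← h0]; exact τ.monotone ht.1

/-- A positive fixed point of the return map gives a pseudo-cycle, made of one orbit in each
half-plane. -/
theorem exists_pseudoCycle (C : IsChart Z a i m ρ N M) {R ε q : ℝ} (hR0 : 0 < R) (hR : R ≤ ρ)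
    (hF : HasPattern (fun x => M (axisPoint 0 (M (axisPoint 0 x)))) ε q) (hq : 0 < q)
    (hqR : q < m ^ 2 * R) :
    ∃ Γ, IsPseudoCycle Z (Metric.ball 0 R) Γ ∧ axisPoint 0 (M (axisPoint 0 q)) ∈ Γ := by
  have h := C.toIsFoliation
  have ha := C.sign
  set l := cycleLabel (fun x => M (axisPoint 0 x)) q with hl
  have hl0 := fun t (ht : t = 1 ∨ t = -1) => (cycleLabel_spec h hF hq ht).1
  have hlP := fun t (ht : t = 1 ∨ t = -1) => (cycleLabel_spec h hF hq ht).2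
  have hl1 : l 1 = q := by simp [hl, cycleLabel]
  have hlm : l (-1) = M (axisPoint 0 q) := by norm_num [hl, cycleLabel]
  have hm := h.pos
  have hlR : ∀ t, t = 1 ∨ t = -1 → |l t| < m * R := by
    have hmR : m ^ 2 * R ≤ m * R := by nlinarith [h.le_one, mul_pos hm hR0]
    rintro t (rfl | rfl)
    · rw [hl1, abs_of_pos hq]; linarith
    · have h1 := (h.half_return_slope hq.le).2
      have hneg := hl0 (-1) (Or.inr rfl)
      rw [← hl] at hneg
      rw [axisPoint_zero, h.map_zero', ← hlm, sub_zero] at h1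
      rw [abs_of_neg (by linarith)]
      calc -l (-1) ≤ m⁻¹ * q := by linarith
        _ < m⁻¹ * (m ^ 2 * R) := mul_lt_mul_of_pos_left hqR (inv_pos.2 hm)
        _ = m * R := by field_simp
  have orbit : ∀ s : ℝ, s = 1 ∨ s = -1 → ∃ T σ, IsRegularOrbitWithEdges Z (Metric.ball 0 R) T σ ∧
      IsHalfOrbit N M a i s T σ ∧ N (σ 0) = l (-a) ∧ N (σ T) = l a := by
    intro s hs
    obtain ⟨c, o, e0, e1, hb⟩ := h.exists_half_curve ha i hs hl0 hlP
    obtain ⟨T, σ, h1, h2, h3, h4, -⟩ := C.exists_orbit o hR fun t ht => by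
      obtain ⟨t', ht', hle⟩ := hb t ht
      exact lt_of_mul_lt_mul_left (hle.trans_lt (hlR t' ht')) hm.le
    exact ⟨T, σ, h1, h2, by rw [h3, e0], by rw [h4, e1]⟩
  obtain ⟨S, f, hf, of, f0, f1⟩ := orbit 1 (Or.inl rfl)
  obtain ⟨T, g, hg, og, g0, g1⟩ := orbit (-1) (Or.inr rfl)
  have e0 : f 0 = g 0 := (h.eq_of_coord_eq (k := i + 1) (by rw [of.departing, og.departing])).1
    (f0.trans g0.symm)
  have e1 : f S = g T := (h.eq_of_coord_eq (k := i + 1) (by rw [of.arrival, og.arrival])).1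
    (f1.trans g1.symm)
  have hne : ∀ u ∈ Icc 0 S, ∀ v ∈ Ioo 0 T, f u ≠ g v := fun u hu v hv e => by
    have h1 := of.side_nonneg hu
    have h2 := og.side v hv
    rw [e] at h1
    linarith
  obtain ⟨E, hE, hEi, hEr⟩ := exists_circle of.pos og.pos of.continuousOn og.continuousOn of.injOn
    og.injOn e0 e1 hne
  have hd : Disjoint (f '' Ioo 0 S) (g '' Ioo 0 T) := by
    rw [disjoint_left]
    rintro _ ⟨u, hu, rfl⟩ ⟨v, hv, e⟩
    exact hne u (Ioo_subset_Icc_self hu) v hv e.symm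
  refine ⟨f '' Icc 0 S ∪ g '' Icc 0 T, ⟨1, ![S, T], ![f, g], ?_, ?_, ?_, ?_, ⟨E, hE, hEi, hEr⟩,
    0, 1, by decide, Or.inl e0⟩, ?_⟩
  · intro k
    fin_cases k
    exacts [hf, hg]
  · intro k k' hk
    fin_cases k <;> fin_cases k'
    · exact (hk rfl).elim
    · exact hd
    · exact hd.symm
    · exact (hk rfl).elim
  · intro k
    fin_cases k
    · exact ⟨f 0, Or.inl rfl, Or.inl e0⟩
    · exact ⟨g 0, Or.inl rfl, Or.inl e0.symm⟩
  · ext x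
    simp [Fin.exists_fin_two]
  -- The half-line `p 0 < 0` is met at an edge if `i = 0`, and at a crossing point if `i = 1`.
  · rw [← hlm]
    rcases fin_two_cases 0 i with rfl | rfl
    · have key : ∀ u, f u 1 = 0 → f u = axisPoint 0 (N (f u)) := fun u hu => by
        rw [eq_axisPoint_zero hu, h.axis]
      rcases ha with rfl | rfl
      · exact Or.inl ⟨0, of.zero_mem, by rw [key 0 of.departing, f0]⟩
      · exact Or.inl ⟨S, of.end_mem, by rw [key S of.arrival, f1]⟩
    · obtain ⟨t, ht, hti⟩ := og.exists_crossing h ha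
      obtain ⟨c1, c2⟩ := og.crossing_leaf h ha ht hti
      have hN : N (g t) = l (-1) := by
        rcases ha with rfl | rfl
        · rw [← (c2 rfl).1, g0]
        · rw [(c1 rfl).2, g1]
      refine Or.inr ⟨t, ⟨ht.1.le, ht.2.le⟩, ?_⟩
      have e := eq_axisPoint_zero (p := g t) hti
      rw [← hN]
      nth_rewrite 2 [e]
      rwa [h.axis]

theorem surjective_axis_one (C : IsChart Z a i m ρ N M) :
    Function.Surjective fun w => N (axisPoint 1 w) := by
  have hm := C.pos
  have hb : ∀ w : ℝ, 0 ≤ w → m * w ≤ N (axisPoint 1 w) ∧ N (axisPoint 1 (-w)) ≤ -(m * w) := by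
    intro w hw
    have hn : ∀ x : ℝ, ‖(axisPoint 1 x : Plane)‖ = |x| := fun x => by
      rw [axisPoint, Pi.norm_single, Real.norm_eq_abs]
    have h1 := (C.slope 0 (axisPoint 1 w) fun k => by fin_cases k <;> simp [axisPoint, hw]).1
    have h2 := (C.slope (axisPoint 1 (-w)) 0 fun k => by fin_cases k <;> simp [axisPoint, hw]).1
    rw [sub_zero, hn, C.map_zero, abs_of_nonneg hw] at h1
    rw [zero_sub, norm_neg, hn, C.map_zero, abs_neg, abs_of_nonneg hw] at h2
    constructor <;> linarith
  refine Continuous.surjective (C.continuous.comp (continuous_axisPoint 1)) ?_ ?_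
  · refine tendsto_atTop_mono' _ ?_ (tendsto_id.const_mul_atTop hm)
    filter_upwards [eventually_ge_atTop 0] with w hw using (hb w hw).1
  · refine tendsto_atBot_mono' _ ?_ (tendsto_id.const_mul_atBot hm)
    filter_upwards [eventually_le_atBot 0] with w hw
    have := (hb (-w) (by linarith)).2
    simp only [neg_neg, id] at this ⊢
    linarith

/-- The first return map on `{x₂ = 0, x₁ < 0}` is the square of the half-return map. -/
theorem hasMultiplier (C : IsChart Z a i m ρ N M) {R ε q d : ℝ} (hR0 : 0 < R) (hR : R ≤ ρ)
    (hF : HasPattern (fun x => M (axisPoint 0 (M (axisPoint 0 x)))) ε q) (hq : 0 < q)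
    (hqR : q < m ^ 2 * R) {Γ : Set Plane} (hΓ : axisPoint 0 (M (axisPoint 0 q)) ∈ Γ)
    (hd : HasDerivAt (fun x => M (axisPoint 0 (M (axisPoint 0 x)))) d (M (axisPoint 0 q))) :
    HasMultiplier Z (Metric.ball 0 R) Γ d := by
  have h := C.toIsFoliation
  have hm := h.pos
  have hfix : M (axisPoint 0 (M (axisPoint 0 q))) = q := hF.fixed
  have hneg : M (axisPoint 0 q) < 0 := by
    have := h.half_return_strictAnti hq
    simpa only [axisPoint_zero, h.map_zero'] using this
  have hq1 : |q| < m * R := by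
    rw [abs_of_pos hq]
    nlinarith [h.le_one, mul_pos hm hR0]
  have hq2 : |M (axisPoint 0 q)| < m * R := by
    have h1 := (h.half_return_slope hq.le).2
    rw [axisPoint_zero, h.map_zero', sub_zero] at h1
    rw [abs_of_neg hneg]
    calc -M (axisPoint 0 q) ≤ m⁻¹ * q := by linarith
      _ < m⁻¹ * (m ^ 2 * R) := mul_lt_mul_of_pos_left hqR (inv_pos.2 hm)
      _ = m * R := by field_simp
  have hcP : Continuous fun x => M (axisPoint 0 x) := h.continuous'.comp (continuous_axisPoint 0)
  refine ⟨M (axisPoint 0 q), hneg, hΓ, _, by simp only [hfix], ?_, hd⟩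
  filter_upwards [(continuous_abs.comp hcP).continuousAt.eventually_lt
      (continuousAt_const (y := m * R)) (by simpa only [Function.comp, hfix] using hq1),
    (continuous_abs.comp (hcP.comp hcP)).continuousAt.eventually_lt
      (continuousAt_const (y := m * R)) (by simpa only [Function.comp, hfix] using hq2)] with x h1 h2
  obtain ⟨y, hy⟩ := C.surjective_axis_one (M (axisPoint 0 x))
  obtain ⟨w, hw⟩ := C.surjective_axis_one (M (axisPoint 0 (M (axisPoint 0 x))))
  simp only [Function.comp] at hy hw h1 h2
  refine ⟨y, M (axisPoint 0 x), w, ?_, ?_, ?_, ?_⟩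
  · refine C.transit_Y hR0 hR (by rw [← h.eq_axis, hy]) (by rw [← h.eq_axis, hy]; exact h1)
  · have := C.transit_X (y := y) hR0 hR (by rw [hy]; exact h1)
    rwa [hy] at this
  · refine C.transit_Y hR0 hR (by rw [← h.eq_axis, hw]) (by rw [← h.eq_axis, hw]; exact h2)
  · have := C.transit_X (y := w) hR0 hR (by rw [hw]; exact h2)
    rwa [hw] at this

end IsChart

end Existence


/-! ### Charts of families of piecewise vector fields -/

section Extension

/-- The nearest point of the square `[-ρ, ρ] × [-ρ, ρ]`. -/
def clampPoint (ρ : ℝ) (p : Plane) : Plane := ![clamp ρ (p 0), clamp ρ (p 1)]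

@[simp] theorem clampPoint_zero (ρ : ℝ) (p : Plane) : clampPoint ρ p 0 = clamp ρ (p 0) := rfl

@[simp] theorem clampPoint_one (ρ : ℝ) (p : Plane) : clampPoint ρ p 1 = clamp ρ (p 1) := rfl

theorem norm_clampPoint_le {ρ : ℝ} (hρ : 0 ≤ ρ) (p : Plane) : ‖clampPoint ρ p‖ ≤ ρ :=
  (pi_norm_le_iff_of_nonneg hρ).2 fun k => by
    fin_cases k
    exacts [abs_clamp_le hρ _, abs_clamp_le hρ _]

theorem clampPoint_eq {ρ : ℝ} {p : Plane} (hp : ‖p‖ ≤ ρ) : clampPoint ρ p = p := by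
  ext k
  have := (norm_le_pi_norm p k).trans hp
  fin_cases k
  exacts [clamp_eq this, clamp_eq this]

theorem clampPoint_axis_zero {ρ : ℝ} (hρ : 0 ≤ ρ) (x : ℝ) :
    clampPoint ρ (axisPoint 0 x) = axisPoint 0 (clamp ρ x) := by
  ext k; fin_cases k <;> simp [axisPoint, clamp_zero hρ]

theorem clampPoint_axis_one {ρ : ℝ} (hρ : 0 ≤ ρ) (x : ℝ) :
    clampPoint ρ (axisPoint 1 x) = axisPoint 1 (clamp ρ x) := by
  ext k; fin_cases k <;> simp [axisPoint, clamp_zero hρ]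

/-- The extension to the plane of the function `G` on the square, with slopes `w` and `1` in the two
coordinates outside of the square. -/
def extendField (ρ w : ℝ) (G : Plane → ℝ) (p : Plane) : ℝ :=
  G (clampPoint ρ p) + w * (p 0 - clamp ρ (p 0)) + (p 1 - clamp ρ (p 1))

theorem extendField_eq {ρ w : ℝ} {G : Plane → ℝ} {p : Plane} (hp : ‖p‖ ≤ ρ) :
    extendField ρ w G p = G p := by
  have e := clampPoint_eq hp
  have e0 : clamp ρ (p 0) = p 0 := congrFun e 0
  have e1 : clamp ρ (p 1) = p 1 := congrFun e 1
  rw [extendField, e, e0, e1]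
  ring

theorem clamp_neg (ρ x : ℝ) (hρ : 0 ≤ ρ) : clamp ρ (-x) = -clamp ρ x := by
  rcases le_total ρ x with h | h
  · rw [clamp_of_le hρ h, clamp_of_le_neg (by linarith)]
  rcases le_total x (-ρ) with h' | h'
  · rw [clamp_of_le_neg h', clamp_of_le hρ (by linarith), neg_neg]
  · rw [clamp_eq (abs_le.2 ⟨h', h⟩), clamp_eq (abs_le.2 ⟨by linarith, by linarith⟩)]

theorem clampPoint_rescale {s ρ : ℝ} (hs : s = 1 ∨ s = -1) (hρ : 0 ≤ ρ) (p : Plane) :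
    clampPoint ρ (rescale s 1 p) = rescale s 1 (clampPoint ρ p) := by
  ext k
  fin_cases k
  · rcases hs with rfl | rfl
    · simp
    · simp [clamp_neg _ _ hρ]
  · simp

/-- Bounds for the partial derivatives of `G` on a square give bounds for its increments. The sign
`s` allows for a function decreasing with the first coordinate. -/
theorem increment_bounds {G : Plane → ℝ} {k ρ s : ℝ} (hs : s = 1 ∨ s = -1)
    (h : ∀ p, ‖p‖ ≤ ρ → ∃ L : Plane →L[ℝ] ℝ, HasFDerivAt G L p ∧
      s * L (axisPoint 0 1) ∈ Icc k k⁻¹ ∧ L (axisPoint 1 1) ∈ Icc k k⁻¹) {p q : Plane}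
    (hp : ‖p‖ ≤ ρ) (hq : ‖q‖ ≤ ρ) (hpq : p ≤ q) :
    k * ((q 0 - p 0) + (q 1 - p 1)) ≤ G (rescale s 1 q) - G (rescale s 1 p) ∧
      G (rescale s 1 q) - G (rescale s 1 p) ≤ k⁻¹ * ((q 0 - p 0) + (q 1 - p 1)) := by
  set c : ℝ → Plane := fun t => rescale s 1 (p + t • (q - p)) with hc
  have hcn : ∀ t ∈ Icc (0 : ℝ) 1, ‖c t‖ ≤ ρ := fun t ht => by
    rw [hc, IsFoliation.norm_rescale hs (Or.inl rfl)]
    have hball : p + t • (q - p) ∈ Metric.closedBall (0 : Plane) ρ :=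
      (convex_closedBall (0 : Plane) ρ).add_smul_sub_mem (by simpa using hp) (by simpa using hq) ht
    simpa using hball
  have hcd : ∀ t, HasDerivAt c (rescale s 1 (q - p)) t := fun t => by
    rw [hasDerivAt_pi]
    intro k
    have key : ∀ (w : ℝ) (k : Fin 2), HasDerivAt (fun t : ℝ => w * (p k + t * (q k - p k)))
        (w * (q k - p k)) t := fun w k => by
      have := (((hasDerivAt_id t).mul_const (q k - p k)).const_add (p k)).const_mul w
      simpa using this
    fin_cases k
    · simpa [hc] using key s 0
    · simpa [hc] using key 1 1
  choose! L hL hL0 hL1 using h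
  have hder : ∀ t ∈ Icc (0 : ℝ) 1, HasDerivAt (fun t => G (c t)) (L (c t) (rescale s 1 (q - p))) t :=
    fun t ht => (hL _ (hcn t ht)).comp_hasDerivAt t (hcd t)
  obtain ⟨t, ht, e⟩ := exists_hasDerivAt_eq_slope (fun t => G (c t))
    (fun t => L (c t) (rescale s 1 (q - p))) zero_lt_one
    (fun t ht => (hder t ht).continuousAt.continuousWithinAt)
    (fun t ht => hder t (Ioo_subset_Icc_self ht))
  have c0 : c 0 = rescale s 1 p := by simp [hc]
  have c1 : c 1 = rescale s 1 q := by simp [hc]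
  rw [c0, c1, sub_zero, div_one, axisPoint_add (rescale s 1 (q - p)) 0, map_add, map_smul, map_smul]
    at e
  simp only [zero_add, rescale_zero', rescale_one', Pi.sub_apply, smul_eq_mul, one_mul] at e
  rw [← e]
  have h0 := hL0 _ (hcn t (Ioo_subset_Icc_self ht))
  have h1 := hL1 _ (hcn t (Ioo_subset_Icc_self ht))
  have d0 : 0 ≤ q 0 - p 0 := sub_nonneg.2 (hpq 0)
  have d1 : 0 ≤ q 1 - p 1 := sub_nonneg.2 (hpq 1)
  have f1 := mul_le_mul_of_nonneg_right h0.1 d0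
  have f2 := mul_le_mul_of_nonneg_right h0.2 d0
  have f3 := mul_le_mul_of_nonneg_right h1.1 d1
  have f4 := mul_le_mul_of_nonneg_right h1.2 d1
  constructor <;> linarith

/-- The extension keeps the bounds for the slopes: an increment is the sum of an increment inside the
square and of one outside of it. -/
theorem extendField_slope {G : Plane → ℝ} {k ρ s w : ℝ} (hk : 0 < k) (hk1 : k ≤ 1)
    (hs : s = 1 ∨ s = -1) (hρ : 0 ≤ ρ) (hw : s * w ∈ Icc k k⁻¹)
    (h : ∀ p, ‖p‖ ≤ ρ → ∃ L : Plane →L[ℝ] ℝ, HasFDerivAt G L p ∧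
      s * L (axisPoint 0 1) ∈ Icc k k⁻¹ ∧ L (axisPoint 1 1) ∈ Icc k k⁻¹) :
    HasSlope (fun p => extendField ρ w G (rescale s 1 p)) (k / 2) := by
  intro p q hpq
  have h0 := hpq 0
  have h1 := hpq 1
  have hmono : clampPoint ρ p ≤ clampPoint ρ q := fun l => by
    fin_cases l
    exacts [monotone_clamp ρ h0, monotone_clamp ρ h1]
  have b := increment_bounds hs h (norm_clampPoint_le hρ p) (norm_clampPoint_le hρ q) hmono
  simp only [clampPoint_zero, clampPoint_one] at b
  have c0 := clamp_sub_le (ρ := ρ) h0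
  have c1 := clamp_sub_le (ρ := ρ) h1
  have e : ∀ p, extendField ρ w G (rescale s 1 p) = G (rescale s 1 (clampPoint ρ p)) +
      (s * w) * (p 0 - clamp ρ (p 0)) + (p 1 - clamp ρ (p 1)) := fun p => by
    have e0 := congrFun (clampPoint_rescale hs hρ p) 0
    simp only [clampPoint_zero, rescale_zero'] at e0
    rw [extendField, clampPoint_rescale hs hρ, rescale_zero', rescale_one', one_mul, e0]
    ring
  have n0 : q 0 - p 0 ≤ ‖q - p‖ := (le_abs_self _).trans (norm_le_pi_norm (q - p) 0)
  have n1 : q 1 - p 1 ≤ ‖q - p‖ := (le_abs_self _).trans (norm_le_pi_norm (q - p) 1)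
  have n2 : ‖q - p‖ ≤ (q 0 - p 0) + (q 1 - p 1) := by
    refine (pi_norm_le_iff_of_nonneg (by linarith)).2 fun l => ?_
    rw [Pi.sub_apply, Real.norm_eq_abs, abs_of_nonneg (sub_nonneg.2 (hpq l))]
    fin_cases l <;> simp <;> linarith
  have hk' : 1 ≤ k⁻¹ := (one_le_inv₀ hk).2 hk1
  have d0 : 0 ≤ (q 0 - p 0) - (clamp ρ (q 0) - clamp ρ (p 0)) := sub_nonneg.2 c0
  have d1 : 0 ≤ (q 1 - p 1) - (clamp ρ (q 1) - clamp ρ (p 1)) := sub_nonneg.2 c1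
  have f1 := mul_le_mul_of_nonneg_right hw.1 d0
  have f2 := mul_le_mul_of_nonneg_right hw.2 d0
  have f3 := mul_le_mul_of_nonneg_right hk1 d1
  have f4 := mul_le_mul_of_nonneg_right hk' d1
  simp only [e]
  constructor
  · have : k * ‖q - p‖ ≤ k * ((q 0 - p 0) + (q 1 - p 1)) := mul_le_mul_of_nonneg_left n2 hk.le
    have h3 := mul_nonneg hk.le (norm_nonneg (q - p))
    linarith [b.1]
  · have e2 : (k / 2)⁻¹ * ‖q - p‖ = k⁻¹ * (‖q - p‖ + ‖q - p‖) := by rw [inv_div]; ring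
    have : k⁻¹ * ((q 0 - p 0) + (q 1 - p 1)) ≤ k⁻¹ * (‖q - p‖ + ‖q - p‖) :=
      mul_le_mul_of_nonneg_left (add_le_add n0 n1) (inv_nonneg.2 hk.le)
    rw [e2]
    linarith [b.2]

end Extension

section Families

theorem eventually_origin {E F : Type*} [TopologicalSpace E] [TopologicalSpace F] [Zero F] {l₀ : E}
    {p : E × F → Prop} (h : ∀ᶠ z in 𝓝 (l₀, (0 : F)), p z) : ∀ᶠ l in 𝓝 l₀, p (l, 0) :=
  ((continuous_id.prodMk continuous_const).tendsto l₀).eventually h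

variable {E : Type*} [NormedAddCommGroup E] [NormedSpace ℝ E]

theorem contDiff_axis (k : Fin 2) : ContDiff ℝ 3 fun z : E × ℝ => (z.1, (axisPoint k z.2 : Plane)) := by
  refine contDiff_fst.prodMk (contDiff_pi.2 fun j => ?_)
  rcases fin_two_cases k j with rfl | rfl
  · simpa only [axisPoint_self] using contDiff_snd
  · simpa only [axisPoint_succ] using contDiff_const

theorem ContDiffAt.comp_axis {G : E × Plane → ℝ} {l₀ : E} (hG : ContDiffAt ℝ 3 G (l₀, 0))
    (k : Fin 2) : ContDiffAt ℝ 3 (fun z : E × ℝ => G (z.1, axisPoint k z.2)) (l₀, 0) :=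
  ContDiffAt.comp (f := fun z : E × ℝ => (z.1, (axisPoint k z.2 : Plane))) (g := G) (l₀, 0)
    (by simpa only [axisPoint_zero] using hG) (contDiff_axis k).contDiffAt

/-- The signs of the fields at the origin: `Σᵢ` is crossing, in the direction of sign `a`, the other
branch is sliding or escaping, and `X` goes to it in the direction of sign `-a`. -/
structure IsTransient (Z : PiecewiseField) (a : ℝ) (i : Fin 2) : Prop where
  sign : a = 1 ∨ a = -1
  crossing_X : 0 < a * Z.X 0 i
  crossing_Y : 0 < a * Z.Y 0 i
  sliding_X : a * Z.X 0 (i + 1) < 0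
  sliding_Y : 0 < a * Z.Y 0 (i + 1)

theorem IsTransient.ne_zero {Z : PiecewiseField} {a : ℝ} {i : Fin 2} (hZ : IsTransient Z a i)
    (k : Fin 2) : Z.X 0 k ≠ 0 ∧ Z.Y 0 k ≠ 0 := by
  constructor <;> intro h0 <;> rcases fin_two_cases i k with rfl | rfl
  · have := hZ.crossing_X; simp [h0] at this
  · have := hZ.sliding_X; simp [h0] at this
  · have := hZ.crossing_Y; simp [h0] at this
  · have := hZ.sliding_Y; simp [h0] at this

/-- First integrals `A` of `X` and `B` of `Y`, in a neighbourhood of the origin, for the fields of a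
family with parameters near `l₀`. They agree on `Σ₁`, and `A` is the coordinate on `Σ₂`. -/
structure IsIntegralFamily (Z : E → PiecewiseField) (l₀ : E) (A B : E × Plane → ℝ) : Prop where
  contDiffAt_A : ContDiffAt ℝ 3 A (l₀, 0)
  contDiffAt_B : ContDiffAt ℝ 3 B (l₀, 0)
  integral_A : ∀ᶠ z : E × Plane in 𝓝 (l₀, 0), fderiv ℝ A z (0, (Z z.1).X z.2) = 0
  integral_B : ∀ᶠ z : E × Plane in 𝓝 (l₀, 0), fderiv ℝ B z (0, (Z z.1).Y z.2) = 0
  axis : ∀ᶠ z : E × ℝ in 𝓝 (l₀, 0), A (z.1, axisPoint 0 z.2) = z.2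
  eq_axis : ∀ᶠ z : E × ℝ in 𝓝 (l₀, 0), A (z.1, axisPoint 1 z.2) = B (z.1, axisPoint 1 z.2)
  continuousAt_X : ContinuousAt (fun z : E × Plane => (Z z.1).X z.2) (l₀, 0)
  continuousAt_Y : ContinuousAt (fun z : E × Plane => (Z z.1).Y z.2) (l₀, 0)
  eventually_X : ∀ᶠ z : E × Plane in 𝓝 (l₀, 0), ContinuousAt (Z z.1).X z.2
  eventually_Y : ∀ᶠ z : E × Plane in 𝓝 (l₀, 0), ContinuousAt (Z z.1).Y z.2
  mem_dom : ∀ᶠ z : E × Plane in 𝓝 (l₀, 0), z.2 ∈ (Z z.1).dom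

/-- The partial derivative of `A` with respect to the coordinate of index `k`. -/
def partialDeriv (A : E × Plane → ℝ) (k : Fin 2) (z : E × Plane) : ℝ :=
  fderiv ℝ A z (0, axisPoint k 1)

theorem partialDeriv_continuousAt {A : E × Plane → ℝ} {z : E × Plane} (hA : ContDiffAt ℝ 3 A z)
    (k : Fin 2) : ContinuousAt (partialDeriv A k) z :=
  ((hA.fderiv_right (m := 0) (by norm_num)).continuousAt).clm_apply continuousAt_const

theorem eventually_hasFDerivAt {A : E × Plane → ℝ} {z₀ : E × Plane} (hA : ContDiffAt ℝ 3 A z₀) :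
    ∀ᶠ z in 𝓝 z₀, HasFDerivAt (fun p => A (z.1, p))
      ((fderiv ℝ A z).comp (ContinuousLinearMap.inr ℝ E Plane)) z.2 := by
  filter_upwards [hA.eventually (by simp)] with z hz
  have hd : HasFDerivAt A (fderiv ℝ A z) (z.1, z.2) :=
    (hz.differentiableAt (by norm_num)).hasFDerivAt
  exact hd.comp z.2 (hasFDerivAt_prodMk_right z.1 z.2)

theorem fderiv_eq_partialDeriv (A : E × Plane → ℝ) (z : E × Plane) (v : Plane) (k : Fin 2) :
    fderiv ℝ A z (0, v) = v k * partialDeriv A k z + v (k + 1) * partialDeriv A (k + 1) z := by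
  have h : ((0 : E), v) = v k • ((0 : E), axisPoint k 1) + v (k + 1) • ((0 : E), axisPoint (k + 1) 1) := by
    rw [Prod.smul_mk, Prod.smul_mk, smul_zero, smul_zero, Prod.mk_add_mk, add_zero,
      ← axisPoint_add]
  rw [h, map_add, map_smul, map_smul]
  rfl

theorem hasDerivAt_axis {A : E × Plane → ℝ} {l : E} {x : ℝ} {k : Fin 2}
    (h : HasFDerivAt (fun p => A (l, p))
      ((fderiv ℝ A (l, axisPoint k x)).comp (ContinuousLinearMap.inr ℝ E Plane)) (axisPoint k x)) :
    HasDerivAt (fun x => A (l, axisPoint k x)) (partialDeriv A k (l, axisPoint k x)) x := by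
  have hd : HasDerivAt (fun x : ℝ => (axisPoint k x : Plane)) (axisPoint k 1) x := by
    rw [hasDerivAt_pi]
    intro j
    rcases fin_two_cases k j with rfl | rfl
    · simpa only [axisPoint_self] using hasDerivAt_id' x
    · simpa only [axisPoint_succ] using hasDerivAt_const x (0 : ℝ)
  exact h.comp_hasDerivAt x hd

namespace IsIntegralFamily

variable {Z : E → PiecewiseField} {l₀ : E} {A B : E × Plane → ℝ} {a : ℝ} {i : Fin 2}

/-- The partial derivatives of the first integrals at the origin. -/
theorem eventually_partialDeriv (h : IsIntegralFamily Z l₀ A B) (hZ : IsTransient (Z l₀) a i) :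
    ∀ᶠ l in 𝓝 l₀, partialDeriv A 0 (l, 0) = 1 ∧
      partialDeriv A 1 (l, 0) = -((Z l).X 0 0 / (Z l).X 0 1) ∧
      partialDeriv B 0 (l, 0) = alpha (Z l) ∧
      partialDeriv B 1 (l, 0) = -((Z l).X 0 0 / (Z l).X 0 1) := by
  have hX1 := (((continuous_apply 1).continuousAt.comp h.continuousAt_X).eventually_ne
    (show ((fun p : Plane => p 1) ∘ fun z : E × Plane => (Z z.1).X z.2) (l₀, 0) ≠ 0 from
      (hZ.ne_zero 1).1))
  have hY0 := (((continuous_apply 0).continuousAt.comp h.continuousAt_Y).eventually_ne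
    (show ((fun p : Plane => p 0) ∘ fun z : E × Plane => (Z z.1).Y z.2) (l₀, 0) ≠ 0 from
      (hZ.ne_zero 0).2))
  have ax := eventually_eventually_nhds.2 h.axis
  have eax := eventually_eventually_nhds.2 h.eq_axis
  have curve : ∀ (l : E), Tendsto (fun x : ℝ => (l, x)) (𝓝 0) (𝓝 (l, 0)) := fun l =>
    (continuous_const.prodMk continuous_id).tendsto 0
  filter_upwards [eventually_origin hX1, eventually_origin hY0, eventually_origin ax, eventually_origin eax,
    eventually_origin (eventually_hasFDerivAt h.contDiffAt_A),
    eventually_origin (eventually_hasFDerivAt h.contDiffAt_B),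
    eventually_origin h.integral_A, eventually_origin h.integral_B] with l h1 h2 h3 h4 h5 h6 h7 h8
  have hA : ∀ k, HasDerivAt (fun x => A (l, axisPoint k x)) (partialDeriv A k (l, 0)) 0 := fun k => by
    have := hasDerivAt_axis (A := A) (l := l) (x := 0) (k := k) (by rw [axisPoint_zero]; exact h5)
    rwa [axisPoint_zero] at this
  have hB : ∀ k, HasDerivAt (fun x => B (l, axisPoint k x)) (partialDeriv B k (l, 0)) 0 := fun k => by
    have := hasDerivAt_axis (A := B) (l := l) (x := 0) (k := k) (by rw [axisPoint_zero]; exact h6)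
    rwa [axisPoint_zero] at this
  have e0 : partialDeriv A 0 (l, 0) = 1 :=
    ((hA 0).congr_of_eventuallyEq (f₁ := id) (by
      filter_upwards [(curve l).eventually h3] with x hx using hx.symm)).unique (hasDerivAt_id 0)
  have e1 : partialDeriv B 1 (l, 0) = partialDeriv A 1 (l, 0) :=
    (hB 1).unique ((hA 1).congr_of_eventuallyEq (by
      filter_upwards [(curve l).eventually h4] with x hx using hx.symm))
  simp only [fderiv_eq_partialDeriv _ _ _ 0, zero_add, Function.comp] at h1 h2 h7 h8
  have e2 : partialDeriv A 1 (l, 0) = -((Z l).X 0 0 / (Z l).X 0 1) := by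
    rw [e0] at h7
    field_simp
    linarith
  refine ⟨e0, e2, ?_, e1.trans e2⟩
  rw [e1, e2] at h8
  rw [alpha]
  field_simp at h8 ⊢
  linarith

theorem hasDerivAt_half_return (h : IsIntegralFamily Z l₀ A B) (hZ : IsTransient (Z l₀) a i) :
    ∀ᶠ l in 𝓝 l₀, HasDerivAt (fun x => B (l, axisPoint 0 x)) (alpha (Z l)) 0 := by
  filter_upwards [eventually_origin (eventually_hasFDerivAt h.contDiffAt_B),
    h.eventually_partialDeriv hZ] with l h6 h7
  have := hasDerivAt_axis (A := B) (l := l) (x := 0) (k := 0) (by rw [axisPoint_zero]; exact h6)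
  rwa [axisPoint_zero, h7.2.2.1] at this

theorem map_zero (h : IsIntegralFamily Z l₀ A B) :
    ∀ᶠ l in 𝓝 l₀, A (l, 0) = 0 ∧ B (l, 0) = 0 := by
  filter_upwards [eventually_origin h.axis, eventually_origin h.eq_axis] with l h1 h2
  simp only [axisPoint_zero] at h1 h2
  exact ⟨h1, h2 ▸ h1⟩

theorem eventually_bounds {X : Type*} [TopologicalSpace X] {f : X → ℝ} {x₀ : X}
    (hf : ContinuousAt f x₀) (h0 : 0 < f x₀) :
    ∀ᶠ k in 𝓝[>] (0 : ℝ), ∀ᶠ x in 𝓝 x₀, f x ∈ Icc k k⁻¹ := by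
  have h1 : ∀ᶠ k in 𝓝[>] (0 : ℝ), k < f x₀ :=
    eventually_nhdsWithin_of_eventually_nhds (eventually_lt_nhds h0)
  have h2 : ∀ᶠ k in 𝓝[>] (0 : ℝ), f x₀ < k⁻¹ := tendsto_inv_nhdsGT_zero.eventually_gt_atTop _
  filter_upwards [h1, h2] with k hk hk'
  filter_upwards [hf.eventually_const_lt hk, hf.eventually_lt_const hk'] with x hx hx'
  exact ⟨hx.le, hx'.le⟩

/-- For the parameters near `l₀`, the extensions to the plane of the first integrals make charts in a
common disc. -/
theorem exists_chart (h : IsIntegralFamily Z l₀ A B) (hZ : IsTransient (Z l₀) a i) :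
    ∃ m > 0, ∃ ρ₀ > 0, ∀ᶠ l in 𝓝 l₀, ∀ ρ, 0 < ρ → ρ ≤ ρ₀ → ∀ s, s = 2 ∨ s = 1 / 2 →
      IsChart (Z l) a i m ρ (extendField ρ 1 fun p => A (l, p))
        (extendField ρ (-s) fun p => B (l, p)) := by
  -- At the origin all the partial derivatives are positive, except that of `B` along `Σ₂`, which is
  -- `α < 0`. These signs persist, with uniform bounds, in a disc and for parameters near `l₀`.
  obtain ⟨d0, d1, d2, d3⟩ := (h.eventually_partialDeriv hZ).self_of_nhds
  have hslope : 0 < -((Z l₀).X 0 0 / (Z l₀).X 0 1) ∧ alpha (Z l₀) < 0 := by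
    have ha2 := IsFoliation.sq_of_sign hZ.sign
    have hXX : (Z l₀).X 0 i * (Z l₀).X 0 (i + 1) < 0 := by
      have := mul_neg_of_pos_of_neg hZ.crossing_X hZ.sliding_X
      nlinarith
    have hYY : 0 < (Z l₀).Y 0 i * (Z l₀).Y 0 (i + 1) := by
      have := mul_pos hZ.crossing_Y hZ.sliding_Y
      nlinarith
    rw [← coord_mul i] at hXX hYY
    have hx := (hZ.ne_zero 1).1
    have hy := (hZ.ne_zero 0).2
    have q1 : (Z l₀).X 0 0 / (Z l₀).X 0 1 < 0 := by
      rw [← mul_div_mul_right _ _ hx]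
      exact div_neg_of_neg_of_pos hXX (mul_self_pos.2 hx)
    have q2 : 0 < (Z l₀).Y 0 1 / (Z l₀).Y 0 0 := by
      rw [← mul_div_mul_right _ _ hy, mul_comm]
      exact div_pos hYY (mul_self_pos.2 hy)
    refine ⟨by linarith, ?_⟩
    rw [alpha, mul_div_mul_comm]
    exact mul_neg_of_neg_of_pos q1 q2
  have cA := fun k => partialDeriv_continuousAt h.contDiffAt_A k
  have cB := fun k => partialDeriv_continuousAt h.contDiffAt_B k
  have hk1 : ∀ᶠ k in 𝓝[>] (0 : ℝ), k ≤ 1 / 2 :=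
    eventually_nhdsWithin_of_eventually_nhds (eventually_le_nhds (by norm_num))
  obtain ⟨k, b0, b1, b2, b3, hk0, hk1⟩ := ((eventually_bounds (cA 0) (by rw [d0]; norm_num)).and
    ((eventually_bounds (cA 1) (by rw [d1]; exact hslope.1)).and
    ((eventually_bounds (cB 0).neg (by
      change 0 < -partialDeriv B 0 (l₀, 0)
      rw [d2]; linarith [hslope.2])).and
    ((eventually_bounds (cB 1) (by rw [d3]; exact hslope.1)).and
    ((show ∀ᶠ k in 𝓝[>] (0 : ℝ), 0 < k from self_mem_nhdsWithin).and hk1))))).exists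
  have signs : ∀ᶠ z : E × Plane in 𝓝 (l₀, 0), 0 < a * (Z z.1).X z.2 i ∧ 0 < a * (Z z.1).Y z.2 i ∧
      a * (Z z.1).X z.2 (i + 1) < 0 ∧ 0 < a * (Z z.1).Y z.2 (i + 1) := by
    have cX := fun k => (((continuous_apply k).continuousAt.comp h.continuousAt_X).const_mul a :
      ContinuousAt (fun z : E × Plane => a * (Z z.1).X z.2 k) (l₀, 0))
    have cY := fun k => (((continuous_apply k).continuousAt.comp h.continuousAt_Y).const_mul a :
      ContinuousAt (fun z : E × Plane => a * (Z z.1).Y z.2 k) (l₀, 0))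
    filter_upwards [(cX i).eventually_const_lt hZ.crossing_X,
      (cY i).eventually_const_lt hZ.crossing_Y, (cX (i + 1)).eventually_lt_const hZ.sliding_X,
      (cY (i + 1)).eventually_const_lt hZ.sliding_Y] with z z1 z2 z3 z4 using ⟨z1, z2, z3, z4⟩
  obtain ⟨r₁, hr₁, box₁⟩ := eventually_box (b0.and (b1.and (b2.and (b3.and (signs.and
    ((eventually_hasFDerivAt h.contDiffAt_A).and ((eventually_hasFDerivAt h.contDiffAt_B).and
    (h.integral_A.and (h.integral_B.and (h.eventually_X.and
      (h.eventually_Y.and h.mem_dom)))))))))))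
  obtain ⟨r₂, hr₂, box₂⟩ := eventually_box (h.axis.and h.eq_axis)
  -- The two slopes `s` of the extension are those needed to keep the return map without fixed points
  -- outside of the disc; both are allowed here.
  refine ⟨k / 2, by linarith, min r₁ r₂ / 2, half_pos (lt_min hr₁ hr₂), ?_⟩
  filter_upwards [box₁, box₂] with l hl₁ hl₂ ρ hρ hρle s hs
  have hρ₁ : ρ < r₁ := by have := min_le_left r₁ r₂; linarith
  have hρ₂ : ρ < r₂ := by have := min_le_right r₁ r₂; linarith
  have hkinv : 2 ≤ k⁻¹ := by rw [le_inv_comm₀ two_pos hk0]; linarith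
  have hall := fun (p : Plane) (hp : ‖p‖ ≤ ρ) => hl₁ p (hp.trans_lt hρ₁)
  have hax := fun (x : ℝ) => hl₂ (clamp ρ x) ((abs_clamp_le hρ.le x).trans_lt hρ₂)
  have loc : ∀ {G : Plane → ℝ} {w : ℝ} {L : Plane →L[ℝ] ℝ} {p : Plane}, ‖p‖ < ρ →
      HasFDerivAt G L p → HasFDerivAt (extendField ρ w G) L p := fun {G w L p} hp hG =>
    hG.congr_of_eventuallyEq (by
      filter_upwards [Metric.isOpen_ball.mem_nhds (mem_ball_zero_iff.2 hp)] with q hq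
      exact extendField_eq (mem_ball_zero_iff.1 hq).le)
  have pne : ∀ {x : ℝ}, x ∈ Icc k k⁻¹ → x ≠ 0 := fun hx => (hk0.trans_le hx.1).ne'
  refine ⟨⟨by linarith, ?_, ?_, fun x => ?_, fun y => ?_⟩, hZ.sign, hρ, fun p hp => ?_, fun p hp => ?_,
    fun p hp => ?_, fun p hp => ?_, fun p hp => ?_, fun p hp => ?_, fun p hp => ?_⟩
  · have := extendField_slope (G := fun p => A (l, p)) (w := 1) hk0 (by linarith) (Or.inl rfl) hρ.le
      (by rw [one_mul]; exact ⟨by linarith, by linarith⟩) fun p hp => by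
        obtain ⟨u0, u1, -, -, -, u5, -⟩ := hall p hp
        exact ⟨_, u5, by rw [one_mul]; exact u0, u1⟩
    have e : ∀ p : Plane, rescale 1 1 p = p := fun p => by ext j; fin_cases j <;> simp
    simpa only [e] using this
  · refine extendField_slope (G := fun p => B (l, p)) (w := -s) hk0 (by linarith) (Or.inr rfl) hρ.le
      ?_ fun p hp => ?_
    · rcases hs with rfl | rfl
      · exact ⟨by linarith, by linarith⟩
      · exact ⟨by linarith, by linarith⟩
    · obtain ⟨-, -, u2, u3, -, -, u6, -⟩ := hall p hp
      exact ⟨_, u6, by rw [neg_one_mul]; exact u2, u3⟩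
  · rw [extendField, clampPoint_axis_zero hρ.le, (hax x).1]
    simp [axisPoint, clamp_zero hρ.le]
  · rw [extendField, extendField, clampPoint_axis_one hρ.le, (hax y).2]
    simp [axisPoint, clamp_zero hρ.le]
  · exact (hall p hp.le).2.2.2.2.2.2.2.2.2.2.2
  · obtain ⟨u0, u1, -, -, -, u5, -, u7, -, u9, -⟩ := hall p hp.le
    refine ⟨u9, _, loc hp u5, u7, fun j => ?_⟩
    fin_cases j
    exacts [pne u0, pne u1]
  · obtain ⟨-, -, u2, u3, -, -, u6, -, u8, -, u10, -⟩ := hall p hp.le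
    refine ⟨u10, _, loc hp u6, u8, fun j => ?_⟩
    fin_cases j
    exacts [neg_ne_zero.1 (pne u2), pne u3]
  · exact (hall p hp.le).2.2.2.2.1.1
  · exact (hall p hp.le).2.2.2.2.1.2.1
  · exact (hall p hp.le).2.2.2.2.1.2.2.1
  · exact (hall p hp.le).2.2.2.2.1.2.2.2

end IsIntegralFamily

end Families


/-! ### Unfoldings with the same bifurcation -/

section Unfoldings

theorem HasSlope.of_le {N : Plane → ℝ} {m m' : ℝ} (hN : HasSlope N m) (h0 : 0 < m') (h : m' ≤ m) :
    HasSlope N m' := fun p q hpq =>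
  ⟨(mul_le_mul_of_nonneg_right h (norm_nonneg _)).trans (hN p q hpq).1,
    (hN p q hpq).2.trans (mul_le_mul_of_nonneg_right (inv_anti₀ h0 h) (norm_nonneg _))⟩

theorem IsChart.of_le {Z : PiecewiseField} {a : ℝ} {i : Fin 2} {m m' ρ : ℝ} {N M : Plane → ℝ}
    (C : IsChart Z a i m ρ N M) (h0 : 0 < m') (h : m' ≤ m) : IsChart Z a i m' ρ N M :=
  { C with
    toIsFoliation := ⟨h0, C.slope.of_le h0 h, C.slope'.of_le h0 h, C.axis, C.eq_axis⟩ }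

/-- The field `Z` has a chart in the disc of radius `ρ`, in which the square of the half-return map
has the pattern of the pseudo-Hopf bifurcation, with a hyperbolic fixed point `q < R` which is
positive if and only if `ε (α_Z + 1) > 0`. -/
def HasUnfoldingChart (Z : PiecewiseField) (a : ℝ) (i : Fin 2) (m ρ R ε : ℝ) : Prop :=
  ∃ (N M : Plane → ℝ) (q : ℝ), IsChart Z a i m ρ N M ∧
    HasPattern (fun x => M (axisPoint 0 (M (axisPoint 0 x)))) ε q ∧ q < R ∧
    (q = 0 ↔ ε * (alpha Z + 1) ≤ 0) ∧
    (0 < q → ∃ d, HasDerivAt (fun x => M (axisPoint 0 (M (axisPoint 0 x)))) d (M (axisPoint 0 q)) ∧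
      0 < d ∧ 0 < ε * (d - 1))

/-- The fields of the family `Z` with parameters near `l₀` have unfolding charts in a common disc. -/
def HasUnfoldingCharts {E : Type*} [TopologicalSpace E] (Z : E → PiecewiseField) (l₀ : E) (a : ℝ)
    (i : Fin 2) (ε : ℝ) : Prop :=
  ∃ m > 0, ∃ ρ₀ > 0, ∀ ρ, 0 < ρ → ρ ≤ ρ₀ → ∀ R, 0 < R →
    ∀ᶠ l in 𝓝 l₀, HasUnfoldingChart (Z l) a i m ρ R ε

/-- A family of first integrals for which `α = -1` and the cubic coefficient of the return map has
the sign of `ε` at the parameter `l₀` has unfolding charts. -/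
theorem IsIntegralFamily.hasUnfoldingCharts {E : Type*} [NormedAddCommGroup E] [NormedSpace ℝ E]
    {Z : E → PiecewiseField} {l₀ : E} {A B : E × Plane → ℝ} {a : ℝ} {i : Fin 2}
    (h : IsIntegralFamily Z l₀ A B) (hZ : IsTransient (Z l₀) a i) (hα : alpha (Z l₀) = -1) {η ε : ℝ}
    (hη : HasTaylorThree (fun x => B (l₀, axisPoint 0 (B (l₀, axisPoint 0 x)))) 1 0 η)
    (hε : 0 < ε * η) : HasUnfoldingCharts Z l₀ a i ε := by
  obtain ⟨m, hm, ρ₁, hρ₁, hchart⟩ := h.exists_chart hZ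
  have hP : ContDiffAt ℝ 3 (fun z : E × ℝ => B (z.1, axisPoint 0 z.2)) (l₀, 0) :=
    ContDiffAt.comp_axis h.contDiffAt_B 0
  obtain ⟨ρ₂, hρ₂, hpat⟩ := eventually_pattern hP
    (by filter_upwards [h.map_zero] with l hl; simpa only [axisPoint_zero] using hl.2)
    (h.hasDerivAt_half_return hZ) hα hη hε
  refine ⟨m, hm, min ρ₁ ρ₂, lt_min hρ₁ hρ₂, fun ρ hρ hρle R hR => ?_⟩
  filter_upwards [hchart, h.map_zero, hpat ρ hρ (hρle.trans (min_le_right _ _)) (min R (ρ / 4))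
    (lt_min hR (by linarith)) ((min_le_right _ _).trans (by linarith))] with l hl hl0 hp
  obtain ⟨hslope, q, hq0, hqR, hfix, hout, hin, hq, hd⟩ := hp
  -- Outside of the disc the half-return map is continued with slope `-s`, so that the return map
  -- expands if `ε > 0` and contracts if `ε < 0`, as it does between its last fixed point and the
  -- boundary of the disc.
  set s : ℝ := if 0 < ε then 2 else 1 / 2 with hs
  have C := hl ρ hρ (hρle.trans (min_le_left _ _)) s (by rw [hs]; split <;> simp)
  set P := fun x => B (l, axisPoint 0 x) with hPdef
  have hMP : ∀ x, extendField ρ (-s) (fun p => B (l, p)) (axisPoint 0 x) = extendSlope ρ s P x :=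
    fun x => by
      rw [extendField, clampPoint_axis_zero hρ.le, extendSlope]
      simp [axisPoint, clamp_zero hρ.le, hPdef, sub_eq_add_neg]
  have hq4 : q < ρ / 4 := hqR.trans_le (min_le_right _ _)
  have hP0 : P 0 = 0 := by simp only [hPdef, axisPoint_zero, hl0.2]
  have hPq : |P q| < ρ := by
    have := hslope 0 q (by linarith) hq0 (by linarith)
    change _ ≤ P 0 - P q ∧ P 0 - P q ≤ _ at this
    rw [hP0] at this
    rw [abs_lt]
    constructor <;> linarith [this.1, this.2]
  refine ⟨_, _, q, C, ?_, hqR.trans_le (min_le_left _ _), hq, fun hq0 => ?_⟩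
  · simp only [hMP]
    exact extendSlope_hasPattern hρ hP0 hslope hq0 (by linarith) hfix hout hin
  · obtain ⟨d, hd, hd'⟩ := hd hq0
    refine ⟨d, ?_, hd'⟩
    have e1 : extendSlope ρ s P q = P q := extendSlope_eq (by rw [abs_of_pos hq0]; linarith)
    simp only [hMP, e1]
    refine hd.congr_of_eventuallyEq ?_
    have hc : ContinuousAt P (P q) := by
      have hslc : ContinuousOn P (Icc (-(2 * ρ)) (2 * ρ)) := by
        have : LipschitzOnWith (5 / 4) P (Icc (-(2 * ρ)) (2 * ρ)) := by
          refine LipschitzOnWith.of_dist_le_mul fun u hu v hv => ?_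
          rw [Real.dist_eq, Real.dist_eq]
          push_cast
          rcases le_total u v with huv | huv
          · have := hslope u v hu.1 huv hv.2
            rw [abs_sub_comm u v, abs_of_nonneg (sub_nonneg.2 huv), abs_le]
            constructor <;> linarith [this.1, this.2]
          · have := hslope v u hv.1 huv hu.2
            rw [abs_of_nonneg (sub_nonneg.2 huv), abs_le]
            constructor <;> linarith [this.1, this.2]
        exact this.continuousOn
      rw [abs_lt] at hPq
      exact hslc.continuousAt (Icc_mem_nhds (by linarith) (by linarith))
    have hPPq : |P (P q)| < ρ := by
      rw [show P (P q) = q from hfix, abs_of_pos hq0]; linarith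
    filter_upwards [(continuous_abs.continuousAt).eventually_lt_const hPq,
      (continuous_abs.continuousAt.comp hc).eventually_lt_const hPPq] with x hx hx'
    rw [extendSlope_eq (P := P) hx.le]
    exact extendSlope_eq hx'.le

/-- Two families with unfolding charts of the same type are equivalent, if corresponding parameters
are on the same side of the bifurcation. -/
theorem locallyWeakEquivalent_of_charts {Z Z' : ℝ → PiecewiseField} {a ε : ℝ} {i : Fin 2}
    (h : HasUnfoldingCharts Z 0 a i ε) (h' : HasUnfoldingCharts Z' 0 a i ε) (μ : ℝ ≃ₜ ℝ)
    (hμ : μ 0 = 0)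
    (hside : ∀ᶠ δ in 𝓝 (0 : ℝ), ε * (alpha (Z δ) + 1) ≤ 0 ↔ ε * (alpha (Z' (μ δ)) + 1) ≤ 0) :
    LocallyWeakEquivalent Z Z' := by
  obtain ⟨m₁, hm₁, ρ₁, hρ₁, h⟩ := h
  obtain ⟨m₂, hm₂, ρ₂, hρ₂, h'⟩ := h'
  set m := min m₁ m₂
  have hm : 0 < m := lt_min hm₁ hm₂
  set ρ := min ρ₁ ρ₂
  have hρ : 0 < ρ := lt_min hρ₁ hρ₂
  have he : 0 < m ^ 2 * ρ / 2 := by positivity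
  have hμ0 : Tendsto μ (𝓝 0) (𝓝 0) := by
    have := μ.continuous.tendsto 0
    rwa [hμ] at this
  refine ⟨μ, hμ, Metric.ball 0 (m ^ 2 * (m ^ 2 * ρ / 2)), Metric.ball_mem_nhds _ (by positivity), ?_⟩
  filter_upwards [h ρ hρ (min_le_left _ _) _ he,
    hμ0.eventually (h' ρ hρ (min_le_right _ _) _ he), hside] with δ hδ hδ' hs
  obtain ⟨N, M, q, C, hF, hqR, hq, -⟩ := hδ
  obtain ⟨N', M', q', C', hF', hqR', hq', -⟩ := hδ'
  have C := C.of_le hm (min_le_left _ _)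
  have C' := C'.of_le hm (min_le_right _ _)
  obtain ⟨Q, hQ, hQa, -⟩ := exists_equiv_of_slope C.pos
    (fun u v huv => C.toIsFoliation.half_return_slope huv)
  obtain ⟨Q', hQ', hQa', -⟩ := exists_equiv_of_slope C'.pos
    (fun u v huv => C'.toIsFoliation.half_return_slope huv)
  simp only [← hQ] at hF
  simp only [← hQ'] at hF'
  -- The half-return maps have the same pattern, hence they are conjugate; the conjugacy can be chosen
  -- to fix a point which does not depend on the parameter, whence the uniform neighbourhood.
  obtain ⟨κ, κ0, κP, κe⟩ := exists_conj_of_antitone hQa hQa'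
    (by rw [hQ, axisPoint_zero, C.map_zero']) (by rw [hQ', axisPoint_zero, C'.map_zero']) hF hF'
    (by rw [hq, hq', hs]) hqR hqR'
  simp only [hQ, hQ'] at κP
  obtain ⟨H, h1, h2, h3⟩ := IsChart.exists_sigmaEquivalence C C' κ0 κP he κe (by
    have : 0 < m ^ 2 * ρ := by positivity
    linarith)
  exact ⟨H, h1, h2, h3⟩

/-- The pseudo-cycle exists for the parameters at which the return map has a positive fixed point,
and its multiplier is the derivative of the return map there. -/
theorem pseudoCycleBifurcation_of_charts {Z : ℝ → PiecewiseField} {a b s : ℝ} {i : Fin 2}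
    (h : HasUnfoldingCharts Z 0 a i b)
    (hside : ∀ᶠ δ in 𝓝 (0 : ℝ), b * (alpha (Z δ) + 1) ≤ 0 ↔ s * δ ≤ 0) :
    PseudoCycleBifurcation Z s b := by
  obtain ⟨m, hm, ρ, hρ, h⟩ := h
  intro V hV
  obtain ⟨R₀, hR₀, hRV⟩ := Metric.mem_nhds_iff.1 hV
  set R := min R₀ ρ
  have hR : 0 < R := lt_min hR₀ hρ
  refine ⟨Metric.ball 0 R, (Metric.ball_subset_ball (min_le_left _ _)).trans hRV, Metric.isOpen_ball,
    Metric.mem_ball_self hR, ?_⟩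
  filter_upwards [h ρ hρ le_rfl (m ^ 2 * R) (by positivity), hside] with δ hδ hs
  obtain ⟨N, M, q, C, hF, hqR, hq, hd⟩ := hδ
  have hW : ∀ p ∈ Metric.ball (0 : Plane) R, ‖p‖ < ρ := fun p hp =>
    (mem_ball_zero_iff.1 hp).trans_le (min_le_right _ _)
  rw [hs] at hq
  constructor
  · intro hpos
    have hq0 : 0 < q := lt_of_le_of_ne hF.nonneg fun e => (hq.1 e.symm).not_gt hpos
    obtain ⟨Γ, hΓ, hmem⟩ := C.exists_pseudoCycle hR (min_le_right _ _) hF hq0 hqR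
    obtain ⟨d, hd, hd0, hd1⟩ := hd hq0
    refine ⟨Γ, hΓ, fun Γ' hΓ' => C.pseudoCycle_unique hW hF hΓ' hΓ, d,
      C.hasMultiplier hR (min_le_right _ _) hF hq0 hqR hmem hd, fun hb => ?_, fun hb => ⟨hd0, ?_⟩⟩
    · have := (mul_pos_iff_of_pos_left hb).1 hd1
      linarith
    · by_contra! h1
      have := mul_nonpos_of_nonpos_of_nonneg hb.le (sub_nonneg.2 h1)
      linarith
  · intro hle Γ hΓ
    exact (C.pseudoCycle_orbits hW hF hΓ).1.ne' (hq.2 hle)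

end Unfoldings


/-! ### The return coefficients near a pseudo-Hopf field -/

section TaylorFamilies

theorem HasTaylorThree.exists_remainder {f : ℝ → ℝ} {a b c : ℝ} (h : HasTaylorThree f a b c) :
    ∃ u : ℝ → ℝ, Tendsto u (𝓝 0) (𝓝 0) ∧
      ∀ᶠ x in 𝓝 0, f x = a * x + b * x ^ 2 + c * x ^ 3 + u x * x ^ 3 := by
  obtain ⟨u, hu, e⟩ := Asymptotics.isLittleO_iff_exists_eq_mul.1 h
  refine ⟨u, hu, ?_⟩
  filter_upwards [e] with x hx
  simp only [Pi.mul_apply] at hx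
  linarith

/-- When the linear coefficient is `-1`, the square of a map has no quadratic term. -/
theorem HasTaylorThree.comp_self {f : ℝ → ℝ} {b c : ℝ} (h : HasTaylorThree f (-1) b c) :
    HasTaylorThree (fun x => f (f x)) 1 0 (-2 * c - 2 * b ^ 2) := by
  obtain ⟨u, hu, e⟩ := h.exists_remainder
  have hf := h.tendsto
  refine Asymptotics.isLittleO_iff_exists_eq_mul.2 ⟨fun x => c - u x - 2 * b * x * (c + u x) +
    b * x * (b + c * x + x * u x) ^ 2 + (c + u (f x)) * (-1 + x * (b + c * x + x * u x)) ^ 3, ?_, ?_⟩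
  · have hx : Tendsto (fun x : ℝ => x) (𝓝 0) (𝓝 0) := tendsto_id
    have hu' := hu.comp hf
    have ht : Tendsto (fun x => b + c * x + x * u x) (𝓝 0) (𝓝 (b + c * 0 + 0 * 0)) :=
      (tendsto_const_nhds.add (hx.const_mul c)).add (hx.mul hu)
    have := (((tendsto_const_nhds (x := c)).sub hu).sub ((hx.const_mul (2 * b)).mul
      ((tendsto_const_nhds (x := c)).add hu))).add ((hx.const_mul b).mul (ht.pow 2)) |>.add
      (((tendsto_const_nhds (x := c)).add hu').mul (((tendsto_const_nhds (x := (-1 : ℝ))).add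
        (hx.mul ht)).pow 3))
    have e0 : c - 0 - 2 * b * 0 * (c + 0) + b * 0 * (b + c * 0 + 0 * 0) ^ 2 +
        (c + 0) * (-1 + 0 * (b + c * 0 + 0 * 0)) ^ 3 = 0 := by ring
    rwa [e0] at this
  · filter_upwards [e, hf.eventually e] with x h1 h2
    rw [Pi.mul_apply, h2]
    generalize u (f x) = u'
    rw [h1]
    ring

variable {E : Type*} [NormedAddCommGroup E] [NormedSpace ℝ E]

/-- The Taylor coefficients of a family of class `C³` are continuous. -/
theorem exists_taylor {f : E × ℝ → ℝ} {l₀ : E} (hf : ContDiffAt ℝ 3 f (l₀, 0))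
    (h0 : ∀ᶠ l in 𝓝 l₀, f (l, 0) = 0) : ∃ a b c : E → ℝ, ContinuousAt a l₀ ∧ ContinuousAt b l₀ ∧
      ContinuousAt c l₀ ∧ ∀ᶠ l in 𝓝 l₀, HasTaylorThree (fun x => f (l, x)) (a l) (b l) (c l) ∧
        HasDerivAt (fun x => f (l, x)) (a l) 0 := by
  obtain ⟨f₁, hf₁, d1⟩ := exists_partial_deriv (n := 2) (by exact_mod_cast hf)
  obtain ⟨f₂, hf₂, d2⟩ := exists_partial_deriv (n := 1) (by exact_mod_cast hf₁)
  obtain ⟨f₃, hf₃, d3⟩ := exists_partial_deriv (n := 0) (by exact_mod_cast hf₂)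
  have hc : ContinuousAt (fun l : E => (l, (0 : ℝ))) l₀ := (by fun_prop)
  have cont : ∀ {g : E × ℝ → ℝ}, ContinuousAt g (l₀, 0) → ContinuousAt (fun l => g (l, 0)) l₀ :=
    fun {g} hg => ContinuousAt.comp (f := fun l : E => (l, (0 : ℝ))) (g := g) hg hc
  refine ⟨fun l => f₁ (l, 0), fun l => f₂ (l, 0) / 2, fun l => f₃ (l, 0) / 6,
    cont hf₁.continuousAt, (cont hf₂.continuousAt).div_const 2, (cont hf₃.continuousAt).div_const 6, ?_⟩
  filter_upwards [h0, eventually_origin (eventually_eventually_nhds.2 d1),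
    eventually_origin (eventually_eventually_nhds.2 d2), eventually_origin d3] with l e0 e1 e2 e3
  have curve : Tendsto (fun x : ℝ => (l, x)) (𝓝 0) (𝓝 (l, 0)) :=
    (continuous_const.prodMk continuous_id).tendsto 0
  exact ⟨hasTaylorThree_of_hasDerivAt (f₁ := fun x => f₁ (l, x)) (f₂ := fun x => f₂ (l, x)) e0 (curve.eventually e1) (curve.eventually e2) e3,
    (curve.eventually e1).self_of_nhds⟩

end TaylorFamilies

section Persistence

variable {E : Type*} [NormedAddCommGroup E] [NormedSpace ℝ E] {Z : E → PiecewiseField} {l₀ : E}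
  {A B H : E × Plane → ℝ} {a : ℝ} {i : Fin 2}

theorem extendField_axis_zero {ρ w x : ℝ} {G : Plane → ℝ} (hx : |x| < ρ) (k : Fin 2) :
    extendField ρ w G (axisPoint k x) = G (axisPoint k x) :=
  extendField_eq (by rw [axisPoint, Pi.norm_single, Real.norm_eq_abs]; exact hx.le)

theorem IsChart.isPseudoHopf_sign {Z : PiecewiseField} {m ρ : ℝ} {N M : Plane → ℝ}
    (C : IsChart Z a i m ρ N M) : (0 < Z.X 0 i * Z.Y 0 i ∧ Z.X 0 (i + 1) * Z.Y 0 (i + 1) < 0) ∧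
      Z.X 0 0 * Z.X 0 1 < 0 := by
  have h0 : ‖(0 : Plane)‖ < ρ := by rw [norm_zero]; exact C.rad_pos
  refine ⟨⟨C.crossing h0, C.sliding h0⟩, ?_⟩
  rw [coord_mul i]
  have := (C.mul_pos_iff (y := -Z.X 0 (i + 1)) (C.crossing_X 0 h0)).2
    (by linarith [C.sliding_X 0 h0])
  linarith

namespace IsIntegralFamily

theorem taylor_of_hasReturnCoefficients (h : IsIntegralFamily Z l₀ A B)
    (hZ : IsTransient (Z l₀) a i) {β η : ℝ} (hη : HasReturnCoefficients (Z l₀) β η) :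
    HasTaylorThree (fun x => B (l₀, axisPoint 0 (B (l₀, axisPoint 0 x)))) (alpha (Z l₀) ^ 2)
      ((alpha (Z l₀) + alpha (Z l₀) ^ 2) * β) η := by
  obtain ⟨m, -, ρ, hρ, hc⟩ := h.exists_chart hZ
  have C := hc.self_of_nhds ρ hρ le_rfl 2 (Or.inl rfl)
  have hsmall : ∀ᶠ x : ℝ in 𝓝 0, |x| < ρ :=
    continuous_abs.continuousAt.eventually_lt_const (by simpa using hρ)
  have hM : ∀ᶠ x in 𝓝 0, extendField ρ (-2) (fun p => B (l₀, p)) (axisPoint 0 x) =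
      B (l₀, axisPoint 0 x) := by
    filter_upwards [hsmall] with x hx using extendField_axis_zero hx 0
  have ht : Tendsto (fun x : ℝ => extendField ρ (-2) (fun p => B (l₀, p)) (axisPoint 0 x)) (𝓝 0)
      (𝓝 0) := by
    have := (C.continuous'.comp (continuous_axisPoint 0)).tendsto 0
    simpa [Function.comp_def, axisPoint_zero, C.map_zero'] using this
  refine (C.taylor_of_hasReturnCoefficients hη).congr ?_
  filter_upwards [hM, ht.eventually hM] with x h1 h2
  rw [h2, h1]

/-- Near a pseudo-Hopf field, the pseudo-Hopf fields are characterised by `α = -1`: the numbers `β`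
and `η` are defined and vary continuously. -/
theorem eventually_isPseudoHopf (h : IsIntegralFamily Z l₀ A B) (hZ : IsTransient (Z l₀) a i)
    (hH : ContDiffAt ℝ 3 H (l₀, 0)) (hH0 : ∀ᶠ l in 𝓝 l₀, H (l, 0) = 0)
    (hB : ∀ z, B z = A (z.1, axisPoint 1 (H z))) (hP : IsPseudoHopf (Z l₀)) :
    ∀ᶠ l in 𝓝 l₀, alpha (Z l) = -1 → IsPseudoHopf (Z l) := by
  obtain ⟨-, -, hα, β, η, hret, hβ, hη⟩ := hP
  obtain ⟨m, -, ρ, hρ, hc⟩ := h.exists_chart hZ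
  have hsmall : ∀ᶠ x : ℝ in 𝓝 0, |x| < ρ :=
    continuous_abs.continuousAt.eventually_lt_const (by simpa using hρ)
  obtain ⟨aX, bX, cX, kaX, kbX, kcX, tX⟩ := exists_taylor (ContDiffAt.comp_axis h.contDiffAt_A 1)
    (by filter_upwards [h.map_zero] with l hl; simpa only [axisPoint_zero] using hl.1)
  obtain ⟨aY, bY, cY, kaY, kbY, kcY, tY⟩ := exists_taylor (ContDiffAt.comp_axis hH 0)
    (by filter_upwards [hH0] with l hl; simpa only [axisPoint_zero] using hl)
  obtain ⟨aP, bP, cP, kaP, kbP, kcP, tP⟩ := exists_taylor (ContDiffAt.comp_axis h.contDiffAt_B 0)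
    (by filter_upwards [h.map_zero] with l hl; simpa only [axisPoint_zero] using hl.2)
  simp only at tX tY tP
  have square : ∀ l, HasTaylorThree (fun x => B (l, axisPoint 0 x)) (aP l) (bP l) (cP l) → aP l = -1 →
      HasTaylorThree (fun x => B (l, axisPoint 0 (B (l, axisPoint 0 x)))) 1 0
        (-2 * cP l - 2 * bP l ^ 2) := fun l hl e => by
    rw [e] at hl
    exact hl.comp_self
  have eα : ∀ᶠ l in 𝓝 l₀, aP l = alpha (Z l) := by
    filter_upwards [h.hasDerivAt_half_return hZ, tP] with l h1 h2 using h2.2.unique h1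
  -- By the uniqueness of Taylor coefficients, `β` and `η` are given by those of the first integrals,
  -- and so they remain different from zero.
  have hη₀ : -2 * cP l₀ - 2 * bP l₀ ^ 2 ≠ 0 := by
    have t := h.taylor_of_hasReturnCoefficients hZ hret
    rw [hα] at t
    have := (t.unique (square l₀ tP.self_of_nhds.1 (eα.self_of_nhds.trans hα))).2.2
    rwa [← this]
  have eqβ : ∀ᶠ z : E × ℝ in 𝓝 (l₀, 0), A (z.1, axisPoint 1 z.2) = B (z.1, axisPoint 1 z.2) :=
    h.eq_axis
  have hYt : ∀ᶠ l in 𝓝 l₀, Tendsto (fun x => H (l, axisPoint 0 x)) (𝓝 0) (𝓝 0) := by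
    filter_upwards [tY] with l hl using hl.1.tendsto
  have hβ₀ : bX l₀ * aY l₀ ^ 2 + aX l₀ * bY l₀ ≠ 0 := by
    have C := hc.self_of_nhds ρ hρ le_rfl 2 (Or.inl rfl)
    obtain ⟨f, g, aX', bX', cX', aY', bY', cY', hf, hg, tf, tg, e, -⟩ := hret
    have e1 : aX' = aX l₀ ∧ bX' = bX l₀ ∧ cX' = cX l₀ :=
      tf.unique (tX.self_of_nhds.1.congr (by
        filter_upwards [C.eventually_eq_of_isTransitionMap_X hf, hsmall] with y hy hy'
        rw [hy, extendField_axis_zero hy' 1]))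
    have e2 : aY' = aY l₀ ∧ bY' = bY l₀ ∧ cY' = cY l₀ :=
      tg.unique (tY.self_of_nhds.1.congr (by
        filter_upwards [C.eventually_eq_of_isTransitionMap_Y hg, hsmall,
          tg.tendsto.eventually hsmall, hYt.self_of_nhds.eventually hsmall] with x h1 h2 h3 h4
        refine C.axis_one_strictMono.injective ?_
        rw [C.eq_axis (g x), ← h1, extendField_axis_zero h2, extendField_axis_zero h4, hB]))
    rw [← e1.1, ← e1.2.1, ← e2.1, ← e2.2.1, ← e]
    exact hβ
  have kβ : ContinuousAt (fun l => bX l * aY l ^ 2 + aX l * bY l) l₀ :=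
    (kbX.mul (kaY.pow 2)).add (kaX.mul kbY)
  have kη : ContinuousAt (fun l => -2 * cP l - 2 * bP l ^ 2) l₀ :=
    (kcP.const_mul _).sub ((kbP.pow 2).const_mul _)
  filter_upwards [hc, tX, tY, tP, eα, kβ.eventually_ne hβ₀, kη.eventually_ne hη₀, hYt,
    eventually_origin (eventually_eventually_nhds.2 h.eq_axis)] with l hcl htX htY htP hα' hβ' hη' hYt
    heq hαl
  have C := hcl ρ hρ le_rfl 2 (Or.inl rfl)
  have curve : Tendsto (fun x : ℝ => (l, x)) (𝓝 0) (𝓝 (l, 0)) :=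
    (continuous_const.prodMk continuous_id).tendsto 0
  refine ⟨⟨i, C.isPseudoHopf_sign.1⟩, C.isPseudoHopf_sign.2, hαl, _, _,
    ⟨_, _, _, _, cX l, _, _, cY l, C.isTransitionMap_X, C.isTransitionMap_Y
      (g := fun x => H (l, axisPoint 0 x)) ?_, htX.1.congr ?_, htY.1, rfl, ?_⟩, hβ', hη'⟩
  · filter_upwards [hsmall, hYt.eventually hsmall, hYt.eventually (curve.eventually heq)] with x h1 h2 h3
    rw [extendField_axis_zero h1, extendField_axis_zero h2, ← h3, hB]
  · filter_upwards [hsmall] with y hy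
    rw [extendField_axis_zero hy]
  · have hPl := square l htP.1 (hα'.trans hαl)
    rw [hαl, show ((-1 : ℝ)) ^ 2 = 1 by norm_num, neg_add_cancel, zero_mul]
    have ePP : ∀ᶠ x in 𝓝 0, extendField ρ 1 (fun p => A (l, p)) (axisPoint 1 (H (l, axisPoint 0 x))) =
        B (l, axisPoint 0 x) := by
      filter_upwards [hYt.eventually hsmall] with x h2
      rw [extendField_axis_zero h2, hB]
    refine hPl.congr ?_
    filter_upwards [ePP, htP.1.tendsto.eventually ePP] with x h1 h2
    simp only [Function.comp]
    rw [h1, h2]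

end IsIntegralFamily

end Persistence

section Fields

variable {r : ℕ} {U : TopologicalSpace.Opens Plane}

/-- The first integrals of `X` and `Y` near the origin can be chosen jointly smooth in the field and
the point. That of `Y` is obtained by composing a first integral `H`, normalised on `Σ₁`, with the
restriction of `A` to `Σ₁`. -/
theorem exists_integralFamily (hr : 3 ≤ r) (hU : (0 : Plane) ∈ U) (Z₀ : Omega r U)
    (hX : fieldValue Z₀.1 0 1 ≠ 0) (hY : fieldValue Z₀.2 0 0 ≠ 0) :
    ∃ A B H : Omega r U × Plane → ℝ, IsIntegralFamily Omega.toField Z₀ A B ∧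
      ContDiffAt ℝ 3 H (Z₀, 0) ∧ (∀ᶠ Z in 𝓝 Z₀, H (Z, 0) = 0) ∧
      ∀ z, B z = A (z.1, axisPoint 1 (H z)) := by
  obtain ⟨A₁, cA, aA, iA⟩ := exists_first_integral hr hU 1 Z₀.1 hX
  obtain ⟨H₁, cH, aH, iH⟩ := exists_first_integral hr hU 0 Z₀.2 hY
  set π₁ : Omega r U × Plane →L[ℝ] VectorFields r U × Plane :=
    ((ContinuousLinearMap.fst ℝ _ _).comp (ContinuousLinearMap.fst ℝ _ _)).prod
      (ContinuousLinearMap.snd ℝ _ _)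
  set π₂ : Omega r U × Plane →L[ℝ] VectorFields r U × Plane :=
    ((ContinuousLinearMap.snd ℝ _ _).comp (ContinuousLinearMap.fst ℝ _ _)).prod
      (ContinuousLinearMap.snd ℝ _ _)
  set A : Omega r U × Plane → ℝ := fun z => A₁ (π₁ z) with hA
  set H : Omega r U × Plane → ℝ := fun z => H₁ (π₂ z) with hH
  set B : Omega r U × Plane → ℝ := fun z => A (z.1, axisPoint 1 (H z)) with hB
  have t₁ : Tendsto π₁ (𝓝 (Z₀, 0)) (𝓝 (Z₀.1, 0)) := π₁.continuous.tendsto (Z₀, 0)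
  have t₂ : Tendsto π₂ (𝓝 (Z₀, 0)) (𝓝 (Z₀.2, 0)) := π₂.continuous.tendsto (Z₀, 0)
  have kA : ContDiffAt ℝ 3 A (Z₀, 0) := ContDiffAt.comp (g := A₁) (Z₀, 0) cA π₁.contDiff.contDiffAt
  have kH : ContDiffAt ℝ 3 H (Z₀, 0) := ContDiffAt.comp (g := H₁) (Z₀, 0) cH π₂.contDiff.contDiffAt
  have aH' : ∀ᶠ z : Omega r U × ℝ in 𝓝 (Z₀, 0), H (z.1, axisPoint 1 z.2) = z.2 := by
    have : Tendsto (fun z : Omega r U × ℝ => (z.1.2, z.2)) (𝓝 (Z₀, 0)) (𝓝 (Z₀.2, 0)) :=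
      ((continuous_snd.comp continuous_fst).prodMk continuous_snd).tendsto (Z₀, 0)
    filter_upwards [this.eventually aH] with z hz using hz
  have hH0 : ∀ᶠ Z in 𝓝 Z₀, H (Z, 0) = 0 := by
    filter_upwards [eventually_origin aH'] with Z hZ
    simpa only [axisPoint_zero] using hZ
  have hH00 := hH0.self_of_nhds
  have kψ : ContDiffAt ℝ 3 (fun z : Omega r U × Plane => (z.1, H z)) (Z₀, 0) :=
    contDiffAt_fst.prodMk kH
  have kB : ContDiffAt ℝ 3 B (Z₀, 0) :=
    ContDiffAt.comp (f := fun z : Omega r U × Plane => (z.1, H z))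
      (g := fun z : Omega r U × ℝ => A (z.1, axisPoint 1 z.2)) (Z₀, 0)
      (by rw [hH00]; exact ContDiffAt.comp_axis kA 1) kψ
  have fderiv_comp : ∀ {G : VectorFields r U × Plane → ℝ} {π : Omega r U × Plane →L[ℝ]
      VectorFields r U × Plane} {z : Omega r U × Plane}, ContDiffAt ℝ 3 G (π z) →
      ∀ v, fderiv ℝ (fun z => G (π z)) z v = fderiv ℝ G (π z) (π v) := fun {G π z} hG v => by
    have := (hG.differentiableAt (by norm_num)).hasFDerivAt.comp z π.hasFDerivAt
    exact DFunLike.congr_fun this.fderiv v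
  have jX : ContinuousAt (fun z : Omega r U × Plane => fieldValue z.1.1 z.2) (Z₀, 0) :=
    ContinuousAt.comp (g := fun z : VectorFields r U × Plane => fieldValue z.1 z.2) (f := π₁)
      (fieldValue_continuousAt hU Z₀.1) π₁.continuous.continuousAt
  have jY : ContinuousAt (fun z : Omega r U × Plane => fieldValue z.1.2 z.2) (Z₀, 0) :=
    ContinuousAt.comp (g := fun z : VectorFields r U × Plane => fieldValue z.1 z.2) (f := π₂)
      (fieldValue_continuousAt hU Z₀.2) π₂.continuous.continuousAt
  have dom : ∀ᶠ z : Omega r U × Plane in 𝓝 (Z₀, 0), z.2 ∈ U :=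
    continuous_snd.continuousAt.preimage_mem_nhds (U.isOpen.mem_nhds hU)
  have jV : ∀ (V : VectorFields r U) (p : Plane), p ∈ U → ContinuousAt (fieldValue V) p :=
    fun V p hp => by
      have h1 := (fieldValue_contDiffOn (r := r) (U := U)).continuousOn.continuousAt
        ((isOpen_univ.prod U.isOpen).mem_nhds (⟨mem_univ V, hp⟩ : (V, p) ∈ univ ×ˢ (U : Set Plane)))
      exact ContinuousAt.comp (g := fun z : VectorFields r U × Plane => fieldValue z.1 z.2)
        (f := fun p => (V, p)) h1 (by fun_prop)
  refine ⟨A, B, H, ⟨kA, kB, ?_, ?_, ?_, ?_, jX, jY, ?_, ?_, dom⟩, kH, hH0, fun z => rfl⟩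
  · filter_upwards [t₁.eventually (cA.eventually (by simp)), t₁.eventually iA] with z h1 h2
    rw [hA, fderiv_comp h1]
    exact h2
  · have hψt : Tendsto (fun z : Omega r U × Plane => (z.1, (axisPoint 1 (H z) : Plane)))
        (𝓝 (Z₀, 0)) (𝓝 (Z₀, 0)) := by
      have := (((contDiff_axis 1).continuous.tendsto (Z₀, H (Z₀, 0))).comp kψ.continuousAt)
      simp only [hH00, axisPoint_zero, Function.comp_def] at this
      exact this
    filter_upwards [t₂.eventually (cH.eventually (by simp)), t₂.eventually iH,
      hψt.eventually (kA.eventually (by simp)), kH.eventually (by simp)] with z h1 h2 h3 h4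
    have dH : fderiv ℝ H z (0, fieldValue z.1.2 z.2) = 0 := by
      rw [hH, fderiv_comp h1]
      exact h2
    have d1 : HasFDerivAt (fun z : Omega r U × Plane => (z.1, H z))
        ((ContinuousLinearMap.fst ℝ _ _).prod (fderiv ℝ H z)) z :=
      hasFDerivAt_fst.prodMk (h4.differentiableAt (by norm_num)).hasFDerivAt
    have d2 := ((contDiff_axis (E := Omega r U) 1).differentiable (by norm_num) (z.1, H z)).hasFDerivAt
    have d3 := (h3.differentiableAt (by norm_num)).hasFDerivAt.comp z (d2.comp z d1)
    have e : fderiv ℝ B z = _ := d3.fderiv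
    change fderiv ℝ B z (0, fieldValue z.1.2 z.2) = 0
    rw [e]
    simp [dH, Prod.mk_zero_zero]
  · have : Tendsto (fun z : Omega r U × ℝ => (z.1.1, z.2)) (𝓝 (Z₀, 0)) (𝓝 (Z₀.1, 0)) :=
      ((continuous_fst.comp continuous_fst).prodMk continuous_snd).tendsto (Z₀, 0)
    filter_upwards [this.eventually aA] with z hz using hz
  · filter_upwards [aH'] with z hz
    simp only [hB, hz]
  · filter_upwards [dom] with z hz using jV _ _ hz
  · filter_upwards [dom] with z hz using jV _ _ hz

end Fields


/-! ### The normal form -/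

section NormalForm

theorem fderiv_eq_of_hasDerivAt {E : Type*} [NormedAddCommGroup E] [NormedSpace ℝ E]
    {A : E × Plane → ℝ} {z : E × Plane} (hA : DifferentiableAt ℝ A z) {v : Plane} {d : ℝ}
    (h : HasDerivAt (fun t : ℝ => A (z.1, z.2 + t • v)) d 0) : fderiv ℝ A z (0, v) = d := by
  have hc : HasDerivAt (fun t : ℝ => (z.1, z.2 + t • v)) ((0 : E), v) 0 := by
    have := ((hasDerivAt_id (0 : ℝ)).smul_const v).const_add z.2
    rw [one_smul] at this
    exact (hasDerivAt_const _ _).prodMk this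
  have hA' : HasFDerivAt A (fderiv ℝ A z) (z.1, z.2 + (0 : ℝ) • v) := by
    rw [zero_smul, add_zero]
    exact hA.hasFDerivAt
  exact (hA'.comp_hasDerivAt (0 : ℝ) hc).unique h

variable {a b c : ℝ}

/-- The index of the crossing branch, in terms of the sign of `X₁ Y₁` at the origin. -/
def crossingIndex (c : ℝ) : Fin 2 := if c = 1 then 0 else 1

theorem normalForm_isTransient (ha : a = 1 ∨ a = -1) (hc : c = 1 ∨ c = -1) :
    IsTransient (normalForm a b c 0) a (crossingIndex c) := by
  have ha2 := IsFoliation.sq_of_sign ha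
  rcases hc with rfl | rfl
  · rw [crossingIndex, if_pos rfl]
    refine ⟨ha, ?_, ?_, ?_, ?_⟩ <;> simp [normalForm, ha2]
  · rw [crossingIndex, if_neg (by norm_num)]
    refine ⟨ha, ?_, ?_, ?_, ?_⟩ <;> simp [normalForm, ha2]

theorem alpha_normalForm (ha : a = 1 ∨ a = -1) (δ : ℝ) :
    alpha (normalForm a b c δ) = -(a * c) / (a * c + δ) := by
  have ha0 : a ≠ 0 := by rcases ha with rfl | rfl <;> norm_num
  simp only [alpha, normalForm, Matrix.cons_val_zero, Matrix.cons_val_one, Pi.zero_apply, ne_eq,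
    OfNat.ofNat_ne_zero, not_false_eq_true, zero_pow, mul_zero, add_zero]
  rw [neg_mul, div_neg, mul_div_mul_right _ _ ha0, neg_div]

theorem normalForm_side (ha : a = 1 ∨ a = -1) (hc : c = 1 ∨ c = -1) :
    ∀ᶠ δ in 𝓝 (0 : ℝ), b * (alpha (normalForm a b c δ) + 1) ≤ 0 ↔ a * b * c * δ ≤ 0 := by
  filter_upwards [Metric.ball_mem_nhds (0 : ℝ) one_pos] with δ hδ
  rw [mem_ball_zero_iff, Real.norm_eq_abs, abs_lt] at hδ
  rw [alpha_normalForm ha, show a * b * c * δ = b * (a * c * δ) by ring]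
  have hk : (a * c) = 1 ∨ a * c = -1 := by
    rcases ha with rfl | rfl <;> rcases hc with rfl | rfl <;> norm_num
  generalize a * c = k at hk
  have hpos : 0 < 1 + k * δ := by rcases hk with rfl | rfl <;> linarith
  have hne : k + δ ≠ 0 := by rcases hk with rfl | rfl <;> intro h <;> linarith
  have e : b * (-k / (k + δ) + 1) = b * (k * δ) / (1 + k * δ) := by
    rw [div_add_one hne, ← mul_div_assoc, div_eq_div_iff hne hpos.ne']
    rcases hk with rfl | rfl <;> ring
  rw [e, div_le_iff₀ hpos, zero_mul]

/-- The first integral `x₁ + (ac / (ac + δ)) x₂` of `X_δ`. -/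
def normalFormA (k : ℝ) (z : ℝ × Plane) : ℝ := z.2 0 + z.2 1 * (k / (k + z.1))

/-- The first integral of `Y`, which is polynomial, normalised so that it agrees on `Σ₁` with the one
of `X_δ`. -/
def normalFormB (a b k : ℝ) (z : ℝ × Plane) : ℝ :=
  (z.2 1 - (z.2 0 + a / 2 * z.2 0 ^ 2 + b / 3 * z.2 0 ^ 3)) * (k / (k + z.1))

theorem normalForm_integralFamily (ha : a = 1 ∨ a = -1) (hc : c = 1 ∨ c = -1) :
    IsIntegralFamily (normalForm a b c) 0 (normalFormA (a * c)) (normalFormB a b (a * c)) := by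
  have ha2 := IsFoliation.sq_of_sign ha
  have hk : a * c ≠ 0 := by rcases ha with rfl | rfl <;> rcases hc with rfl | rfl <;> norm_num
  set k := a * c with hkdef
  have s0 : ContDiff ℝ 3 fun z : ℝ × Plane => z.2 0 := (contDiff_apply ℝ ℝ 0).comp contDiff_snd
  have s1 : ContDiff ℝ 3 fun z : ℝ × Plane => z.2 1 := (contDiff_apply ℝ ℝ 1).comp contDiff_snd
  have hq : ContDiffAt ℝ 3 (fun z : ℝ × Plane => k / (k + z.1)) (0, 0) :=
    contDiffAt_const.div (contDiffAt_const.add contDiffAt_fst) (by simpa using hk)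
  have cA : ContDiffAt ℝ 3 (normalFormA k) (0, 0) := s0.contDiffAt.add (s1.contDiffAt.mul hq)
  have cB : ContDiffAt ℝ 3 (normalFormB a b k) (0, 0) := by
    refine ContDiffAt.mul (s1.contDiffAt.sub ?_) hq
    exact ((s0.add (contDiff_const.mul (s0.pow 2))).add (contDiff_const.mul (s0.pow 3))).contDiffAt
  have hne : ∀ᶠ z : ℝ × Plane in 𝓝 (0, 0), k + z.1 ≠ 0 := by
    have : ContinuousAt (fun z : ℝ × Plane => k + z.1) (0, 0) := by fun_prop
    exact this.eventually_ne (by simpa using hk)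
  have jX : Continuous fun z : ℝ × Plane => (normalForm a b c z.1).X z.2 := by
    refine continuous_pi fun j => ?_
    fin_cases j <;> simp only [normalForm] <;> simp <;> fun_prop
  have jY : Continuous fun z : ℝ × Plane => (normalForm a b c z.1).Y z.2 := by
    refine continuous_pi fun j => ?_
    fin_cases j <;> simp only [normalForm] <;> simp <;> fun_prop
  have line : ∀ (p v : Plane) (j : Fin 2), HasDerivAt (fun t : ℝ => (p + t • v) j) (v j) 0 :=
    fun p v j => by
      have := ((hasDerivAt_id (0 : ℝ)).mul_const (v j)).const_add (p j)
      simpa using this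
  refine ⟨cA, cB, ?_, ?_, ?_, ?_, jX.continuousAt, jY.continuousAt, ?_, ?_, ?_⟩
  · filter_upwards [cA.eventually (by simp), hne] with z hz hkz
    refine fderiv_eq_of_hasDerivAt (hz.differentiableAt (by norm_num)) ?_
    have := (line z.2 ((normalForm a b c z.1).X z.2) 0).add
      ((line z.2 ((normalForm a b c z.1).X z.2) 1).mul_const (k / (k + z.1)))
    refine this.congr_deriv ?_
    simp only [normalForm, Matrix.cons_val_zero, Matrix.cons_val_one, ← hkdef]
    field_simp
    ring
  · filter_upwards [cB.eventually (by simp)] with z hz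
    refine fderiv_eq_of_hasDerivAt (hz.differentiableAt (by norm_num)) ?_
    set v := (normalForm a b c z.1).Y z.2 with hv
    have l0 := line z.2 v 0
    have := ((line z.2 v 1).sub ((l0.add ((l0.pow 2).const_mul (a / 2))).add
      ((l0.pow 3).const_mul (b / 3)))).mul_const (k / (k + z.1))
    refine this.congr_deriv ?_
    have e0 : v 0 = a := by simp [hv, normalForm]
    have e1 : v 1 = a + z.2 0 + a * b * z.2 0 ^ 2 := by simp [hv, normalForm]
    rw [e0, e1]
    simp only [zero_smul, add_zero]
    push_cast
    linear_combination (-(z.2 0) * (k / (k + z.1))) * ha2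
  · exact Eventually.of_forall fun z => by simp [normalFormA, axisPoint]
  · exact Eventually.of_forall fun z => by simp [normalFormA, normalFormB, axisPoint]
  · exact Eventually.of_forall fun z => (jX.comp (f := fun p : Plane => (z.1, p))
      (by fun_prop)).continuousAt
  · exact Eventually.of_forall fun z => (jY.comp (f := fun p : Plane => (z.1, p))
      (by fun_prop)).continuousAt
  · exact Eventually.of_forall fun z => trivial

theorem normalForm_hasUnfoldingCharts (ha : a = 1 ∨ a = -1) (hb : b = 1 ∨ b = -1)
    (hc : c = 1 ∨ c = -1) : HasUnfoldingCharts (normalForm a b c) 0 a (crossingIndex c) b := by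
  have ha2 := IsFoliation.sq_of_sign ha
  have hk : a * c ≠ 0 := by rcases ha with rfl | rfl <;> rcases hc with rfl | rfl <;> norm_num
  have htaylor : HasTaylorThree (fun x => normalFormB a b (a * c) (0, axisPoint 0 x)) (-1) (-(a / 2))
      (-(b / 3)) := by
    refine Asymptotics.IsLittleO.congr_left (Asymptotics.isLittleO_zero _ _) fun x => ?_
    simp only [normalFormB, axisPoint, Pi.single_eq_same, add_zero, div_self hk]
    simp
    ring
  refine (normalForm_integralFamily ha hc).hasUnfoldingCharts (normalForm_isTransient ha hc) ?_
    htaylor.comp_self ?_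
  · rw [alpha_normalForm ha, add_zero, neg_div, div_self hk]
  · rcases ha with rfl | rfl <;> rcases hb with rfl | rfl <;> norm_num

end NormalForm


/-! ### Transversality to the pseudo-Hopf set -/

section Transversality

variable {r : ℕ} {U : TopologicalSpace.Opens Plane}

/-- The constant vector fields belong to the space. -/
theorem exists_fieldValue_eq (r : ℕ) (U : TopologicalSpace.Opens Plane) (w : Plane) :
    ∃ K : VectorFields r U, ∀ p ∈ U, fieldValue K p = w := by
  refine ⟨⟨fun k => BoundedContinuousFunction.const U (iteratedFDeriv ℝ (k : ℕ) (fun _ : Plane => w) 0),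
    fun _ => w, contDiffOn_const, fun k x => ?_⟩, fun p hp => ?_⟩
  · rw [iteratedFDerivWithin_of_isOpen _ U.isOpen x.2]
    change iteratedFDeriv ℝ (k : ℕ) (fun _ : Plane => w) 0 = _
    generalize (k : ℕ) = n
    cases n with
    | zero => ext; simp
    | succ n => rw [iteratedFDeriv_succ_const]; rfl
  · rw [fieldValue, dif_pos hp]
    change iteratedFDeriv ℝ 0 (fun _ : Plane => w) 0 0 = w
    simp

/-- The value of a coordinate of a vector field at a point, as a continuous linear form. -/
def coordCLM (p : Plane) (k : Fin 2) : VectorFields r U →L[ℝ] ℝ :=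
  (ContinuousLinearMap.proj k).comp
    ((ContinuousMultilinearMap.apply ℝ (fun _ : Fin 0 => Plane) Plane 0).comp
      (jetCLM 0 (Nat.zero_le r) p))

theorem coordCLM_apply (p : Plane) (k : Fin 2) (V : VectorFields r U) :
    coordCLM p k V = fieldValue V p k := by
  rw [fieldValue_eq_jet]
  rfl

/-- The function `X₁ Y₂ + X₂ Y₁` at the origin, which vanishes if and only if `α = -1`. -/
def resonance (Z : Omega r U) : ℝ :=
  fieldValue Z.1 0 0 * fieldValue Z.2 0 1 + fieldValue Z.1 0 1 * fieldValue Z.2 0 0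

theorem contDiff_coord_fst (k : Fin 2) : ContDiff ℝ 1 fun Z : Omega r U => fieldValue Z.1 0 k := by
  simp only [← coordCLM_apply]
  exact (coordCLM 0 k).contDiff.comp contDiff_fst

theorem contDiff_coord_snd (k : Fin 2) : ContDiff ℝ 1 fun Z : Omega r U => fieldValue Z.2 0 k := by
  simp only [← coordCLM_apply]
  exact (coordCLM 0 k).contDiff.comp contDiff_snd

theorem contDiff_resonance : ContDiff ℝ 1 (resonance (r := r) (U := U)) :=
  ((contDiff_coord_fst 0).mul (contDiff_coord_snd 1)).add
    ((contDiff_coord_fst 1).mul (contDiff_coord_snd 0))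

theorem alpha_add_one {Z : Omega r U} (hX : fieldValue Z.1 0 1 ≠ 0) (hY : fieldValue Z.2 0 0 ≠ 0) :
    alpha Z.toField + 1 = resonance Z / (fieldValue Z.1 0 1 * fieldValue Z.2 0 0) := by
  change fieldValue Z.1 0 0 * fieldValue Z.2 0 1 / (fieldValue Z.1 0 1 * fieldValue Z.2 0 0) + 1 = _
  rw [div_add_one (mul_ne_zero hX hY), resonance]

theorem mem_tangentConeAt_of_hasDerivAt {E : Type*} [NormedAddCommGroup E] [NormedSpace ℝ E]
    {S : Set E} {σ : ℝ → E} {v : E} {t : ℝ} (h : HasDerivAt σ v t) (hS : ∀ᶠ s in 𝓝 t, σ s ∈ S) :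
    v ∈ tangentConeAt ℝ S (σ t) := by
  have h1 := HasFDerivWithinAt.mapsTo_tangent_cone
    (h.hasFDerivAt.hasFDerivWithinAt (s := {s | σ s ∈ S}))
  have h2 : (1 : ℝ) ∈ tangentConeAt ℝ {s | σ s ∈ S} t := by
    rw [tangentConeAt_of_mem_nhds hS]
    trivial
  have h3 := tangentConeAt_mono (𝕜 := ℝ) (x := σ t) (image_subset_iff.2 (Subset.refl _) :
    σ '' {s | σ s ∈ S} ⊆ S) (h1 h2)
  simpa using h3

/-- A function with nonzero derivative `k` at a zero has there the sign of `k δ`. -/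
theorem eventually_sign_of_hasDerivAt {g : ℝ → ℝ} {k : ℝ} (h : HasDerivAt g k 0) (h0 : g 0 = 0)
    (hk : k ≠ 0) (s : ℝ) : ∀ᶠ δ in 𝓝 (0 : ℝ), s * g δ ≤ 0 ↔ s * (k * δ) ≤ 0 := by
  have hs := hasDerivAt_iff_tendsto_slope.1 h
  have hp : ∀ᶠ δ in 𝓝[≠] (0 : ℝ), 0 < k * slope g 0 δ :=
    (hs.const_mul k).eventually_const_lt (mul_self_pos.2 hk)
  filter_upwards [eventually_nhdsWithin_iff.1 hp] with δ hδ
  rcases eq_or_ne δ 0 with rfl | hne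
  · simp [h0]
  have hq := hδ hne
  rw [slope_def_field, h0, sub_zero, sub_zero] at hq
  have hk2 : 0 < k * k := mul_self_pos.2 hk
  -- The quotient of `g δ` by `k δ` is positive.
  have e : s * g δ = s * (k * δ) * (k * (g δ / δ) / (k * k)) := by field_simp
  rw [e]
  have : 0 < k * (g δ / δ) / (k * k) := div_pos hq hk2
  constructor
  · intro hle
    by_contra! hlt
    linarith [mul_pos hlt this]
  · intro hle
    exact mul_nonpos_of_nonpos_of_nonneg hle this.le

theorem exists_homeomorph_sign {k : ℝ} (hk : k ≠ 0) :
    ∃ μ : ℝ ≃ₜ ℝ, μ 0 = 0 ∧ ∀ s δ, s * μ δ ≤ 0 ↔ s * (k * δ) ≤ 0 := by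
  rcases lt_or_gt_of_ne hk with h | h
  · refine ⟨Homeomorph.neg ℝ, by simp, fun s δ => ?_⟩
    rw [Homeomorph.coe_neg, show s * (k * δ) = -k * (s * -δ) by ring]
    exact ⟨fun h' => mul_nonpos_of_nonneg_of_nonpos (by linarith) h',
      fun h' => nonpos_of_mul_nonpos_right h' (by linarith)⟩
  · refine ⟨Homeomorph.refl ℝ, rfl, fun s δ => ?_⟩
    rw [Homeomorph.refl_apply, show s * (k * δ) = k * (s * δ) by ring]
    exact ⟨fun h' => mul_nonpos_of_nonneg_of_nonpos h.le h',
      fun h' => nonpos_of_mul_nonpos_right h' h⟩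

/-- The sign conditions in terms of `a` and `c`. As `X₁ X₂ < 0`, the equation `α = -1` yields
`Y₁ Y₂ > 0`. -/
theorem IsPseudoHopf.isTransient {Z : PiecewiseField} (hZ : IsPseudoHopf Z) {a c : ℝ}
    (ha : a = Real.sign (Z.Y 0 0)) (hc : c = Real.sign (Z.X 0 0 * Z.Y 0 0)) :
    IsTransient Z a (crossingIndex c) := by
  obtain ⟨-, hX, hα, -⟩ := hZ
  rw [alpha] at hα
  have hY0 : Z.Y 0 0 ≠ 0 := by
    intro h
    rw [h, mul_zero, div_zero] at hα
    norm_num at hα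
  have hX1 : Z.X 0 1 ≠ 0 := right_ne_zero_of_mul hX.ne
  have hX0 : Z.X 0 0 ≠ 0 := left_ne_zero_of_mul hX.ne
  rw [div_eq_iff (mul_ne_zero hX1 hY0)] at hα
  have hYY : 0 < Z.Y 0 0 * Z.Y 0 1 := by
    have h1 : Z.Y 0 0 * Z.Y 0 1 * Z.X 0 0 ^ 2 = -(Z.X 0 0 * Z.X 0 1) * Z.Y 0 0 ^ 2 := by
      linear_combination Z.X 0 0 * Z.Y 0 0 * hα
    have h2 : 0 < Z.Y 0 0 * Z.Y 0 1 * Z.X 0 0 ^ 2 := by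
      rw [h1]
      have := sq_pos_of_ne_zero hY0
      exact mul_pos (by linarith) this
    exact pos_of_mul_pos_left h2 (sq_nonneg _)
  have ha' : a = 1 ∨ a = -1 := by
    rw [ha]
    exact (Real.sign_apply_eq_of_ne_zero _ hY0).symm
  have e0 : 0 < a * Z.Y 0 0 := ha ▸ Real.sign_mul_pos_of_ne_zero _ hY0
  have ha2 := IsFoliation.sq_of_sign ha'
  have e1 : 0 < a * Z.Y 0 1 := by
    have : a * Z.Y 0 0 * (a * Z.Y 0 1) = Z.Y 0 0 * Z.Y 0 1 := by linear_combination Z.Y 0 0 * Z.Y 0 1 * ha2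
    exact pos_of_mul_pos_right (this ▸ hYY) e0.le
  have eX : a * Z.X 0 0 * (a * Z.X 0 1) < 0 := by
    have : a * Z.X 0 0 * (a * Z.X 0 1) = Z.X 0 0 * Z.X 0 1 := by linear_combination Z.X 0 0 * Z.X 0 1 * ha2
    linarith
  have hXY : Z.X 0 0 * Z.Y 0 0 = (a * Z.X 0 0) * (a * Z.Y 0 0) := by
    linear_combination -(Z.X 0 0 * Z.Y 0 0) * ha2
  rcases lt_or_gt_of_ne (mul_ne_zero hX0 hY0) with h | h
  · rw [hc, Real.sign_of_neg h, crossingIndex, if_neg (by norm_num)]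
    have hx : a * Z.X 0 0 < 0 := by
      by_contra! hn
      have := mul_nonneg hn e0.le
      linarith
    have hx1 : 0 < a * Z.X 0 1 := by
      by_contra! hn
      have := mul_nonneg_of_nonpos_of_nonpos hx.le hn
      linarith
    exact ⟨ha', hx1, e1, hx, e0⟩
  · rw [hc, Real.sign_of_pos h, crossingIndex, if_pos rfl]
    have hx : 0 < a * Z.X 0 0 := by
      by_contra! hn
      have := mul_nonpos_of_nonpos_of_nonneg hn e0.le
      linarith
    have hx1 : a * Z.X 0 1 < 0 := by
      by_contra! hn
      have := mul_nonneg hx.le hn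
      linarith
    exact ⟨ha', hx, e0, hx1, e1⟩

/-- A curve transverse to the pseudo-Hopf set crosses the hypersurface `resonance = 0` with nonzero
speed. Otherwise a correction of order `o(δ)` would bring it into this hypersurface, hence into the
pseudo-Hopf set, and its velocity would be a tangent vector. -/
theorem IsIntegralFamily.resonance_deriv_ne_zero {A B H : Omega r U × Plane → ℝ} {Z : Omega r U}
    {a : ℝ} {i : Fin 2} (h : IsIntegralFamily Omega.toField Z A B) (hU : (0 : Plane) ∈ U)
    (hT : IsTransient Z.toField a i) (hH : ContDiffAt ℝ 3 H (Z, 0)) (hH0 : ∀ᶠ Z in 𝓝 Z, H (Z, 0) = 0)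
    (hB : ∀ z, B z = A (z.1, axisPoint 1 (H z))) (hZ : Z ∈ pseudoHopfSet r U) {γ : ℝ → Omega r U}
    {v : Omega r U} (hγ0 : γ 0 = Z) (hγ : HasDerivAt γ v 0) (hv : v ∉ tangentConeAt ℝ (pseudoHopfSet r U) Z)
    {k : ℝ} (hk : HasDerivAt (fun δ => resonance (γ δ)) k 0) : k ≠ 0 := by
  rintro rfl
  obtain ⟨K, hK⟩ := exists_fieldValue_eq r U ![1, 0]
  have hX1 : fieldValue Z.1 0 1 ≠ 0 := (hT.ne_zero 1).1
  have hY0 : fieldValue Z.2 0 0 ≠ 0 := (hT.ne_zero 0).2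
  have hY1 : fieldValue Z.2 0 1 ≠ 0 := (hT.ne_zero 1).2
  have hres : resonance Z = 0 := by
    have := alpha_add_one hX1 hY0
    rw [show alpha Z.toField = -1 from hZ.2.2.1, neg_add_cancel, eq_comm, div_eq_zero_iff] at this
    exact this.resolve_right (mul_ne_zero hX1 hY0)
  -- Adding `g δ` to the first component of `X` brings the curve back to `α = -1`.
  set g : ℝ → ℝ := fun δ => -resonance (γ δ) / fieldValue (γ δ).2 0 1 with hg
  have hY1' : HasDerivAt (fun δ => fieldValue (γ δ).2 0 1) (fderiv ℝ (fun Z : Omega r U =>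
      fieldValue Z.2 0 1) (γ 0) v) 0 :=
    ((contDiff_coord_snd 1).differentiable (by norm_num) (γ 0)).hasFDerivAt.comp_hasDerivAt 0 hγ
  have hdg : HasDerivAt g 0 0 := by
    have := hk.neg.div hY1' (by rwa [hγ0])
    refine this.congr_deriv ?_
    simp [hγ0, hres]
  have hg0 : g 0 = 0 := by simp [hg, hγ0, hres]
  set σ : ℝ → Omega r U := fun δ => γ δ + g δ • (K, 0) with hσ
  have hσ0 : σ 0 = Z := by simp [hσ, hg0, hγ0]
  have hdσ : HasDerivAt σ v 0 := by
    have := hγ.add (hdg.smul_const ((K, 0) : Omega r U))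
    rwa [zero_smul, add_zero] at this
  refine hv (hσ0 ▸ mem_tangentConeAt_of_hasDerivAt hdσ ?_)
  have tγ : Tendsto γ (𝓝 0) (𝓝 Z) := hγ0 ▸ hγ.continuousAt.tendsto
  have tσ : Tendsto σ (𝓝 0) (𝓝 Z) := by
    have := hdσ.continuousAt.tendsto
    rwa [hσ0] at this
  filter_upwards [tσ.eventually (h.eventually_isPseudoHopf hT hH hH0 hB hZ),
    tσ.eventually ((contDiff_coord_fst 1).continuous.continuousAt.eventually_ne hX1),
    tσ.eventually ((contDiff_coord_snd 0).continuous.continuousAt.eventually_ne hY0),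
    tγ.eventually ((contDiff_coord_snd 1).continuous.continuousAt.eventually_ne hY1)] with δ h1 h2 h3 h4
  refine h1 ?_
  have := alpha_add_one h2 h3
  have hr : resonance (σ δ) = 0 := by
    have f1 : ∀ j, fieldValue (σ δ).1 0 j = fieldValue (γ δ).1 0 j + g δ * (![1, 0] : Plane) j := by
      intro j
      rw [← hK 0 hU]
      simp only [← coordCLM_apply]
      rw [hσ, Prod.fst_add, map_add, Prod.smul_fst, map_smul, smul_eq_mul]
    have f2 : (σ δ).2 = (γ δ).2 := by simp [hσ]
    have e0 := f1 0
    have e1 := f1 1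
    simp only [Matrix.cons_val_zero, Matrix.cons_val_one, mul_one, mul_zero, add_zero] at e0 e1
    rw [resonance, e0, e1, f2, add_mul, hg, div_mul_cancel₀ _ h4, resonance]
    ring
  rw [hr, zero_div] at this
  linarith

end Transversality

end PseudoHopf

end

open PseudoHopf in
theorem mainTheorem9 (r : ℕ) (hr : 3 ≤ r) (U : TopologicalSpace.Opens Plane)
    (hU : (0 : Plane) ∈ U) (Z : Omega r U) (hZ : Z ∈ pseudoHopfSet r U)
    (β η : ℝ) (hη : HasReturnCoefficients Z.toField β η)
    (γ : ℝ → Omega r U) (hγ : IsVersalUnfolding Z γ)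
    (a b c : ℝ) (ha : a = Real.sign (Z.toField.Y 0 0)) (hb : b = Real.sign η)
    (hc : c = Real.sign (Z.toField.X 0 0 * Z.toField.Y 0 0)) :
    LocallyWeakEquivalent (fun δ => (γ δ).toField) (normalForm a b c) ∧
      PseudoCycleBifurcation (normalForm a b c) (a * b * c) b := by
  have hZ' : IsPseudoHopf Z.toField := hZ
  have hα : alpha Z.toField = -1 := hZ'.2.2.1
  have hT := hZ'.isTransient ha hc
  have hX0 : fieldValue Z.1 0 0 ≠ 0 := (hT.ne_zero 0).1
  have hX1 : fieldValue Z.1 0 1 ≠ 0 := (hT.ne_zero 1).1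
  have hY0 : fieldValue Z.2 0 0 ≠ 0 := (hT.ne_zero 0).2
  obtain ⟨A, B, H, h, hH, hH0, hB⟩ := exists_integralFamily hr hU Z hX1 hY0
  have htaylor := h.taylor_of_hasReturnCoefficients hT hη
  have hη0 : η ≠ 0 := by
    -- The coefficient `η` does not depend on the choice of the transition maps.
    obtain ⟨β', η', h', -, hη'⟩ := hZ'.2.2.2
    rwa [(htaylor.unique (h.taylor_of_hasReturnCoefficients hT h')).2.2]
  rw [hα, show ((-1 : ℝ)) ^ 2 = 1 by norm_num, neg_add_cancel, zero_mul] at htaylor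
  have sign_cases : ∀ {x y : ℝ}, x = Real.sign y → y ≠ 0 → x = 1 ∨ x = -1 := fun {x y} e hy => by
    rw [e]
    exact (Real.sign_apply_eq_of_ne_zero _ hy).symm
  have ha' := sign_cases ha hY0
  have hb' := sign_cases hb hη0
  have hc' := sign_cases hc (mul_ne_zero hX0 hY0)
  have charts := h.hasUnfoldingCharts hT hα htaylor (ε := b)
    (hb ▸ Real.sign_mul_pos_of_ne_zero _ hη0)
  obtain ⟨hγ0, ⟨δ₀, hδ₀, hγd⟩, hv⟩ := hγ
  have dγ : HasDerivAt γ (deriv γ 0) 0 :=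
    ((hγd.differentiableOn (by norm_num)).differentiableAt
      (Ioo_mem_nhds (by linarith) hδ₀)).hasDerivAt
  have dres : HasDerivAt (fun δ => resonance (γ δ)) _ 0 :=
    (contDiff_resonance.differentiable (by norm_num) (γ 0)).hasFDerivAt.comp_hasDerivAt 0 dγ
  set k := fderiv ℝ resonance (γ 0) (deriv γ 0)
  have hk : k ≠ 0 := h.resonance_deriv_ne_zero hU hT hH hH0 hB hZ hγ0 dγ hv dres
  have tγ : Tendsto γ (𝓝 0) (𝓝 Z) := hγ0 ▸ dγ.continuousAt.tendsto
  have chartsγ : HasUnfoldingCharts (fun δ => (γ δ).toField) 0 a (crossingIndex c) b := by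
    obtain ⟨m, hm, ρ₀, hρ₀, hc⟩ := charts
    exact ⟨m, hm, ρ₀, hρ₀, fun ρ h1 h2 R hR => tγ.eventually (hc ρ h1 h2 R hR)⟩
  have ha2 := IsFoliation.sq_of_sign ha'
  have hc2 := IsFoliation.sq_of_sign hc'
  -- The sign of `X₂ Y₁` at the origin is `-c`.
  have hcXY : c * (fieldValue Z.1 0 1 * fieldValue Z.2 0 0) < 0 := by
    have h1 : 0 < c * (fieldValue Z.1 0 0 * fieldValue Z.2 0 0) :=
      hc ▸ Real.sign_mul_pos_of_ne_zero _ (mul_ne_zero hX0 hY0)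
    have h2 : fieldValue Z.1 0 0 * fieldValue Z.1 0 1 < 0 := hZ'.2.1
    by_contra! hn
    have := mul_nonneg h1.le hn
    have e : c * (fieldValue Z.1 0 0 * fieldValue Z.2 0 0) *
        (c * (fieldValue Z.1 0 1 * fieldValue Z.2 0 0)) =
        fieldValue Z.1 0 0 * fieldValue Z.1 0 1 * fieldValue Z.2 0 0 ^ 2 := by
      linear_combination fieldValue Z.1 0 0 * fieldValue Z.1 0 1 * fieldValue Z.2 0 0 ^ 2 * hc2
    have := mul_neg_of_neg_of_pos h2 (sq_pos_of_ne_zero hY0)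
    linarith
  have hside := normalForm_side (a := a) (b := b) (c := c) ha' hc'
  have hres0 : resonance (γ 0) = 0 := by
    have := alpha_add_one hX1 hY0
    rw [hα, neg_add_cancel, eq_comm, div_eq_zero_iff] at this
    rw [hγ0]
    exact this.resolve_right (mul_ne_zero hX1 hY0)
  -- The parameter change is `δ` or `-δ`, according to the direction in which `γ` crosses the
  -- pseudo-Hopf set.
  obtain ⟨μ, hμ0, hμ⟩ := exists_homeomorph_sign (k := -a * k)
    (mul_ne_zero (neg_ne_zero.2 (by rcases ha' with h | h <;> rw [h] <;> norm_num)) hk)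
  have hμt : Tendsto μ (𝓝 0) (𝓝 0) := by
    have := μ.continuous.tendsto 0
    rwa [hμ0] at this
  refine ⟨locallyWeakEquivalent_of_charts chartsγ (normalForm_hasUnfoldingCharts ha' hb' hc') μ hμ0 ?_,
    pseudoCycleBifurcation_of_charts (normalForm_hasUnfoldingCharts ha' hb' hc') hside⟩
  have kXY : Continuous fun Z : Omega r U => c * (fieldValue Z.1 0 1 * fieldValue Z.2 0 0) :=
    continuous_const.mul ((contDiff_coord_fst 1).continuous.mul (contDiff_coord_snd 0).continuous)
  filter_upwards [hμt.eventually hside, eventually_sign_of_hasDerivAt dres hres0 hk (-(b * c)),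
    tγ.eventually (kXY.continuousAt.eventually_lt_const hcXY)] with δ h1 h2 h3
  have hne : fieldValue (γ δ).1 0 1 * fieldValue (γ δ).2 0 0 ≠ 0 := right_ne_zero_of_mul h3.ne
  rw [h1, hμ, show a * b * c * (-a * k * δ) = -(b * c) * (k * δ) by
    linear_combination (-(b * c * k * δ)) * ha2, ← h2,
    alpha_add_one (left_ne_zero_of_mul hne) (right_ne_zero_of_mul hne)]
  have e : b * (resonance (γ δ) / (fieldValue (γ δ).1 0 1 * fieldValue (γ δ).2 0 0)) =
      -(b * c) * resonance (γ δ) / -(c * (fieldValue (γ δ).1 0 1 * fieldValue (γ δ).2 0 0)) := by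
    rw [← mul_div_assoc, neg_mul, neg_div_neg_eq, mul_right_comm, mul_comm _ c,
      mul_div_mul_left _ _ (left_ne_zero_of_mul h3.ne)]
  rw [e, div_le_iff₀ (neg_pos.2 h3), zero_mul]
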